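/- Let $(\Sigma_1,g_1)$ and $(\Sigma_2,g_2)$ be connected oriented Lorentzian surfaces with Gauss curvatures $\kappa_1,\kappa_2$, and let $j_k$ be the paracomplex structure of $\Sigma_k$, i.e. the smooth field of endomorphisms, determined by $g_k$ and the orientation, with $j_k^2=\mathrm{Id}$ and $g_k(j_k\cdot,j_k\cdot)=-g_k$; put $\omega_k=g_k(j_k\cdot,\cdot)$. For $\epsilon\in\{-1,1\}$ equip $\Sigma_1\times\Sigma_2$ with the metric $G^\epsilon=g_1+\epsilon g_2$, the paracomplex structure $J=j_1\oplus j_2$ and the symplectic form $\Omega^\epsilon=G^\epsilon(J\cdot,\cdot)=\pi_1^*\omega_1+\epsilon\pi_2^*\omega_2$. Let $S$ be a surface and let $\Phi=(\phi,\psi):S\to\Sigma_1\times\Sigma_2$ be a smooth Lagrangian immersion (that is, $\Phi^*\Omega^\epsilon=0$) whose induced metric $\Phi^*G^\epsilon$ is nondegenerate. A Hamiltonian variation of $\Phi$ is a smooth family $(\Phi_\tau)_{|\tau|<\delta}$ of Lagrangian maps $S\to\Sigma_1\times\Sigma_2$ with $\Phi_0=\Phi$, equal to $\Phi$ outside a compact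 set $K\subset S$, such that for every $\tau$ the one-form $\Omega^\epsilon(\partial_\tau\Phi_\tau,d\Phi_\tau\,\cdot)$ is the differential of a function $u_\tau$ that vanishes outside $K$ and depends smoothly on $(\tau,p)$. Its volume is $V_K(\tau)=\int_K\sqrt{|\det \Phi_\tau^*G^\epsilon|}$. The immersion $\Phi$ is Hamiltonian $G^\epsilon$-minimal if $V_K'(0)=0$ for every Hamiltonian variation of $\Phi$. Assume that $\Phi$ is Hamiltonian $G^\epsilon$-minimal and of projected rank one, i.e. at every point of $S$ the differential of $\phi$ or that of $\psi$ has rank one. Then both differentials have rank one at every point, so that $\phi$ and $\psi$ locally trace out curves, and these are non-null. Let $\epsilon_\phi,\epsilon_\psi\in\{-1,1\}$ be the signs of $g_1$ and $g_2$ on the nonzero tangent vectors of these curves, and assume that $\epsilon_\phi\kappa_1\le 0$ along $\phi$ and $\epsilon_\psi\kappa_2\le 0$ along $\psi$. Then $\Phi$ is a local maximizer of the volume in its Hamiltonian isotopy class to second order, i.e. it is Hamiltonian stable: for every Hamiltonian variation of $\Phi$ the function $V_K$ is twice continuously differentiable near $0$ and $V_K''(0)\le 0$. -/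

import Mathlib

open Set Bundle
open scoped Manifold ContDiff

noncomputable section

/-- The model plane of all surfaces. -/
abbrev Plane : Type := EuclideanSpace ℝ (Fin 2)

instance planeChartedSpace : ChartedSpace Plane Plane := chartedSpaceSelf Plane

/-! ### Lorentzian surfaces and their para-Kähler structures -/

/-- A smooth metric of signature `(1,1)` on a surface. In dimension two, a symmetric bilinear form
which takes both signs is automatically nondegenerate. -/
structure LorentzMetric (M : Type*) [TopologicalSpace M] [ChartedSpace Plane M]
    [IsManifold (𝓡 2) ∞ M] where
  /-- the bilinear form on each tangent plane -/
  form (x : M) : TangentSpace (𝓡 2) x →L[ℝ] TangentSpace (𝓡 2) x →L[ℝ] ℝ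
  symm (x : M) (v w : TangentSpace (𝓡 2) x) : form x v w = form x w v
  exists_pos (x : M) : ∃ v : TangentSpace (𝓡 2) x, 0 < form x v v
  exists_neg (x : M) : ∃ v : TangentSpace (𝓡 2) x, form x v v < 0
  contMDiff : ContMDiff (𝓡 2) ((𝓡 2).prod 𝓘(ℝ, Plane →L[ℝ] Plane →L[ℝ] ℝ)) ∞
    (fun x ↦ TotalSpace.mk' (Plane →L[ℝ] Plane →L[ℝ] ℝ)
      (E := fun x : M ↦ TangentSpace (𝓡 2) x →L[ℝ] TangentSpace (𝓡 2) x →L[ℝ] ℝ) x (form x))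

/-- The paracomplex structure `j` of an oriented Lorentzian surface: `j² = id` and
`g(j·, j·) = -g(·,·)`. At every point exactly two endomorphisms `± j₀` satisfy these equations
(`j₀` exchanges the vectors of an orthonormal basis), one for each orientation of the tangent
plane; so a smooth `j` amounts to the choice of an orientation. -/
structure ParacomplexStructure {M : Type*} [TopologicalSpace M] [ChartedSpace Plane M]
    [IsManifold (𝓡 2) ∞ M] (g : LorentzMetric M) where
  /-- the endomorphism of each tangent plane -/
  endo (x : M) : TangentSpace (𝓡 2) x →L[ℝ] TangentSpace (𝓡 2) x
  endo_endo (x : M) (v : TangentSpace (𝓡 2) x) : endo x (endo x v) = v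
  form_endo (x : M) (v w : TangentSpace (𝓡 2) x) :
    g.form x (endo x v) (endo x w) = - g.form x v w
  contMDiff : ContMDiff (𝓡 2) ((𝓡 2).prod 𝓘(ℝ, Plane →L[ℝ] Plane)) ∞
    (fun x ↦ TotalSpace.mk' (Plane →L[ℝ] Plane)
      (E := fun x : M ↦ TangentSpace (𝓡 2) x →L[ℝ] TangentSpace (𝓡 2) x) x (endo x))

/-! ### Local coordinates, Gauss curvature -/

section Coordinates

variable {M : Type*} [TopologicalSpace M] [ChartedSpace Plane M]

/-- The matrix `b(∂ᵢ, ∂ⱼ)` of a field `b` of bilinear forms in the chart `e`, at the point of `M`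
with coordinates `y`. -/
def coordMatrix (b : ∀ p : M, TangentSpace (𝓡 2) p → TangentSpace (𝓡 2) p → ℝ)
    (e : OpenPartialHomeomorph M Plane) (y : Plane) : Matrix (Fin 2) (Fin 2) ℝ :=
  Matrix.of fun i j ↦ b (e.symm y)
    (mfderiv (𝓡 2) (𝓡 2) e.symm y (EuclideanSpace.single i (1 : ℝ)))
    (mfderiv (𝓡 2) (𝓡 2) e.symm y (EuclideanSpace.single j (1 : ℝ)))

/-- The partial derivative `∂ᵢ f` of a function of two coordinates. -/
def coordDeriv (i : Fin 2) (f : Plane → ℝ) (y : Plane) : ℝ :=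
  fderiv ℝ f y (EuclideanSpace.single i (1 : ℝ))

/-- The Christoffel symbol `Γᵏᵢⱼ` of a metric given by its coordinate matrix. -/
def christoffel (g : Plane → Matrix (Fin 2) (Fin 2) ℝ) (k i j : Fin 2) (y : Plane) : ℝ :=
  (1 / 2) * ∑ l, (g y)⁻¹ k l *
    (coordDeriv i (fun z ↦ g z j l) y + coordDeriv j (fun z ↦ g z i l) y
      - coordDeriv l (fun z ↦ g z i j) y)

/-- The component `Rˡᵢⱼₖ` of the curvature tensor: `R(∂ᵢ, ∂ⱼ)∂ₖ = ∑ₗ Rˡᵢⱼₖ ∂ₗ`, where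
`R(X, Y)Z = ∇_X ∇_Y Z - ∇_Y ∇_X Z - ∇_[X,Y] Z`. -/
def curvatureCoeff (g : Plane → Matrix (Fin 2) (Fin 2) ℝ) (l i j k : Fin 2) (y : Plane) : ℝ :=
  coordDeriv i (christoffel g l j k) y - coordDeriv j (christoffel g l i k) y
    + ∑ m, (christoffel g m j k y * christoffel g l i m y
      - christoffel g m i k y * christoffel g l j m y)

/-- The Gauss curvature `g(R(∂₀, ∂₁)∂₁, ∂₀) / det g` of a metric given by its coordinate matrix. -/
def coordGaussCurvature (g : Plane → Matrix (Fin 2) (Fin 2) ℝ) (y : Plane) : ℝ :=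
  (∑ l, curvatureCoeff g l 0 1 1 y * g y l 0) / (g y).det

/-- The Gauss curvature of a Lorentzian surface. It does not depend on the chart used. -/
def LorentzMetric.gaussCurvature [IsManifold (𝓡 2) ∞ M] (g : LorentzMetric M) (x : M) : ℝ :=
  coordGaussCurvature (coordMatrix (fun p v w ↦ g.form p v w) (chartAt Plane x)) (chartAt Plane x x)

end Coordinates

/-! ### The product structure on `M₁ × M₂`, with `T(M₁ × M₂) = TM₁ ⊕ TM₂` -/

section Product

variable {M₁ M₂ : Type*}
  [TopologicalSpace M₁] [ChartedSpace Plane M₁] [IsManifold (𝓡 2) ∞ M₁]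
  [TopologicalSpace M₂] [ChartedSpace Plane M₂] [IsManifold (𝓡 2) ∞ M₂]

/-- The tangent space of `M₁ × M₂` at `q`, split as a direct sum. -/
abbrev ProdTangent (q : M₁ × M₂) : Type := TangentSpace (𝓡 2) q.1 × TangentSpace (𝓡 2) q.2

/-- The metric `G^ε = g₁ + ε g₂`. -/
def prodMetric (g₁ : LorentzMetric M₁) (g₂ : LorentzMetric M₂) (ε : ℝ) (q : M₁ × M₂)
    (X Y : ProdTangent q) : ℝ :=
  g₁.form q.1 X.1 Y.1 + ε * g₂.form q.2 X.2 Y.2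

/-- The paracomplex structure `J = j₁ ⊕ j₂`. -/
def prodEndo {g₁ : LorentzMetric M₁} {g₂ : LorentzMetric M₂} (j₁ : ParacomplexStructure g₁)
    (j₂ : ParacomplexStructure g₂) (q : M₁ × M₂) (X : ProdTangent q) : ProdTangent q :=
  (j₁.endo q.1 X.1, j₂.endo q.2 X.2)

/-- The symplectic form `Ω^ε = π₁^*ω₁ + ε π₂^*ω₂ = G^ε(J·,·)`, where `ωₖ = gₖ(jₖ·,·)`. -/
def prodSymplectic {g₁ : LorentzMetric M₁} {g₂ : LorentzMetric M₂} (j₁ : ParacomplexStructure g₁)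
    (j₂ : ParacomplexStructure g₂) (ε : ℝ) (q : M₁ × M₂) (X Y : ProdTangent q) : ℝ :=
  prodMetric g₁ g₂ ε q (prodEndo j₁ j₂ q X) Y

end Product

/-! ### Maps of a surface `S` into `M₁ × M₂` -/

section Maps

variable {M₁ M₂ S : Type*}
  [TopologicalSpace M₁] [ChartedSpace Plane M₁] [IsManifold (𝓡 2) ∞ M₁]
  [TopologicalSpace M₂] [ChartedSpace Plane M₂] [IsManifold (𝓡 2) ∞ M₂]
  [TopologicalSpace S] [ChartedSpace Plane S]

/-- The differential of `Φ = (φ, ψ)`. -/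
def pairDeriv (Φ : S → M₁ × M₂) (p : S) (v : TangentSpace (𝓡 2) p) : ProdTangent (Φ p) :=
  (mfderiv (𝓡 2) (𝓡 2) (fun q ↦ (Φ q).1) p v, mfderiv (𝓡 2) (𝓡 2) (fun q ↦ (Φ q).2) p v)

/-- The velocity at time `τ` of a curve in `M₁ × M₂`. -/
def pairVelocity (c : ℝ → M₁ × M₂) (τ : ℝ) : ProdTangent (c τ) :=
  (mfderiv 𝓘(ℝ, ℝ) (𝓡 2) (fun r ↦ (c r).1) τ (1 : ℝ),
    mfderiv 𝓘(ℝ, ℝ) (𝓡 2) (fun r ↦ (c r).2) τ (1 : ℝ))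

/-- The induced metric `Φ^* G^ε`. -/
def inducedMetric (g₁ : LorentzMetric M₁) (g₂ : LorentzMetric M₂) (ε : ℝ) (Φ : S → M₁ × M₂)
    (p : S) (v w : TangentSpace (𝓡 2) p) : ℝ :=
  prodMetric g₁ g₂ ε (Φ p) (pairDeriv Φ p v) (pairDeriv Φ p w)

/-- `Φ^* Ω^ε = 0`. -/
def IsLagrangian {g₁ : LorentzMetric M₁} {g₂ : LorentzMetric M₂} (j₁ : ParacomplexStructure g₁)
    (j₂ : ParacomplexStructure g₂) (ε : ℝ) (Φ : S → M₁ × M₂) : Prop :=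
  ∀ (p : S) (v w : TangentSpace (𝓡 2) p),
    prodSymplectic j₁ j₂ ε (Φ p) (pairDeriv Φ p v) (pairDeriv Φ p w) = 0

/-- A smooth Lagrangian immersion whose induced metric is nondegenerate. -/
structure IsNondegLagrangianImmersion {g₁ : LorentzMetric M₁} {g₂ : LorentzMetric M₂}
    (j₁ : ParacomplexStructure g₁) (j₂ : ParacomplexStructure g₂) (ε : ℝ)
    (Φ : S → M₁ × M₂) : Prop where
  contMDiff : ContMDiff (𝓡 2) ((𝓡 2).prod (𝓡 2)) ∞ Φ
  injective (p : S) : Function.Injective (pairDeriv Φ p)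
  lagrangian : IsLagrangian j₁ j₂ ε Φ
  nondegenerate (p : S) (v : TangentSpace (𝓡 2) p) :
    (∀ w : TangentSpace (𝓡 2) p, inducedMetric g₁ g₂ ε Φ p v w = 0) → v = 0

/-- `Φ = (φ, ψ)` is of projected rank one at every point: `dφ` or `dψ` has rank one. -/
def IsProjectedRankOne (Φ : S → M₁ × M₂) : Prop :=
  ∀ p : S,
    Module.finrank ℝ (LinearMap.range
      (mfderiv (𝓡 2) (𝓡 2) (fun q ↦ (Φ q).1) p).toLinearMap) = 1 ∨
    Module.finrank ℝ (LinearMap.range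
      (mfderiv (𝓡 2) (𝓡 2) (fun q ↦ (Φ q).2) p).toLinearMap) = 1

/-- Let `f : S → M` be of rank one, so that locally it traces out a curve. The condition says that
`ε_f κ ≤ 0` along this curve, where `κ` is the Gauss curvature of `(M, g)` and `ε_f` is the sign of
`g` on the tangent vectors `df(v) ≠ 0` of the curve. -/
def SignedCurvatureNonpos {M : Type*} [TopologicalSpace M] [ChartedSpace Plane M]
    [IsManifold (𝓡 2) ∞ M] (g : LorentzMetric M) (f : S → M) : Prop :=
  ∀ (p : S) (v : TangentSpace (𝓡 2) p), mfderiv (𝓡 2) (𝓡 2) f p v ≠ 0 →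
    Real.sign (g.form (f p) (mfderiv (𝓡 2) (𝓡 2) f p v) (mfderiv (𝓡 2) (𝓡 2) f p v))
      * g.gaussCurvature (f p) ≤ 0

end Maps

/-! ### Volume -/

section Volume

variable {S : Type*} [TopologicalSpace S] [ChartedSpace Plane S] [IsManifold (𝓡 2) ∞ S]
  [T2Space S] [SigmaCompactSpace S]

/-- A smooth partition of unity on `S` subordinate to the domains of the charts. -/
def chartPartition (S : Type*) [TopologicalSpace S] [ChartedSpace Plane S] [IsManifold (𝓡 2) ∞ S]
    [T2Space S] [SigmaCompactSpace S] : SmoothPartitionOfUnity S (𝓡 2) S univ :=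
  (SmoothPartitionOfUnity.exists_isSubordinate_chartAt_source (𝓡 2) S).choose

theorem chartPartition_isSubordinate :
    (chartPartition S).IsSubordinate fun i ↦ (chartAt Plane i).source :=
  (SmoothPartitionOfUnity.exists_isSubordinate_chartAt_source (𝓡 2) S).choose_spec

/-- The volume over a compact set `K ⊆ S` of a field `b` of symmetric bilinear forms: the integral
over `K` of the density `√|det b|`. Only finitely many terms of the sum are nonzero, and the value
does not depend on the charts or on the partition of unity. -/
def volumeOn (b : ∀ p : S, TangentSpace (𝓡 2) p → TangentSpace (𝓡 2) p → ℝ) (K : Set S) : ℝ :=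
  ∑ᶠ i : S, ∫ y in (chartAt Plane i).target ∩ (chartAt Plane i).symm ⁻¹' K,
    chartPartition S i ((chartAt Plane i).symm y) *
      √|(coordMatrix b (chartAt Plane i) y).det|

end Volume

/-! ### Hamiltonian variations -/

section Hamiltonian

variable {M₁ M₂ S : Type*}
  [TopologicalSpace M₁] [ChartedSpace Plane M₁] [IsManifold (𝓡 2) ∞ M₁]
  [TopologicalSpace M₂] [ChartedSpace Plane M₂] [IsManifold (𝓡 2) ∞ M₂]
  [TopologicalSpace S] [ChartedSpace Plane S] [IsManifold (𝓡 2) ∞ S]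

/-- `F τ`, `|τ| < δ`, is a smooth Hamiltonian variation of `Φ` supported in the compact set `K`:
all `F τ` are Lagrangian, and at every time the one-form `Ω^ε(∂F/∂τ, dF_τ ·)` on `S` is the
differential of a function `u τ` supported in `K`. (When `F τ` is a nondegenerate immersion, this
says that the normal part of the velocity is `J ∇(u τ)`.) -/
structure IsHamiltonianVariation {g₁ : LorentzMetric M₁} {g₂ : LorentzMetric M₂}
    (j₁ : ParacomplexStructure g₁) (j₂ : ParacomplexStructure g₂) (ε : ℝ)
    (Φ : S → M₁ × M₂) (F : ℝ → S → M₁ × M₂) (K : Set S) (δ : ℝ) : Prop where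
  pos : 0 < δ
  isCompact : IsCompact K
  contMDiffOn : ContMDiffOn (𝓘(ℝ, ℝ).prod (𝓡 2)) ((𝓡 2).prod (𝓡 2)) ∞
    (fun z : ℝ × S ↦ F z.1 z.2) (Ioo (-δ) δ ×ˢ univ)
  zero : F 0 = Φ
  eq_of_notMem : ∀ τ ∈ Ioo (-δ) δ, ∀ p ∉ K, F τ p = Φ p
  lagrangian : ∀ τ ∈ Ioo (-δ) δ, IsLagrangian j₁ j₂ ε (F τ)
  exists_hamiltonian : ∃ u : ℝ → S → ℝ,
    ContMDiffOn (𝓘(ℝ, ℝ).prod (𝓡 2)) 𝓘(ℝ, ℝ) ∞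
      (fun z : ℝ × S ↦ u z.1 z.2) (Ioo (-δ) δ ×ˢ univ) ∧
    (∀ τ ∈ Ioo (-δ) δ, ∀ p ∉ K, u τ p = 0) ∧
    ∀ τ ∈ Ioo (-δ) δ, ∀ (p : S) (v : TangentSpace (𝓡 2) p),
      prodSymplectic j₁ j₂ ε (F τ p) (pairVelocity (fun r ↦ F r p) τ) (pairDeriv (F τ) p v)
        = mfderiv (𝓡 2) 𝓘(ℝ, ℝ) (u τ) p v

variable [T2Space S] [SigmaCompactSpace S]

/-- `Φ` is Hamiltonian `G^ε`-minimal: it is a critical point of the volume with respect to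
Hamiltonian variations. -/
def IsHamiltonianMinimal {g₁ : LorentzMetric M₁} {g₂ : LorentzMetric M₂}
    (j₁ : ParacomplexStructure g₁) (j₂ : ParacomplexStructure g₂) (ε : ℝ)
    (Φ : S → M₁ × M₂) : Prop :=
  ∀ (F : ℝ → S → M₁ × M₂) (K : Set S) (δ : ℝ), IsHamiltonianVariation j₁ j₂ ε Φ F K δ →
    HasDerivAt (fun τ ↦ volumeOn (inducedMetric g₁ g₂ ε (F τ)) K) 0 0

/-- The second variation of the volume exists and is nonpositive for all Hamiltonian variations of
`Φ`. For Hamiltonian minimal `Φ` this is Hamiltonian stability, with the sign of a maximum. -/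
def HasNonposHamiltonianSecondVariation {g₁ : LorentzMetric M₁} {g₂ : LorentzMetric M₂}
    (j₁ : ParacomplexStructure g₁) (j₂ : ParacomplexStructure g₂) (ε : ℝ)
    (Φ : S → M₁ × M₂) : Prop :=
  ∀ (F : ℝ → S → M₁ × M₂) (K : Set S) (δ : ℝ), IsHamiltonianVariation j₁ j₂ ε Φ F K δ →
    ContDiffAt ℝ 2 (fun τ ↦ volumeOn (inducedMetric g₁ g₂ ε (F τ)) K) 0 ∧
    iteratedDeriv 2 (fun τ ↦ volumeOn (inducedMetric g₁ g₂ ε (F τ)) K) 0 ≤ 0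

end Hamiltonian

end

noncomputable section

open Set Bundle
open scoped Manifold ContDiff

set_option linter.unusedSectionVars false

/-! The Lagrangian, rank one and nondegeneracy conditions split every tangent plane of `S` into the
kernels of `dψ` and `dφ`, on which `dφ` and `dψ` are not null (`exists_tangent_splitting`). Hence
`Φ` is locally `(γ₁(s), γ₂(t))` with two curves parametrized by arclength (`exists_isAdaptedChart`).
In such an adapted chart the induced metric is `e₁ ds² + e₂ dt²` with `e₁ = ε_φ` and `e₂ = ε ε_ψ`,
and the area density is `1`.

Let `k₁`, `k₂` be the geodesic curvatures of the curves and `u` the Hamiltonian of a variation at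
time `0`, with derivatives `u_s`, `u_t`. The first variation of the area density is `div X + k₁ e₁
u_s + k₂ e₂ u_t`, where `X` is the tangential part of the velocity. The second one is
(`second_variation`) `-(Δu)² - (k₁ e₁ u_s - k₂ e₂ u_t)² + ε_φ κ₁ u_s² + ε_ψ κ₂ u_t² + div Z + k₁ e₁
w_s + k₂ e₂ w_t`, with an explicit field `Z` (`fluxFst`, `fluxSnd`) and an explicit function `w`
(`secondPotential`). The first four terms are nonpositive by the curvature assumption. The others
have the shape of a first variation: they are the contributions of a reparametrization of the
surface with velocity `Z`, whose Hamiltonian vanishes, and of a normal variation with Hamiltonian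
`w`. Both kinds of variation exist (`exists_tangential_variation`, `exists_normal_variation`), so
minimality makes the integral of these terms vanish. Neither Stokes' theorem nor an Euler-Lagrange
equation is needed.

`Z` and `w` are defined in adapted charts. Two adapted charts differ locally by a reflection of the
axes, under which `Z` behaves as a vector field and `w` is invariant (`fluxFst_pullback`,
`fluxSnd_pullback`, `secondPotential_pullback`). They can therefore be cut off by a partition of
unity, and each piece is realized by a variation supported in one adapted chart. The resulting
pointwise inequality (`IsAdaptedChart.second_variation_le`) is multiplied by a Jacobian and
integrated in the preferred charts of `S`.

The pointwise formulas come from moving frames. A null coframe with its connection form is pulled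
back along the variation of each factor. Cartan's equations then give a Jacobi identity for the
second time derivative of the pulled-back metric (`IsMovingFrame.jacobi`), and the signed sum of
four such identities is the second variation formula. -/

theorem mfderiv_comp_fderiv {E E' M : Type*} [NormedAddCommGroup E] [NormedSpace ℝ E]
    [NormedAddCommGroup E'] [NormedSpace ℝ E'] [TopologicalSpace M] [ChartedSpace Plane M]
    {f : E' → M} {h : E → E'} {z : E}
    (hf : MDifferentiableAt 𝓘(ℝ, E') (𝓡 2) f (h z)) (hh : DifferentiableAt ℝ h z) (v : E) :
    mfderiv 𝓘(ℝ, E) (𝓡 2) (fun z ↦ f (h z)) z v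
      = mfderiv 𝓘(ℝ, E') (𝓡 2) f (h z) (fderiv ℝ h z v) := by
  have := mfderiv_comp z (I' := 𝓘(ℝ, E')) hf hh.mdifferentiableAt
  rw [mfderiv_eq_fderiv] at this
  exact congrArg (fun L ↦ L v) this

/-! ### Pull-backs of the metric and of the area form to a normed space -/

section PullBack

variable {E E' M : Type*} [NormedAddCommGroup E] [NormedSpace ℝ E]
  [NormedAddCommGroup E'] [NormedSpace ℝ E']
  [TopologicalSpace M] [ChartedSpace Plane M] [IsManifold (𝓡 2) ∞ M]

/-- The pull-back `f^* g`, evaluated on two constant vector fields. -/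
def pullForm (g : LorentzMetric M) (f : E → M) (v w : E) (z : E) : ℝ :=
  g.form (f z) (mfderiv 𝓘(ℝ, E) (𝓡 2) f z v) (mfderiv 𝓘(ℝ, E) (𝓡 2) f z w)

/-- The pull-back of the area form `g(j·,·)`, evaluated on two constant vector fields. -/
def pullArea {g : LorentzMetric M} (j : ParacomplexStructure g) (f : E → M) (v w : E) (z : E) : ℝ :=
  g.form (f z) (j.endo (f z) (mfderiv 𝓘(ℝ, E) (𝓡 2) f z v)) (mfderiv 𝓘(ℝ, E) (𝓡 2) f z w)

/-- The tangent spaces vary with `f z`, so smoothness is stated for a map into the tangent bundle.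
In this form the evaluation of smooth bundle maps on vector fields applies to `g` and `j`. -/
theorem contMDiffAt_mfderiv_const {f : E → M} {z : E} (hf : ContMDiffAt 𝓘(ℝ, E) (𝓡 2) ∞ f z)
    (v : E) : ContMDiffAt 𝓘(ℝ, E) ((𝓡 2).prod 𝓘(ℝ, Plane)) ∞
      (fun z ↦ TotalSpace.mk' Plane (E := fun x : M ↦ TangentSpace (𝓡 2) x) (f z)
        (mfderiv 𝓘(ℝ, E) (𝓡 2) f z v)) z := by
  rw [contMDiffAt_totalSpace]
  refine ⟨hf, ?_⟩
  have := (ContMDiffAt.mfderiv_const (n := ∞) (m := ∞) hf (by simp)).clm_apply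
    (contMDiffAt_const (c := v))
  refine this.congr_of_eventuallyEq ?_
  filter_upwards [hf.continuousAt.eventually
    ((chartAt Plane (f z)).open_source.mem_nhds (mem_chart_source Plane (f z)))] with x hx
  have e := congrArg (fun L : E →L[ℝ] Plane ↦ L v) (inTangentCoordinates_eq (I := 𝓘(ℝ, E))
    (I' := 𝓡 2) id f (fun y ↦ mfderiv 𝓘(ℝ, E) (𝓡 2) f y) (x₀ := z) (x := x) (by rw [chartAt_self_eq]; trivial) hx)
  refine Eq.trans ?_ e.symm
  simp only [tangentBundleCore_coordChange_model_space]
  rfl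

theorem contDiffAt_pullForm (g : LorentzMetric M) {f : E → M} {z : E}
    (hf : ContMDiffAt 𝓘(ℝ, E) (𝓡 2) ∞ f z) (v w : E) :
    ContDiffAt ℝ ∞ (pullForm g f v w) z := by
  rw [← contMDiffAt_iff_contDiffAt]
  have h1 := (g.contMDiff.contMDiffAt (x := f z)).comp z hf
  have h := ContMDiffAt.clm_bundle_apply₂ (F₃ := ℝ) (E₃ := Bundle.Trivial M ℝ)
    h1 (contMDiffAt_mfderiv_const hf v) (contMDiffAt_mfderiv_const hf w)
  simp only [contMDiffAt_totalSpace] at h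
  exact h.2

theorem contDiffAt_pullArea {g : LorentzMetric M} (j : ParacomplexStructure g) {f : E → M} {z : E}
    (hf : ContMDiffAt 𝓘(ℝ, E) (𝓡 2) ∞ f z) (v w : E) :
    ContDiffAt ℝ ∞ (pullArea j f v w) z := by
  rw [← contMDiffAt_iff_contDiffAt]
  have h1 := (g.contMDiff.contMDiffAt (x := f z)).comp z hf
  have h2 := (j.contMDiff.contMDiffAt (x := f z)).comp z hf
  have h3 := ContMDiffAt.clm_bundle_apply h2 (contMDiffAt_mfderiv_const hf v)
  have h := ContMDiffAt.clm_bundle_apply₂ (F₃ := ℝ) (E₃ := Bundle.Trivial M ℝ)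
    h1 h3 (contMDiffAt_mfderiv_const hf w)
  simp only [contMDiffAt_totalSpace] at h
  exact h.2

theorem pullForm_comp (g : LorentzMetric M) {f : E' → M} {h : E → E'} {z : E}
    (hf : MDifferentiableAt 𝓘(ℝ, E') (𝓡 2) f (h z)) (hh : DifferentiableAt ℝ h z) (v w : E) :
    pullForm g (fun z ↦ f (h z)) v w z = pullForm g f (fderiv ℝ h z v) (fderiv ℝ h z w) (h z) := by
  simp only [pullForm, mfderiv_comp_fderiv hf hh]

theorem pullArea_comp {g : LorentzMetric M} (j : ParacomplexStructure g) {f : E' → M} {h : E → E'}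
    {z : E} (hf : MDifferentiableAt 𝓘(ℝ, E') (𝓡 2) f (h z)) (hh : DifferentiableAt ℝ h z) (v w : E) :
    pullArea j (fun z ↦ f (h z)) v w z
      = pullArea j f (fderiv ℝ h z v) (fderiv ℝ h z w) (h z) := by
  simp only [pullArea, mfderiv_comp_fderiv hf hh]

open Filter Topology in
theorem pullForm_congr (g : LorentzMetric M) {f f' : E → M} {z : E} (h : f =ᶠ[𝓝 z] f') (v w : E) :
    pullForm g f v w z = pullForm g f' v w z := by
  have h1 := h.mfderiv_eq (I := 𝓘(ℝ, E)) (I' := 𝓡 2)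
  have h2 := h.eq_of_nhds
  simp only [pullForm]
  -- Both derivatives take values in a tangent space that depends on the base point. They are
  -- generalized before the base points are identified.
  revert h1
  generalize mfderiv 𝓘(ℝ, E) (𝓡 2) f z = A
  generalize mfderiv 𝓘(ℝ, E) (𝓡 2) f' z = B
  revert A B
  rw [h2]
  rintro A B rfl
  rfl

open Filter Topology in
theorem pullArea_congr {g : LorentzMetric M} (j : ParacomplexStructure g) {f f' : E → M} {z : E}
    (h : f =ᶠ[𝓝 z] f') (v w : E) : pullArea j f v w z = pullArea j f' v w z := by
  have h1 := h.mfderiv_eq (I := 𝓘(ℝ, E)) (I' := 𝓡 2)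
  have h2 := h.eq_of_nhds
  simp only [pullArea]
  revert h1
  generalize mfderiv 𝓘(ℝ, E) (𝓡 2) f z = A
  generalize mfderiv 𝓘(ℝ, E) (𝓡 2) f' z = B
  revert A B
  rw [h2]
  rintro A B rfl
  rfl

end PullBack

/-! ### Null coframes, connection forms and the Gauss curvature in coordinates -/

section CoordCurvature

open Filter Topology

theorem coordDeriv_mul {f h : Plane → ℝ} {y : Plane} (hf : DifferentiableAt ℝ f y)
    (hh : DifferentiableAt ℝ h y) (i : Fin 2) :
    coordDeriv i (fun z ↦ f z * h z) y = f y * coordDeriv i h y + coordDeriv i f y * h y := by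
  simp only [coordDeriv, fderiv_fun_mul hf hh]
  simp
  ring

theorem coordDeriv_add {f h : Plane → ℝ} {y : Plane} (hf : DifferentiableAt ℝ f y)
    (hh : DifferentiableAt ℝ h y) (i : Fin 2) :
    coordDeriv i (fun z ↦ f z + h z) y = coordDeriv i f y + coordDeriv i h y := by
  simp only [coordDeriv, fderiv_fun_add hf hh]
  simp

theorem coordDeriv_sub {f h : Plane → ℝ} {y : Plane} (hf : DifferentiableAt ℝ f y)
    (hh : DifferentiableAt ℝ h y) (i : Fin 2) :
    coordDeriv i (fun z ↦ f z - h z) y = coordDeriv i f y - coordDeriv i h y := by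
  simp only [coordDeriv, fderiv_fun_sub hf hh]
  simp

theorem coordDeriv_congr {f h : Plane → ℝ} {y : Plane} (hf : f =ᶠ[𝓝 y] h) (i : Fin 2) :
    coordDeriv i f y = coordDeriv i h y := by
  simp only [coordDeriv, hf.fderiv_eq]

theorem coordDeriv_comm {f : Plane → ℝ} {y : Plane} (hf : ContDiffAt ℝ ∞ f y) (i j : Fin 2) :
    coordDeriv i (coordDeriv j f) y = coordDeriv j (coordDeriv i f) y := by
  have hd : DifferentiableAt ℝ (fderiv ℝ f) y :=
    (hf.fderiv_right (m := 1) (by norm_cast)).differentiableAt (by simp)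
  have key : ∀ v w : Plane, fderiv ℝ (fun z ↦ fderiv ℝ f z v) y w = fderiv ℝ (fderiv ℝ f) y w v := by
    intro v w
    rw [fderiv_clm_apply hd (differentiableAt_const v)]
    simp
  have hs : IsSymmSndFDerivAt ℝ f y := (hf.of_le (m := 2) (by norm_cast)).isSymmSndFDerivAt (n := 2) (by simp)
  unfold coordDeriv
  rw [key, key]
  exact hs _ _

theorem contDiffAt_coordDeriv {f : Plane → ℝ} {y : Plane} (hf : ContDiffAt ℝ ∞ f y) (i : Fin 2) :
    ContDiffAt ℝ ∞ (coordDeriv i f) y :=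
  (hf.fderiv_right (m := ∞) (by simp)).clm_apply contDiffAt_const

/-- The metric `½ (θ⁺ ⊗ θ⁻ + θ⁻ ⊗ θ⁺)` with `θ⁺ = ∑ aᵢ dxⁱ` and `θ⁻ = ∑ cᵢ dxⁱ`. -/
def nullMatrix (a c : Fin 2 → Plane → ℝ) (y : Plane) : Matrix (Fin 2) (Fin 2) ℝ :=
  Matrix.of fun i j ↦ (a i y * c j y + c i y * a j y) / 2

theorem nullMatrix_det (a c : Fin 2 → Plane → ℝ) (y : Plane) :
    (nullMatrix a c y).det = - (a 0 y * c 1 y - a 1 y * c 0 y) ^ 2 / 4 := by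
  simp [nullMatrix, Matrix.det_fin_two]
  ring

theorem coordDeriv_nullMatrix {a c : Fin 2 → Plane → ℝ} {y : Plane}
    (ha : ∀ i, DifferentiableAt ℝ (a i) y) (hc : ∀ i, DifferentiableAt ℝ (c i) y) (i j l : Fin 2) :
    coordDeriv l (fun z ↦ nullMatrix a c z i j) y
      = (coordDeriv l (a i) y * c j y + a i y * coordDeriv l (c j) y
        + coordDeriv l (c i) y * a j y + c i y * coordDeriv l (a j) y) / 2 := by
  have : (fun z ↦ nullMatrix a c z i j)
      = fun z ↦ (fun _ ↦ (1 / 2 : ℝ)) z * (a i z * c j z + c i z * a j z) := by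
    funext z; simp [nullMatrix]; ring
  rw [this, coordDeriv_mul (by fun_prop) (by fun_prop), coordDeriv_add (by fun_prop) (by fun_prop),
    coordDeriv_mul (ha i) (hc j), coordDeriv_mul (hc i) (ha j)]
  simp [coordDeriv]
  ring

/-- The Levi-Civita connection in terms of a null coframe and its connection form `η`. -/
theorem nullCoframe_christoffel {a c η : Fin 2 → Plane → ℝ} {y : Plane}
    (ha : ∀ i, DifferentiableAt ℝ (a i) y) (hc : ∀ i, DifferentiableAt ℝ (c i) y)
    (hw : a 0 y * c 1 y - a 1 y * c 0 y ≠ 0)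
    (hda : coordDeriv 0 (a 1) y - coordDeriv 1 (a 0) y = -(η 0 y * a 1 y - η 1 y * a 0 y))
    (hdc : coordDeriv 0 (c 1) y - coordDeriv 1 (c 0) y = η 0 y * c 1 y - η 1 y * c 0 y)
    (i j : Fin 2) :
    (a 0 y * christoffel (nullMatrix a c) 0 i j y + a 1 y * christoffel (nullMatrix a c) 1 i j y
      = coordDeriv i (a j) y + η i y * a j y) ∧
    (c 0 y * christoffel (nullMatrix a c) 0 i j y + c 1 y * christoffel (nullMatrix a c) 1 i j y
      = coordDeriv i (c j) y - η i y * c j y) := by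
  -- The structure equations eliminate `∂₁a₀` and `∂₁c₀`. What remains is an identity of rational
  -- functions in the other first derivatives.
  have h1 : coordDeriv 1 (a 0) y = coordDeriv 0 (a 1) y + (η 0 y * a 1 y - η 1 y * a 0 y) := by
    linarith
  have h2 : coordDeriv 1 (c 0) y = coordDeriv 0 (c 1) y - (η 0 y * c 1 y - η 1 y * c 0 y) := by
    linarith
  -- The factor is the reciprocal of the determinant `-w²/4`, where `w = a₀c₁ - a₁c₀`.
  have hinv : (nullMatrix a c y)⁻¹ = (- 4 / (a 0 y * c 1 y - a 1 y * c 0 y) ^ 2) •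
      (nullMatrix a c y).adjugate := by
    rw [Matrix.inv_def, nullMatrix_det, Ring.inverse_eq_inv']
    congr 1
    field_simp
  have i00 : (nullMatrix a c y)⁻¹ 0 0 = - 4 / (a 0 y * c 1 y - a 1 y * c 0 y) ^ 2 *
      (a 1 y * c 1 y) := by
    rw [hinv, Matrix.adjugate_fin_two]; simp [nullMatrix, -mul_eq_mul_left_iff]; try ring
  have i01 : (nullMatrix a c y)⁻¹ 0 1 = - 4 / (a 0 y * c 1 y - a 1 y * c 0 y) ^ 2 *
      (-(a 0 y * c 1 y + c 0 y * a 1 y) / 2) := by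
    rw [hinv, Matrix.adjugate_fin_two]; simp [nullMatrix, -mul_eq_mul_left_iff]; try ring
  have i10 : (nullMatrix a c y)⁻¹ 1 0 = - 4 / (a 0 y * c 1 y - a 1 y * c 0 y) ^ 2 *
      (-(a 0 y * c 1 y + c 0 y * a 1 y) / 2) := by
    rw [hinv, Matrix.adjugate_fin_two]; simp [nullMatrix, -mul_eq_mul_left_iff]; try ring
  have i11 : (nullMatrix a c y)⁻¹ 1 1 = - 4 / (a 0 y * c 1 y - a 1 y * c 0 y) ^ 2 *
      (a 0 y * c 0 y) := by
    rw [hinv, Matrix.adjugate_fin_two]; simp [nullMatrix, -mul_eq_mul_left_iff]; try ring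
  simp only [christoffel, coordDeriv_nullMatrix ha hc, Fin.sum_univ_two, i00, i01, i10, i11]
  clear hinv i00 i01 i10 i11
  revert i j
  simp only [Fin.forall_fin_two, h1, h2]
  clear h1 h2 hda hdc ha hc
  generalize a 0 y = a0 at *
  generalize a 1 y = a1 at *
  generalize c 0 y = c0 at *
  generalize c 1 y = c1 at *
  have hw' : a0 * c1 - c0 * a1 ≠ 0 := by rwa [mul_comm c0]
  have hw'' : a0 * c1 - a1 * c0 = a0 * c1 - c0 * a1 := by ring
  rw [hw'']
  refine ⟨⟨⟨?_, ?_⟩, ⟨?_, ?_⟩⟩, ⟨⟨?_, ?_⟩, ⟨?_, ?_⟩⟩⟩ <;> field_simp <;> ring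

/-- Curvature is built from derivatives of the matrix, so only the germ counts. This permits
replacing the coordinate matrix of a metric by `nullMatrix`, with which it agrees only near a point.
-/
theorem coordGaussCurvature_congr {g h : Plane → Matrix (Fin 2) (Fin 2) ℝ} {y : Plane}
    (H : g =ᶠ[𝓝 y] h) : coordGaussCurvature g y = coordGaussCurvature h y := by
  have h1 : ∀ i j l, ∀ᶠ z in 𝓝 y, coordDeriv l (fun z ↦ g z i j) z
      = coordDeriv l (fun z ↦ h z i j) z := by
    intro i j l
    filter_upwards [H.eventuallyEq_nhds] with z hz
    exact coordDeriv_congr (hz.fun_comp (fun m ↦ m i j)) l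
  have h2 : ∀ k i j, christoffel g k i j =ᶠ[𝓝 y] christoffel h k i j := by
    intro k i j
    filter_upwards [H, eventually_all.2 fun l ↦ h1 j l i, eventually_all.2 fun l ↦ h1 i l j,
      eventually_all.2 fun l ↦ h1 i j l] with z hz a b c
    simp only [christoffel, hz, a, b, c]
  simp only [coordGaussCurvature, curvatureCoeff, H.eq_of_nhds, coordDeriv_congr (h2 _ _ _),
    (h2 _ _ _).eq_of_nhds]

/-- Cartan's structure equation `dη = ½ K θ⁺ ∧ θ⁻`. -/
theorem nullCoframe_curvature {a c η : Fin 2 → Plane → ℝ} {y : Plane}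
    (ha : ∀ i, ContDiffAt ℝ ∞ (a i) y) (hc : ∀ i, ContDiffAt ℝ ∞ (c i) y)
    (hη : ∀ i, ContDiffAt ℝ ∞ (η i) y)
    (hw : a 0 y * c 1 y - a 1 y * c 0 y ≠ 0)
    (hda : ∀ᶠ z in 𝓝 y,
      coordDeriv 0 (a 1) z - coordDeriv 1 (a 0) z = -(η 0 z * a 1 z - η 1 z * a 0 z))
    (hdc : ∀ᶠ z in 𝓝 y,
      coordDeriv 0 (c 1) z - coordDeriv 1 (c 0) z = η 0 z * c 1 z - η 1 z * c 0 z) :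
    coordDeriv 0 (η 1) y - coordDeriv 1 (η 0) y
      = coordGaussCurvature (nullMatrix a c) y / 2 * (a 0 y * c 1 y - a 1 y * c 0 y) := by
  have hae : ∀ᶠ z in 𝓝 y, ∀ i, ContDiffAt ℝ 1 (a i) z :=
    eventually_all.2 fun i ↦ (((ha i).of_le (by norm_cast)).eventually (by simp))
  have hce : ∀ᶠ z in 𝓝 y, ∀ i, ContDiffAt ℝ 1 (c i) z :=
    eventually_all.2 fun i ↦ (((hc i).of_le (by norm_cast)).eventually (by simp))
  have hwc : ContinuousAt (fun z ↦ a 0 z * c 1 z - a 1 z * c 0 z) y := by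
    have := fun i ↦ (ha i).continuousAt
    have := fun i ↦ (hc i).continuousAt
    fun_prop (disch := assumption)
  have hwe := hwc.eventually_ne hw
  have key : ∀ᶠ z in 𝓝 y, ∀ i j,
    (a 0 z * christoffel (nullMatrix a c) 0 i j z + a 1 z * christoffel (nullMatrix a c) 1 i j z
      = coordDeriv i (a j) z + η i z * a j z) ∧
    (c 0 z * christoffel (nullMatrix a c) 0 i j z + c 1 z * christoffel (nullMatrix a c) 1 i j z
      = coordDeriv i (c j) z - η i z * c j z) := by
    filter_upwards [hae, hce, hwe, hda, hdc] with z h1 h2 h3 h4 h5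
    exact fun i j ↦ nullCoframe_christoffel (fun i ↦ (h1 i).differentiableAt (by simp))
      (fun i ↦ (h2 i).differentiableAt (by simp)) h3 h4 h5 i j
  set Γ := christoffel (nullMatrix a c) with hΓ
  -- Cramer's rule makes the Christoffel symbols smooth
  have cramer : ∀ i j, (Γ 0 i j =ᶠ[𝓝 y] fun z ↦
        (c 1 z * (coordDeriv i (a j) z + η i z * a j z)
          - a 1 z * (coordDeriv i (c j) z - η i z * c j z)) / (a 0 z * c 1 z - a 1 z * c 0 z)) ∧
      (Γ 1 i j =ᶠ[𝓝 y] fun z ↦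
        (a 0 z * (coordDeriv i (c j) z - η i z * c j z)
          - c 0 z * (coordDeriv i (a j) z + η i z * a j z)) / (a 0 z * c 1 z - a 1 z * c 0 z)) := by
    intro i j
    constructor
    all_goals
      filter_upwards [key, hwe] with z hz hw
      obtain ⟨h1, h2⟩ := hz i j
      rw [eq_div_iff hw, ← h1, ← h2]
      ring
  have hdΓ : ∀ k i j, DifferentiableAt ℝ (Γ k i j) y := by
    intro k i j
    have h1 := fun i ↦ (ha i).differentiableAt (by simp)
    have h2 := fun i ↦ (hc i).differentiableAt (by simp)
    have h3 := fun i ↦ (hη i).differentiableAt (by simp)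
    have h4 := fun i j ↦ (contDiffAt_coordDeriv (ha j) i).differentiableAt (by simp)
    have h5 := fun i j ↦ (contDiffAt_coordDeriv (hc j) i).differentiableAt (by simp)
    fin_cases k
    · refine DifferentiableAt.congr_of_eventuallyEq ?_ (cramer i j).1
      fun_prop (disch := assumption)
    · refine DifferentiableAt.congr_of_eventuallyEq ?_ (cramer i j).2
      fun_prop (disch := assumption)
  have da := fun i ↦ (ha i).differentiableAt (n := ∞) (by simp)
  have dc := fun i ↦ (hc i).differentiableAt (n := ∞) (by simp)
  have dη := fun i ↦ (hη i).differentiableAt (n := ∞) (by simp)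
  have dda := fun i j ↦ (contDiffAt_coordDeriv (ha j) i).differentiableAt (n := ∞) (by simp)
  have ddc := fun i j ↦ (contDiffAt_coordDeriv (hc j) i).differentiableAt (n := ∞) (by simp)
  -- The identities `∇θ⁺ = -η ⊗ θ⁺` and `∇θ⁻ = η ⊗ θ⁻` hold near `y`, so they may be differentiated
  -- once more.
  have D1 : ∀ l i j, a 0 y * coordDeriv l (Γ 0 i j) y + coordDeriv l (a 0) y * Γ 0 i j y
      + (a 1 y * coordDeriv l (Γ 1 i j) y + coordDeriv l (a 1) y * Γ 1 i j y)
      = coordDeriv l (coordDeriv i (a j)) y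
        + (η i y * coordDeriv l (a j) y + coordDeriv l (η i) y * a j y) := by
    intro l i j
    have := coordDeriv_congr (key.mono fun z hz ↦ (hz i j).1) l
    rwa [coordDeriv_add ((da 0).fun_mul (hdΓ 0 i j)) ((da 1).fun_mul (hdΓ 1 i j)),
      coordDeriv_mul (da 0) (hdΓ 0 i j), coordDeriv_mul (da 1) (hdΓ 1 i j),
      coordDeriv_add (dda i j) ((dη i).fun_mul (da j)), coordDeriv_mul (dη i) (da j)] at this
  have D2 : ∀ l i j, c 0 y * coordDeriv l (Γ 0 i j) y + coordDeriv l (c 0) y * Γ 0 i j y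
      + (c 1 y * coordDeriv l (Γ 1 i j) y + coordDeriv l (c 1) y * Γ 1 i j y)
      = coordDeriv l (coordDeriv i (c j)) y
        - (η i y * coordDeriv l (c j) y + coordDeriv l (η i) y * c j y) := by
    intro l i j
    have := coordDeriv_congr (key.mono fun z hz ↦ (hz i j).2) l
    rwa [coordDeriv_add ((dc 0).fun_mul (hdΓ 0 i j)) ((dc 1).fun_mul (hdΓ 1 i j)),
      coordDeriv_mul (dc 0) (hdΓ 0 i j), coordDeriv_mul (dc 1) (hdΓ 1 i j),
      coordDeriv_sub (ddc i j) ((dη i).fun_mul (dc j)), coordDeriv_mul (dη i) (dc j)] at this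
  have k0 := key.self_of_nhds
  set w := a 0 y * c 1 y - a 1 y * c 0 y with hwdef
  -- Contracting the curvature tensor with `θ⁺` leaves `dη(∂₀, ∂₁) θ⁺(∂₁)`: the second derivatives
  -- of `a₁` cancel by symmetry and the products of Christoffel symbols by the first order
  -- identities. `R2` is the same computation for `θ⁻`, on which `η` acts with the opposite sign.
  have R1 : a 0 y * curvatureCoeff (nullMatrix a c) 0 0 1 1 y
      + a 1 y * curvatureCoeff (nullMatrix a c) 1 0 1 1 y
      = (coordDeriv 0 (η 1) y - coordDeriv 1 (η 0) y) * a 1 y := by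
    have e1 := D1 0 1 1
    have e2 := D1 1 0 1
    have e3 := coordDeriv_comm (ha 1) 0 1
    simp only [curvatureCoeff, Fin.sum_univ_two, ← hΓ]
    have p := fun i j ↦ (k0 i j).1
    linear_combination e1 - e2 + e3 + Γ 0 1 1 y * p 0 0 + Γ 1 1 1 y * p 0 1
      - Γ 0 0 1 y * p 1 0 - Γ 1 0 1 y * p 1 1 + η 0 y * p 1 1 - η 1 y * p 0 1
  have R2 : c 0 y * curvatureCoeff (nullMatrix a c) 0 0 1 1 y
      + c 1 y * curvatureCoeff (nullMatrix a c) 1 0 1 1 y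
      = - (coordDeriv 0 (η 1) y - coordDeriv 1 (η 0) y) * c 1 y := by
    have e1 := D2 0 1 1
    have e2 := D2 1 0 1
    have e3 := coordDeriv_comm (hc 1) 0 1
    simp only [curvatureCoeff, Fin.sum_univ_two, ← hΓ]
    have p := fun i j ↦ (k0 i j).2
    linear_combination e1 - e2 + e3 + Γ 0 1 1 y * p 0 0 + Γ 1 1 1 y * p 0 1
      - Γ 0 0 1 y * p 1 0 - Γ 1 0 1 y * p 1 1 - η 0 y * p 1 1 + η 1 y * p 0 1
  -- As `2 g(∂ₗ, ∂₀) = aₗc₀ + cₗa₀`, lowering the index takes `c₀/2` times `R1` and `a₀/2` times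
  -- `R2`, which gives `-dη(∂₀, ∂₁) w/2`. The determinant is `-w²/4`.
  have hK : coordGaussCurvature (nullMatrix a c) y
      = (- (coordDeriv 0 (η 1) y - coordDeriv 1 (η 0) y) * w / 2) / (- w ^ 2 / 4) := by
    rw [coordGaussCurvature, nullMatrix_det, ← hwdef]
    congr 1
    simp only [Fin.sum_univ_two, nullMatrix, Matrix.of_apply]
    linear_combination (c 0 y / 2) * R1 + (a 0 y / 2) * R2
  rw [hK]
  field_simp
  ring

end CoordCurvature

/-! ### Orthogonal expansion in a paracomplex plane -/

section LinearAlgebra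

/-- The vectors `v` and `J v` are orthogonal, and `B(Jv, Jv) = -B(v, v)` is nonzero, so they form a
basis and the identity is the orthogonal expansion of `w`. The minus sign is that of `B(Jv, Jv)`. -/
theorem smul_eq_of_paracomplex {V : Type*} [AddCommGroup V] [Module ℝ V]
    (hV : Module.finrank ℝ V = 2) (B : V →ₗ[ℝ] V →ₗ[ℝ] ℝ) (J : V →ₗ[ℝ] V)
    (hB : ∀ v w, B v w = B w v) (hJ : ∀ v, J (J v) = v) (hBJ : ∀ v w, B (J v) (J w) = - B v w)
    {v : V} (hv : B v v ≠ 0) (w : V) :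
    B v v • w = B v w • v - B (J v) w • J v := by
  have h0 : B v (J v) = 0 := by
    have := hBJ (J v) v
    rw [hJ, hB (J v) v] at this
    linarith
  have hli : LinearIndependent ℝ ![v, J v] := by
    rw [LinearIndependent.pair_iff]
    intro s t hst
    have h1 : s * B v v = 0 := by
      have := congrArg (B v) hst
      simpa [h0] using this
    have h2 : t * B v v = 0 := by
      have := congrArg (B (J v)) hst
      simpa [hB (J v) v, h0, hBJ] using this
    exact ⟨(mul_eq_zero.1 h1).resolve_right hv, (mul_eq_zero.1 h2).resolve_right hv⟩
  have : FiniteDimensional ℝ V := Module.finite_of_finrank_eq_succ hV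
  let b := basisOfLinearIndependentOfCardEqFinrank hli (by simp [hV])
  obtain ⟨s, t, rfl⟩ : ∃ s t : ℝ, w = s • v + t • J v := by
    refine ⟨b.repr w 0, b.repr w 1, ?_⟩
    have := b.sum_repr w
    rw [Fin.sum_univ_two] at this
    simpa [b] using this.symm
  simp only [map_add, map_smul, smul_eq_mul, h0, hBJ, hB (J v) v]
  module

end LinearAlgebra

/-! ### Derivatives in constant directions and pull-backs of one-forms -/

section DirDeriv

open Filter Topology

variable {E : Type*} [NormedAddCommGroup E] [NormedSpace ℝ E]

/-- The derivative of a function in a constant direction. -/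
def dirDeriv (v : E) (f : E → ℝ) (z : E) : ℝ := fderiv ℝ f z v

theorem dirDeriv_mul {f h : E → ℝ} {z : E} (hf : DifferentiableAt ℝ f z)
    (hh : DifferentiableAt ℝ h z) (v : E) :
    dirDeriv v (fun z ↦ f z * h z) z = dirDeriv v f z * h z + f z * dirDeriv v h z := by
  simp only [dirDeriv, fderiv_fun_mul hf hh]
  simp
  ring

theorem dirDeriv_add {f h : E → ℝ} {z : E} (hf : DifferentiableAt ℝ f z)
    (hh : DifferentiableAt ℝ h z) (v : E) :
    dirDeriv v (fun z ↦ f z + h z) z = dirDeriv v f z + dirDeriv v h z := by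
  simp only [dirDeriv, fderiv_fun_add hf hh]
  simp

theorem dirDeriv_sub {f h : E → ℝ} {z : E} (hf : DifferentiableAt ℝ f z)
    (hh : DifferentiableAt ℝ h z) (v : E) :
    dirDeriv v (fun z ↦ f z - h z) z = dirDeriv v f z - dirDeriv v h z := by
  simp only [dirDeriv, fderiv_fun_sub hf hh]
  simp

theorem dirDeriv_const_mul (c : ℝ) {f : E → ℝ} {z : E} (hf : DifferentiableAt ℝ f z) (v : E) :
    dirDeriv v (fun z ↦ c * f z) z = c * dirDeriv v f z := by
  simp only [dirDeriv, fderiv_const_mul hf]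
  simp

theorem dirDeriv_congr {f h : E → ℝ} {z : E} (hf : f =ᶠ[𝓝 z] h) (v : E) :
    dirDeriv v f z = dirDeriv v h z := by
  simp only [dirDeriv, hf.fderiv_eq]

theorem eventuallyEq_dirDeriv {f h : E → ℝ} {z : E} (hf : f =ᶠ[𝓝 z] h) (v : E) :
    dirDeriv v f =ᶠ[𝓝 z] dirDeriv v h := by
  filter_upwards [hf.eventuallyEq_nhds] with y hy using dirDeriv_congr hy v

theorem dirDeriv_comm {f : E → ℝ} {z : E} (hf : ContDiffAt ℝ ∞ f z) (v w : E) :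
    dirDeriv v (dirDeriv w f) z = dirDeriv w (dirDeriv v f) z := by
  have hd : DifferentiableAt ℝ (fderiv ℝ f) z :=
    (hf.fderiv_right (m := 1) (by norm_cast)).differentiableAt (by simp)
  have key : ∀ v w : E, fderiv ℝ (fun z ↦ fderiv ℝ f z v) z w = fderiv ℝ (fderiv ℝ f) z w v := by
    intro v w
    rw [fderiv_clm_apply hd (differentiableAt_const v)]
    simp
  have hs : IsSymmSndFDerivAt ℝ f z :=
    (hf.of_le (m := 2) (by norm_cast)).isSymmSndFDerivAt (n := 2) (by simp)
  unfold dirDeriv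
  rw [key, key]
  exact hs _ _

theorem contDiffAt_dirDeriv {f : E → ℝ} {z : E} (hf : ContDiffAt ℝ ∞ f z) (v : E) :
    ContDiffAt ℝ ∞ (dirDeriv v f) z :=
  (hf.fderiv_right (m := ∞) (by simp)).clm_apply contDiffAt_const

theorem dirDeriv_add_vec (v w : E) (f : E → ℝ) (z : E) :
    dirDeriv (v + w) f z = dirDeriv v f z + dirDeriv w f z := by simp [dirDeriv]

theorem dirDeriv_smul_vec (c : ℝ) (v : E) (f : E → ℝ) (z : E) :
    dirDeriv (c • v) f z = c * dirDeriv v f z := by simp [dirDeriv]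

theorem fderiv_apply_coord {f : E → Plane} {z : E} (hf : DifferentiableAt ℝ f z) (v : E) (i : Fin 2) :
    fderiv ℝ f z v i = dirDeriv v (fun z ↦ f z i) z := by
  have : (fun z ↦ f z i) = fun z ↦ (EuclideanSpace.proj i : Plane →L[ℝ] ℝ) (f z) := rfl
  rw [dirDeriv, this, fderiv_fun_comp z (ContinuousLinearMap.differentiableAt _) hf,
    ContinuousLinearMap.fderiv]
  rfl

theorem plane_eq (v : Plane) :
    v = v 0 • EuclideanSpace.single 0 (1 : ℝ) + v 1 • EuclideanSpace.single 1 (1 : ℝ) := by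
  ext i
  fin_cases i <;> simp

theorem dirDeriv_comp_plane {a : Plane → ℝ} {f : E → Plane} {z : E}
    (ha : DifferentiableAt ℝ a (f z)) (hf : DifferentiableAt ℝ f z) (v : E) :
    dirDeriv v (fun z ↦ a (f z)) z = coordDeriv 0 a (f z) * dirDeriv v (fun z ↦ f z 0) z
      + coordDeriv 1 a (f z) * dirDeriv v (fun z ↦ f z 1) z := by
  rw [dirDeriv, fderiv_fun_comp z ha hf]
  simp only [ContinuousLinearMap.comp_apply]
  rw [plane_eq (fderiv ℝ f z v)]
  simp only [map_add, map_smul, smul_eq_mul, coordDeriv, fderiv_apply_coord hf]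
  ring

/-- The pull-back of the one-form `∑ aᵢ dxⁱ`, evaluated on a constant vector field. -/
def pullCovector (a : Fin 2 → Plane → ℝ) (f : E → Plane) (v : E) (z : E) : ℝ :=
  a 0 (f z) * dirDeriv v (fun z ↦ f z 0) z + a 1 (f z) * dirDeriv v (fun z ↦ f z 1) z

theorem contDiffAt_coord {f : E → Plane} {z : E} (hf : ContDiffAt ℝ ∞ f z) (i : Fin 2) :
    ContDiffAt ℝ ∞ (fun z ↦ f z i) z :=
  (EuclideanSpace.proj i : Plane →L[ℝ] ℝ).contDiff.contDiffAt.comp z hf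

theorem contDiffAt_pullCovector {a : Fin 2 → Plane → ℝ} {f : E → Plane} {z : E}
    (ha : ∀ i, ContDiffAt ℝ ∞ (a i) (f z)) (hf : ContDiffAt ℝ ∞ f z) (v : E) :
    ContDiffAt ℝ ∞ (pullCovector a f v) z :=
  (((ha 0).comp z hf).mul (contDiffAt_dirDeriv (contDiffAt_coord hf 0) v)).add
    (((ha 1).comp z hf).mul (contDiffAt_dirDeriv (contDiffAt_coord hf 1) v))

/-- The exterior derivative commutes with the pull-back of one-forms. -/
theorem dirDeriv_pullCovector_sub {a : Fin 2 → Plane → ℝ} {f : E → Plane} {z : E}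
    (ha : ∀ i, ContDiffAt ℝ ∞ (a i) (f z)) (hf : ContDiffAt ℝ ∞ f z) (v w : E) :
    dirDeriv v (pullCovector a f w) z - dirDeriv w (pullCovector a f v) z
      = (coordDeriv 0 (a 1) (f z) - coordDeriv 1 (a 0) (f z)) *
        (dirDeriv v (fun z ↦ f z 0) z * dirDeriv w (fun z ↦ f z 1) z
          - dirDeriv v (fun z ↦ f z 1) z * dirDeriv w (fun z ↦ f z 0) z) := by
  have hd : ∀ i, DifferentiableAt ℝ (fun z ↦ a i (f z)) z := fun i ↦
    ((ha i).comp z hf).differentiableAt (by simp)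
  have hd' : ∀ i u, DifferentiableAt ℝ (dirDeriv u (fun z ↦ f z i)) z := fun i u ↦
    (contDiffAt_dirDeriv (contDiffAt_coord hf i) u).differentiableAt (by simp)
  have key : ∀ u u', dirDeriv u (pullCovector a f u') z = _ := fun u u' ↦
    (dirDeriv_add ((hd 0).fun_mul (hd' 0 u')) ((hd 1).fun_mul (hd' 1 u')) u)
  rw [key, key]
  simp only [dirDeriv_mul (hd _) (hd' _ _),
    dirDeriv_comp_plane ((ha _).differentiableAt (by simp)) (hf.differentiableAt (by simp)),
    dirDeriv_comm (contDiffAt_coord hf _) w v]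
  ring

end DirDeriv

/-! ### Existence of null coframes -/

section Frames

open Filter Topology

theorem finrank_tangentPlane {M : Type*} [TopologicalSpace M] [ChartedSpace Plane M] (x : M) :
    Module.finrank ℝ (TangentSpace (𝓡 2) x) = 2 :=
  finrank_euclideanSpace_fin (𝕜 := ℝ) (n := 2)

/-- The differential of the inverse of a smooth chart is surjective. -/
theorem exists_mfderiv_symm_eq {M : Type*} [TopologicalSpace M] [ChartedSpace Plane M]
    {e : OpenPartialHomeomorph M Plane}
    (he : ContMDiffOn (𝓡 2) (𝓡 2) ∞ e e.source)
    (he' : ContMDiffOn (𝓡 2) (𝓡 2) ∞ e.symm e.target) {y : Plane} (hy : y ∈ e.target)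
    (w : TangentSpace (𝓡 2) (e.symm y)) :
    ∃ v : Plane, mfderiv (𝓡 2) (𝓡 2) e.symm y v = w := by
  have h1 : MDifferentiableAt (𝓡 2) (𝓡 2) e.symm y :=
    ((he' y hy).contMDiffAt (e.open_target.mem_nhds hy)).mdifferentiableAt (by simp)
  have h2 : MDifferentiableAt (𝓡 2) (𝓡 2) e (e.symm y) :=
    ((he _ (e.map_target hy)).contMDiffAt
      (e.open_source.mem_nhds (e.map_target hy))).mdifferentiableAt (by simp)
  have h1' : MDifferentiableAt (𝓡 2) (𝓡 2) e.symm (e (e.symm y)) := by rwa [e.right_inv hy]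
  have h3 := mfderiv_comp (e.symm y) (I' := 𝓡 2) h1' h2
  have h4 : (e.symm ∘ e) =ᶠ[𝓝 (e.symm y)] id := by
    filter_upwards [e.open_source.mem_nhds (e.map_target hy)] with p hp using e.left_inv hp
  rw [h4.mfderiv_eq, mfderiv_id] at h3
  refine ⟨mfderiv (𝓡 2) (𝓡 2) e (e.symm y) w, ?_⟩
  have h5 := congrArg (fun L : Plane →L[ℝ] Plane ↦ L w) h3
  have h6 : mfderiv (𝓡 2) (𝓡 2) e.symm (e (e.symm y)) = (mfderiv (𝓡 2) (𝓡 2) e.symm y :) := by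
    rw [e.right_inv hy]
  rw [h6] at h5
  exact h5.symm

variable {M : Type*} [TopologicalSpace M] [ChartedSpace Plane M] [IsManifold (𝓡 2) ∞ M]

/-- `θ⁺ = ∑ aᵢ dxⁱ` and `θ⁻ = ∑ cᵢ dxⁱ` form a null coframe, diagonalizing the paracomplex structure,
in the preferred chart at `x`, and `∑ ηᵢ dxⁱ` is its Levi-Civita connection form. -/
structure IsNullCoframe {g : LorentzMetric M} (j : ParacomplexStructure g) (x : M)
    (a c η : Fin 2 → Plane → ℝ) : Prop where
  smooth : ∀ᶠ y in 𝓝 (chartAt Plane x x), ∀ i,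
    ContDiffAt ℝ ∞ (a i) y ∧ ContDiffAt ℝ ∞ (c i) y ∧ ContDiffAt ℝ ∞ (η i) y
  form : ∀ᶠ y in 𝓝 (chartAt Plane x x), ∀ v w : Plane,
    pullForm g (chartAt Plane x).symm v w y
      = ((a 0 y * v 0 + a 1 y * v 1) * (c 0 y * w 0 + c 1 y * w 1)
        + (c 0 y * v 0 + c 1 y * v 1) * (a 0 y * w 0 + a 1 y * w 1)) / 2
  area : ∀ᶠ y in 𝓝 (chartAt Plane x x), ∀ v w : Plane,
    pullArea j (chartAt Plane x).symm v w y
      = ((a 0 y * v 0 + a 1 y * v 1) * (c 0 y * w 0 + c 1 y * w 1)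
        - (c 0 y * v 0 + c 1 y * v 1) * (a 0 y * w 0 + a 1 y * w 1)) / 2
  deriv_fst : ∀ᶠ y in 𝓝 (chartAt Plane x x),
    coordDeriv 0 (a 1) y - coordDeriv 1 (a 0) y = -(η 0 y * a 1 y - η 1 y * a 0 y)
  deriv_snd : ∀ᶠ y in 𝓝 (chartAt Plane x x),
    coordDeriv 0 (c 1) y - coordDeriv 1 (c 0) y = η 0 y * c 1 y - η 1 y * c 0 y
  curvature : coordDeriv 0 (η 1) (chartAt Plane x x) - coordDeriv 1 (η 0) (chartAt Plane x x)
    = g.gaussCurvature x / 2 * (a 0 (chartAt Plane x x) * c 1 (chartAt Plane x x)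
      - a 1 (chartAt Plane x x) * c 0 (chartAt Plane x x))

/-- The form `g` on a tangent plane as a bilinear map. -/
def LorentzMetric.bilin (g : LorentzMetric M) (x : M) :
    TangentSpace (𝓡 2) x →ₗ[ℝ] TangentSpace (𝓡 2) x →ₗ[ℝ] ℝ :=
  LinearMap.mk₂ ℝ (fun v w ↦ g.form x v w) (by intros; simp) (by intros; simp) (by intros; simp)
    (by intros; simp)

theorem pullForm_linear (g : LorentzMetric M) {E : Type*} [NormedAddCommGroup E] [NormedSpace ℝ E]
    (f : E → M) (z : E) : ∃ B : E →ₗ[ℝ] E →ₗ[ℝ] ℝ, ∀ v w, B v w = pullForm g f v w z :=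
  let D : E →ₗ[ℝ] TangentSpace (𝓡 2) (f z) :=
    (mfderiv 𝓘(ℝ, E) (𝓡 2) f z : E →L[ℝ] TangentSpace (𝓡 2) (f z)).toLinearMap
  ⟨(g.bilin (f z)).compl₁₂ D D, fun _ _ ↦ rfl⟩

theorem pullArea_linear {g : LorentzMetric M} (j : ParacomplexStructure g) {E : Type*}
    [NormedAddCommGroup E] [NormedSpace ℝ E] (f : E → M) (z : E) :
    ∃ B : E →ₗ[ℝ] E →ₗ[ℝ] ℝ, ∀ v w, B v w = pullArea j f v w z :=
  let D : E →ₗ[ℝ] TangentSpace (𝓡 2) (f z) :=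
    (mfderiv 𝓘(ℝ, E) (𝓡 2) f z : E →L[ℝ] TangentSpace (𝓡 2) (f z)).toLinearMap
  ⟨(g.bilin (f z)).compl₁₂ ((j.endo (f z)).toLinearMap ∘ₗ D) D, fun _ _ ↦ rfl⟩

theorem LorentzMetric.smul_eq {g : LorentzMetric M} (j : ParacomplexStructure g) {x : M}
    {v : TangentSpace (𝓡 2) x} (hv : g.form x v v ≠ 0) (w : TangentSpace (𝓡 2) x) :
    g.form x v v • w = g.form x v w • v - g.form x (j.endo x v) w • j.endo x v :=
  smul_eq_of_paracomplex (finrank_tangentPlane x)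
    (g.bilin x) (j.endo x).toLinearMap (g.symm x) (j.endo_endo x) (j.form_endo x) hv w

theorem ParacomplexStructure.form_endo_self {g : LorentzMetric M} (j : ParacomplexStructure g)
    (x : M) (v : TangentSpace (𝓡 2) x) : g.form x (j.endo x v) v = 0 := by
  have h := j.form_endo x (j.endo x v) v
  rw [j.endo_endo, g.symm x v] at h
  linarith

theorem ParacomplexStructure.area_skew {g : LorentzMetric M} (j : ParacomplexStructure g)
    (x : M) (v w : TangentSpace (𝓡 2) x) :
    g.form x (j.endo x v) w = - g.form x (j.endo x w) v := by
  have h := j.form_endo_self x (v + w)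
  simp only [map_add, add_apply, j.form_endo_self] at h
  linarith

/-- Pairing the expansion of `v` in the frame `u`, `j u` with `w` expresses the metric by the two
covectors `g(u, ·)` and `g(j u, ·)` alone. Their sum and difference are the null covectors from
which coframes are made. -/
theorem LorentzMetric.form_eq {g : LorentzMetric M} (j : ParacomplexStructure g) {x : M}
    {u : TangentSpace (𝓡 2) x} (hu : g.form x u u ≠ 0) (v w : TangentSpace (𝓡 2) x) :
    g.form x v w * g.form x u u = g.form x u v * g.form x u w
      - g.form x (j.endo x u) v * g.form x (j.endo x u) w := by
  have := congrArg (fun q ↦ g.form x q w) (g.smul_eq j hu v)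
  simp only [map_smul, map_sub, smul_apply, sub_apply, smul_eq_mul] at this
  linarith

theorem ParacomplexStructure.area_eq {g : LorentzMetric M} (j : ParacomplexStructure g) {x : M}
    {u : TangentSpace (𝓡 2) x} (hu : g.form x u u ≠ 0) (v w : TangentSpace (𝓡 2) x) :
    g.form x (j.endo x v) w * g.form x u u = g.form x u v * g.form x (j.endo x u) w
      - g.form x (j.endo x u) v * g.form x u w := by
  have := congrArg (fun q ↦ g.form x (j.endo x q) w) (g.smul_eq j hu v)
  simp only [map_smul, map_sub, smul_apply, sub_apply, smul_eq_mul,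
    j.endo_endo] at this
  linarith

theorem chartAt_symm_contMDiffAt (x : M) {y : Plane} (hy : y ∈ (chartAt Plane x).target) :
    ContMDiffAt (𝓡 2) (𝓡 2) ∞ (chartAt Plane x).symm y :=
  (contMDiffOn_chart_symm (I := 𝓡 2) (x := x) y hy).contMDiffAt
    ((chartAt Plane x).open_target.mem_nhds hy)

theorem chartAt_contMDiffAt (x : M) {p : M} (hp : p ∈ (chartAt Plane x).source) :
    ContMDiffAt (𝓡 2) (𝓡 2) ∞ (chartAt Plane x) p :=
  (contMDiffOn_chart (I := 𝓡 2) (x := x) p hp).contMDiffAt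
    ((chartAt Plane x).open_source.mem_nhds hp)

/-- For a vector `u`, constant in coordinates, with `m = g(u, u) ≠ 0`, the covectors `θ⁺ = g(u, ·) -
g(ju, ·)` and `θ⁻ = (g(u, ·) + g(ju, ·))/m` are null. Their symmetric and antisymmetric products are
`g` and the area form. The connection form is then determined by the exterior derivatives of `θ⁺`
and `θ⁻`. -/
theorem exists_isNullCoframe {g : LorentzMetric M} (j : ParacomplexStructure g) (x : M) :
    ∃ a c η, IsNullCoframe j x a c η := by
  set e := chartAt Plane x with he
  set y₀ := e x with hy₀
  have hx : x ∈ e.source := mem_chart_source Plane x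
  have hy₀t : y₀ ∈ e.target := e.map_source hx
  have hsurj : ∀ y ∈ e.target, ∀ w : TangentSpace (𝓡 2) (e.symm y),
      ∃ v : Plane, mfderiv (𝓡 2) (𝓡 2) e.symm y v = w := fun y hy w ↦
    exists_mfderiv_symm_eq contMDiffOn_chart contMDiffOn_chart_symm hy w
  obtain ⟨u₀, hu₀⟩ := g.exists_pos (e.symm y₀)
  obtain ⟨u, hu⟩ := hsurj y₀ hy₀t u₀
  have hm₀ : pullForm g e.symm u u y₀ ≠ 0 := by
    have : pullForm g e.symm u u y₀ = g.form (e.symm y₀) u₀ u₀ := by rw [← hu]; rfl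
    rw [this]; exact hu₀.ne'
  have htarget : ∀ᶠ y in 𝓝 y₀, y ∈ e.target := e.open_target.mem_nhds hy₀t
  have hsmF : ∀ y ∈ e.target, ∀ v w, ContDiffAt ℝ ∞ (pullForm g e.symm v w) y := fun y hy v w ↦
    contDiffAt_pullForm g (chartAt_symm_contMDiffAt x hy) v w
  have hsmA : ∀ y ∈ e.target, ∀ v w, ContDiffAt ℝ ∞ (pullArea j e.symm v w) y := fun y hy v w ↦
    contDiffAt_pullArea j (chartAt_symm_contMDiffAt x hy) v w
  set m := pullForm g e.symm u u with hm
  have hme : ∀ᶠ y in 𝓝 y₀, m y ≠ 0 := (hsmF y₀ hy₀t u u).continuousAt.eventually_ne hm₀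
  set b : Fin 2 → Plane := fun i ↦ EuclideanSpace.single i (1 : ℝ) with hb
  set a : Fin 2 → Plane → ℝ := fun i y ↦ pullForm g e.symm u (b i) y - pullArea j e.symm u (b i) y
    with ha
  set c : Fin 2 → Plane → ℝ := fun i y ↦
    (pullForm g e.symm u (b i) y + pullArea j e.symm u (b i) y) / m y with hc
  have hasm : ∀ y ∈ e.target, ∀ i, ContDiffAt ℝ ∞ (a i) y := fun y hy i ↦
    (hsmF y hy _ _).sub (hsmA y hy _ _)
  have hcsm : ∀ y ∈ e.target, m y ≠ 0 → ∀ i, ContDiffAt ℝ ∞ (c i) y := fun y hy h i ↦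
    ((hsmF y hy _ _).add (hsmA y hy _ _)).div (hsmF y hy _ _) h
  set θ : (Fin 2 → Plane → ℝ) → Plane → Plane → ℝ := fun a y v ↦ a 0 y * v 0 + a 1 y * v 1 with hθ
  have hθa : ∀ y v, θ a y v = pullForm g e.symm u v y - pullArea j e.symm u v y := by
    intro y v
    conv_rhs => rw [plane_eq v]
    obtain ⟨B, hB⟩ := pullForm_linear g e.symm y
    obtain ⟨A, hA⟩ := pullArea_linear j e.symm y
    simp only [hθ, ha, ← hB, ← hA, map_add, map_smul, smul_eq_mul, hb]
    ring
  have hθc : ∀ y v, θ c y v = (pullForm g e.symm u v y + pullArea j e.symm u v y) / m y := by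
    intro y v
    conv_rhs => rw [plane_eq v]
    obtain ⟨B, hB⟩ := pullForm_linear g e.symm y
    obtain ⟨A, hA⟩ := pullArea_linear j e.symm y
    simp only [hθ, hc, ← hB, ← hA, map_add, map_smul, smul_eq_mul, hb]
    ring
  have hform : ∀ y, m y ≠ 0 → ∀ v w, pullForm g e.symm v w y
      = (θ a y v * θ c y w + θ c y v * θ a y w) / 2 := by
    intro y hy v w
    have := g.form_eq j (x := e.symm y) (u := mfderiv (𝓡 2) (𝓡 2) e.symm y u) hy
      (mfderiv (𝓡 2) (𝓡 2) e.symm y v) (mfderiv (𝓡 2) (𝓡 2) e.symm y w)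
    change pullForm g e.symm v w y * m y = pullForm g e.symm u v y * pullForm g e.symm u w y
      - pullArea j e.symm u v y * pullArea j e.symm u w y at this
    rw [hθa, hθa, hθc, hθc]
    field_simp
    linear_combination 2 * this
  have harea : ∀ y, m y ≠ 0 → ∀ v w, pullArea j e.symm v w y
      = (θ a y v * θ c y w - θ c y v * θ a y w) / 2 := by
    intro y hy v w
    have := j.area_eq (x := e.symm y) (u := mfderiv (𝓡 2) (𝓡 2) e.symm y u) hy
      (mfderiv (𝓡 2) (𝓡 2) e.symm y v) (mfderiv (𝓡 2) (𝓡 2) e.symm y w)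
    change pullArea j e.symm v w y * m y = pullForm g e.symm u v y * pullArea j e.symm u w y
      - pullArea j e.symm u v y * pullForm g e.symm u w y at this
    rw [hθa, hθa, hθc, hθc]
    field_simp
    linear_combination 2 * this
  -- The coframe is independent because the area form it defines is not zero: on `u` and `ju` it has
  -- the value `-m`.
  have hw : ∀ y ∈ e.target, m y ≠ 0 → a 0 y * c 1 y - a 1 y * c 0 y ≠ 0 := by
    intro y hy hmy h0
    obtain ⟨w, hw⟩ := hsurj y hy (j.endo _ (mfderiv (𝓡 2) (𝓡 2) e.symm y u))
    have h1 : pullArea j e.symm u w y = - m y := by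
      have := j.form_endo _ (mfderiv (𝓡 2) (𝓡 2) e.symm y u) (mfderiv (𝓡 2) (𝓡 2) e.symm y u)
      rw [← hw] at this
      simp only [pullArea]
      rw [← hw]
      exact this
    rw [harea y hmy] at h1
    simp only [hθ] at h1
    have : (a 0 y * c 1 y - a 1 y * c 0 y) * (u 0 * w 1 - u 1 * w 0) = - (2 * m y) := by
      linear_combination 2 * h1
    rw [h0, zero_mul] at this
    exact hmy (by linarith)
  -- Writing `dθ⁺ = X θ⁺ ∧ θ⁻` and `dθ⁻ = Y θ⁺ ∧ θ⁻`, the form `η = Y θ⁺ + X θ⁻` solves `dθ⁺ = -η ∧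
  -- θ⁺` and `dθ⁻ = η ∧ θ⁻`.
  set X : Plane → ℝ := fun y ↦ (coordDeriv 0 (a 1) y - coordDeriv 1 (a 0) y) /
    (a 0 y * c 1 y - a 1 y * c 0 y) with hX
  set Y : Plane → ℝ := fun y ↦ (coordDeriv 0 (c 1) y - coordDeriv 1 (c 0) y) /
    (a 0 y * c 1 y - a 1 y * c 0 y) with hY
  set η : Fin 2 → Plane → ℝ := fun i y ↦ Y y * a i y + X y * c i y with hη
  have hηsm : ∀ y ∈ e.target, m y ≠ 0 → ∀ i, ContDiffAt ℝ ∞ (η i) y := by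
    intro y hy h i
    have w0 := hw y hy h
    have A := hasm y hy
    have B := hcsm y hy h
    have W : ContDiffAt ℝ ∞ (fun y ↦ a 0 y * c 1 y - a 1 y * c 0 y) y :=
      ((A 0).mul (B 1)).sub ((A 1).mul (B 0))
    exact ((((contDiffAt_coordDeriv (B 1) 0).sub (contDiffAt_coordDeriv (B 0) 1)).div W w0).mul
      (A i)).add ((((contDiffAt_coordDeriv (A 1) 0).sub
        (contDiffAt_coordDeriv (A 0) 1)).div W w0).mul (B i))
  have hda : ∀ᶠ y in 𝓝 y₀,
      coordDeriv 0 (a 1) y - coordDeriv 1 (a 0) y = -(η 0 y * a 1 y - η 1 y * a 0 y) := by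
    filter_upwards [htarget, hme] with y hy h
    have w0 := hw y hy h
    have : (coordDeriv 0 (a 1) y - coordDeriv 1 (a 0) y) = X y * (a 0 y * c 1 y - a 1 y * c 0 y) :=
      (div_mul_cancel₀ _ w0).symm
    rw [this]
    simp only [hη]
    ring
  have hdc : ∀ᶠ y in 𝓝 y₀,
      coordDeriv 0 (c 1) y - coordDeriv 1 (c 0) y = η 0 y * c 1 y - η 1 y * c 0 y := by
    filter_upwards [htarget, hme] with y hy h
    have w0 := hw y hy h
    have : (coordDeriv 0 (c 1) y - coordDeriv 1 (c 0) y) = Y y * (a 0 y * c 1 y - a 1 y * c 0 y) :=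
      (div_mul_cancel₀ _ w0).symm
    rw [this]
    simp only [hη]
    ring
  refine ⟨a, c, η, ?_, ?_, ?_, hda, hdc, ?_⟩
  · filter_upwards [htarget, hme] with y hy h i
    exact ⟨hasm y hy i, hcsm y hy h i, hηsm y hy h i⟩
  · filter_upwards [hme] with y hy
    exact hform y hy
  · filter_upwards [hme] with y hy
    exact harea y hy
  · have := nullCoframe_curvature (hasm y₀ hy₀t) (hcsm y₀ hy₀t hm₀) (hηsm y₀ hy₀t hm₀)
      (hw y₀ hy₀t hm₀) hda hdc
    refine this.trans ?_
    have hK : coordGaussCurvature (nullMatrix a c) y₀ = g.gaussCurvature x := by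
      refine coordGaussCurvature_congr ?_
      filter_upwards [hme] with y hy
      ext k l
      have := hform y hy (b k) (b l)
      have hθb : ∀ a : Fin 2 → Plane → ℝ, ∀ k, θ a y (b k) = a k y := by
        intro a k
        simp only [hθ, hb]
        fin_cases k <;> simp
      simp only [hθb] at this
      exact this.symm
    rw [hK]

end Frames

/-! ### Moving null frames along maps and their gauge transformations -/

section MovingFrames

open Filter Topology

/-- A null coframe along a map `f` near `z₀`, with `f^* g = (s/2) (A⁺ ⊗ A⁻ + A⁻ ⊗ A⁺)`, its connection
form `W`, and the curvature `κ` at `z₀`. -/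
structure IsMovingFrame {E M : Type*} [NormedAddCommGroup E] [NormedSpace ℝ E]
    [TopologicalSpace M] [ChartedSpace Plane M] [IsManifold (𝓡 2) ∞ M]
    {g : LorentzMetric M} (j : ParacomplexStructure g) (f : E → M) (z₀ : E) (s κ : ℝ)
    (Ap Am W : E → E → ℝ) : Prop where
  smooth (v : E) : ContDiffAt ℝ ∞ (Ap v) z₀ ∧ ContDiffAt ℝ ∞ (Am v) z₀ ∧ ContDiffAt ℝ ∞ (W v) z₀
  form : ∀ᶠ z in 𝓝 z₀, ∀ v w, pullForm g f v w z = s / 2 * (Ap v z * Am w z + Am v z * Ap w z)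
  area : ∀ᶠ z in 𝓝 z₀, ∀ v w, pullArea j f v w z = s / 2 * (Ap v z * Am w z - Am v z * Ap w z)
  deriv_fst (v w : E) : ∀ᶠ z in 𝓝 z₀,
    dirDeriv v (Ap w) z - dirDeriv w (Ap v) z = -(W v z * Ap w z - W w z * Ap v z)
  deriv_snd (v w : E) : ∀ᶠ z in 𝓝 z₀,
    dirDeriv v (Am w) z - dirDeriv w (Am v) z = W v z * Am w z - W w z * Am v z
  curvature (v w : E) : dirDeriv v (W w) z₀ - dirDeriv w (W v) z₀
    = κ * (s / 2) * (Ap v z₀ * Am w z₀ - Am v z₀ * Ap w z₀)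

theorem eventually_chart_symm_eq {E M : Type*} [TopologicalSpace E]
    [TopologicalSpace M] [ChartedSpace Plane M] {f : E → M} {z : E} {x : M} (hf : ContinuousAt f z)
    (hx : f z ∈ (chartAt Plane x).source) :
    f =ᶠ[𝓝 z] fun z ↦ (chartAt Plane x).symm (chartAt Plane x (f z)) := by
  filter_upwards [hf.eventually ((chartAt Plane x).open_source.mem_nhds hx)] with y hy
  exact ((chartAt Plane x).left_inv hy).symm

variable {E M : Type*} [NormedAddCommGroup E] [NormedSpace ℝ E]
  [TopologicalSpace M] [ChartedSpace Plane M] [IsManifold (𝓡 2) ∞ M]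

theorem contDiffAt_chart_comp {f : E → M} {z : E} {x : M} (hf : ContMDiffAt 𝓘(ℝ, E) (𝓡 2) ∞ f z)
    (hx : f z ∈ (chartAt Plane x).source) :
    ContDiffAt ℝ ∞ (fun z ↦ chartAt Plane x (f z)) z := by
  rw [← contMDiffAt_iff_contDiffAt]
  exact (chartAt_contMDiffAt x hx).comp z hf

theorem pullForm_chart (g : LorentzMetric M) {f : E → M} {z : E} {x : M}
    (hf : ContMDiffAt 𝓘(ℝ, E) (𝓡 2) ∞ f z) (hx : f z ∈ (chartAt Plane x).source) (v w : E) :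
    pullForm g f v w z = pullForm g (chartAt Plane x).symm
      (fderiv ℝ (fun z ↦ chartAt Plane x (f z)) z v) (fderiv ℝ (fun z ↦ chartAt Plane x (f z)) z w)
      (chartAt Plane x (f z)) := by
  rw [pullForm_congr g (eventually_chart_symm_eq hf.continuousAt hx)]
  exact pullForm_comp g (f := (chartAt Plane x).symm) (h := fun z ↦ chartAt Plane x (f z))
    ((chartAt_symm_contMDiffAt x ((chartAt Plane x).map_source hx)).mdifferentiableAt (by simp))
    ((contDiffAt_chart_comp hf hx).differentiableAt (by simp)) v w

theorem pullArea_chart {g : LorentzMetric M} (j : ParacomplexStructure g) {f : E → M} {z : E} {x : M}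
    (hf : ContMDiffAt 𝓘(ℝ, E) (𝓡 2) ∞ f z) (hx : f z ∈ (chartAt Plane x).source) (v w : E) :
    pullArea j f v w z = pullArea j (chartAt Plane x).symm
      (fderiv ℝ (fun z ↦ chartAt Plane x (f z)) z v) (fderiv ℝ (fun z ↦ chartAt Plane x (f z)) z w)
      (chartAt Plane x (f z)) := by
  rw [pullArea_congr j (eventually_chart_symm_eq hf.continuousAt hx)]
  exact pullArea_comp j (f := (chartAt Plane x).symm) (h := fun z ↦ chartAt Plane x (f z))
    ((chartAt_symm_contMDiffAt x ((chartAt Plane x).map_source hx)).mdifferentiableAt (by simp))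
    ((contDiffAt_chart_comp hf hx).differentiableAt (by simp)) v w

/-- All conditions on a null coframe are equations between differential forms, and these are
preserved by pulling back along `f` read in the chart. The curvature equation is available only at
the centre `x` of the chart, hence only at `z₀`. -/
theorem IsNullCoframe.isMovingFrame {g : LorentzMetric M} {j : ParacomplexStructure g} {x : M}
    {a c η : Fin 2 → Plane → ℝ} (H : IsNullCoframe j x a c η) {f : E → M} {z₀ : E}
    (hf : ∀ᶠ z in 𝓝 z₀, ContMDiffAt 𝓘(ℝ, E) (𝓡 2) ∞ f z) (hx : f z₀ = x) :
    IsMovingFrame j f z₀ 1 (g.gaussCurvature x) (pullCovector a fun z ↦ chartAt Plane x (f z))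
      (pullCovector c fun z ↦ chartAt Plane x (f z))
      (pullCovector η fun z ↦ chartAt Plane x (f z)) := by
  set F : E → Plane := fun z ↦ chartAt Plane x (f z) with hF
  have hF₀ : F z₀ = chartAt Plane x x := by simp only [hF, hx]
  have hsrc : ∀ᶠ z in 𝓝 z₀, f z ∈ (chartAt Plane x).source :=
    hf.self_of_nhds.continuousAt.eventually
      ((chartAt Plane x).open_source.mem_nhds (by rw [hx]; exact mem_chart_source Plane x))
  have hFs : ∀ᶠ z in 𝓝 z₀, ContDiffAt ℝ ∞ F z := by
    filter_upwards [hf, hsrc] with z h1 h2 using contDiffAt_chart_comp h1 h2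
  have hFt : Tendsto F (𝓝 z₀) (𝓝 (chartAt Plane x x)) := by
    have := hFs.self_of_nhds.continuousAt
    rwa [ContinuousAt, hF₀] at this
  have hsm := hFt.eventually H.smooth
  have hsm₀ := hsm.self_of_nhds
  have hF₀s := hFs.self_of_nhds
  refine ⟨fun v ↦ ⟨contDiffAt_pullCovector (fun i ↦ (hsm₀ i).1) hF₀s v,
    contDiffAt_pullCovector (fun i ↦ (hsm₀ i).2.1) hF₀s v,
    contDiffAt_pullCovector (fun i ↦ (hsm₀ i).2.2) hF₀s v⟩, ?_, ?_, ?_, ?_, ?_⟩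
  · filter_upwards [hf, hsrc, hFs, hFt.eventually H.form] with z h1 h2 h3 h4 v w
    have hd := h3.differentiableAt (n := ∞) (by simp)
    rw [pullForm_chart g h1 h2, ← hF, h4 (fderiv ℝ F z v) (fderiv ℝ F z w)]
    simp only [pullCovector, fderiv_apply_coord hd]
    ring
  · filter_upwards [hf, hsrc, hFs, hFt.eventually H.area] with z h1 h2 h3 h4 v w
    have hd := h3.differentiableAt (n := ∞) (by simp)
    rw [pullArea_chart j h1 h2, ← hF, h4 (fderiv ℝ F z v) (fderiv ℝ F z w)]
    simp only [pullCovector, fderiv_apply_coord hd]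
    ring
  · intro v w
    filter_upwards [hFs, hsm, hFt.eventually H.deriv_fst] with z h1 h2 h3
    rw [dirDeriv_pullCovector_sub (fun i ↦ (h2 i).1) h1, h3]
    simp only [pullCovector]
    ring
  · intro v w
    filter_upwards [hFs, hsm, hFt.eventually H.deriv_snd] with z h1 h2 h3
    rw [dirDeriv_pullCovector_sub (fun i ↦ (h2 i).2.1) h1, h3]
    simp only [pullCovector]
    ring
  · intro v w
    rw [dirDeriv_pullCovector_sub (fun i ↦ (hsm₀ i).2.2) hF₀s, hF₀, H.curvature]
    simp only [pullCovector, hF₀]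
    ring

/-- Gauge transformations of a moving frame. -/
theorem IsMovingFrame.gauge {g : LorentzMetric M} {j : ParacomplexStructure g} {f : E → M} {z₀ : E}
    {κ s : ℝ} (hs : s * s = 1) {Ap Am W : E → E → ℝ} (H : IsMovingFrame j f z₀ 1 κ Ap Am W)
    {Tp Tm : E → ℝ} (hTp : ContDiffAt ℝ ∞ Tp z₀) (hTm : ContDiffAt ℝ ∞ Tm z₀)
    (hT : ∀ᶠ z in 𝓝 z₀, Tp z * Tm z = s) :
    IsMovingFrame j f z₀ s κ (fun v z ↦ s * Tm z * Ap v z) (fun v z ↦ s * Tp z * Am v z)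
      (fun v z ↦ W v z + s * Tm z * dirDeriv v Tp z) := by
  have fin : ∀ {F : E → ℝ}, ContDiffAt ℝ ∞ F z₀ → ∀ᶠ z in 𝓝 z₀, DifferentiableAt ℝ F z := by
    intro F hF
    filter_upwards [(hF.of_le (m := 1) (by norm_cast)).eventually (by simp)] with z hz
    exact hz.differentiableAt (by simp)
  -- Since `s² = 1`, the relation `Tp Tm = s` means `s Tm = 1/Tp` and `s Tp = 1/Tm`: the frame is
  -- divided by `Tp` and `Tm`, and the connection form changes by `d log Tp`. Differentiating the
  -- relation removes all derivatives of `Tm`.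
  have hTm' : ∀ᶠ z in 𝓝 z₀, ∀ v, dirDeriv v Tm z = -s * Tm z ^ 2 * dirDeriv v Tp z := by
    filter_upwards [hT.eventually_nhds, fin hTp, fin hTm] with z hz h1 h2 v
    have h3 := dirDeriv_mul h1 h2 v
    rw [dirDeriv_congr (h := fun _ ↦ s) hz] at h3
    simp only [dirDeriv, fderiv_fun_const, Pi.zero_apply, zero_apply] at h3 ⊢
    have h4 := hz.self_of_nhds
    linear_combination -s * Tm z * h3 - fderiv ℝ Tm z v * hs - s * fderiv ℝ Tm z v * h4
  refine ⟨fun v ↦ ⟨(contDiffAt_const.mul hTm).mul (H.smooth v).1,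
    (contDiffAt_const.mul hTp).mul (H.smooth v).2.1,
    (H.smooth v).2.2.add ((contDiffAt_const.mul hTm).mul (contDiffAt_dirDeriv hTp v))⟩,
    ?_, ?_, ?_, ?_, ?_⟩
  · filter_upwards [H.form, hT] with z h1 h2 v w
    rw [h1]
    linear_combination (-s * s * s / 2 * (Ap v z * Am w z + Am v z * Ap w z)) * h2
      - (s * s + 1) / 2 * (Ap v z * Am w z + Am v z * Ap w z) * hs
  · filter_upwards [H.area, hT] with z h1 h2 v w
    rw [h1]
    linear_combination (-s * s * s / 2 * (Ap v z * Am w z - Am v z * Ap w z)) * h2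
      - (s * s + 1) / 2 * (Ap v z * Am w z - Am v z * Ap w z) * hs
  · intro v w
    filter_upwards [H.deriv_fst v w, hT, hTm', fin hTm, fin (H.smooth v).1, fin (H.smooth w).1]
      with z h1 h2 h3 h4 h5 h6
    rw [dirDeriv_mul (h4.const_mul s) h6, dirDeriv_mul (h4.const_mul s) h5,
      dirDeriv_const_mul s h4, dirDeriv_const_mul s h4, h3, h3]
    linear_combination s * Tm z * h1
  · intro v w
    filter_upwards [H.deriv_snd v w, hT, fin hTp, fin (H.smooth v).2.1, fin (H.smooth w).2.1]
      with z h1 h2 h4 h5 h6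
    rw [dirDeriv_mul (h4.const_mul s) h6, dirDeriv_mul (h4.const_mul s) h5,
      dirDeriv_const_mul s h4, dirDeriv_const_mul s h4]
    linear_combination s * Tp z * h1 - (dirDeriv v Tp z * Am w z - dirDeriv w Tp z * Am v z) *
      (s * s * h2 + s * hs)
  · intro v w
    -- The change of the connection form is closed, so the curvature equation is unaffected.
    have d : ∀ v, dirDeriv v Tm z₀ = -s * Tm z₀ ^ 2 * dirDeriv v Tp z₀ := hTm'.self_of_nhds
    have e : ∀ v w, dirDeriv v (fun z ↦ W w z + s * Tm z * dirDeriv w Tp z) z₀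
        = dirDeriv v (W w) z₀ + (s * dirDeriv v Tm z₀ * dirDeriv w Tp z₀
          + s * Tm z₀ * dirDeriv v (dirDeriv w Tp) z₀) := by
      intro v w
      have h1 := (H.smooth w).2.2.differentiableAt (by simp)
      have h2 := hTm.differentiableAt (by simp)
      have h3 := (contDiffAt_dirDeriv hTp w).differentiableAt (by simp)
      rw [dirDeriv_add h1 ((h2.const_mul s).fun_mul h3), dirDeriv_mul (h2.const_mul s) h3,
        dirDeriv_const_mul s h2]
    rw [e, e, d, d, dirDeriv_comm hTp w v]
    have h2 := hT.self_of_nhds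
    linear_combination H.curvature v w
      - κ / 2 * (Ap v z₀ * Am w z₀ - Am v z₀ * Ap w z₀) * ((s * s + 1) * hs + s * s * s * h2)

/-- Let `φ` be a map with `g(dφ(d), dφ(d)) = s = ±1`. Along every deformation `f` of `φ` there is a
moving frame which is adapted to `dφ(d)`, with a connection form that depends only on `φ`. -/
theorem exists_adapted_movingFrame {g : LorentzMetric M} (j : ParacomplexStructure g)
    {φ : Plane → M} {y₀ d : Plane} {s : ℝ} (hs : s * s = 1)
    (hφ : ∀ᶠ y in 𝓝 y₀, ContMDiffAt 𝓘(ℝ, Plane) (𝓡 2) ∞ φ y)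
    (hd : ∀ᶠ y in 𝓝 y₀, pullForm g φ d d y = s) :
    ∃ k : ℝ, ∀ f : ℝ × Plane → M,
      (∀ᶠ z in 𝓝 ((0 : ℝ), y₀), ContMDiffAt 𝓘(ℝ, ℝ × Plane) (𝓡 2) ∞ f z) →
      (∀ᶠ y in 𝓝 y₀, f (0, y) = φ y) →
      ∃ Ap Am W : ℝ × Plane → ℝ × Plane → ℝ,
        IsMovingFrame j f (0, y₀) s (g.gaussCurvature (φ y₀)) Ap Am W ∧
        (∀ᶠ y in 𝓝 y₀, Ap (0, d) (0, y) = 1 ∧ Am (0, d) (0, y) = 1) ∧ W (0, d) (0, y₀) = k := by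
  obtain ⟨a, c, η, H⟩ := exists_isNullCoframe j (φ y₀)
  set x := φ y₀ with hx
  set F : Plane → Plane := fun y ↦ chartAt Plane x (φ y) with hF
  have H0 := H.isMovingFrame hφ rfl
  set tp : Plane → ℝ := pullCovector a F d with htp
  set tm : Plane → ℝ := pullCovector c F d with htm
  -- The numbers `tp` and `tm` are the values of the coframe on `dφ(d)`, so this is the
  -- normalization `g(dφ(d), dφ(d)) = s`. Dividing by them gives both forms the value `1` on `d`.
  have ht : ∀ᶠ y in 𝓝 y₀, tp y * tm y = s := by
    filter_upwards [H0.form, hd] with y h1 h2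
    rw [h1] at h2
    linear_combination h2
  -- This is the connection form after the gauge transformation, evaluated on `d` at time `0`. It is
  -- made from `φ` and the coframe only, so the same `k` serves all deformations `f`. It is the
  -- geodesic curvature of the curve with respect to the normal `j dφ(d)`.
  refine ⟨pullCovector η F d y₀ + s * tm y₀ * dirDeriv d tp y₀, fun f hf h0 ↦ ?_⟩
  have hf0 : f (0, y₀) = x := h0.self_of_nhds
  have H1 := H.isMovingFrame hf hf0
  set G : ℝ × Plane → Plane := fun z ↦ chartAt Plane x (f z) with hG
  have hsnd : ContDiffAt ℝ ∞ (Prod.snd : ℝ × Plane → Plane) (0, y₀) := contDiffAt_snd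
  -- The gauge factors of `φ` are extended independently of time.
  have hTp : ContDiffAt ℝ ∞ (fun z : ℝ × Plane ↦ tp z.2) (0, y₀) :=
    ContDiffAt.comp (g := tp) (0, y₀) (H0.smooth d).1 hsnd
  have hTm : ContDiffAt ℝ ∞ (fun z : ℝ × Plane ↦ tm z.2) (0, y₀) :=
    ContDiffAt.comp (g := tm) (0, y₀) (H0.smooth d).2.1 hsnd
  have htend : Tendsto (Prod.snd : ℝ × Plane → Plane) (𝓝 (0, y₀)) (𝓝 y₀) := hsnd.continuousAt
  have H2 := H1.gauge hs hTp hTm (htend.eventually ht)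
  have hslice : Tendsto (fun y : Plane ↦ ((0 : ℝ), y)) (𝓝 y₀) (𝓝 (0, y₀)) :=
    (by fun_prop : Continuous fun y : Plane ↦ ((0 : ℝ), y)).continuousAt
  have hsrc : ∀ᶠ z in 𝓝 ((0 : ℝ), y₀), f z ∈ (chartAt Plane x).source :=
    hf.self_of_nhds.continuousAt.eventually
      ((chartAt Plane x).open_source.mem_nhds (by rw [hf0]; exact mem_chart_source Plane x))
  -- Derivatives in directions `(0, d)` at time `0` see `f` only through `φ`.
  have hres : ∀ a : Fin 2 → Plane → ℝ, ∀ᶠ y in 𝓝 y₀, pullCovector a G (0, d) (0, y)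
      = pullCovector a F d y := by
    intro a
    filter_upwards [hslice.eventually hf, hslice.eventually hsrc, h0.eventually_nhds]
      with y h1 h2 h3
    have hGd := (contDiffAt_chart_comp h1 h2).differentiableAt (n := ∞) (by simp)
    have e0 : F =ᶠ[𝓝 y] fun y ↦ G (0, y) := by
      filter_upwards [h3] with y' h'
      simp only [hF, hG, h']
    have e1 : ∀ i, dirDeriv (0, d) (fun z ↦ G z i) (0, y) = dirDeriv d (fun y ↦ F y i) y := by
      intro i
      refine Eq.trans ?_ (dirDeriv_congr (e0.fun_comp (fun q : Plane ↦ q i)) d).symm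
      have hi : DifferentiableAt ℝ (fun z ↦ G z i) (0, y) :=
        (EuclideanSpace.proj i : Plane →L[ℝ] ℝ).differentiableAt.comp _ hGd
      have hinr : HasFDerivAt (fun y : Plane ↦ ((0 : ℝ), y)) (ContinuousLinearMap.inr ℝ ℝ Plane) y :=
        hasFDerivAt_prodMk_right _ _
      have := (hi.hasFDerivAt.comp y hinr).fderiv
      rw [dirDeriv, dirDeriv]
      have t := congrArg (fun L : Plane →L[ℝ] ℝ ↦ L d) this
      exact t.symm
    have e2 : G (0, y) = F y := e0.eq_of_nhds.symm
    simp only [pullCovector, e1, e2]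
  refine ⟨_, _, _, H2, ?_, ?_⟩
  · filter_upwards [hres a, hres c, ht] with y h1 h2 h3
    simp only [h1, h2]
    constructor <;> linear_combination s * h3 + hs
  · have e1 := (hres η).self_of_nhds
    have e2 : dirDeriv (0, d) (fun z : ℝ × Plane ↦ tp z.2) (0, y₀) = dirDeriv d tp y₀ := by
      have hd' : DifferentiableAt ℝ tp y₀ := (H0.smooth d).1.differentiableAt (by simp)
      have hsd : HasFDerivAt (Prod.snd : ℝ × Plane → Plane) (ContinuousLinearMap.snd ℝ ℝ Plane)
        ((0 : ℝ), y₀) := hasFDerivAt_snd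
      have := (HasFDerivAt.comp (g := tp) ((0 : ℝ), y₀) hd'.hasFDerivAt hsd).fderiv
      have t := congrArg (fun L : ℝ × Plane →L[ℝ] ℝ ↦ L (0, d)) this
      exact t
    simp only [e1, e2]

end MovingFrames

/-! ### Second order identities for moving frames, and restriction to time zero -/

section Jets

open Filter Topology

section General

variable {E : Type*} [NormedAddCommGroup E] [NormedSpace ℝ E]

theorem eventually_differentiableAt {f : E → ℝ} {z : E} (hf : ContDiffAt ℝ ∞ f z) :
    ∀ᶠ y in 𝓝 z, DifferentiableAt ℝ f y := by
  filter_upwards [(hf.of_le (m := 1) (by norm_cast)).eventually (by simp)] with y hy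
  exact hy.differentiableAt (by simp)

theorem differentiableAt_of_smooth {f : E → ℝ} {z : E} (hf : ContDiffAt ℝ ∞ f z) :
    DifferentiableAt ℝ f z := hf.differentiableAt (by simp)

theorem dirDeriv_dirDeriv_mul {f h : E → ℝ} {z : E} (hf : ContDiffAt ℝ ∞ f z)
    (hh : ContDiffAt ℝ ∞ h z) (v w : E) :
    dirDeriv v (dirDeriv w fun z ↦ f z * h z) z
      = dirDeriv v (dirDeriv w f) z * h z + dirDeriv w f z * dirDeriv v h z
        + (dirDeriv v f z * dirDeriv w h z + f z * dirDeriv v (dirDeriv w h) z) := by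
  have h1 : dirDeriv w (fun z ↦ f z * h z) =ᶠ[𝓝 z]
      fun z ↦ dirDeriv w f z * h z + f z * dirDeriv w h z := by
    filter_upwards [eventually_differentiableAt hf, eventually_differentiableAt hh] with y h1 h2
    exact dirDeriv_mul h1 h2 w
  have a1 := differentiableAt_of_smooth hf
  have a2 := differentiableAt_of_smooth hh
  have a3 := differentiableAt_of_smooth (contDiffAt_dirDeriv hf w)
  have a4 := differentiableAt_of_smooth (contDiffAt_dirDeriv hh w)
  rw [dirDeriv_congr h1, dirDeriv_add (a3.fun_mul a2) (a1.fun_mul a4), dirDeriv_mul a3 a2,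
    dirDeriv_mul a1 a4]

theorem dirDeriv_dirDeriv_add {f h : E → ℝ} {z : E} (hf : ContDiffAt ℝ ∞ f z)
    (hh : ContDiffAt ℝ ∞ h z) (v w : E) :
    dirDeriv v (dirDeriv w fun z ↦ f z + h z) z
      = dirDeriv v (dirDeriv w f) z + dirDeriv v (dirDeriv w h) z := by
  have h1 : dirDeriv w (fun z ↦ f z + h z) =ᶠ[𝓝 z] fun z ↦ dirDeriv w f z + dirDeriv w h z := by
    filter_upwards [eventually_differentiableAt hf, eventually_differentiableAt hh] with y h1 h2
    exact dirDeriv_add h1 h2 w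
  rw [dirDeriv_congr h1, dirDeriv_add (differentiableAt_of_smooth (contDiffAt_dirDeriv hf w))
    (differentiableAt_of_smooth (contDiffAt_dirDeriv hh w))]

theorem dirDeriv_dirDeriv_const_mul (c : ℝ) {f : E → ℝ} {z : E} (hf : ContDiffAt ℝ ∞ f z)
    (v w : E) :
    dirDeriv v (dirDeriv w fun z ↦ c * f z) z = c * dirDeriv v (dirDeriv w f) z := by
  have h1 : dirDeriv w (fun z ↦ c * f z) =ᶠ[𝓝 z] fun z ↦ c * dirDeriv w f z := by
    filter_upwards [eventually_differentiableAt hf] with y h1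
    exact dirDeriv_const_mul c h1 w
  rw [dirDeriv_congr h1, dirDeriv_const_mul c (differentiableAt_of_smooth (contDiffAt_dirDeriv hf w))]

end General

section Frame

variable {E M : Type*} [NormedAddCommGroup E] [NormedSpace ℝ E]
  [TopologicalSpace M] [ChartedSpace Plane M] [IsManifold (𝓡 2) ∞ M]
  {g : LorentzMetric M} {j : ParacomplexStructure g} {f : E → M} {z₀ : E} {s κ : ℝ}
  {Ap Am W : E → E → ℝ}

theorem IsMovingFrame.deriv_form (H : IsMovingFrame j f z₀ s κ Ap Am W) (u v w : E) :
    ∀ᶠ z in 𝓝 z₀, dirDeriv u (pullForm g f v w) z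
      = s / 2 * (dirDeriv u (Ap v) z * Am w z + Ap v z * dirDeriv u (Am w) z
        + (dirDeriv u (Am v) z * Ap w z + Am v z * dirDeriv u (Ap w) z)) := by
  filter_upwards [H.form.eventually_nhds, eventually_differentiableAt (H.smooth v).1,
    eventually_differentiableAt (H.smooth v).2.1, eventually_differentiableAt (H.smooth w).1,
    eventually_differentiableAt (H.smooth w).2.1] with z h a1 a2 a3 a4
  rw [dirDeriv_congr (h := fun z ↦ s / 2 * (Ap v z * Am w z + Am v z * Ap w z))
    (h.mono fun z hz ↦ hz v w), dirDeriv_const_mul _ ((a1.fun_mul a4).fun_add (a2.fun_mul a3)),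
    dirDeriv_add (a1.fun_mul a4) (a2.fun_mul a3), dirDeriv_mul a1 a4, dirDeriv_mul a2 a3]

theorem IsMovingFrame.deriv_area (H : IsMovingFrame j f z₀ s κ Ap Am W) (u v w : E) :
    ∀ᶠ z in 𝓝 z₀, dirDeriv u (pullArea j f v w) z
      = s / 2 * (dirDeriv u (Ap v) z * Am w z + Ap v z * dirDeriv u (Am w) z
        - (dirDeriv u (Am v) z * Ap w z + Am v z * dirDeriv u (Ap w) z)) := by
  filter_upwards [H.area.eventually_nhds, eventually_differentiableAt (H.smooth v).1,
    eventually_differentiableAt (H.smooth v).2.1, eventually_differentiableAt (H.smooth w).1,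
    eventually_differentiableAt (H.smooth w).2.1] with z h a1 a2 a3 a4
  rw [dirDeriv_congr (h := fun z ↦ s / 2 * (Ap v z * Am w z - Am v z * Ap w z))
    (h.mono fun z hz ↦ hz v w), dirDeriv_const_mul _ ((a1.fun_mul a4).fun_sub (a2.fun_mul a3)),
    dirDeriv_sub (a1.fun_mul a4) (a2.fun_mul a3), dirDeriv_mul a1 a4, dirDeriv_mul a2 a3]

theorem IsMovingFrame.deriv_deriv_form (H : IsMovingFrame j f z₀ s κ Ap Am W) (t u v w : E) :
    dirDeriv t (dirDeriv u (pullForm g f v w)) z₀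
      = s / 2 * (dirDeriv t (dirDeriv u (Ap v)) z₀ * Am w z₀
          + dirDeriv u (Ap v) z₀ * dirDeriv t (Am w) z₀
          + (dirDeriv t (Ap v) z₀ * dirDeriv u (Am w) z₀
            + Ap v z₀ * dirDeriv t (dirDeriv u (Am w)) z₀)
        + (dirDeriv t (dirDeriv u (Am v)) z₀ * Ap w z₀
          + dirDeriv u (Am v) z₀ * dirDeriv t (Ap w) z₀
          + (dirDeriv t (Am v) z₀ * dirDeriv u (Ap w) z₀
            + Am v z₀ * dirDeriv t (dirDeriv u (Ap w)) z₀))) := by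
  have a1 := (H.smooth v).1
  have a2 := (H.smooth v).2.1
  have a3 := (H.smooth w).1
  have a4 := (H.smooth w).2.1
  rw [dirDeriv_congr (eventuallyEq_dirDeriv (h := fun z ↦ s / 2 * (Ap v z * Am w z + Am v z * Ap w z))
    (H.form.mono fun z hz ↦ hz v w) u),
    dirDeriv_dirDeriv_const_mul _ ((a1.mul a4).add (a2.mul a3)),
    dirDeriv_dirDeriv_add (a1.mul a4) (a2.mul a3), dirDeriv_dirDeriv_mul a1 a4,
    dirDeriv_dirDeriv_mul a2 a3]

/-- The second variation of the length element: a Jacobi type identity. -/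
theorem IsMovingFrame.jacobi (H : IsMovingFrame j f z₀ s κ Ap Am W) (τ v : E) :
    dirDeriv τ (dirDeriv τ (pullForm g f v v)) z₀ / 2 - dirDeriv v (dirDeriv τ (pullForm g f τ v)) z₀
        + dirDeriv v (dirDeriv v (pullForm g f τ τ)) z₀ / 2
      = s * ((dirDeriv v (Ap τ) z₀ + W v z₀ * Ap τ z₀) * (dirDeriv v (Am τ) z₀ - W v z₀ * Am τ z₀))
        - s / 2 * ((dirDeriv τ (Ap τ) z₀ + W τ z₀ * Ap τ z₀)
            * (dirDeriv v (Am v) z₀ - W v z₀ * Am v z₀)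
          + (dirDeriv τ (Am τ) z₀ - W τ z₀ * Am τ z₀) * (dirDeriv v (Ap v) z₀ + W v z₀ * Ap v z₀))
        + κ * (s / 2) ^ 2 * (Ap τ z₀ * Am v z₀ - Am τ z₀ * Ap v z₀) ^ 2 := by
  have sp := fun v ↦ (H.smooth v).1
  have sm := fun v ↦ (H.smooth v).2.1
  have sw := fun v ↦ (H.smooth v).2.2
  have dp := fun v ↦ differentiableAt_of_smooth (sp v)
  have dm := fun v ↦ differentiableAt_of_smooth (sm v)
  have dw := fun v ↦ differentiableAt_of_smooth (sw v)
  have ddp := fun v w ↦ differentiableAt_of_smooth (contDiffAt_dirDeriv (sp v) w)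
  have ddm := fun v w ↦ differentiableAt_of_smooth (contDiffAt_dirDeriv (sm v) w)
  -- The structure equations exchange the time derivative of the frame on `v` for the `v`-derivative
  -- of the frame on the velocity.
  have P1 : ∀ᶠ z in 𝓝 z₀, dirDeriv τ (Ap v) z
      = dirDeriv v (Ap τ) z - (W τ z * Ap v z - W v z * Ap τ z) := by
    filter_upwards [H.deriv_fst τ v] with z hz
    linarith
  have M1 : ∀ᶠ z in 𝓝 z₀, dirDeriv τ (Am v) z
      = dirDeriv v (Am τ) z + (W τ z * Am v z - W v z * Am τ z) := by
    filter_upwards [H.deriv_snd τ v] with z hz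
    linarith
  have P2 : ∀ u, dirDeriv u (dirDeriv τ (Ap v)) z₀ = dirDeriv u (dirDeriv v (Ap τ)) z₀
      - (dirDeriv u (W τ) z₀ * Ap v z₀ + W τ z₀ * dirDeriv u (Ap v) z₀
        - (dirDeriv u (W v) z₀ * Ap τ z₀ + W v z₀ * dirDeriv u (Ap τ) z₀)) := by
    intro u
    rw [dirDeriv_congr P1, dirDeriv_sub (ddp _ _) (((dw _).fun_mul (dp _)).fun_sub
      ((dw _).fun_mul (dp _))), dirDeriv_sub ((dw _).fun_mul (dp _)) ((dw _).fun_mul (dp _)),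
      dirDeriv_mul (dw _) (dp _), dirDeriv_mul (dw _) (dp _)]
  have M2 : ∀ u, dirDeriv u (dirDeriv τ (Am v)) z₀ = dirDeriv u (dirDeriv v (Am τ)) z₀
      + (dirDeriv u (W τ) z₀ * Am v z₀ + W τ z₀ * dirDeriv u (Am v) z₀
        - (dirDeriv u (W v) z₀ * Am τ z₀ + W v z₀ * dirDeriv u (Am τ) z₀)) := by
    intro u
    rw [dirDeriv_congr M1, dirDeriv_add (ddm _ _) (((dw _).fun_mul (dm _)).fun_sub
      ((dw _).fun_mul (dm _))), dirDeriv_sub ((dw _).fun_mul (dm _)) ((dw _).fun_mul (dm _)),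
      dirDeriv_mul (dw _) (dm _), dirDeriv_mul (dw _) (dm _)]
  -- After this substitution the second derivatives of the frame cancel up to symmetry. The
  -- derivatives of `W` survive only in the combination `dW(τ, v)`, which is the curvature term.
  simp only [H.deriv_deriv_form, P2, M2, P1.self_of_nhds, M1.self_of_nhds,
    dirDeriv_comm (sp τ) v τ, dirDeriv_comm (sm τ) v τ]
  linear_combination s / 2 * (Ap τ z₀ * Am v z₀ - Am τ z₀ * Ap v z₀) * H.curvature τ v

end Frame

section Slice

theorem hasFDerivAt_slice {h : ℝ × Plane → ℝ} {y : Plane} (hh : DifferentiableAt ℝ h (0, y)) :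
    HasFDerivAt (fun y ↦ h (0, y)) ((fderiv ℝ h (0, y)).comp (ContinuousLinearMap.inr ℝ ℝ Plane))
      y := by
  have hinr : HasFDerivAt (fun y : Plane ↦ ((0 : ℝ), y)) (ContinuousLinearMap.inr ℝ ℝ Plane) y :=
    hasFDerivAt_prodMk_right _ _
  exact hh.hasFDerivAt.comp y hinr

theorem dirDeriv_slice_eq {h : ℝ × Plane → ℝ} {y : Plane} (hh : DifferentiableAt ℝ h (0, y))
    (d : Plane) : dirDeriv (0, d) h (0, y) = dirDeriv d (fun y ↦ h (0, y)) y := by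
  rw [dirDeriv, dirDeriv, (hasFDerivAt_slice hh).fderiv]
  rfl

/-- Identities that hold only at time `0` may still be differentiated in the directions `(0, d)`.
This is how the normalizations of the frame at time `0` enter derivatives of higher order. -/
theorem dirDeriv_slice_congr {h h' : ℝ × Plane → ℝ} {y : Plane} (hh : DifferentiableAt ℝ h (0, y))
    (hh' : DifferentiableAt ℝ h' (0, y)) (H : ∀ᶠ y' in 𝓝 y, h (0, y') = h' (0, y')) (d : Plane) :
    dirDeriv (0, d) h (0, y) = dirDeriv (0, d) h' (0, y) := by
  rw [dirDeriv_slice_eq hh, dirDeriv_slice_eq hh', dirDeriv_congr H]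

theorem dirDeriv_slice_const {h : ℝ × Plane → ℝ} {y : Plane} {c : ℝ}
    (hh : DifferentiableAt ℝ h (0, y)) (H : ∀ᶠ y' in 𝓝 y, h (0, y') = c) (d : Plane) :
    dirDeriv (0, d) h (0, y) = 0 := by
  rw [dirDeriv_slice_congr (h' := fun _ ↦ c) hh (by fun_prop) H]
  simp [dirDeriv]

theorem tendsto_slice (y₀ : Plane) :
    Tendsto (fun y : Plane ↦ ((0 : ℝ), y)) (𝓝 y₀) (𝓝 (0, y₀)) :=
  (by fun_prop : Continuous fun y : Plane ↦ ((0 : ℝ), y)).continuousAt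

end Slice

end Jets

/-! ### Deformations of a curve in one factor -/

section FactorJets

open Filter Topology

/-- The time direction of `ℝ × Plane`. -/
def timeDir : ℝ × Plane := (1, 0)

/-- The jets, at time `0`, of the pull-backs `q` and `ar` of a metric and an area form under a family
of maps which at time `0` are constant in the direction `d'` and trace out a curve with
`q(d, d) = e` in the direction `d`. -/
structure FactorJets (q ar : ℝ × Plane → ℝ × Plane → ℝ × Plane → ℝ) (y₀ d d' : Plane)
    (e κ k : ℝ) : Prop where
  smooth_q (v w : ℝ × Plane) : ContDiffAt ℝ ∞ (q v w) (0, y₀)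
  smooth_ar (v w : ℝ × Plane) : ContDiffAt ℝ ∞ (ar v w) (0, y₀)
  q_main : ∀ᶠ y in 𝓝 y₀, q (0, d) (0, d) (0, y) = e
  q_mixed : ∀ᶠ y in 𝓝 y₀, q (0, d) (0, d') (0, y) = 0
  q_null : ∀ᶠ y in 𝓝 y₀, q (0, d') (0, d') (0, y) = 0
  q_time : ∀ᶠ y in 𝓝 y₀, q timeDir (0, d') (0, y) = 0
  ar_time : ∀ᶠ y in 𝓝 y₀, ar timeDir (0, d') (0, y) = 0
  deriv_main : dirDeriv timeDir (q (0, d) (0, d)) (0, y₀)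
    = 2 * (dirDeriv (0, d) (q timeDir (0, d)) (0, y₀) + k * ar timeDir (0, d) (0, y₀))
  deriv_deriv_main : dirDeriv (0, d') (dirDeriv timeDir (q (0, d) (0, d))) (0, y₀)
    = 2 * (dirDeriv (0, d') (dirDeriv (0, d) (q timeDir (0, d))) (0, y₀)
      + k * dirDeriv (0, d') (ar timeDir (0, d)) (0, y₀))
  deriv_mixed : dirDeriv timeDir (q (0, d) (0, d')) (0, y₀)
    = dirDeriv (0, d') (q timeDir (0, d)) (0, y₀)
  deriv_null : ∀ᶠ y in 𝓝 y₀, dirDeriv timeDir (q (0, d') (0, d')) (0, y) = 0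
  jacobi_main : dirDeriv timeDir (dirDeriv timeDir (q (0, d) (0, d))) (0, y₀) / 2
      - dirDeriv (0, d) (dirDeriv timeDir (q timeDir (0, d))) (0, y₀)
      + dirDeriv (0, d) (dirDeriv (0, d) (q timeDir timeDir)) (0, y₀) / 2
    = e * ((dirDeriv (0, d) (q timeDir (0, d)) (0, y₀) + k * ar timeDir (0, d) (0, y₀)) ^ 2
        - (dirDeriv (0, d) (ar timeDir (0, d)) (0, y₀) + k * q timeDir (0, d) (0, y₀)) ^ 2)
      + k * (dirDeriv timeDir (ar timeDir (0, d)) (0, y₀)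
        - e * (ar timeDir (0, d) (0, y₀)
            * (dirDeriv (0, d) (q timeDir (0, d)) (0, y₀) + k * ar timeDir (0, d) (0, y₀))
          - q timeDir (0, d) (0, y₀)
            * (dirDeriv (0, d) (ar timeDir (0, d)) (0, y₀) + k * q timeDir (0, d) (0, y₀))))
      + κ * ar timeDir (0, d) (0, y₀) ^ 2
  jacobi_null : dirDeriv timeDir (dirDeriv timeDir (q (0, d') (0, d'))) (0, y₀) / 2
      - dirDeriv (0, d') (dirDeriv timeDir (q timeDir (0, d'))) (0, y₀)
      + dirDeriv (0, d') (dirDeriv (0, d') (q timeDir timeDir)) (0, y₀) / 2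
    = e * (dirDeriv (0, d') (q timeDir (0, d)) (0, y₀) ^ 2
      - dirDeriv (0, d') (ar timeDir (0, d)) (0, y₀) ^ 2)
  deriv_ar : dirDeriv timeDir (ar timeDir (0, d')) (0, y₀)
    = e * (ar timeDir (0, d) (0, y₀) * dirDeriv (0, d') (q timeDir (0, d)) (0, y₀)
      - q timeDir (0, d) (0, y₀) * dirDeriv (0, d') (ar timeDir (0, d)) (0, y₀))

theorem dirDeriv_dirDeriv_slice_congr {h h' : ℝ × Plane → ℝ} {y : Plane}
    (hh : ContDiffAt ℝ ∞ h (0, y)) (hh' : ContDiffAt ℝ ∞ h' (0, y))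
    (H : ∀ᶠ y' in 𝓝 y, h (0, y') = h' (0, y')) (d d' : Plane) :
    dirDeriv (0, d) (dirDeriv (0, d') h) (0, y) = dirDeriv (0, d) (dirDeriv (0, d') h') (0, y) := by
  refine dirDeriv_slice_congr (differentiableAt_of_smooth (contDiffAt_dirDeriv hh _))
    (differentiableAt_of_smooth (contDiffAt_dirDeriv hh' _)) ?_ d
  filter_upwards [H.eventually_nhds, (tendsto_slice y).eventually (eventually_differentiableAt hh),
    (tendsto_slice y).eventually (eventually_differentiableAt hh')] with y' h1 h2 h3
  exact dirDeriv_slice_congr h2 h3 h1 d'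

/-- At time `0` both frame forms equal `1` on `d` and `0` on `d'`. The structure equations then give
`W(d') = 0` and express all time derivatives through the components of the velocity, `k`, and the
value of `W` on the time direction. The latter is a matter of gauge and drops out of every identity
in the list. -/
theorem IsMovingFrame.factorJets {M : Type*}
    [TopologicalSpace M] [ChartedSpace Plane M] [IsManifold (𝓡 2) ∞ M]
    {g : LorentzMetric M} {j : ParacomplexStructure g} {f : ℝ × Plane → M} {y₀ d d' : Plane}
    {s κ k ε : ℝ} {Ap Am W : ℝ × Plane → ℝ × Plane → ℝ}
    (H : IsMovingFrame j f (0, y₀) s κ Ap Am W)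
    (hf : ContMDiffAt 𝓘(ℝ, ℝ × Plane) (𝓡 2) ∞ f (0, y₀))
    (hd : ∀ᶠ y in 𝓝 y₀, Ap (0, d) (0, y) = 1 ∧ Am (0, d) (0, y) = 1)
    (hk : W (0, d) (0, y₀) = k)
    (hd' : ∀ᶠ y in 𝓝 y₀, Ap (0, d') (0, y) = 0 ∧ Am (0, d') (0, y) = 0)
    (hs : s * s = 1) (hε : ε * ε = 1) :
    FactorJets (fun v w z ↦ ε * pullForm g f v w z) (fun v w z ↦ ε * pullArea j f v w z) y₀ d d'
      (ε * s) (ε * κ) k := by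
  have sl := tendsto_slice y₀
  have sq := fun v w ↦ contDiffAt_pullForm g hf v w
  have sa := fun v w ↦ contDiffAt_pullArea j hf v w
  have sq' : ∀ v w, ContDiffAt ℝ ∞ (fun z ↦ ε * pullForm g f v w z) (0, y₀) :=
    fun v w ↦ contDiffAt_const.mul (sq v w)
  have sa' : ∀ v w, ContDiffAt ℝ ∞ (fun z ↦ ε * pullArea j f v w z) (0, y₀) :=
    fun v w ↦ contDiffAt_const.mul (sa v w)
  have sp := fun v ↦ (H.smooth v).1
  have sm := fun v ↦ (H.smooth v).2.1
  have sw := fun v ↦ (H.smooth v).2.2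
  have dp := fun v ↦ differentiableAt_of_smooth (sp v)
  have dm := fun v ↦ differentiableAt_of_smooth (sm v)
  have dw := fun v ↦ differentiableAt_of_smooth (sw v)
  have F := sl.eventually H.form
  have A := sl.eventually H.area
  have edp := fun v ↦ sl.eventually (eventually_differentiableAt (sp v))
  have edm := fun v ↦ sl.eventually (eventually_differentiableAt (sm v))
  -- derivatives of the frame along the slice
  have zd : ∀ b, ∀ᶠ y in 𝓝 y₀,
      dirDeriv (0, b) (Ap (0, d)) (0, y) = 0 ∧ dirDeriv (0, b) (Am (0, d)) (0, y) = 0 := by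
    intro b
    filter_upwards [hd.eventually_nhds, edp (0, d), edm (0, d)] with y h1 h2 h3
    exact ⟨dirDeriv_slice_const h2 (h1.mono fun y h ↦ h.1) b,
      dirDeriv_slice_const h3 (h1.mono fun y h ↦ h.2) b⟩
  have zd' : ∀ b, ∀ᶠ y in 𝓝 y₀,
      dirDeriv (0, b) (Ap (0, d')) (0, y) = 0 ∧ dirDeriv (0, b) (Am (0, d')) (0, y) = 0 := by
    intro b
    filter_upwards [hd'.eventually_nhds, edp (0, d'), edm (0, d')] with y h1 h2 h3
    exact ⟨dirDeriv_slice_const h2 (h1.mono fun y h ↦ h.1) b,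
      dirDeriv_slice_const h3 (h1.mono fun y h ↦ h.2) b⟩
  -- In the structure equation on `d`, `d'` the derivatives vanish because the frame is constant on
  -- both vectors along the slice. Only `W(d')` is left.
  have W0 : ∀ᶠ y in 𝓝 y₀, W (0, d') (0, y) = 0 := by
    filter_upwards [sl.eventually (H.deriv_fst (0, d) (0, d')), zd d', zd' d, hd, hd']
      with y h1 h2 h3 h4 h5
    rw [h2.1, h3.1, h4.1, h5.1] at h1
    linarith
  -- time derivatives of the frame
  have Td : ∀ᶠ y in 𝓝 y₀,
      dirDeriv timeDir (Ap (0, d)) (0, y) = dirDeriv (0, d) (Ap timeDir) (0, y)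
        - (W timeDir (0, y) - W (0, d) (0, y) * Ap timeDir (0, y)) ∧
      dirDeriv timeDir (Am (0, d)) (0, y) = dirDeriv (0, d) (Am timeDir) (0, y)
        + (W timeDir (0, y) - W (0, d) (0, y) * Am timeDir (0, y)) := by
    filter_upwards [sl.eventually (H.deriv_fst timeDir (0, d)),
      sl.eventually (H.deriv_snd timeDir (0, d)), hd] with y h1 h2 h3
    rw [h3.1] at h1
    rw [h3.2] at h2
    constructor <;> linarith
  have Td' : ∀ᶠ y in 𝓝 y₀,
      dirDeriv timeDir (Ap (0, d')) (0, y) = dirDeriv (0, d') (Ap timeDir) (0, y) ∧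
      dirDeriv timeDir (Am (0, d')) (0, y) = dirDeriv (0, d') (Am timeDir) (0, y) := by
    filter_upwards [sl.eventually (H.deriv_fst timeDir (0, d')),
      sl.eventually (H.deriv_snd timeDir (0, d')), hd', W0] with y h1 h2 h3 h4
    rw [h3.1, h4] at h1
    rw [h3.2, h4] at h2
    constructor <;> linarith
  -- The curvature equation on `d'`, `d` has right side zero, since the frame vanishes on `d'`; and
  -- `W(d')` vanishes along the slice. So `k` does not vary along `d'`.
  have Wd : dirDeriv (0, d') (W (0, d)) (0, y₀) = 0 := by
    have h := H.curvature (0, d') (0, d)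
    rw [dirDeriv_slice_const (dw _) W0, hd'.self_of_nhds.1, hd'.self_of_nhds.2] at h
    linarith
  -- the velocity on the slice
  have X0 : ∀ᶠ y in 𝓝 y₀, ε * pullForm g f timeDir (0, d) (0, y)
      = ε * s / 2 * (Ap timeDir (0, y) + Am timeDir (0, y)) := by
    filter_upwards [F, hd] with y h1 h2
    rw [h1, h2.1, h2.2]; ring
  have O0 : ∀ᶠ y in 𝓝 y₀, ε * pullArea j f timeDir (0, d) (0, y)
      = ε * s / 2 * (Ap timeDir (0, y) - Am timeDir (0, y)) := by
    filter_upwards [A, hd] with y h1 h2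
    rw [h1, h2.1, h2.2]; ring
  have spm : ContDiffAt ℝ ∞ (fun z ↦ ε * s / 2 * (Ap timeDir z + Am timeDir z)) (0, y₀) :=
    contDiffAt_const.mul ((sp _).add (sm _))
  have smm : ContDiffAt ℝ ∞ (fun z ↦ ε * s / 2 * (Ap timeDir z - Am timeDir z)) (0, y₀) :=
    contDiffAt_const.mul ((sp _).sub (sm _))
  have X1 : ∀ b, dirDeriv (0, b) (fun z ↦ ε * pullForm g f timeDir (0, d) z) (0, y₀)
      = ε * s / 2 * (dirDeriv (0, b) (Ap timeDir) (0, y₀) + dirDeriv (0, b) (Am timeDir) (0, y₀)) := by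
    intro b
    rw [dirDeriv_slice_congr (differentiableAt_of_smooth (sq' _ _)) (differentiableAt_of_smooth spm)
      X0, dirDeriv_const_mul _ ((dp _).fun_add (dm _)), dirDeriv_add (dp _) (dm _)]
  have O1 : ∀ b, dirDeriv (0, b) (fun z ↦ ε * pullArea j f timeDir (0, d) z) (0, y₀)
      = ε * s / 2 * (dirDeriv (0, b) (Ap timeDir) (0, y₀) - dirDeriv (0, b) (Am timeDir) (0, y₀)) := by
    intro b
    rw [dirDeriv_slice_congr (differentiableAt_of_smooth (sa' _ _)) (differentiableAt_of_smooth smm)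
      O0, dirDeriv_const_mul _ ((dp _).fun_sub (dm _)), dirDeriv_sub (dp _) (dm _)]
  have X2 : dirDeriv (0, d') (dirDeriv (0, d) fun z ↦ ε * pullForm g f timeDir (0, d) z) (0, y₀)
      = ε * s / 2 * (dirDeriv (0, d') (dirDeriv (0, d) (Ap timeDir)) (0, y₀)
        + dirDeriv (0, d') (dirDeriv (0, d) (Am timeDir)) (0, y₀)) := by
    rw [dirDeriv_dirDeriv_slice_congr (sq' _ _) spm X0,
      dirDeriv_dirDeriv_const_mul _ ((sp _).add (sm _)), dirDeriv_dirDeriv_add (sp _) (sm _)]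
  have eX0 := X0.self_of_nhds
  have eO0 := O0.self_of_nhds
  -- time derivative of the metric on the slice
  have G1 : ∀ v w, ∀ᶠ y in 𝓝 y₀, dirDeriv timeDir (fun z ↦ ε * pullForm g f v w z) (0, y)
      = ε * dirDeriv timeDir (pullForm g f v w) (0, y) := by
    intro v w
    filter_upwards [sl.eventually (eventually_differentiableAt (sq v w))] with y hy
    exact dirDeriv_const_mul _ hy _
  have Gdd : ∀ᶠ y in 𝓝 y₀,
      dirDeriv timeDir (fun z ↦ ε * pullForm g f (0, d) (0, d) z) (0, y)
      = ε * s * ((dirDeriv (0, d) (Ap timeDir) (0, y) + dirDeriv (0, d) (Am timeDir) (0, y))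
        + W (0, d) (0, y) * (Ap timeDir (0, y) - Am timeDir (0, y))) := by
    filter_upwards [G1 (0, d) (0, d), sl.eventually (H.deriv_form timeDir (0, d) (0, d)), Td, hd]
      with y h1 h2 h3 h4
    rw [h1, h2, h3.1, h3.2, h4.1, h4.2]
    ring
  have c2 : ∀ t u v w, dirDeriv t (dirDeriv u fun z ↦ ε * pullForm g f v w z) (0, y₀)
      = ε * dirDeriv t (dirDeriv u (pullForm g f v w)) (0, y₀) := fun t u v w ↦
    dirDeriv_dirDeriv_const_mul ε (sq v w) t u
  have ca : ∀ t v w, dirDeriv t (fun z ↦ ε * pullArea j f v w z) (0, y₀)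
      = ε * dirDeriv t (pullArea j f v w) (0, y₀) := fun t v w ↦
    dirDeriv_const_mul ε (differentiableAt_of_smooth (sa v w)) t
  have hs1 := mul_self_eq_one_iff.mp hs
  have hε1 := mul_self_eq_one_iff.mp hε
  have hd0 := hd.self_of_nhds
  have hd0' := hd'.self_of_nhds
  have Td0 := Td.self_of_nhds
  have Td0' := Td'.self_of_nhds
  refine ⟨sq', sa', ?_, ?_, ?_, ?_, ?_, ?_, ?_, ?_, ?_, ?_, ?_, ?_⟩
  · filter_upwards [F, hd] with y h1 h2
    rw [h1, h2.1, h2.2]; ring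
  · filter_upwards [F, hd'] with y h1 h2
    rw [h1, h2.1, h2.2]; ring
  · filter_upwards [F, hd'] with y h1 h2
    rw [h1, h2.1, h2.2]; ring
  · filter_upwards [F, hd'] with y h1 h2
    rw [h1, h2.1, h2.2]; ring
  · filter_upwards [A, hd'] with y h1 h2
    rw [h1, h2.1, h2.2]; ring
  · rw [Gdd.self_of_nhds, X1, eO0, hk]
    ring
  · have e1 : ContDiffAt ℝ ∞ (dirDeriv (0, d) (Ap timeDir)) (0, y₀) := contDiffAt_dirDeriv (sp _) _
    have e2 : ContDiffAt ℝ ∞ (dirDeriv (0, d) (Am timeDir)) (0, y₀) := contDiffAt_dirDeriv (sm _) _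
    have d1 := differentiableAt_of_smooth e1
    have d2 := differentiableAt_of_smooth e2
    rw [dirDeriv_slice_congr (h' := fun z ↦ ε * s * ((dirDeriv (0, d) (Ap timeDir) z
        + dirDeriv (0, d) (Am timeDir) z) + W (0, d) z * (Ap timeDir z - Am timeDir z)))
        (differentiableAt_of_smooth (contDiffAt_dirDeriv (sq' _ _) _))
        (((d1.fun_add d2).fun_add ((dw _).fun_mul ((dp _).fun_sub (dm _)))).const_mul _) Gdd,
      dirDeriv_const_mul _ ((d1.fun_add d2).fun_add ((dw _).fun_mul ((dp _).fun_sub (dm _)))),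
      dirDeriv_add (d1.fun_add d2) ((dw _).fun_mul ((dp _).fun_sub (dm _))),
      dirDeriv_add d1 d2, dirDeriv_mul (dw _) ((dp _).fun_sub (dm _)), dirDeriv_sub (dp _) (dm _),
      Wd, X2, O1, hk]
    ring
  · rw [(G1 _ _).self_of_nhds, (H.deriv_form timeDir (0, d) (0, d')).self_of_nhds, Td0'.1, Td0'.2,
      hd0.1, hd0.2, hd0'.1, hd0'.2, X1]
    ring
  · filter_upwards [G1 (0, d') (0, d'), sl.eventually (H.deriv_form timeDir (0, d') (0, d')), hd']
      with y h1 h2 h3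
    rw [h1, h2, h3.1, h3.2]
    ring
  -- The remaining time derivatives are collected in the Jacobi identity in the direction `d`. There
  -- the terms with the acceleration are multiplied by `k` and reappear as the time derivative of
  -- the area form on the velocity.
  · rw [X1, O1, eX0, eO0, c2, c2, c2, ca, (H.deriv_area timeDir timeDir (0, d)).self_of_nhds,
      Td0.1, Td0.2, hd0.1, hd0.2, hk]
    have hJ := H.jacobi timeDir (0, d)
    rw [(zd d).self_of_nhds.1, (zd d).self_of_nhds.2, hd0.1, hd0.2, hk] at hJ
    rcases hε1 with rfl | rfl
    · rcases hs1 with rfl | rfl <;> linear_combination hJ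
    · rcases hs1 with rfl | rfl <;> linear_combination -hJ
  · rw [X1, O1, c2, c2, c2]
    have hJ := H.jacobi timeDir (0, d')
    rw [(zd' d').self_of_nhds.1, (zd' d').self_of_nhds.2, hd0'.1, hd0'.2, W0.self_of_nhds] at hJ
    rcases hε1 with rfl | rfl
    · rcases hs1 with rfl | rfl <;> linear_combination hJ
    · rcases hs1 with rfl | rfl <;> linear_combination -hJ
  · rw [X1, O1, eX0, eO0, ca, (H.deriv_area timeDir timeDir (0, d')).self_of_nhds,
      Td0'.1, Td0'.2, hd0'.1, hd0'.2]
    rcases hs1 with rfl | rfl <;> rcases hε1 with rfl | rfl <;> ring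

end FactorJets

/-! ### First and second variation of the area density -/

section Variation

open Filter Topology

/-- The area density `√|det G|` of a field of bilinear forms in the directions `d`, `d'`. -/
def areaDensity (G : ℝ × Plane → ℝ × Plane → ℝ × Plane → ℝ) (d d' : Plane) (z : ℝ × Plane) : ℝ :=
  √|G (0, d) (0, d) z * G (0, d') (0, d') z - G (0, d) (0, d') z * G (0, d) (0, d') z|

/-- The component along `d` of the vector field whose divergence enters the second variation. -/
def fluxFst (G ar : ℝ × Plane → ℝ × Plane → ℝ × Plane → ℝ) (d d' : Plane) (e₁ e₂ : ℝ)
    (z : ℝ × Plane) : ℝ :=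
  e₁ * (dirDeriv timeDir (G timeDir (0, d)) z - 1 / 2 * dirDeriv (0, d) (G timeDir timeDir) z)
    + 2 * e₁ * e₂ * (ar timeDir (0, d) z * dirDeriv (0, d') (ar timeDir (0, d')) z)
    + e₁ * e₂ * (G timeDir (0, d) z * dirDeriv timeDir (G (0, d') (0, d')) z)

/-- The component along `d'` of the vector field whose divergence enters the second variation. -/
def fluxSnd (G ar : ℝ × Plane → ℝ × Plane → ℝ × Plane → ℝ) (d d' : Plane) (e₁ e₂ : ℝ)
    (z : ℝ × Plane) : ℝ :=
  e₂ * (dirDeriv timeDir (G timeDir (0, d')) z - 1 / 2 * dirDeriv (0, d') (G timeDir timeDir) z)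
    - 2 * e₁ * e₂ * (ar timeDir (0, d) z * dirDeriv (0, d) (ar timeDir (0, d')) z)
    + e₁ * e₂ * (G timeDir (0, d') z * dirDeriv timeDir (G (0, d) (0, d)) z)
    - 2 * e₁ * e₂ * dirDeriv (0, d) (fun z ↦ G timeDir (0, d) z * G timeDir (0, d') z) z

/-- The Hamiltonian potential that enters the second variation. -/
def secondPotential (G ar : ℝ × Plane → ℝ × Plane → ℝ × Plane → ℝ) (u : ℝ × Plane → ℝ)
    (d d' : Plane) (e₁ e₂ : ℝ) (z : ℝ × Plane) : ℝ :=
  dirDeriv timeDir u z - (e₁ * (G timeDir (0, d) z * ar timeDir (0, d) z)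
    + e₂ * (G timeDir (0, d') z * ar timeDir (0, d') z))

section Density

variable {G : ℝ × Plane → ℝ × Plane → ℝ × Plane → ℝ} {d d' y₀ : Plane} {e₁ e₂ : ℝ}

/-- At the base point the Gram determinant is `e₁ e₂`, a sign. Nearby the absolute value is
therefore multiplication by `e₁ e₂`, and no absolute value has to be differentiated. -/
theorem eventually_areaDensity (he₁ : e₁ * e₁ = 1) (he₂ : e₂ * e₂ = 1)
    (hG : ∀ v w, ContDiffAt ℝ ∞ (G v w) (0, y₀))
    (h₁ : G (0, d) (0, d) (0, y₀) = e₁) (h₂ : G (0, d') (0, d') (0, y₀) = e₂)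
    (h₃ : G (0, d) (0, d') (0, y₀) = 0) :
    ∀ᶠ z in 𝓝 ((0 : ℝ), y₀), 0 < e₁ * e₂ * (G (0, d) (0, d) z * G (0, d') (0, d') z
      - G (0, d) (0, d') z * G (0, d) (0, d') z) ∧
      areaDensity G d d' z = √(e₁ * e₂ * (G (0, d) (0, d) z * G (0, d') (0, d') z
      - G (0, d) (0, d') z * G (0, d) (0, d') z)) := by
  have hc : ContinuousAt (fun z ↦ e₁ * e₂ * (G (0, d) (0, d) z * G (0, d') (0, d') z
      - G (0, d) (0, d') z * G (0, d) (0, d') z)) (0, y₀) :=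
    continuousAt_const.mul (((hG _ _).continuousAt.mul (hG _ _).continuousAt).sub
      ((hG _ _).continuousAt.mul (hG _ _).continuousAt))
  have h0 : e₁ * e₂ * (G (0, d) (0, d) (0, y₀) * G (0, d') (0, d') (0, y₀)
      - G (0, d) (0, d') (0, y₀) * G (0, d) (0, d') (0, y₀)) = 1 := by
    rw [h₁, h₂, h₃]
    linear_combination e₂ * e₂ * he₁ + he₂
  filter_upwards [hc.eventually (lt_mem_nhds (a := 0) (by simp only [h0]; norm_num))] with z hz
  refine ⟨hz, ?_⟩
  rw [areaDensity, ← abs_of_pos hz, abs_mul, abs_mul]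
  have a1 : |e₁| = 1 := by rcases mul_self_eq_one_iff.mp he₁ with rfl | rfl <;> norm_num
  have a2 : |e₂| = 1 := by rcases mul_self_eq_one_iff.mp he₂ with rfl | rfl <;> norm_num
  rw [a1, a2, one_mul, one_mul]

/-- The square of the density is `e₁ e₂` times a polynomial in the metric coefficients.
Differentiating this relation twice and solving for the derivatives of the density avoids those of
the square root. -/
theorem areaDensity_jets (he₁ : e₁ * e₁ = 1) (he₂ : e₂ * e₂ = 1)
    (hG : ∀ v w, ContDiffAt ℝ ∞ (G v w) (0, y₀))
    (h₁ : ∀ᶠ y in 𝓝 y₀, G (0, d) (0, d) (0, y) = e₁)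
    (h₂ : ∀ᶠ y in 𝓝 y₀, G (0, d') (0, d') (0, y) = e₂)
    (h₃ : ∀ᶠ y in 𝓝 y₀, G (0, d) (0, d') (0, y) = 0) :
    ContDiffAt ℝ ∞ (areaDensity G d d') (0, y₀) ∧ areaDensity G d d' (0, y₀) = 1 ∧
    dirDeriv timeDir (areaDensity G d d') (0, y₀)
      = (e₁ * dirDeriv timeDir (G (0, d) (0, d)) (0, y₀)
        + e₂ * dirDeriv timeDir (G (0, d') (0, d')) (0, y₀)) / 2 ∧
    dirDeriv timeDir (dirDeriv timeDir (areaDensity G d d')) (0, y₀)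
      = (e₁ * dirDeriv timeDir (dirDeriv timeDir (G (0, d) (0, d))) (0, y₀)
          + e₂ * dirDeriv timeDir (dirDeriv timeDir (G (0, d') (0, d'))) (0, y₀)) / 2
        + e₁ * e₂ * (dirDeriv timeDir (G (0, d) (0, d)) (0, y₀)
            * dirDeriv timeDir (G (0, d') (0, d')) (0, y₀)
          - dirDeriv timeDir (G (0, d) (0, d')) (0, y₀) ^ 2)
        - (e₁ * dirDeriv timeDir (G (0, d) (0, d)) (0, y₀)
          + e₂ * dirDeriv timeDir (G (0, d') (0, d')) (0, y₀)) ^ 2 / 4 := by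
  have ev := eventually_areaDensity he₁ he₂ hG h₁.self_of_nhds h₂.self_of_nhds h₃.self_of_nhds
  set δ : ℝ × Plane → ℝ := fun z ↦ G (0, d) (0, d) z * G (0, d') (0, d') z
      - G (0, d) (0, d') z * G (0, d) (0, d') z with hδ
  have s1 : ContDiffAt ℝ ∞ (fun z ↦ G (0, d) (0, d) z * G (0, d') (0, d') z) (0, y₀) :=
    (hG _ _).mul (hG _ _)
  have s2 : ContDiffAt ℝ ∞ (fun z ↦ G (0, d) (0, d') z * G (0, d) (0, d') z) (0, y₀) :=
    (hG _ _).mul (hG _ _)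
  have sδ : ContDiffAt ℝ ∞ δ (0, y₀) := s1.sub s2
  have sD : ContDiffAt ℝ ∞ (areaDensity G d d') (0, y₀) := by
    refine ContDiffAt.congr_of_eventuallyEq ?_ (ev.mono fun z hz ↦ hz.2)
    exact (contDiffAt_const.mul sδ).sqrt ev.self_of_nhds.1.ne'
  have e12 : e₁ * e₂ * (e₁ * e₂) = 1 := by linear_combination e₂ * e₂ * he₁ + he₂
  have D0 : areaDensity G d d' (0, y₀) = 1 := by
    rw [ev.self_of_nhds.2, h₁.self_of_nhds, h₂.self_of_nhds, h₃.self_of_nhds]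
    simp [e12]
  have sq : (fun z ↦ areaDensity G d d' z * areaDensity G d d' z) =ᶠ[𝓝 (0, y₀)]
      fun z ↦ e₁ * e₂ * δ z := by
    filter_upwards [ev] with z hz
    rw [hz.2, Real.mul_self_sqrt hz.1.le]
  have dG := fun v w ↦ differentiableAt_of_smooth (hG v w)
  have j1 := dirDeriv_congr sq timeDir
  have j2 := dirDeriv_congr (eventuallyEq_dirDeriv sq timeDir) timeDir
  have dD := differentiableAt_of_smooth sD
  rw [dirDeriv_mul dD dD, dirDeriv_const_mul _ (differentiableAt_of_smooth sδ),
    dirDeriv_sub (differentiableAt_of_smooth s1) (differentiableAt_of_smooth s2),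
    dirDeriv_mul (dG _ _) (dG _ _), dirDeriv_mul (dG _ _) (dG _ _), D0, h₁.self_of_nhds,
    h₂.self_of_nhds, h₃.self_of_nhds] at j1
  have k1 : dirDeriv timeDir (areaDensity G d d') (0, y₀)
      = (e₁ * dirDeriv timeDir (G (0, d) (0, d)) (0, y₀)
        + e₂ * dirDeriv timeDir (G (0, d') (0, d')) (0, y₀)) / 2 := by
    linear_combination 1 / 2 * j1 + e₂ / 2 * dirDeriv timeDir (G (0, d') (0, d')) (0, y₀) * he₁
      + e₁ / 2 * dirDeriv timeDir (G (0, d) (0, d)) (0, y₀) * he₂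
  refine ⟨sD, D0, k1, ?_⟩
  have hcm : ∀ z, e₁ * e₂ * δ z = e₁ * e₂ * (G (0, d) (0, d) z * G (0, d') (0, d') z)
    - e₁ * e₂ * (G (0, d) (0, d') z * G (0, d) (0, d') z) := fun z ↦ by ring
  rw [dirDeriv_dirDeriv_mul sD sD, dirDeriv_dirDeriv_const_mul _ sδ] at j2
  -- The difference is written as a sum with factor `-1`, so that the rules for sums and constant
  -- multiples suffice.
  have j3 : dirDeriv timeDir (dirDeriv timeDir δ) (0, y₀)
      = dirDeriv timeDir (dirDeriv timeDir fun z ↦ G (0, d) (0, d) z * G (0, d') (0, d') z) (0, y₀)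
      - dirDeriv timeDir (dirDeriv timeDir fun z ↦ G (0, d) (0, d') z * G (0, d) (0, d') z)
        (0, y₀) := by
    have : δ = fun z ↦ (G (0, d) (0, d) z * G (0, d') (0, d') z)
      + (-1) * (G (0, d) (0, d') z * G (0, d) (0, d') z) := by
      ext z
      simp only [hδ]
      ring
    rw [this, dirDeriv_dirDeriv_add s1 (contDiffAt_const.mul s2), dirDeriv_dirDeriv_const_mul _ s2]
    ring
  rw [j3, dirDeriv_dirDeriv_mul (hG _ _) (hG _ _), dirDeriv_dirDeriv_mul (hG _ _) (hG _ _), D0, k1,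
    h₁.self_of_nhds, h₂.self_of_nhds, h₃.self_of_nhds] at j2
  linear_combination 1 / 2 * j2
    + e₂ / 2 * dirDeriv timeDir (dirDeriv timeDir (G (0, d') (0, d'))) (0, y₀) * he₁
      + e₁ / 2 * dirDeriv timeDir (dirDeriv timeDir (G (0, d) (0, d))) (0, y₀) * he₂

end Density

variable {q₁ a₁ q₂ a₂ G ar : ℝ × Plane → ℝ × Plane → ℝ × Plane → ℝ} {y₀ d d' : Plane}
  {e₁ e₂ κ₁ κ₂ k₁ k₂ : ℝ}

/-- The jets of the sum of two factors. -/
theorem first_variation (H₁ : FactorJets q₁ a₁ y₀ d d' e₁ κ₁ k₁)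
    (H₂ : FactorJets q₂ a₂ y₀ d' d e₂ κ₂ k₂)
    (hG : ∀ v w, G v w = fun z ↦ q₁ v w z + q₂ v w z)
    (har : ∀ v w, ar v w = fun z ↦ a₁ v w z + a₂ v w z) :
    (e₁ * dirDeriv timeDir (G (0, d) (0, d)) (0, y₀)
        + e₂ * dirDeriv timeDir (G (0, d') (0, d')) (0, y₀)) / 2
      = e₁ * dirDeriv (0, d) (G timeDir (0, d)) (0, y₀)
        + e₂ * dirDeriv (0, d') (G timeDir (0, d')) (0, y₀)
        + k₁ * e₁ * ar timeDir (0, d) (0, y₀) + k₂ * e₂ * ar timeDir (0, d') (0, y₀) := by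
  have dq₁ := fun v w ↦ differentiableAt_of_smooth (H₁.smooth_q v w)
  have dq₂ := fun v w ↦ differentiableAt_of_smooth (H₂.smooth_q v w)
  simp only [hG, har]
  rw [dirDeriv_add (dq₁ _ _) (dq₂ _ _), dirDeriv_add (dq₁ _ _) (dq₂ _ _),
    dirDeriv_add (dq₁ _ _) (dq₂ _ _), dirDeriv_add (dq₁ _ _) (dq₂ _ _),
    H₁.deriv_main, H₂.deriv_main, H₁.deriv_null.self_of_nhds, H₂.deriv_null.self_of_nhds,
    H₁.ar_time.self_of_nhds, H₂.ar_time.self_of_nhds,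
    dirDeriv_slice_const (dq₁ _ _) H₁.q_time, dirDeriv_slice_const (dq₂ _ _) H₂.q_time]
  ring

/-- The left side is the second time derivative of the area density found in `areaDensity_jets`. The
Jacobi identities of both factors replace its second derivatives by squares, curvature terms and
derivatives along the surface. The area form on the velocity is `du`, so its mixed derivatives are
symmetric. The products then complete to the squares of the Laplacian `e₁ u_dd + e₂ u_d'd'` and of
`k₁ e₁ u_d - k₂ e₂ u_d'`. The rest is the divergence of the flux together with the derivatives of
`secondPotential` weighted by `k₁`, `k₂`. The two flux components are not symmetric in the factors;
only the divergence enters here. -/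
theorem second_variation (he₁ : e₁ * e₁ = 1) (he₂ : e₂ * e₂ = 1)
    (H₁ : FactorJets q₁ a₁ y₀ d d' e₁ κ₁ k₁)
    (H₂ : FactorJets q₂ a₂ y₀ d' d e₂ κ₂ k₂)
    (hG : ∀ v w, G v w = fun z ↦ q₁ v w z + q₂ v w z)
    (har : ∀ v w, ar v w = fun z ↦ a₁ v w z + a₂ v w z)
    (hsym : ∀ v w, q₂ v w = q₂ w v)
    {u : ℝ × Plane → ℝ} (hu : ContDiffAt ℝ ∞ u (0, y₀))
    (hud : ∀ᶠ z in 𝓝 ((0 : ℝ), y₀), ar timeDir (0, d) z = dirDeriv (0, d) u z)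
    (hud' : ∀ᶠ z in 𝓝 ((0 : ℝ), y₀), ar timeDir (0, d') z = dirDeriv (0, d') u z) :
    (e₁ * dirDeriv timeDir (dirDeriv timeDir (G (0, d) (0, d))) (0, y₀)
          + e₂ * dirDeriv timeDir (dirDeriv timeDir (G (0, d') (0, d'))) (0, y₀)) / 2
        + e₁ * e₂ * (dirDeriv timeDir (G (0, d) (0, d)) (0, y₀)
            * dirDeriv timeDir (G (0, d') (0, d')) (0, y₀)
          - dirDeriv timeDir (G (0, d) (0, d')) (0, y₀) ^ 2)
        - (e₁ * dirDeriv timeDir (G (0, d) (0, d)) (0, y₀)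
          + e₂ * dirDeriv timeDir (G (0, d') (0, d')) (0, y₀)) ^ 2 / 4
      = - (e₁ * dirDeriv (0, d) (ar timeDir (0, d)) (0, y₀)
            + e₂ * dirDeriv (0, d') (ar timeDir (0, d')) (0, y₀)) ^ 2
        - (k₁ * e₁ * ar timeDir (0, d) (0, y₀) - k₂ * e₂ * ar timeDir (0, d') (0, y₀)) ^ 2
        + e₁ * κ₁ * ar timeDir (0, d) (0, y₀) ^ 2 + e₂ * κ₂ * ar timeDir (0, d') (0, y₀) ^ 2
        + dirDeriv (0, d) (fluxFst G ar d d' e₁ e₂) (0, y₀)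
        + dirDeriv (0, d') (fluxSnd G ar d d' e₁ e₂) (0, y₀)
        + k₁ * e₁ * dirDeriv (0, d) (secondPotential G ar u d d' e₁ e₂) (0, y₀)
        + k₂ * e₂ * dirDeriv (0, d') (secondPotential G ar u d d' e₁ e₂) (0, y₀) := by
  have sG : ∀ v w, ContDiffAt ℝ ∞ (G v w) (0, y₀) := fun v w ↦ by
    rw [hG]; exact (H₁.smooth_q v w).add (H₂.smooth_q v w)
  have sa : ∀ v w, ContDiffAt ℝ ∞ (ar v w) (0, y₀) := fun v w ↦ by
    rw [har]; exact (H₁.smooth_ar v w).add (H₂.smooth_ar v w)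
  have dG := fun v w ↦ differentiableAt_of_smooth (sG v w)
  have da := fun v w ↦ differentiableAt_of_smooth (sa v w)
  have ddG := fun t v w ↦ differentiableAt_of_smooth (contDiffAt_dirDeriv (sG v w) t)
  have dda := fun t v w ↦ differentiableAt_of_smooth (contDiffAt_dirDeriv (sa v w) t)
  have dq₁ := fun v w ↦ differentiableAt_of_smooth (H₁.smooth_q v w)
  have dq₂ := fun v w ↦ differentiableAt_of_smooth (H₂.smooth_q v w)
  have da₁ := fun v w ↦ differentiableAt_of_smooth (H₁.smooth_ar v w)
  have da₂ := fun v w ↦ differentiableAt_of_smooth (H₂.smooth_ar v w)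
  have ddq₁ := fun t v w ↦ differentiableAt_of_smooth (contDiffAt_dirDeriv (H₁.smooth_q v w) t)
  have ddq₂ := fun t v w ↦ differentiableAt_of_smooth (contDiffAt_dirDeriv (H₂.smooth_q v w) t)
  have du := fun v ↦ differentiableAt_of_smooth (contDiffAt_dirDeriv hu v)
  have hsl := tendsto_slice y₀
  -- values and slice derivatives
  have eX : ∀ᶠ y in 𝓝 y₀, G timeDir (0, d) (0, y) = q₁ timeDir (0, d) (0, y) := by
    filter_upwards [H₂.q_time] with y hy
    simp only [hG, hy, add_zero]
  have eX' : ∀ᶠ y in 𝓝 y₀, G timeDir (0, d') (0, y) = q₂ timeDir (0, d') (0, y) := by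
    filter_upwards [H₁.q_time] with y hy
    simp only [hG, hy, zero_add]
  have eA : ∀ᶠ y in 𝓝 y₀, ar timeDir (0, d) (0, y) = a₁ timeDir (0, d) (0, y) := by
    filter_upwards [H₂.ar_time] with y hy
    simp only [har, hy, add_zero]
  have eA' : ∀ᶠ y in 𝓝 y₀, ar timeDir (0, d') (0, y) = a₂ timeDir (0, d') (0, y) := by
    filter_upwards [H₁.ar_time] with y hy
    simp only [har, hy, zero_add]
  have X1 := fun b ↦ dirDeriv_slice_congr (dG _ _) (dq₁ _ _) eX b
  have X1' := fun b ↦ dirDeriv_slice_congr (dG _ _) (dq₂ _ _) eX' b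
  have A1 := fun b ↦ dirDeriv_slice_congr (da _ _) (da₁ _ _) eA b
  have A1' := fun b ↦ dirDeriv_slice_congr (da _ _) (da₂ _ _) eA' b
  have X2 := fun b b' ↦ dirDeriv_dirDeriv_slice_congr (sG _ _) (H₁.smooth_q _ _) eX b b'
  have X2' := fun b b' ↦ dirDeriv_dirDeriv_slice_congr (sG _ _) (H₂.smooth_q _ _) eX' b b'
  have m1 : dirDeriv timeDir (G (0, d) (0, d)) (0, y₀)
      = 2 * (dirDeriv (0, d) (q₁ timeDir (0, d)) (0, y₀) + k₁ * a₁ timeDir (0, d) (0, y₀)) := by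
    rw [hG, dirDeriv_add (dq₁ _ _) (dq₂ _ _), H₁.deriv_main, H₂.deriv_null.self_of_nhds, add_zero]
  have m2 : dirDeriv timeDir (G (0, d') (0, d')) (0, y₀)
      = 2 * (dirDeriv (0, d') (q₂ timeDir (0, d')) (0, y₀) + k₂ * a₂ timeDir (0, d') (0, y₀)) := by
    rw [hG, dirDeriv_add (dq₁ _ _) (dq₂ _ _), H₂.deriv_main, H₁.deriv_null.self_of_nhds, zero_add]
  have m3 : dirDeriv timeDir (G (0, d) (0, d')) (0, y₀)
      = dirDeriv (0, d') (q₁ timeDir (0, d)) (0, y₀)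
        + dirDeriv (0, d) (q₂ timeDir (0, d')) (0, y₀) := by
    rw [hG, dirDeriv_add (dq₁ _ _) (dq₂ _ _), H₁.deriv_mixed, hsym, H₂.deriv_mixed]
  have n1 : dirDeriv (0, d') (dirDeriv timeDir (G (0, d) (0, d))) (0, y₀)
      = 2 * (dirDeriv (0, d') (dirDeriv (0, d) (q₁ timeDir (0, d))) (0, y₀)
        + k₁ * dirDeriv (0, d') (a₁ timeDir (0, d)) (0, y₀)) := by
    rw [hG, dirDeriv_dirDeriv_add (H₁.smooth_q _ _) (H₂.smooth_q _ _), H₁.deriv_deriv_main,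
      dirDeriv_slice_const (ddq₂ _ _ _) H₂.deriv_null, add_zero]
  have n2 : dirDeriv (0, d) (dirDeriv timeDir (G (0, d') (0, d'))) (0, y₀)
      = 2 * (dirDeriv (0, d) (dirDeriv (0, d') (q₂ timeDir (0, d'))) (0, y₀)
        + k₂ * dirDeriv (0, d) (a₂ timeDir (0, d')) (0, y₀)) := by
    rw [hG, dirDeriv_dirDeriv_add (H₁.smooth_q _ _) (H₂.smooth_q _ _), H₂.deriv_deriv_main,
      dirDeriv_slice_const (ddq₁ _ _ _) H₁.deriv_null, zero_add]
  have D2 : ∀ t v w x, dirDeriv t (dirDeriv v (G w x)) (0, y₀)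
      = dirDeriv t (dirDeriv v (q₁ w x)) (0, y₀) + dirDeriv t (dirDeriv v (q₂ w x)) (0, y₀) :=
    fun t v w x ↦ by rw [hG, dirDeriv_dirDeriv_add (H₁.smooth_q _ _) (H₂.smooth_q _ _)]
  -- the potential
  have U1 : dirDeriv (0, d) (dirDeriv timeDir u) (0, y₀)
      = dirDeriv timeDir (a₁ timeDir (0, d)) (0, y₀)
        + e₂ * (a₂ timeDir (0, d') (0, y₀) * dirDeriv (0, d) (q₂ timeDir (0, d')) (0, y₀)
      - q₂ timeDir (0, d') (0, y₀) * dirDeriv (0, d) (a₂ timeDir (0, d')) (0, y₀)) := by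
    rw [dirDeriv_comm hu, ← dirDeriv_congr hud, har, dirDeriv_add (da₁ _ _) (da₂ _ _), H₂.deriv_ar]
  have U2 : dirDeriv (0, d') (dirDeriv timeDir u) (0, y₀)
      = dirDeriv timeDir (a₂ timeDir (0, d')) (0, y₀)
        + e₁ * (a₁ timeDir (0, d) (0, y₀) * dirDeriv (0, d') (q₁ timeDir (0, d)) (0, y₀)
      - q₁ timeDir (0, d) (0, y₀) * dirDeriv (0, d') (a₁ timeDir (0, d)) (0, y₀)) := by
    rw [dirDeriv_comm hu, ← dirDeriv_congr hud', har, dirDeriv_add (da₁ _ _) (da₂ _ _), H₁.deriv_ar]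
    ring
  -- This is the symmetry of the mixed second derivatives of `u`; at time `0` each derivative of `u`
  -- sees one factor only.
  have U3 : dirDeriv (0, d) (a₂ timeDir (0, d')) (0, y₀)
      = dirDeriv (0, d') (a₁ timeDir (0, d)) (0, y₀) := by
    rw [← A1', ← A1, dirDeriv_congr hud, dirDeriv_congr hud', dirDeriv_comm hu]
  -- divergences
  have V1 : ∀ b, dirDeriv (0, b) (secondPotential G ar u d d' e₁ e₂) (0, y₀) = _ := fun b ↦ by
    unfold secondPotential
    rw [dirDeriv_sub (du _) ((((dG _ _).fun_mul (da _ _)).const_mul _).fun_add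
        (((dG _ _).fun_mul (da _ _)).const_mul _)),
      dirDeriv_add (((dG _ _).fun_mul (da _ _)).const_mul _)
        (((dG _ _).fun_mul (da _ _)).const_mul _),
      dirDeriv_const_mul _ ((dG _ _).fun_mul (da _ _)),
      dirDeriv_const_mul _ ((dG _ _).fun_mul (da _ _)), dirDeriv_mul (dG _ _) (da _ _),
      dirDeriv_mul (dG _ _) (da _ _)]
  have Y1 : ∀ b, dirDeriv (0, b) (fluxFst G ar d d' e₁ e₂) (0, y₀) = _ := fun b ↦ by
    unfold fluxFst
    have t1 := ((ddG timeDir timeDir (0, d)).fun_sub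
      ((ddG (0, d) timeDir timeDir).const_mul (1 / 2))).const_mul e₁
    have t2 := ((da timeDir (0, d)).fun_mul (dda (0, d') timeDir (0, d'))).const_mul (2 * e₁ * e₂)
    have t3 := ((dG timeDir (0, d)).fun_mul (ddG timeDir (0, d') (0, d'))).const_mul (e₁ * e₂)
    rw [dirDeriv_add (t1.fun_add t2) t3, dirDeriv_add t1 t2,
      dirDeriv_const_mul _ ((ddG _ _ _).fun_sub ((ddG _ _ _).const_mul _)),
      dirDeriv_sub (ddG _ _ _) ((ddG _ _ _).const_mul _), dirDeriv_const_mul _ (ddG _ _ _),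
      dirDeriv_const_mul _ ((da _ _).fun_mul (dda _ _ _)), dirDeriv_mul (da _ _) (dda _ _ _),
      dirDeriv_const_mul _ ((dG _ _).fun_mul (ddG _ _ _)), dirDeriv_mul (dG _ _) (ddG _ _ _)]
  have Y2 : ∀ b, dirDeriv (0, b) (fluxSnd G ar d d' e₁ e₂) (0, y₀) = _ := fun b ↦ by
    unfold fluxSnd
    have t1 := ((ddG timeDir timeDir (0, d')).fun_sub
      ((ddG (0, d') timeDir timeDir).const_mul (1 / 2))).const_mul e₂
    have t2 := ((da timeDir (0, d)).fun_mul (dda (0, d) timeDir (0, d'))).const_mul (2 * e₁ * e₂)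
    have t3 := ((dG timeDir (0, d')).fun_mul (ddG timeDir (0, d) (0, d))).const_mul (e₁ * e₂)
    have t5 := differentiableAt_of_smooth
      (contDiffAt_dirDeriv ((sG timeDir (0, d)).mul (sG timeDir (0, d'))) (0, d))
    have t4 := t5.const_mul (2 * e₁ * e₂)
    rw [dirDeriv_sub ((t1.fun_sub t2).fun_add t3) t4, dirDeriv_add (t1.fun_sub t2) t3,
      dirDeriv_sub t1 t2,
      dirDeriv_const_mul _ ((ddG _ _ _).fun_sub ((ddG _ _ _).const_mul _)),
      dirDeriv_sub (ddG _ _ _) ((ddG _ _ _).const_mul _), dirDeriv_const_mul _ (ddG _ _ _),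
      dirDeriv_const_mul _ ((da _ _).fun_mul (dda _ _ _)), dirDeriv_mul (da _ _) (dda _ _ _),
      dirDeriv_const_mul _ ((dG _ _).fun_mul (ddG _ _ _)), dirDeriv_mul (dG _ _) (ddG _ _ _),
      dirDeriv_const_mul _ t5, dirDeriv_dirDeriv_mul (sG _ _) (sG _ _)]
  rw [V1, V1, Y1, Y2, dirDeriv_comm (sa timeDir (0, d')) (0, d') (0, d)]
  simp only [X1, X1', A1, A1', X2, X2', eX.self_of_nhds, eX'.self_of_nhds, eA.self_of_nhds,
    eA'.self_of_nhds, m1, m2, m3, n1, n2, U1, U2, U3,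
    D2 timeDir timeDir, D2 (0, d) timeDir timeDir, D2 (0, d') timeDir timeDir,
    D2 (0, d) (0, d) timeDir timeDir, D2 (0, d') (0, d') timeDir timeDir]
  have J1 := H₁.jacobi_main
  have J1' := H₁.jacobi_null
  have J2 := H₂.jacobi_main
  have J2' := H₂.jacobi_null
  rw [U3] at J2'
  rw [dirDeriv_comm (H₂.smooth_q timeDir (0, d')) (0, d') (0, d)]
  -- In general the combination is `e₁ (J1 + J2') + e₂ (J1' + J2)`: each Jacobi identity is weighted
  -- with the sign of the direction it belongs to.
  rcases mul_self_eq_one_iff.mp he₁ with rfl | rfl <;>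
    rcases mul_self_eq_one_iff.mp he₂ with rfl | rfl
  · linear_combination J1 + J1' + J2 + J2'
  · linear_combination J1 - J1' - J2 + J2'
  · linear_combination -J1 + J1' + J2 - J2'
  · linear_combination -J1 - J1' - J2 - J2'

end Variation

/-! ### Differentiation of integrals over compact sets -/

section ParametricIntegral

open Filter Topology MeasureTheory

/-- This is the tube lemma. It supplies the open set of parameters on which the integrals below are
differentiated. -/
theorem isOpen_setOf_forall_mem_compact {E Y : Type*} [TopologicalSpace E] [TopologicalSpace Y]
    {U : Set (E × Y)} (hU : IsOpen U) {C : Set Y}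
    (hC : IsCompact C) : IsOpen {x : E | ∀ y ∈ C, (x, y) ∈ U} := by
  rw [isOpen_iff_eventually]
  intro x hx
  exact hC.eventually_forall_of_forall_eventually fun y hy ↦ hU.mem_nhds (hx y hy)

theorem integrableOn_slice {E Y F : Type*} [TopologicalSpace E] [NormedAddCommGroup Y]
    [MeasurableSpace Y] [BorelSpace Y] {μ : Measure Y} [IsFiniteMeasureOnCompacts μ]
    [NormedAddCommGroup F] {D : E × Y → F} {U : Set (E × Y)}
    (hD : ContinuousOn D U) {C : Set Y} (hC : IsCompact C) {x : E} (hx : ∀ y ∈ C, (x, y) ∈ U) :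
    IntegrableOn (fun y ↦ D (x, y)) C μ :=
  (hD.comp (by fun_prop) hx).integrableOn_compact hC

variable {E Y : Type} [NormedAddCommGroup E] [NormedSpace ℝ E]
  [NormedAddCommGroup Y] [NormedSpace ℝ Y] [MeasurableSpace Y] [BorelSpace Y]
  {μ : Measure Y} [IsFiniteMeasureOnCompacts μ]

theorem hasFDerivAt_setIntegral {F : Type} [NormedAddCommGroup F] [NormedSpace ℝ F]
    [CompleteSpace F] {D : E × Y → F} {U : Set (E × Y)} (hU : IsOpen U) (hD : ContDiffOn ℝ ∞ D U)
    {C : Set Y} (hC : IsCompact C) {x : E} (hx : ∀ y ∈ C, (x, y) ∈ U) :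
    HasFDerivAt (fun x ↦ ∫ y in C, D (x, y) ∂μ)
      (∫ y in C, (fderiv ℝ D (x, y)).comp (ContinuousLinearMap.inl ℝ E Y) ∂μ) x := by
  set D' : E × Y → E →L[ℝ] F := fun z ↦ (fderiv ℝ D z).comp (ContinuousLinearMap.inl ℝ E Y)
  have hD' : ContinuousOn D' U :=
    (hD.continuousOn_fderiv_of_isOpen hU (by simp)).clm_comp continuousOn_const
  obtain ⟨M, hM⟩ := hC.exists_bound_of_continuousOn (hD'.comp (by fun_prop) hx :
    ContinuousOn (fun y ↦ D' (x, y)) C)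
  -- The derivative is bounded by `M` over `C` at the parameter `x`. The strict bound `M + 1` is an
  -- open condition, so by compactness of `C` it persists for nearby parameters, and a constant
  -- dominates.
  have hW : IsOpen (U ∩ (fun z ↦ ‖D' z‖) ⁻¹' Iio (M + 1)) :=
    hD'.norm.isOpen_inter_preimage hU isOpen_Iio
  have hN := (isOpen_setOf_forall_mem_compact hW hC).mem_nhds (x := x)
    (fun y hy ↦ ⟨hx y hy, (hM y hy).trans_lt (lt_add_one M)⟩)
  obtain ⟨r, hr, hball⟩ := Metric.mem_nhds_iff.mp hN
  refine hasFDerivAt_integral_of_dominated_of_fderiv_le (F' := fun x y ↦ D' (x, y))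
    (bound := fun _ ↦ M + 1) (Metric.ball_mem_nhds x hr) ?_
    (integrableOn_slice hD.continuousOn hC hx)
    (integrableOn_slice hD' hC hx).aestronglyMeasurable ?_ ?_ ?_
  · filter_upwards [Metric.ball_mem_nhds x hr] with x' hx'
    exact (integrableOn_slice hD.continuousOn hC
      fun y hy ↦ (hball hx' y hy).1).aestronglyMeasurable
  · exact ae_restrict_of_forall_mem hC.measurableSet fun y hy x' hx' ↦ (hball hx' y hy).2.le
  · exact (integrableOn_const hC.measure_lt_top.ne : IntegrableOn (fun _ ↦ M + 1) C μ)
  · refine ae_restrict_of_forall_mem hC.measurableSet fun y hy x' hx' ↦ ?_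
    have h1 := ((hD.contDiffAt (hU.mem_nhds (hball hx' y hy).1)).differentiableAt
      (by simp)).hasFDerivAt
    exact h1.comp x' (hasFDerivAt_prodMk_left x' y)

/-- Each differentiation produces an integral of the same kind with values in `E →L[ℝ] F` instead of
`F`. The value space is therefore quantified inside the induction. -/
theorem contDiffOn_setIntegral {C : Set Y} (hC : IsCompact C) {U : Set (E × Y)} (hU : IsOpen U)
    (n : ℕ) : ∀ {F : Type} [NormedAddCommGroup F] [NormedSpace ℝ F] [CompleteSpace F] {D : E × Y → F},
    ContDiffOn ℝ ∞ D U →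
    ContDiffOn ℝ n (fun x ↦ ∫ y in C, D (x, y) ∂μ) {x : E | ∀ y ∈ C, (x, y) ∈ U} := by
  induction n with
  | zero =>
    intro F _ _ _ D hD
    exact contDiffOn_zero.mpr fun x hx ↦
      (hasFDerivAt_setIntegral hU hD hC hx).continuousAt.continuousWithinAt
  | succ n ih =>
    intro F _ _ _ D hD
    have hT := isOpen_setOf_forall_mem_compact hU hC
    rw [Nat.cast_succ, contDiffOn_succ_iff_fderiv_of_isOpen hT]
    refine ⟨fun x hx ↦ (hasFDerivAt_setIntegral hU hD hC hx).differentiableAt.differentiableWithinAt,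
      by simp, ?_⟩
    have h1 : ContDiffOn ℝ ∞
        (fun z ↦ (fderiv ℝ D z).comp (ContinuousLinearMap.inl ℝ E Y)) U :=
      (hD.fderiv_of_isOpen hU (by simp)).clm_comp contDiffOn_const
    exact (ih h1).congr fun x hx ↦ (hasFDerivAt_setIntegral hU hD hC hx).fderiv

theorem hasDerivAt_setIntegral {D : ℝ × Plane → ℝ} {U : Set (ℝ × Plane)} (hU : IsOpen U)
    (hD : ContDiffOn ℝ ∞ D U) {C : Set Plane} (hC : IsCompact C) {τ : ℝ}
    (hτ : ∀ y ∈ C, (τ, y) ∈ U) :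
    HasDerivAt (fun τ ↦ ∫ y in C, D (τ, y)) (∫ y in C, dirDeriv timeDir D (τ, y)) τ := by
  have h := (hasFDerivAt_setIntegral (μ := volume) hU hD hC hτ).hasDerivAt
  have h1 : ContDiffOn ℝ ∞
      (fun z ↦ (fderiv ℝ D z).comp (ContinuousLinearMap.inl ℝ ℝ Plane)) U :=
    (hD.fderiv_of_isOpen hU (by simp)).clm_comp contDiffOn_const
  rw [ContinuousLinearMap.integral_apply (integrableOn_slice h1.continuousOn hC hτ)] at h
  exact h

theorem contDiffOn_dirDeriv {D : E → ℝ} {U : Set E} (hU : IsOpen U)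
    (hD : ContDiffOn ℝ ∞ D U) (v : E) : ContDiffOn ℝ ∞ (dirDeriv v D) U :=
  (hD.fderiv_of_isOpen hU (by simp)).clm_apply contDiffOn_const

theorem contDiffAt_setIntegral_and_iteratedDeriv_two {D : ℝ × Plane → ℝ} {U : Set (ℝ × Plane)}
    (hU : IsOpen U) (hD : ContDiffOn ℝ ∞ D U) {C : Set Plane} (hC : IsCompact C) {τ : ℝ}
    (hτ : ∀ y ∈ C, (τ, y) ∈ U) :
    ContDiffAt ℝ 2 (fun τ ↦ ∫ y in C, D (τ, y)) τ ∧
    iteratedDeriv 2 (fun τ ↦ ∫ y in C, D (τ, y)) τ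
      = ∫ y in C, dirDeriv timeDir (dirDeriv timeDir D) (τ, y) := by
  have hT := (isOpen_setOf_forall_mem_compact hU hC).mem_nhds hτ
  refine ⟨(contDiffOn_setIntegral hC hU 2 hD).contDiffAt hT, ?_⟩
  rw [iteratedDeriv_succ, iteratedDeriv_one]
  have h1 : deriv (fun τ ↦ ∫ y in C, D (τ, y)) =ᶠ[𝓝 τ]
      fun τ ↦ ∫ y in C, dirDeriv timeDir D (τ, y) := by
    filter_upwards [hT] with τ' h' using (hasDerivAt_setIntegral hU hD hC h').deriv
  rw [h1.deriv_eq, (hasDerivAt_setIntegral hU (contDiffOn_dirDeriv hU hD timeDir) hC hτ).deriv]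

end ParametricIntegral

/-! ### Maps of the surface read in charts -/

section Charts

open Filter Topology

/-- The first coordinate vector. -/
def fstDir : Plane := EuclideanSpace.single 0 1

/-- The second coordinate vector. -/
def sndDir : Plane := EuclideanSpace.single 1 1

theorem plane_eq_smul_add (v : Plane) : v = v 0 • fstDir + v 1 • sndDir := by
  ext i
  fin_cases i <;> simp [fstDir, sndDir]

/-- A chart of class `C^∞`. -/
structure IsSmoothChart {S : Type*} [TopologicalSpace S] [ChartedSpace Plane S]
    (e : OpenPartialHomeomorph S Plane) : Prop where
  contMDiffOn : ContMDiffOn (𝓡 2) (𝓡 2) ∞ e e.source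
  contMDiffOn_symm : ContMDiffOn (𝓡 2) (𝓡 2) ∞ e.symm e.target

section General

variable {M₁ M₂ E E' : Type*} [NormedAddCommGroup E] [NormedSpace ℝ E]
  [NormedAddCommGroup E'] [NormedSpace ℝ E']
  [TopologicalSpace M₁] [ChartedSpace Plane M₁] [IsManifold (𝓡 2) ∞ M₁]
  [TopologicalSpace M₂] [ChartedSpace Plane M₂] [IsManifold (𝓡 2) ∞ M₂]

/-- Smoothness of both components of a map into a product. -/
def SmoothPairAt (f : E → M₁ × M₂) (z : E) : Prop :=
  ContMDiffAt 𝓘(ℝ, E) (𝓡 2) ∞ (fun z ↦ (f z).1) z ∧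
    ContMDiffAt 𝓘(ℝ, E) (𝓡 2) ∞ (fun z ↦ (f z).2) z

/-- The pull-back of `G^ε`. -/
def pairForm (g₁ : LorentzMetric M₁) (g₂ : LorentzMetric M₂) (ε : ℝ) (f : E → M₁ × M₂)
    (v w z : E) : ℝ :=
  1 * pullForm g₁ (fun z ↦ (f z).1) v w z + ε * pullForm g₂ (fun z ↦ (f z).2) v w z

/-- The pull-back of `Ω^ε`. -/
def pairArea {g₁ : LorentzMetric M₁} {g₂ : LorentzMetric M₂} (j₁ : ParacomplexStructure g₁)
    (j₂ : ParacomplexStructure g₂) (ε : ℝ) (f : E → M₁ × M₂) (v w z : E) : ℝ :=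
  1 * pullArea j₁ (fun z ↦ (f z).1) v w z + ε * pullArea j₂ (fun z ↦ (f z).2) v w z

variable {g₁ : LorentzMetric M₁} {g₂ : LorentzMetric M₂} {j₁ : ParacomplexStructure g₁}
  {j₂ : ParacomplexStructure g₂} {ε : ℝ}

theorem SmoothPairAt.comp {f : E' → M₁ × M₂} {h : E → E'} {z : E} (hf : SmoothPairAt f (h z))
    (hh : ContDiffAt ℝ ∞ h z) : SmoothPairAt (fun z ↦ f (h z)) z :=
  ⟨ContMDiffAt.comp (I' := 𝓘(ℝ, E')) (g := fun z ↦ (f z).1) (f := h) z hf.1 hh.contMDiffAt,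
    ContMDiffAt.comp (I' := 𝓘(ℝ, E')) (g := fun z ↦ (f z).2) (f := h) z hf.2 hh.contMDiffAt⟩

theorem SmoothPairAt.mdifferentiableAt {f : E → M₁ × M₂} {z : E} (hf : SmoothPairAt f z) :
    MDifferentiableAt 𝓘(ℝ, E) (𝓡 2) (fun z ↦ (f z).1) z ∧
    MDifferentiableAt 𝓘(ℝ, E) (𝓡 2) (fun z ↦ (f z).2) z :=
  ⟨hf.1.mdifferentiableAt (by simp), hf.2.mdifferentiableAt (by simp)⟩

theorem contDiffAt_pairForm {f : E → M₁ × M₂} {z : E} (hf : SmoothPairAt f z) (v w : E) :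
    ContDiffAt ℝ ∞ (pairForm g₁ g₂ ε f v w) z :=
  (contDiffAt_const.mul (contDiffAt_pullForm g₁ hf.1 v w)).add
    (contDiffAt_const.mul (contDiffAt_pullForm g₂ hf.2 v w))

theorem contDiffAt_pairArea {f : E → M₁ × M₂} {z : E} (hf : SmoothPairAt f z) (v w : E) :
    ContDiffAt ℝ ∞ (pairArea j₁ j₂ ε f v w) z :=
  (contDiffAt_const.mul (contDiffAt_pullArea j₁ hf.1 v w)).add
    (contDiffAt_const.mul (contDiffAt_pullArea j₂ hf.2 v w))

theorem pullForm_symm {M : Type*} [TopologicalSpace M] [ChartedSpace Plane M]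
    [IsManifold (𝓡 2) ∞ M] (g : LorentzMetric M) (f : E → M) (v w z : E) :
    pullForm g f v w z = pullForm g f w v z :=
  g.symm _ _ _

theorem pairForm_symm (f : E → M₁ × M₂) (v w z : E) :
    pairForm g₁ g₂ ε f v w z = pairForm g₁ g₂ ε f w v z := by
  rw [pairForm, pairForm, pullForm_symm g₁, pullForm_symm g₂]

theorem pairForm_linear (f : E → M₁ × M₂) (z : E) :
    ∃ B : E →ₗ[ℝ] E →ₗ[ℝ] ℝ, ∀ v w, pairForm g₁ g₂ ε f v w z = B v w := by
  obtain ⟨B₁, h₁⟩ := pullForm_linear g₁ (fun z ↦ (f z).1) z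
  obtain ⟨B₂, h₂⟩ := pullForm_linear g₂ (fun z ↦ (f z).2) z
  exact ⟨(1 : ℝ) • B₁ + ε • B₂, fun v w ↦ by simp [pairForm, h₁, h₂]⟩

theorem pairArea_linear (f : E → M₁ × M₂) (z : E) :
    ∃ B : E →ₗ[ℝ] E →ₗ[ℝ] ℝ, ∀ v w, pairArea j₁ j₂ ε f v w z = B v w := by
  obtain ⟨B₁, h₁⟩ := pullArea_linear j₁ (fun z ↦ (f z).1) z
  obtain ⟨B₂, h₂⟩ := pullArea_linear j₂ (fun z ↦ (f z).2) z
  exact ⟨(1 : ℝ) • B₁ + ε • B₂, fun v w ↦ by simp [pairArea, h₁, h₂]⟩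

theorem pullArea_skew {M : Type*} [TopologicalSpace M] [ChartedSpace Plane M]
    [IsManifold (𝓡 2) ∞ M] {g : LorentzMetric M} (j : ParacomplexStructure g) (f : E → M)
    (v w z : E) : pullArea j f v w z = - pullArea j f w v z :=
  j.area_skew _ _ _

theorem pairArea_skew (f : E → M₁ × M₂) (v w z : E) :
    pairArea j₁ j₂ ε f v w z = - pairArea j₁ j₂ ε f w v z := by
  rw [pairArea, pairArea, pullArea_skew j₁, pullArea_skew j₂]
  ring

theorem pairForm_comp {f : E' → M₁ × M₂} {h : E → E'} {z : E} (hf : SmoothPairAt f (h z))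
    (hh : DifferentiableAt ℝ h z) (v w : E) : pairForm g₁ g₂ ε (fun z ↦ f (h z)) v w z
      = pairForm g₁ g₂ ε f (fderiv ℝ h z v) (fderiv ℝ h z w) (h z) := by
  simp only [pairForm]
  rw [pullForm_comp g₁ (f := fun z ↦ (f z).1) hf.mdifferentiableAt.1 hh,
    pullForm_comp g₂ (f := fun z ↦ (f z).2) hf.mdifferentiableAt.2 hh]

theorem pairArea_comp {f : E' → M₁ × M₂} {h : E → E'} {z : E} (hf : SmoothPairAt f (h z))
    (hh : DifferentiableAt ℝ h z) (v w : E) : pairArea j₁ j₂ ε (fun z ↦ f (h z)) v w z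
      = pairArea j₁ j₂ ε f (fderiv ℝ h z v) (fderiv ℝ h z w) (h z) := by
  simp only [pairArea]
  rw [pullArea_comp j₁ (f := fun z ↦ (f z).1) hf.mdifferentiableAt.1 hh,
    pullArea_comp j₂ (f := fun z ↦ (f z).2) hf.mdifferentiableAt.2 hh]

theorem pairForm_congr {f f' : E → M₁ × M₂} {z : E} (h : f =ᶠ[𝓝 z] f') (v w : E) :
    pairForm g₁ g₂ ε f v w z = pairForm g₁ g₂ ε f' v w z := by
  have h1 : (fun z ↦ (f z).1) =ᶠ[𝓝 z] fun z ↦ (f' z).1 := h.fun_comp Prod.fst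
  have h2 : (fun z ↦ (f z).2) =ᶠ[𝓝 z] fun z ↦ (f' z).2 := h.fun_comp Prod.snd
  rw [pairForm, pairForm, pullForm_congr g₁ h1, pullForm_congr g₂ h2]

theorem pairArea_congr {f f' : E → M₁ × M₂} {z : E} (h : f =ᶠ[𝓝 z] f') (v w : E) :
    pairArea j₁ j₂ ε f v w z = pairArea j₁ j₂ ε f' v w z := by
  have h1 : (fun z ↦ (f z).1) =ᶠ[𝓝 z] fun z ↦ (f' z).1 := h.fun_comp Prod.fst
  have h2 : (fun z ↦ (f z).2) =ᶠ[𝓝 z] fun z ↦ (f' z).2 := h.fun_comp Prod.snd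
  rw [pairArea, pairArea, pullArea_congr j₁ h1, pullArea_congr j₂ h2]

theorem fderiv_prodMk_right (τ : ℝ) (y v : Plane) :
    fderiv ℝ (fun y : Plane ↦ (τ, y)) y v = (0, v) := by
  rw [(hasFDerivAt_prodMk_right τ y).fderiv]
  rfl

theorem pairForm_slice {f : ℝ × Plane → M₁ × M₂} {τ : ℝ} {y : Plane} (hf : SmoothPairAt f (τ, y))
    (v w : Plane) : pairForm g₁ g₂ ε (fun y ↦ f (τ, y)) v w y
      = pairForm g₁ g₂ ε f (0, v) (0, w) (τ, y) := by
  rw [pairForm_comp (h := fun y : Plane ↦ (τ, y)) hf (by fun_prop), fderiv_prodMk_right,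
    fderiv_prodMk_right]

theorem pairArea_slice {f : ℝ × Plane → M₁ × M₂} {τ : ℝ} {y : Plane} (hf : SmoothPairAt f (τ, y))
    (v w : Plane) : pairArea j₁ j₂ ε (fun y ↦ f (τ, y)) v w y
      = pairArea j₁ j₂ ε f (0, v) (0, w) (τ, y) := by
  rw [pairArea_comp (h := fun y : Plane ↦ (τ, y)) hf (by fun_prop), fderiv_prodMk_right,
    fderiv_prodMk_right]

end General

section Surface

variable {M₁ M₂ S : Type*}
  [TopologicalSpace M₁] [ChartedSpace Plane M₁] [IsManifold (𝓡 2) ∞ M₁]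
  [TopologicalSpace M₂] [ChartedSpace Plane M₂] [IsManifold (𝓡 2) ∞ M₂]
  [TopologicalSpace S] [ChartedSpace Plane S]
  {g₁ : LorentzMetric M₁} {g₂ : LorentzMetric M₂} {j₁ : ParacomplexStructure g₁}
  {j₂ : ParacomplexStructure g₂} {ε : ℝ}

theorem IsSmoothChart.chartAt [IsManifold (𝓡 2) ∞ S] (p : S) : IsSmoothChart (chartAt Plane p) :=
  ⟨contMDiffOn_chart, contMDiffOn_chart_symm⟩

theorem IsSmoothChart.contMDiffAt {e : OpenPartialHomeomorph S Plane} (he : IsSmoothChart e) {p : S}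
    (hp : p ∈ e.source) : ContMDiffAt (𝓡 2) (𝓡 2) ∞ e p :=
  (he.contMDiffOn p hp).contMDiffAt (e.open_source.mem_nhds hp)

theorem IsSmoothChart.contMDiffAt_symm {e : OpenPartialHomeomorph S Plane} (he : IsSmoothChart e)
    {y : Plane} (hy : y ∈ e.target) : ContMDiffAt (𝓡 2) (𝓡 2) ∞ e.symm y :=
  (he.contMDiffOn_symm y hy).contMDiffAt (e.open_target.mem_nhds hy)

theorem IsSmoothChart.contDiffAt_transition {e e' : OpenPartialHomeomorph S Plane}
    (he : IsSmoothChart e) (he' : IsSmoothChart e') {y : Plane} (hy : y ∈ e.target)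
    (hy' : e.symm y ∈ e'.source) : ContDiffAt ℝ ∞ (fun y ↦ e' (e.symm y)) y := by
  rw [← contMDiffAt_iff_contDiffAt]
  exact (he'.contMDiffAt hy').comp y (he.contMDiffAt_symm hy)

/-- A family of maps in a chart. -/
def inChart (F : ℝ → S → M₁ × M₂) (e : OpenPartialHomeomorph S Plane) (z : ℝ × Plane) : M₁ × M₂ :=
  F z.1 (e.symm z.2)

theorem mfderiv_comp_symm {M : Type*} [TopologicalSpace M] [ChartedSpace Plane M]
    {e : OpenPartialHomeomorph S Plane} (he : IsSmoothChart e)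
    {f : S → M} {y : Plane} (hy : y ∈ e.target) (hf : MDifferentiableAt (𝓡 2) (𝓡 2) f (e.symm y))
    (v : Plane) : mfderiv (𝓡 2) (𝓡 2) (fun y ↦ f (e.symm y)) y v
      = mfderiv (𝓡 2) (𝓡 2) f (e.symm y) (mfderiv (𝓡 2) (𝓡 2) e.symm y v) := by
  have := mfderiv_comp y (I' := 𝓡 2) hf ((he.contMDiffAt_symm hy).mdifferentiableAt (by simp))
  exact congrArg (fun L ↦ L v) this

theorem inducedMetric_symm {e : OpenPartialHomeomorph S Plane} (he : IsSmoothChart e)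
    {f : S → M₁ × M₂} {y : Plane} (hy : y ∈ e.target)
    (hf₁ : MDifferentiableAt (𝓡 2) (𝓡 2) (fun p ↦ (f p).1) (e.symm y))
    (hf₂ : MDifferentiableAt (𝓡 2) (𝓡 2) (fun p ↦ (f p).2) (e.symm y)) (v w : Plane) :
    inducedMetric g₁ g₂ ε f (e.symm y) (mfderiv (𝓡 2) (𝓡 2) e.symm y v)
      (mfderiv (𝓡 2) (𝓡 2) e.symm y w) = pairForm g₁ g₂ ε (fun y ↦ f (e.symm y)) v w y := by
  simp only [inducedMetric, prodMetric, pairDeriv, pairForm, pullForm, one_mul]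
  rw [mfderiv_comp_symm he hy hf₁, mfderiv_comp_symm he hy hf₁, mfderiv_comp_symm he hy hf₂,
    mfderiv_comp_symm he hy hf₂]

theorem prodSymplectic_symm {e : OpenPartialHomeomorph S Plane} (he : IsSmoothChart e)
    {f : S → M₁ × M₂} {y : Plane} (hy : y ∈ e.target)
    (hf₁ : MDifferentiableAt (𝓡 2) (𝓡 2) (fun p ↦ (f p).1) (e.symm y))
    (hf₂ : MDifferentiableAt (𝓡 2) (𝓡 2) (fun p ↦ (f p).2) (e.symm y)) (v w : Plane) :
    prodSymplectic j₁ j₂ ε (f (e.symm y)) (pairDeriv f (e.symm y) (mfderiv (𝓡 2) (𝓡 2) e.symm y v))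
      (pairDeriv f (e.symm y) (mfderiv (𝓡 2) (𝓡 2) e.symm y w))
      = pairArea j₁ j₂ ε (fun y ↦ f (e.symm y)) v w y := by
  simp only [prodSymplectic, prodEndo, prodMetric, pairDeriv, pairArea, pullArea, one_mul]
  rw [mfderiv_comp_symm he hy hf₁, mfderiv_comp_symm he hy hf₁, mfderiv_comp_symm he hy hf₂,
    mfderiv_comp_symm he hy hf₂]

/-- A family read in a chart is a single map on `ℝ × Plane`. The velocity is its derivative in the
direction `timeDir`, so velocity and differential enter one pulled-back form. -/
theorem prodSymplectic_velocity_symm {e : OpenPartialHomeomorph S Plane} (he : IsSmoothChart e)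
    {F : ℝ → S → M₁ × M₂} {τ : ℝ} {y : Plane} (hy : y ∈ e.target)
    (hf₁ : MDifferentiableAt (𝓡 2) (𝓡 2) (fun p ↦ (F τ p).1) (e.symm y))
    (hf₂ : MDifferentiableAt (𝓡 2) (𝓡 2) (fun p ↦ (F τ p).2) (e.symm y))
    (hf : SmoothPairAt (inChart F e) (τ, y)) (v : Plane) :
    prodSymplectic j₁ j₂ ε (F τ (e.symm y)) (pairVelocity (fun r ↦ F r (e.symm y)) τ)
      (pairDeriv (F τ) (e.symm y) (mfderiv (𝓡 2) (𝓡 2) e.symm y v))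
      = pairArea j₁ j₂ ε (inChart F e) timeDir (0, v) (τ, y) := by
  simp only [prodSymplectic, prodEndo, prodMetric, pairDeriv, pairArea, pullArea, one_mul,
    pairVelocity]
  have hh : DifferentiableAt ℝ (fun r : ℝ ↦ (r, y)) τ := by fun_prop
  have hh' : DifferentiableAt ℝ (fun y : Plane ↦ (τ, y)) y := by fun_prop
  have e0 : fderiv ℝ (fun r : ℝ ↦ (r, y)) τ 1 = timeDir := by
    rw [(hasFDerivAt_prodMk_left τ y).fderiv]
    rfl
  have a1 := mfderiv_comp_fderiv (f := fun z ↦ (inChart F e z).1) (h := fun r : ℝ ↦ (r, y))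
    hf.mdifferentiableAt.1 hh 1
  have a2 := mfderiv_comp_fderiv (f := fun z ↦ (inChart F e z).2) (h := fun r : ℝ ↦ (r, y))
    hf.mdifferentiableAt.2 hh 1
  have b1 := mfderiv_comp_fderiv (f := fun z ↦ (inChart F e z).1) (h := fun y : Plane ↦ (τ, y))
    hf.mdifferentiableAt.1 hh' v
  have b2 := mfderiv_comp_fderiv (f := fun z ↦ (inChart F e z).2) (h := fun y : Plane ↦ (τ, y))
    hf.mdifferentiableAt.2 hh' v
  rw [e0] at a1 a2
  rw [fderiv_prodMk_right] at b1 b2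
  rw [← a1, ← a2, ← b1, ← b2, ← mfderiv_comp_symm he hy hf₁, ← mfderiv_comp_symm he hy hf₂]
  rfl

/-- Families in two charts. -/
theorem inChart_eventuallyEq (F : ℝ → S → M₁ × M₂) {e e' : OpenPartialHomeomorph S Plane}
    {τ : ℝ} {y : Plane} (hy : y ∈ e.target) (hy' : e.symm y ∈ e'.source) :
    inChart F e =ᶠ[𝓝 (τ, y)] fun z ↦ inChart F e' (z.1, e' (e.symm z.2)) := by
  have h : ∀ᶠ z in 𝓝 (τ, y), e.symm z.2 ∈ e'.source :=
    ((e.continuousAt_symm hy).comp continuousAt_snd).eventually (e'.open_source.mem_nhds hy')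
  filter_upwards [h] with z hz
  simp only [inChart, e'.left_inv hz]

theorem hasFDerivAt_prodMap {h : Plane → Plane} {τ : ℝ} {y : Plane} (hh : DifferentiableAt ℝ h y) :
    HasFDerivAt (fun z : ℝ × Plane ↦ (z.1, h z.2))
      ((ContinuousLinearMap.id ℝ ℝ).prodMap (fderiv ℝ h y)) (τ, y) :=
  HasFDerivAt.prodMap (f := fun t : ℝ ↦ t) (τ, y) (hasFDerivAt_id τ) hh.hasFDerivAt

theorem pairForm_transition (F : ℝ → S → M₁ × M₂) {e e' : OpenPartialHomeomorph S Plane}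
    (he : IsSmoothChart e) (he' : IsSmoothChart e') {τ : ℝ} {y : Plane} (hy : y ∈ e.target)
    (hy' : e.symm y ∈ e'.source) (hF : SmoothPairAt (inChart F e') (τ, e' (e.symm y)))
    (v w : ℝ × Plane) : pairForm g₁ g₂ ε (inChart F e) v w (τ, y)
      = pairForm g₁ g₂ ε (inChart F e') (v.1, fderiv ℝ (fun y ↦ e' (e.symm y)) y v.2)
        (w.1, fderiv ℝ (fun y ↦ e' (e.symm y)) y w.2) (τ, e' (e.symm y)) := by
  have hd := hasFDerivAt_prodMap (τ := τ)
    ((he.contDiffAt_transition he' hy hy').differentiableAt (by simp))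
  rw [pairForm_congr (inChart_eventuallyEq F hy hy'), pairForm_comp
    (h := fun z : ℝ × Plane ↦ (z.1, e' (e.symm z.2))) hF hd.differentiableAt, hd.fderiv]
  rfl

theorem pairArea_transition (F : ℝ → S → M₁ × M₂) {e e' : OpenPartialHomeomorph S Plane}
    (he : IsSmoothChart e) (he' : IsSmoothChart e') {τ : ℝ} {y : Plane} (hy : y ∈ e.target)
    (hy' : e.symm y ∈ e'.source) (hF : SmoothPairAt (inChart F e') (τ, e' (e.symm y)))
    (v w : ℝ × Plane) : pairArea j₁ j₂ ε (inChart F e) v w (τ, y)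
      = pairArea j₁ j₂ ε (inChart F e') (v.1, fderiv ℝ (fun y ↦ e' (e.symm y)) y v.2)
        (w.1, fderiv ℝ (fun y ↦ e' (e.symm y)) y w.2) (τ, e' (e.symm y)) := by
  have hd := hasFDerivAt_prodMap (τ := τ)
    ((he.contDiffAt_transition he' hy hy').differentiableAt (by simp))
  rw [pairArea_congr (inChart_eventuallyEq F hy hy'), pairArea_comp
    (h := fun z : ℝ × Plane ↦ (z.1, e' (e.symm z.2))) hF hd.differentiableAt, hd.fderiv]
  rfl

/-- The Jacobian determinant of a plane map. -/
def jacobianDet (h : Plane → Plane) (y : Plane) : ℝ :=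
  fderiv ℝ h y fstDir 0 * fderiv ℝ h y sndDir 1 - fderiv ℝ h y fstDir 1 * fderiv ℝ h y sndDir 0

/-- The Gram determinant scales with the square of the Jacobian. This carries pointwise statements
from adapted charts to the charts in which the volume is computed; integrals are never transformed.
-/
theorem areaDensity_transition (F : ℝ → S → M₁ × M₂) {e e' : OpenPartialHomeomorph S Plane}
    (he : IsSmoothChart e) (he' : IsSmoothChart e') {τ : ℝ} {y : Plane} (hy : y ∈ e.target)
    (hy' : e.symm y ∈ e'.source) (hF : SmoothPairAt (inChart F e') (τ, e' (e.symm y))) :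
    areaDensity (pairForm g₁ g₂ ε (inChart F e)) fstDir sndDir (τ, y)
      = |jacobianDet (fun y ↦ e' (e.symm y)) y|
        * areaDensity (pairForm g₁ g₂ ε (inChart F e')) fstDir sndDir (τ, e' (e.symm y)) := by
  obtain ⟨B, hB⟩ := pairForm_linear (g₁ := g₁) (g₂ := g₂) (ε := ε) (inChart F e')
    (τ, e' (e.symm y))
  have hsym : ∀ v w, B v w = B w v := fun v w ↦ by rw [← hB, pairForm_symm, hB]
  simp only [areaDensity, jacobianDet, pairForm_transition F he he' hy hy' hF, hB]
  set a := fderiv ℝ (fun y ↦ e' (e.symm y)) y fstDir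
  set c := fderiv ℝ (fun y ↦ e' (e.symm y)) y sndDir
  have ha : ∀ a : Plane, ((0 : ℝ), a) = a 0 • ((0 : ℝ), fstDir) + a 1 • ((0 : ℝ), sndDir) := by
    intro a
    nth_rw 1 [plane_eq_smul_add a]
    simp
  rw [ha a, ha c]
  simp only [map_add, map_smul, LinearMap.add_apply, LinearMap.smul_apply, smul_eq_mul]
  rw [hsym (0, sndDir) (0, fstDir), ← Real.sqrt_sq_eq_abs (a 0 * c 1 - a 1 * c 0),
    ← Real.sqrt_mul (sq_nonneg _),
    ← abs_of_nonneg (sq_nonneg (a 0 * c 1 - a 1 * c 0)), ← abs_mul]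
  congr 2
  ring

end Surface

end Charts

/-! ### Derivatives of the volume -/

section VolumeVariation

open Filter Topology MeasureTheory

variable {M₁ M₂ S : Type*}
  [TopologicalSpace M₁] [ChartedSpace Plane M₁] [IsManifold (𝓡 2) ∞ M₁]
  [TopologicalSpace M₂] [ChartedSpace Plane M₂] [IsManifold (𝓡 2) ∞ M₂]
  [TopologicalSpace S] [ChartedSpace Plane S] [IsManifold (𝓡 2) ∞ S]
  {g₁ : LorentzMetric M₁} {g₂ : LorentzMetric M₂} {j₁ : ParacomplexStructure g₁}
  {j₂ : ParacomplexStructure g₂} {ε : ℝ}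

section Family

variable {Φ : S → M₁ × M₂} {F : ℝ → S → M₁ × M₂} {K : Set S} {δ : ℝ}

theorem IsHamiltonianVariation.contMDiffAt (H : IsHamiltonianVariation j₁ j₂ ε Φ F K δ)
    {τ : ℝ} (hτ : τ ∈ Ioo (-δ) δ) (p : S) :
    ContMDiffAt (𝓘(ℝ, ℝ).prod (𝓡 2)) ((𝓡 2).prod (𝓡 2)) ∞ (fun z : ℝ × S ↦ F z.1 z.2) (τ, p) :=
  (H.contMDiffOn (τ, p) ⟨hτ, trivial⟩).contMDiffAt
    ((isOpen_Ioo.prod isOpen_univ).mem_nhds ⟨hτ, trivial⟩)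

theorem IsHamiltonianVariation.contMDiffAt_time (H : IsHamiltonianVariation j₁ j₂ ε Φ F K δ)
    {τ : ℝ} (hτ : τ ∈ Ioo (-δ) δ) (p : S) :
    ContMDiffAt (𝓡 2) ((𝓡 2).prod (𝓡 2)) ∞ (F τ) p :=
  ContMDiffAt.comp (g := fun z : ℝ × S ↦ F z.1 z.2) p (H.contMDiffAt hτ p)
    (contMDiffAt_const.prodMk contMDiffAt_id)

theorem contMDiffAt_chart_prod {e : OpenPartialHomeomorph S Plane} (he : IsSmoothChart e)
    {z : ℝ × Plane} (hz : z.2 ∈ e.target) :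
    ContMDiffAt 𝓘(ℝ, ℝ × Plane) (𝓘(ℝ, ℝ).prod (𝓡 2)) ∞ (fun z ↦ (z.1, e.symm z.2)) z := by
  refine ContMDiffAt.prodMk contDiffAt_fst.contMDiffAt ?_
  exact ContMDiffAt.comp (I' := 𝓡 2) (g := e.symm) z (he.contMDiffAt_symm hz)
    contDiffAt_snd.contMDiffAt

theorem IsHamiltonianVariation.smoothPairAt (H : IsHamiltonianVariation j₁ j₂ ε Φ F K δ)
    {e : OpenPartialHomeomorph S Plane} (he : IsSmoothChart e) {z : ℝ × Plane}
    (hτ : z.1 ∈ Ioo (-δ) δ) (hz : z.2 ∈ e.target) : SmoothPairAt (inChart F e) z := by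
  have h : ContMDiffAt 𝓘(ℝ, ℝ × Plane) ((𝓡 2).prod (𝓡 2)) ∞ (inChart F e) z :=
    ContMDiffAt.comp (g := fun z : ℝ × S ↦ F z.1 z.2) z (H.contMDiffAt hτ (e.symm z.2))
      (contMDiffAt_chart_prod he hz)
  exact ⟨contMDiffAt_fst.comp z h, contMDiffAt_snd.comp z h⟩

theorem IsHamiltonianVariation.mdifferentiableAt (H : IsHamiltonianVariation j₁ j₂ ε Φ F K δ)
    {τ : ℝ} (hτ : τ ∈ Ioo (-δ) δ) (p : S) :
    MDifferentiableAt (𝓡 2) (𝓡 2) (fun p ↦ (F τ p).1) p ∧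
    MDifferentiableAt (𝓡 2) (𝓡 2) (fun p ↦ (F τ p).2) p :=
  ⟨(contMDiffAt_fst.comp p (H.contMDiffAt_time hτ p)).mdifferentiableAt (by simp),
    (contMDiffAt_snd.comp p (H.contMDiffAt_time hτ p)).mdifferentiableAt (by simp)⟩

theorem IsHamiltonianVariation.inducedMetric_eq (H : IsHamiltonianVariation j₁ j₂ ε Φ F K δ)
    {e : OpenPartialHomeomorph S Plane} (he : IsSmoothChart e) {τ : ℝ} {y : Plane}
    (hτ : τ ∈ Ioo (-δ) δ) (hy : y ∈ e.target) (v w : Plane) :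
    inducedMetric g₁ g₂ ε (F τ) (e.symm y) (mfderiv (𝓡 2) (𝓡 2) e.symm y v)
      (mfderiv (𝓡 2) (𝓡 2) e.symm y w)
      = pairForm g₁ g₂ ε (inChart F e) (0, v) (0, w) (τ, y) := by
  obtain ⟨h1, h2⟩ := H.mdifferentiableAt hτ (e.symm y)
  rw [inducedMetric_symm he hy h1 h2, ← pairForm_slice (H.smoothPairAt he hτ hy)]
  rfl

/-- One potential serves every smooth chart, adapted charts included. -/
theorem IsHamiltonianVariation.exists_potential (H : IsHamiltonianVariation j₁ j₂ ε Φ F K δ) :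
    ∃ u : ℝ → S → ℝ, (∀ τ ∈ Ioo (-δ) δ, ∀ p ∉ K, u τ p = 0) ∧
      ∀ e : OpenPartialHomeomorph S Plane, IsSmoothChart e → ∀ z : ℝ × Plane, z.1 ∈ Ioo (-δ) δ →
        z.2 ∈ e.target → ContDiffAt ℝ ∞ (fun z : ℝ × Plane ↦ u z.1 (e.symm z.2)) z ∧
        ∀ v : Plane, pairArea j₁ j₂ ε (inChart F e) timeDir (0, v) z
          = dirDeriv (0, v) (fun z : ℝ × Plane ↦ u z.1 (e.symm z.2)) z := by
  obtain ⟨u, hu, h0, hu'⟩ := H.exists_hamiltonian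
  refine ⟨u, h0, fun e he z hτ hz ↦ ?_⟩
  have s1 : ContMDiffAt (𝓘(ℝ, ℝ).prod (𝓡 2)) 𝓘(ℝ, ℝ) ∞ (fun z : ℝ × S ↦ u z.1 z.2)
      (z.1, e.symm z.2) :=
    (hu _ ⟨hτ, trivial⟩).contMDiffAt ((isOpen_Ioo.prod isOpen_univ).mem_nhds ⟨hτ, trivial⟩)
  have s2 : ContDiffAt ℝ ∞ (fun z : ℝ × Plane ↦ u z.1 (e.symm z.2)) z := by
    rw [← contMDiffAt_iff_contDiffAt]
    exact ContMDiffAt.comp (g := fun z : ℝ × S ↦ u z.1 z.2) z s1 (contMDiffAt_chart_prod he hz)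
  refine ⟨s2, fun v ↦ ?_⟩
  obtain ⟨h1, h2⟩ := H.mdifferentiableAt hτ (e.symm z.2)
  have h3 := prodSymplectic_velocity_symm (j₁ := j₁) (j₂ := j₂) (ε := ε) he hz h1 h2
    (H.smoothPairAt he hτ hz) v
  refine h3.symm.trans ((hu' z.1 hτ _ _).trans ?_)
  have s3 : MDifferentiableAt (𝓡 2) 𝓘(ℝ, ℝ) (u z.1) (e.symm z.2) :=
    (ContMDiffAt.comp (g := fun z : ℝ × S ↦ u z.1 z.2) (e.symm z.2) s1
      (contMDiffAt_const.prodMk contMDiffAt_id)).mdifferentiableAt (by simp)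
  have h4 := mfderiv_comp z.2 (I' := 𝓡 2) s3 ((he.contMDiffAt_symm hz).mdifferentiableAt (by simp))
  refine (congrArg (fun L ↦ L v) h4).symm.trans ?_
  rw [mfderiv_eq_fderiv, dirDeriv]
  have h5 := HasFDerivAt.comp (g := fun z : ℝ × Plane ↦ u z.1 (e.symm z.2)) z.2
    (f := fun y ↦ (z.1, y)) (s2.differentiableAt (by simp)).hasFDerivAt
    (hasFDerivAt_prodMk_right z.1 z.2)
  exact congrArg (fun L : Plane →L[ℝ] ℝ ↦ L v) h5.fderiv

end Family

section Reduction

variable [T2Space S] [SigmaCompactSpace S]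

theorem finite_chartPartition_indices {K : Set S} (hK : IsCompact K) :
    {i | (tsupport (chartPartition S i) ∩ K).Nonempty}.Finite :=
  (chartPartition S).locallyFinite.closure.finite_nonempty_inter_compact hK

/-- The indices of the charts which contribute to integrals over `K`. -/
def chartIndices {K : Set S} (hK : IsCompact K) : Finset S :=
  (finite_chartPartition_indices hK).toFinset

/-- The part of `K` on which the chart at `i` contributes to integrals, in this chart. -/
def chartCompact (K : Set S) (i : S) : Set Plane :=
  chartAt Plane i '' (tsupport (chartPartition S i) ∩ K)

/-- The partition function of the chart at `i`, in this chart. -/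
def chartWeight (i : S) (y : Plane) : ℝ := chartPartition S i ((chartAt Plane i).symm y)

theorem tsupport_subset_chart_source (i : S) :
    tsupport (chartPartition S i) ⊆ (chartAt Plane i).source :=
  chartPartition_isSubordinate i

theorem isCompact_chartCompact {K : Set S} (hK : IsCompact K) (i : S) :
    IsCompact (chartCompact K i) :=
  (hK.inter_left (isClosed_tsupport _)).image_of_continuousOn
    ((chartAt Plane i).continuousOn.mono
      (inter_subset_left.trans (tsupport_subset_chart_source i)))

theorem chartCompact_subset_target (K : Set S) (i : S) :
    chartCompact K i ⊆ (chartAt Plane i).target := by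
  rintro _ ⟨p, hp, rfl⟩
  exact (chartAt Plane i).map_source (tsupport_subset_chart_source i hp.1)

theorem symm_mem_of_mem_chartCompact {K : Set S} {i : S} {y : Plane} (hy : y ∈ chartCompact K i) :
    (chartAt Plane i).symm y ∈ K := by
  obtain ⟨p, hp, rfl⟩ := hy
  rw [(chartAt Plane i).left_inv (tsupport_subset_chart_source i hp.1)]
  exact hp.2

theorem chartWeight_nonneg (i : S) (y : Plane) : 0 ≤ chartWeight i y :=
  (chartPartition S).nonneg i _

theorem contDiffAt_chartWeight {i : S} {y : Plane} (hy : y ∈ (chartAt Plane i).target) :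
    ContDiffAt ℝ ∞ (chartWeight i) y := by
  rw [← contMDiffAt_iff_contDiffAt]
  exact (chartPartition S i).contMDiff.contMDiffAt.comp y (chartAt_symm_contMDiffAt i hy)

/-- Only finitely many partition functions have a support meeting `K`, and the integrand vanishes
off the compact image of support and `K`. The volume becomes a finite sum of integrals over compact
sets, to which differentiation under the integral applies. -/
theorem volumeOn_eq_sum {K : Set S} (hK : IsCompact K)
    (b : ∀ p : S, TangentSpace (𝓡 2) p → TangentSpace (𝓡 2) p → ℝ) :
    volumeOn b K = ∑ i ∈ chartIndices hK, ∫ y in chartCompact K i,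
      chartWeight i y * √|(coordMatrix b (chartAt Plane i) y).det| := by
  have h : ∀ i : S, (∫ y in (chartAt Plane i).target ∩ (chartAt Plane i).symm ⁻¹' K,
      chartPartition S i ((chartAt Plane i).symm y) * √|(coordMatrix b (chartAt Plane i) y).det|)
      = ∫ y in chartCompact K i,
        chartWeight i y * √|(coordMatrix b (chartAt Plane i) y).det| := by
    intro i
    refine (setIntegral_eq_of_subset_of_forall_sdiff_eq_zero ?_ ?_ ?_)
    -- Measurability: the set is a difference of two open sets, because `K` is closed.
    · have : (chartAt Plane i).target ∩ (chartAt Plane i).symm ⁻¹' K = (chartAt Plane i).target \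
          ((chartAt Plane i).target ∩ (chartAt Plane i).symm ⁻¹' Kᶜ) := by
        ext y
        simp only [mem_inter_iff, mem_preimage, Set.mem_sdiff, mem_compl_iff]
        tauto
      rw [this]
      exact (chartAt Plane i).open_target.measurableSet.diff
        ((chartAt Plane i).symm.isOpen_inter_preimage hK.isClosed.isOpen_compl).measurableSet
    · exact fun y hy ↦ ⟨chartCompact_subset_target K i hy, (symm_mem_of_mem_chartCompact hy : (chartAt Plane i).symm y ∈ K)⟩
    · rintro y ⟨⟨h1, h2⟩, h3⟩
      have : (chartAt Plane i).symm y ∉ tsupport (chartPartition S i) := fun h4 ↦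
        h3 ⟨_, ⟨h4, h2⟩, (chartAt Plane i).right_inv h1⟩
      rw [image_eq_zero_of_notMem_tsupport this, zero_mul]
  rw [volumeOn, finsum_congr h]
  refine finsum_eq_sum_of_support_subset _ fun i hi ↦ ?_
  simp only [chartIndices, Finite.coe_toFinset, mem_ofPred_eq]
  by_contra hne
  rw [not_nonempty_iff_eq_empty] at hne
  exact hi (by simp [chartCompact, hne])

variable {Φ : S → M₁ × M₂} {F : ℝ → S → M₁ × M₂} {K : Set S} {δ : ℝ}

theorem IsHamiltonianVariation.volumeOn_eq (H : IsHamiltonianVariation j₁ j₂ ε Φ F K δ) {τ : ℝ}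
    (hτ : τ ∈ Ioo (-δ) δ) : volumeOn (inducedMetric g₁ g₂ ε (F τ)) K
      = ∑ i ∈ chartIndices H.isCompact, ∫ y in chartCompact K i, chartWeight i y *
        areaDensity (pairForm g₁ g₂ ε (inChart F (chartAt Plane i))) fstDir sndDir (τ, y) := by
  rw [volumeOn_eq_sum H.isCompact]
  refine Finset.sum_congr rfl fun i _ ↦ setIntegral_congr_fun
    (isCompact_chartCompact H.isCompact i).measurableSet fun y hy ↦ ?_
  have ht := chartCompact_subset_target K i hy
  simp only [areaDensity, Matrix.det_fin_two, coordMatrix, Matrix.of_apply]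
  rw [H.inducedMetric_eq (IsSmoothChart.chartAt i) hτ ht,
    H.inducedMetric_eq (IsSmoothChart.chartAt i) hτ ht,
    H.inducedMetric_eq (IsSmoothChart.chartAt i) hτ ht,
    H.inducedMetric_eq (IsSmoothChart.chartAt i) hτ ht,
    pairForm_symm _ (0, EuclideanSpace.single 1 1) (0, EuclideanSpace.single 0 1)]
  rfl

/-- The determinant of the induced metric. -/
def gramDet (G : ℝ × Plane → ℝ × Plane → ℝ × Plane → ℝ) (z : ℝ × Plane) : ℝ :=
  G (0, fstDir) (0, fstDir) z * G (0, sndDir) (0, sndDir) z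
    - G (0, fstDir) (0, sndDir) z * G (0, fstDir) (0, sndDir) z

theorem areaDensity_eq_sqrt (G : ℝ × Plane → ℝ × Plane → ℝ × Plane → ℝ) (z : ℝ × Plane) :
    areaDensity G fstDir sndDir z = √|gramDet G z| := rfl

/-- The region in a chart where a variation is smooth and nondegenerate. -/
def smoothRegion (g₁ : LorentzMetric M₁) (g₂ : LorentzMetric M₂) (ε : ℝ) (F : ℝ → S → M₁ × M₂)
    (e : OpenPartialHomeomorph S Plane) (δ : ℝ) : Set (ℝ × Plane) :=
  (Ioo (-δ) δ ×ˢ e.target) ∩ gramDet (pairForm g₁ g₂ ε (inChart F e)) ⁻¹' {0}ᶜ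

theorem IsHamiltonianVariation.contDiffOn_gramDet (H : IsHamiltonianVariation j₁ j₂ ε Φ F K δ)
    {e : OpenPartialHomeomorph S Plane} (he : IsSmoothChart e) :
    ContDiffOn ℝ ∞ (gramDet (pairForm g₁ g₂ ε (inChart F e))) (Ioo (-δ) δ ×ˢ e.target) := by
  intro z hz
  have h := fun v w ↦ contDiffAt_pairForm (g₁ := g₁) (g₂ := g₂) (ε := ε)
    (H.smoothPairAt he hz.1 hz.2) v w
  exact (((h _ _).mul (h _ _)).sub ((h _ _).mul (h _ _))).contDiffWithinAt

theorem IsHamiltonianVariation.isOpen_smoothRegion (H : IsHamiltonianVariation j₁ j₂ ε Φ F K δ)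
    {e : OpenPartialHomeomorph S Plane} (he : IsSmoothChart e) :
    IsOpen (smoothRegion g₁ g₂ ε F e δ) :=
  (H.contDiffOn_gramDet he).continuousOn.isOpen_inter_preimage
    (isOpen_Ioo.prod e.open_target) isOpen_compl_singleton

/-- Away from the zeros of the Gram determinant both the absolute value and the square root are
smooth. -/
theorem IsHamiltonianVariation.contDiffOn_areaDensity (H : IsHamiltonianVariation j₁ j₂ ε Φ F K δ)
    {e : OpenPartialHomeomorph S Plane} (he : IsSmoothChart e) :
    ContDiffOn ℝ ∞ (areaDensity (pairForm g₁ g₂ ε (inChart F e)) fstDir sndDir)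
      (smoothRegion g₁ g₂ ε F e δ) := by
  refine ContDiffOn.sqrt (f := fun z ↦ |gramDet (pairForm g₁ g₂ ε (inChart F e)) z|) ?_
    fun z hz ↦ abs_ne_zero.mpr hz.2
  exact ((H.contDiffOn_gramDet he).mono inter_subset_left).abs fun z hz ↦ hz.2

theorem dirDeriv_timeDir_weight_mul {w : Plane → ℝ} {D : ℝ × Plane → ℝ} {z : ℝ × Plane}
    (hw : DifferentiableAt ℝ w z.2) (hD : DifferentiableAt ℝ D z) :
    dirDeriv timeDir (fun z ↦ w z.2 * D z) z = w z.2 * dirDeriv timeDir D z := by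
  have h1 : HasFDerivAt (fun z : ℝ × Plane ↦ w z.2)
      ((fderiv ℝ w z.2).comp (ContinuousLinearMap.snd ℝ ℝ Plane)) z :=
    hw.hasFDerivAt.comp z hasFDerivAt_snd
  have h2 : dirDeriv timeDir (fun z : ℝ × Plane ↦ w z.2) z = 0 := by
    rw [dirDeriv, h1.fderiv]
    simp [timeDir]
  rw [dirDeriv_mul h1.differentiableAt hD, h2, zero_mul, zero_add]

/-- Nondegeneracy at time `0` puts the compact sets of integration into the open region where the
density is smooth. The weights do not depend on time, so time derivatives pass through them. -/
theorem IsHamiltonianVariation.volume_variation (H : IsHamiltonianVariation j₁ j₂ ε Φ F K δ)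
    (hnd : ∀ i, ∀ y ∈ (chartAt Plane i).target,
      gramDet (pairForm g₁ g₂ ε (inChart F (chartAt Plane i))) (0, y) ≠ 0) :
    ContDiffAt ℝ 2 (fun τ ↦ volumeOn (inducedMetric g₁ g₂ ε (F τ)) K) 0 ∧
    iteratedDeriv 2 (fun τ ↦ volumeOn (inducedMetric g₁ g₂ ε (F τ)) K) 0
      = ∑ i ∈ chartIndices H.isCompact, ∫ y in chartCompact K i, chartWeight i y *
        dirDeriv timeDir (dirDeriv timeDir (areaDensity (pairForm g₁ g₂ ε
          (inChart F (chartAt Plane i))) fstDir sndDir)) (0, y) ∧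
    deriv (fun τ ↦ volumeOn (inducedMetric g₁ g₂ ε (F τ)) K) 0
      = ∑ i ∈ chartIndices H.isCompact, ∫ y in chartCompact K i, chartWeight i y *
        dirDeriv timeDir (areaDensity (pairForm g₁ g₂ ε
          (inChart F (chartAt Plane i))) fstDir sndDir) (0, y) ∧
    ∀ i, IntegrableOn (fun y ↦ chartWeight i y * dirDeriv timeDir (areaDensity (pairForm g₁ g₂ ε
          (inChart F (chartAt Plane i))) fstDir sndDir) (0, y)) (chartCompact K i) ∧
      IntegrableOn (fun y ↦ chartWeight i y * dirDeriv timeDir (dirDeriv timeDir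
        (areaDensity (pairForm g₁ g₂ ε (inChart F (chartAt Plane i))) fstDir sndDir)) (0, y))
        (chartCompact K i) := by
  set D : S → ℝ × Plane → ℝ := fun i ↦
    areaDensity (pairForm g₁ g₂ ε (inChart F (chartAt Plane i))) fstDir sndDir
  set U : S → Set (ℝ × Plane) := fun i ↦ smoothRegion g₁ g₂ ε F (chartAt Plane i) δ
  have hC := isCompact_chartCompact H.isCompact
  have hU : ∀ i, IsOpen (U i) := fun i ↦ H.isOpen_smoothRegion (IsSmoothChart.chartAt i)
  have hD : ∀ i, ContDiffOn ℝ ∞ (D i) (U i) :=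
    fun i ↦ H.contDiffOn_areaDensity (IsSmoothChart.chartAt i)
  have hw : ∀ i, ∀ z ∈ U i, ContDiffAt ℝ ∞ (fun z : ℝ × Plane ↦ chartWeight i z.2) z :=
    fun i z hz ↦ (contDiffAt_chartWeight hz.1.2).comp z contDiffAt_snd
  have h0 : ∀ i, ∀ y ∈ chartCompact K i, ((0 : ℝ), y) ∈ U i := fun i y hy ↦
    have ht := chartCompact_subset_target K i hy
    ⟨⟨⟨by simpa using H.pos, H.pos⟩, ht⟩, hnd i y ht⟩
  have hwm : ∀ i, ∀ {D' : ℝ × Plane → ℝ}, ContDiffOn ℝ ∞ D' (U i) →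
      ContDiffOn ℝ ∞ (fun z ↦ chartWeight i z.2 * D' z) (U i) := fun i D' h z hz ↦
    (hw i z hz).contDiffWithinAt.mul (h z hz)
  have e1 : ∀ i, ∀ {D' : ℝ × Plane → ℝ}, ContDiffOn ℝ ∞ D' (U i) → ∀ z ∈ U i,
      dirDeriv timeDir (fun z ↦ chartWeight i z.2 * D' z) z
        = chartWeight i z.2 * dirDeriv timeDir D' z := fun i D' h z hz ↦
    dirDeriv_timeDir_weight_mul ((contDiffAt_chartWeight hz.1.2).differentiableAt (by simp))
      (differentiableAt_of_smooth (h.contDiffAt ((hU i).mem_nhds hz)))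
  have e2 : ∀ i, ∀ z ∈ U i, dirDeriv timeDir (dirDeriv timeDir fun z ↦ chartWeight i z.2 * D i z) z
        = chartWeight i z.2 * dirDeriv timeDir (dirDeriv timeDir (D i)) z := fun i z hz ↦ by
    rw [← e1 i (contDiffOn_dirDeriv (hU i) (hD i) timeDir) z hz]
    refine dirDeriv_congr ?_ _
    filter_upwards [(hU i).mem_nhds hz] with z' hz' using e1 i (hD i) z' hz'
  have hV : (fun τ ↦ volumeOn (inducedMetric g₁ g₂ ε (F τ)) K) =ᶠ[𝓝 0] fun τ ↦
      ∑ i ∈ chartIndices H.isCompact, ∫ y in chartCompact K i,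
        (fun z : ℝ × Plane ↦ chartWeight i z.2 * D i z) (τ, y) := by
    filter_upwards [isOpen_Ioo.mem_nhds (show (0 : ℝ) ∈ Ioo (-δ) δ from ⟨by simpa using H.pos, H.pos⟩)]
      with τ hτ using H.volumeOn_eq hτ
  have two := fun i ↦ contDiffAt_setIntegral_and_iteratedDeriv_two (hU i) (hwm i (hD i)) (hC i) (h0 i)
  refine ⟨?_, ?_, ?_, ?_⟩
  · exact (ContDiffAt.sum fun i _ ↦ (two i).1).congr_of_eventuallyEq hV
  · rw [hV.iteratedDeriv_eq, iteratedDeriv_fun_sum fun i _ ↦ (two i).1]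
    refine Finset.sum_congr rfl fun i _ ↦ (two i).2.trans ?_
    exact setIntegral_congr_fun (hC i).measurableSet fun y hy ↦ e2 i _ (h0 i y hy)
  · rw [hV.deriv_eq]
    refine (HasDerivAt.fun_sum fun i _ ↦
      hasDerivAt_setIntegral (hU i) (hwm i (hD i)) (hC i) (h0 i)).deriv.trans ?_
    refine Finset.sum_congr rfl fun i _ ↦ ?_
    exact setIntegral_congr_fun (hC i).measurableSet fun y hy ↦ e1 i (hD i) _ (h0 i y hy)
  · intro i
    have d1 := contDiffOn_dirDeriv (hU i) (hD i) timeDir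
    exact ⟨integrableOn_slice (hwm i d1).continuousOn (hC i) (h0 i),
      integrableOn_slice (hwm i (contDiffOn_dirDeriv (hU i) d1 timeDir)).continuousOn (hC i) (h0 i)⟩

end Reduction

end VolumeVariation

/-! ### Extension of local variations to the surface -/

section Gluing

open Filter Topology

variable {M₁ M₂ S : Type*}
  [TopologicalSpace M₁] [ChartedSpace Plane M₁] [IsManifold (𝓡 2) ∞ M₁]
  [TopologicalSpace M₂] [ChartedSpace Plane M₂] [IsManifold (𝓡 2) ∞ M₂]
  [TopologicalSpace S] [ChartedSpace Plane S] [IsManifold (𝓡 2) ∞ S]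
  {g₁ : LorentzMetric M₁} {g₂ : LorentzMetric M₂} {j₁ : ParacomplexStructure g₁}
  {j₂ : ParacomplexStructure g₂} {ε : ℝ}

theorem pairArea_eq_zero_of_basis {f : ℝ × Plane → M₁ × M₂} {z : ℝ × Plane}
    (h : pairArea j₁ j₂ ε f (0, fstDir) (0, sndDir) z = 0) (v w : Plane) :
    pairArea j₁ j₂ ε f (0, v) (0, w) z = 0 := by
  obtain ⟨B, hB⟩ := pairArea_linear (j₁ := j₁) (j₂ := j₂) (ε := ε) f z
  have ha : ∀ a : Plane, ((0 : ℝ), a) = a 0 • ((0 : ℝ), fstDir) + a 1 • ((0 : ℝ), sndDir) := by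
    intro a
    nth_rw 1 [plane_eq_smul_add a]
    simp
  have hs : ∀ v w, B v w = - B w v := fun v w ↦ by rw [← hB, pairArea_skew, hB]
  have h1 := hs (0, fstDir) (0, fstDir)
  have h2 := hs (0, sndDir) (0, sndDir)
  have h3 := hs (0, sndDir) (0, fstDir)
  rw [hB] at h ⊢
  rw [h] at h3
  rw [ha v, ha w]
  simp only [map_add, map_smul, LinearMap.add_apply, LinearMap.smul_apply, smul_eq_mul, h, h3,
    show B (0, fstDir) (0, fstDir) = 0 by linarith, show B (0, sndDir) (0, sndDir) = 0 by linarith]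
  ring

variable [T2Space S]

theorem contMDiffAt_pair {f : S → M₁ × M₂} {p : S}
    (hf : ContMDiffAt (𝓡 2) ((𝓡 2).prod (𝓡 2)) ∞ f p) :
    ContMDiffAt (𝓡 2) (𝓡 2) ∞ (fun p ↦ (f p).1) p ∧ ContMDiffAt (𝓡 2) (𝓡 2) ∞ (fun p ↦ (f p).2) p :=
  ⟨contMDiffAt_fst.comp p hf, contMDiffAt_snd.comp p hf⟩

theorem mdifferentiableAt_pair {f : S → M₁ × M₂} {p : S}
    (hf : ContMDiffAt (𝓡 2) ((𝓡 2).prod (𝓡 2)) ∞ f p) :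
    MDifferentiableAt (𝓡 2) (𝓡 2) (fun p ↦ (f p).1) p ∧
    MDifferentiableAt (𝓡 2) (𝓡 2) (fun p ↦ (f p).2) p :=
  ⟨(contMDiffAt_pair hf).1.mdifferentiableAt (by simp),
    (contMDiffAt_pair hf).2.mdifferentiableAt (by simp)⟩

theorem smoothPairAt_symm {f : S → M₁ × M₂} {e : OpenPartialHomeomorph S Plane}
    (he : IsSmoothChart e) {y : Plane} (hy : y ∈ e.target)
    (hf : ContMDiffAt (𝓡 2) ((𝓡 2).prod (𝓡 2)) ∞ f (e.symm y)) :
    SmoothPairAt (fun y ↦ f (e.symm y)) y :=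
  ⟨(contMDiffAt_pair hf).1.comp y (he.contMDiffAt_symm hy),
    (contMDiffAt_pair hf).2.comp y (he.contMDiffAt_symm hy)⟩

open Classical in
/-- Local families of maps, glued to a fixed map. -/
def glueFamily (Φ : S → M₁ × M₂) (e : OpenPartialHomeomorph S Plane) (B : ℝ × Plane → M₁ × M₂)
    (τ : ℝ) (p : S) : M₁ × M₂ :=
  if p ∈ e.source then B (τ, e p) else Φ p

/-- A local Lagrangian family which moves only points of a compact set, with a Hamiltonian that does
not depend on time, extends to a Hamiltonian variation. -/
theorem isHamiltonianVariation_glueFamily {Φ : S → M₁ × M₂}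
    (hΦ : ContMDiff (𝓡 2) ((𝓡 2).prod (𝓡 2)) ∞ Φ) (hL : IsLagrangian j₁ j₂ ε Φ)
    {e : OpenPartialHomeomorph S Plane} (he : IsSmoothChart e) {K : Set S} (hK : IsCompact K)
    {C : Set Plane} (hC : IsCompact C) (hCe : C ⊆ e.target) (hCK : e.symm '' C ⊆ K)
    {B : ℝ × Plane → M₁ × M₂} {δ : ℝ} (hδ : 0 < δ)
    (hB : ∀ z, z.1 ∈ Ioo (-δ) δ → z.2 ∈ e.target → SmoothPairAt B z)
    (hB0 : ∀ y ∈ e.target, B (0, y) = Φ (e.symm y))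
    (hBC : ∀ τ ∈ Ioo (-δ) δ, ∀ y ∈ e.target, y ∉ C → B (τ, y) = Φ (e.symm y))
    (hBL : ∀ z, z.1 ∈ Ioo (-δ) δ → z.2 ∈ e.target →
      pairArea j₁ j₂ ε B (0, fstDir) (0, sndDir) z = 0)
    {w : Plane → ℝ} (hw : ∀ y ∈ e.target, ContDiffAt ℝ ∞ w y) (hw0 : ∀ y ∈ e.target, y ∉ C → w y = 0)
    (hBw : ∀ z, z.1 ∈ Ioo (-δ) δ → z.2 ∈ e.target → ∀ v,
      pairArea j₁ j₂ ε B timeDir (0, v) z = dirDeriv v w z.2) :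
    IsHamiltonianVariation j₁ j₂ ε Φ (glueFamily Φ e B) K δ ∧
    (∀ τ, ∀ y ∈ e.target, inChart (glueFamily Φ e B) e (τ, y) = B (τ, y)) ∧
    ∀ τ ∈ Ioo (-δ) δ, ∀ p ∉ e.symm '' C, glueFamily Φ e B τ p = Φ p := by
  classical
  set F := glueFamily Φ e B with hF
  -- `S` is Hausdorff, so the compact set `e.symm '' C` is closed. Hence every point outside the
  -- chart has a neighbourhood on which the family is constant in time.
  have hcl : IsClosed (e.symm '' C) :=
    (hC.image_of_continuousOn (e.continuousOn_symm.mono hCe)).isClosed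
  have hCs : e.symm '' C ⊆ e.source := by
    rintro _ ⟨y, hy, rfl⟩
    exact e.map_target (hCe hy)
  have hin : ∀ τ, ∀ y ∈ e.target, inChart F e (τ, y) = B (τ, y) := fun τ y hy ↦ by
    simp only [inChart, hF, glueFamily, e.map_target hy, if_true, e.right_inv hy]
  have hsrc : ∀ τ, ∀ p ∈ e.source, F τ p = B (τ, e p) := fun τ p hp ↦ if_pos hp
  have hout : ∀ τ ∈ Ioo (-δ) δ, ∀ p ∉ e.symm '' C, F τ p = Φ p := by
    intro τ hτ p hp
    by_cases h : p ∈ e.source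
    · rw [hsrc τ p h, hBC τ hτ _ (e.map_source h), e.left_inv h]
      exact fun h' ↦ hp ⟨_, h', e.left_inv h⟩
    · exact if_neg h
  have hevout : ∀ τ ∈ Ioo (-δ) δ, ∀ p ∉ e.source,
      (fun z : ℝ × S ↦ F z.1 z.2) =ᶠ[𝓝 (τ, p)] fun z ↦ Φ z.2 := by
    intro τ hτ p hp
    filter_upwards [(isOpen_Ioo.prod hcl.isOpen_compl).mem_nhds
      (show (τ, p) ∈ Ioo (-δ) δ ×ˢ (e.symm '' C)ᶜ from ⟨hτ, fun h ↦ hp (hCs h)⟩)] with z hz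
    exact hout z.1 hz.1 z.2 hz.2
  have hFs : ∀ τ ∈ Ioo (-δ) δ, ∀ p, ContMDiffAt (𝓘(ℝ, ℝ).prod (𝓡 2)) ((𝓡 2).prod (𝓡 2)) ∞
      (fun z : ℝ × S ↦ F z.1 z.2) (τ, p) := by
    intro τ hτ p
    by_cases h : p ∈ e.source
    · have h1 : (fun z : ℝ × S ↦ F z.1 z.2) =ᶠ[𝓝 (τ, p)] fun z ↦ B (z.1, e z.2) := by
        filter_upwards [continuousAt_snd.eventually (e.open_source.mem_nhds h)] with z hz
          using hsrc z.1 z.2 hz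
      have h2 : ContMDiffAt (𝓘(ℝ, ℝ).prod (𝓡 2)) 𝓘(ℝ, ℝ × Plane) ∞
          (fun z : ℝ × S ↦ (z.1, e z.2)) (τ, p) :=
        contMDiffAt_fst.prodMk_space (ContMDiffAt.comp (I' := 𝓡 2) (g := e) (τ, p)
          (he.contMDiffAt h) contMDiffAt_snd)
      have h3 := hB (τ, e p) hτ (e.map_source h)
      refine ContMDiffAt.congr_of_eventuallyEq (ContMDiffAt.prodMk
        (ContMDiffAt.comp (g := fun z ↦ (B z).1) (τ, p) h3.1 h2)
        (ContMDiffAt.comp (g := fun z ↦ (B z).2) (τ, p) h3.2 h2)) h1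
    · exact (hΦ.contMDiffAt.comp (τ, p) contMDiffAt_snd).congr_of_eventuallyEq (hevout τ hτ p h)
  have hFt : ∀ τ ∈ Ioo (-δ) δ, ∀ p, ContMDiffAt (𝓡 2) ((𝓡 2).prod (𝓡 2)) ∞ (F τ) p := fun τ hτ p ↦
    ContMDiffAt.comp (g := fun z : ℝ × S ↦ F z.1 z.2) p (hFs τ hτ p)
      (contMDiffAt_const.prodMk contMDiffAt_id)
  have hFe : ∀ {c : OpenPartialHomeomorph S Plane}, IsSmoothChart c → ∀ τ ∈ Ioo (-δ) δ,
      ∀ y ∈ c.target, SmoothPairAt (inChart F c) (τ, y) := by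
    intro c hc τ hτ y hy
    have h := ContMDiffAt.comp (g := fun z : ℝ × S ↦ F z.1 z.2) (τ, y) (hFs τ hτ (c.symm y))
      (contMDiffAt_chart_prod hc hy)
    exact ⟨contMDiffAt_fst.comp _ h, contMDiffAt_snd.comp _ h⟩
  have hevin : ∀ τ, ∀ y ∈ e.target, inChart F e =ᶠ[𝓝 (τ, y)] B := by
    intro τ y hy
    filter_upwards [continuousAt_snd.eventually (e.open_target.mem_nhds hy)] with z hz
      using hin z.1 z.2 hz
  refine ⟨⟨hδ, hK, fun z hz ↦ (hFs z.1 hz.1 z.2).contMDiffWithinAt, ?_,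
    fun τ hτ p hp ↦ hout τ hτ p fun h ↦ hp (hCK h), ?_, ?_⟩, hin, hout⟩
  · ext1 p
    by_cases h : p ∈ e.source
    · rw [hsrc 0 p h, hB0 _ (e.map_source h), e.left_inv h]
    · exact if_neg h
  · intro τ hτ p v w
    by_cases h : p ∈ e.source
    · obtain ⟨y, hy, rfl⟩ : ∃ y ∈ e.target, e.symm y = p := ⟨e p, e.map_source h, e.left_inv h⟩
      obtain ⟨v', rfl⟩ := exists_mfderiv_symm_eq he.contMDiffOn he.contMDiffOn_symm hy v
      obtain ⟨w', rfl⟩ := exists_mfderiv_symm_eq he.contMDiffOn he.contMDiffOn_symm hy w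
      obtain ⟨d1, d2⟩ := mdifferentiableAt_pair (hFt τ hτ (e.symm y))
      refine (prodSymplectic_symm he hy d1 d2 v' w').trans ?_
      refine (pairArea_slice (hFe he τ hτ y hy) v' w').trans ?_
      rw [pairArea_congr (hevin τ y hy)]
      exact pairArea_eq_zero_of_basis (hBL (τ, y) hτ hy) v' w'
    · obtain ⟨c, hc, hpc⟩ : ∃ c : OpenPartialHomeomorph S Plane, IsSmoothChart c ∧ p ∈ c.source :=
        ⟨_, IsSmoothChart.chartAt p, mem_chart_source Plane p⟩
      obtain ⟨y, hy, rfl⟩ : ∃ y ∈ c.target, c.symm y = p :=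
        ⟨c p, c.map_source hpc, c.left_inv hpc⟩
      obtain ⟨v', rfl⟩ := exists_mfderiv_symm_eq hc.contMDiffOn hc.contMDiffOn_symm hy v
      obtain ⟨w', rfl⟩ := exists_mfderiv_symm_eq hc.contMDiffOn hc.contMDiffOn_symm hy w
      obtain ⟨d1, d2⟩ := mdifferentiableAt_pair (hFt τ hτ (c.symm y))
      obtain ⟨d1', d2'⟩ := mdifferentiableAt_pair (hΦ.contMDiffAt (x := c.symm y))
      refine (prodSymplectic_symm hc hy d1 d2 v' w').trans ?_
      have h1 : (fun y ↦ F τ (c.symm y)) =ᶠ[𝓝 y] fun y ↦ Φ (c.symm y) := by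
        have h2 : Tendsto (fun y ↦ (τ, c.symm y)) (𝓝 y) (𝓝 (τ, c.symm y)) :=
          (continuousAt_const.prodMk (c.continuousAt_symm hy))
        exact h2.eventually (hevout τ hτ _ h)
      rw [pairArea_congr h1]
      exact (prodSymplectic_symm hc hy d1' d2' v' w').symm.trans (hL _ _ _)
  -- The Hamiltonian is `w`, carried to `S` by the chart and extended by zero.
  · refine ⟨fun _ p ↦ if p ∈ e.source then w (e p) else 0, ?_, ?_, ?_⟩
    · intro z hz
      refine ContMDiffAt.contMDiffWithinAt ?_
      by_cases h : z.2 ∈ e.source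
      · refine ContMDiffAt.congr_of_eventuallyEq (f := fun z : ℝ × S ↦ w (e z.2)) ?_ ?_
        · exact ContMDiffAt.comp (I' := 𝓡 2) (g := w) z (hw _ (e.map_source h)).contMDiffAt
            (ContMDiffAt.comp (g := e) z (he.contMDiffAt h) contMDiffAt_snd)
        · filter_upwards [continuousAt_snd.eventually (e.open_source.mem_nhds h)] with z hz
          exact if_pos hz
      · refine ContMDiffAt.congr_of_eventuallyEq (f := fun z : ℝ × S ↦ (0 : ℝ)) contMDiffAt_const ?_
        filter_upwards [continuousAt_snd.eventually
          (hcl.isOpen_compl.mem_nhds fun h' ↦ h (hCs h'))] with z hz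
        split_ifs with h'
        · exact hw0 _ (e.map_source h') fun h'' ↦ hz ⟨_, h'', e.left_inv h'⟩
        · rfl
    · intro τ hτ p hp
      simp only
      split_ifs with h'
      · exact hw0 _ (e.map_source h') fun h'' ↦ hp (hCK ⟨_, h'', e.left_inv h'⟩)
      · rfl
    · intro τ hτ p v
      by_cases h : p ∈ e.source
      · obtain ⟨y, hy, rfl⟩ : ∃ y ∈ e.target, e.symm y = p := ⟨e p, e.map_source h, e.left_inv h⟩
        obtain ⟨v', rfl⟩ := exists_mfderiv_symm_eq he.contMDiffOn he.contMDiffOn_symm hy v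
        obtain ⟨d1, d2⟩ := mdifferentiableAt_pair (hFt τ hτ (e.symm y))
        refine (prodSymplectic_velocity_symm he hy d1 d2 (hFe he τ hτ y hy) v').trans ?_
        rw [pairArea_congr (hevin τ y hy), hBw (τ, y) hτ hy]
        have h1 : (fun p ↦ if p ∈ e.source then w (e p) else 0) =ᶠ[𝓝 (e.symm y)]
            fun p ↦ w (e p) := by
          filter_upwards [e.open_source.mem_nhds h] with z hz using if_pos hz
        have h2 : MDifferentiableAt (𝓡 2) 𝓘(ℝ, ℝ) (fun p ↦ if p ∈ e.source then w (e p) else 0)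
            (e.symm y) := by
          refine MDifferentiableAt.congr_of_eventuallyEq ?_ h1
          have hd : MDifferentiableAt (𝓡 2) 𝓘(ℝ, ℝ) w (e (e.symm y)) := by
            rw [e.right_inv hy]
            exact ((hw y hy).differentiableAt (by simp)).mdifferentiableAt
          exact hd.comp (I' := 𝓡 2) _ ((he.contMDiffAt h).mdifferentiableAt (by simp))
        have h3 := mfderiv_comp y (I' := 𝓡 2) h2
          ((he.contMDiffAt_symm hy).mdifferentiableAt (by simp))
        refine Eq.trans ?_ (congrArg (fun L ↦ L v') h3)
        have h4 : ((fun p ↦ if p ∈ e.source then w (e p) else 0) ∘ e.symm) =ᶠ[𝓝 y] w := by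
          filter_upwards [e.open_target.mem_nhds hy] with z hz
          simp only [Function.comp, e.map_target hz, if_true, e.right_inv hz]
        rw [mfderiv_eq_fderiv, h4.fderiv_eq]
        rfl
      · obtain ⟨c, hc, hpc⟩ : ∃ c : OpenPartialHomeomorph S Plane, IsSmoothChart c ∧ p ∈ c.source :=
          ⟨_, IsSmoothChart.chartAt p, mem_chart_source Plane p⟩
        obtain ⟨y, hy, rfl⟩ : ∃ y ∈ c.target, c.symm y = p :=
          ⟨c p, c.map_source hpc, c.left_inv hpc⟩
        obtain ⟨v', rfl⟩ := exists_mfderiv_symm_eq hc.contMDiffOn hc.contMDiffOn_symm hy v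
        obtain ⟨d1, d2⟩ := mdifferentiableAt_pair (hFt τ hτ (c.symm y))
        refine (prodSymplectic_velocity_symm hc hy d1 d2 (hFe hc τ hτ y hy) v').trans ?_
        -- Near a point outside the domain of `e` the family does not depend on time. The velocity
        -- and the differential of the Hamiltonian both vanish there.
        have h1 : inChart F c =ᶠ[𝓝 (τ, y)] fun z ↦ Φ (c.symm z.2) := by
          have h2 : Tendsto (fun z : ℝ × Plane ↦ (z.1, c.symm z.2)) (𝓝 (τ, y))
              (𝓝 (τ, c.symm y)) :=
            continuousAt_fst.prodMk ((c.continuousAt_symm hy).comp continuousAt_snd)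
          exact h2.eventually (hevout τ hτ _ h)
        have h5 : (fun p ↦ if p ∈ e.source then w (e p) else 0) =ᶠ[𝓝 (c.symm y)] fun _ ↦ (0 : ℝ) := by
          filter_upwards [hcl.isOpen_compl.mem_nhds fun h' ↦ h (hCs h')] with z hz
          split_ifs with h'
          · exact hw0 _ (e.map_source h') fun h'' ↦ hz ⟨_, h'', e.left_inv h'⟩
          · rfl
        rw [pairArea_congr h1, pairArea_comp (f := fun y ↦ Φ (c.symm y)) (h := Prod.snd)
          (smoothPairAt_symm hc hy hΦ.contMDiffAt) differentiableAt_snd, h5.mfderiv_eq,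
          mfderiv_const]
        obtain ⟨b, hb⟩ := pairArea_linear (j₁ := j₁) (j₂ := j₂) (ε := ε)
          (fun y ↦ Φ (c.symm y)) y
        rw [hb, fderiv_snd]
        simp [timeDir]
        rfl

end Gluing

/-! ### Hamiltonian variations that reparametrize the surface -/

section Tangential

open Filter Topology

variable {M₁ M₂ S : Type*}
  [TopologicalSpace M₁] [ChartedSpace Plane M₁] [IsManifold (𝓡 2) ∞ M₁]
  [TopologicalSpace M₂] [ChartedSpace Plane M₂] [IsManifold (𝓡 2) ∞ M₂]
  [TopologicalSpace S] [ChartedSpace Plane S] [IsManifold (𝓡 2) ∞ S] [T2Space S]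
  {g₁ : LorentzMetric M₁} {g₂ : LorentzMetric M₂} {j₁ : ParacomplexStructure g₁}
  {j₂ : ParacomplexStructure g₂} {ε : ℝ}

theorem exists_Ioo_forall_mem {U : Set (ℝ × Plane)} (hU : IsOpen U) {C : Set Plane}
    (hC : IsCompact C) (h : ∀ y ∈ C, ((0 : ℝ), y) ∈ U) :
    ∃ δ > 0, ∀ τ ∈ Ioo (-δ) δ, ∀ y ∈ C, (τ, y) ∈ U := by
  obtain ⟨δ, hδ, hb⟩ := Metric.mem_nhds_iff.mp ((isOpen_setOf_forall_mem_compact hU hC).mem_nhds h)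
  refine ⟨δ, hδ, fun τ hτ ↦ hb ?_⟩
  rw [Real.ball_eq_Ioo]
  simpa using hτ

theorem hasFDerivAt_shift {Z : Plane → Plane} {z : ℝ × Plane} (hZ : DifferentiableAt ℝ Z z.2) :
    HasFDerivAt (fun z : ℝ × Plane ↦ z.2 + z.1 • Z z.2)
      (ContinuousLinearMap.snd ℝ ℝ Plane
        + (z.1 • (fderiv ℝ Z z.2).comp (ContinuousLinearMap.snd ℝ ℝ Plane)
          + (ContinuousLinearMap.fst ℝ ℝ Plane).smulRight (Z z.2))) z := by
  have h1 : HasFDerivAt (fun z : ℝ × Plane ↦ Z z.2)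
      ((fderiv ℝ Z z.2).comp (ContinuousLinearMap.snd ℝ ℝ Plane)) z :=
    hZ.hasFDerivAt.comp z hasFDerivAt_snd
  exact hasFDerivAt_snd.add (hasFDerivAt_fst.smul h1)

/-- Compactly supported vector fields on a Lagrangian surface are the velocities of Hamiltonian
variations which reparametrize it. -/
theorem exists_tangential_variation {Φ : S → M₁ × M₂}
    (hΦ : ContMDiff (𝓡 2) ((𝓡 2).prod (𝓡 2)) ∞ Φ) (hL : IsLagrangian j₁ j₂ ε Φ)
    {e : OpenPartialHomeomorph S Plane} (he : IsSmoothChart e) {K : Set S} (hK : IsCompact K)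
    {C : Set Plane} (hC : IsCompact C) (hCe : C ⊆ e.target) (hCK : e.symm '' C ⊆ K)
    {Z : Plane → Plane} (hZ : ∀ y ∈ e.target, ContDiffAt ℝ ∞ Z y)
    (hZC : ∀ y ∈ e.target, y ∉ C → Z y = 0) :
    ∃ F δ, IsHamiltonianVariation j₁ j₂ ε Φ F K δ ∧
      (∀ τ ∈ Ioo (-δ) δ, ∀ p ∉ e.symm '' C, F τ p = Φ p) ∧
      ∀ y ∈ e.target, ∀ v, pairForm g₁ g₂ ε (inChart F e) timeDir (0, v) (0, y)
          = pairForm g₁ g₂ ε (fun y ↦ Φ (e.symm y)) (Z y) v y ∧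
        pairArea j₁ j₂ ε (inChart F e) timeDir (0, v) (0, y) = 0 := by
  have hcont : ContinuousOn (fun z : ℝ × Plane ↦ z.2 + z.1 • Z z.2) (univ ×ˢ e.target) :=
    fun z hz ↦ (hasFDerivAt_shift ((hZ z.2 hz.2).differentiableAt
      (by simp))).continuousAt.continuousWithinAt
  -- Over the compact set `C` the shifted points stay in the target for small times; off `C` they do
  -- not move.
  obtain ⟨δ, hδ, hmem⟩ := exists_Ioo_forall_mem
    (hcont.isOpen_inter_preimage (isOpen_univ.prod e.open_target) e.open_target) hC
    (fun y hy ↦ ⟨⟨trivial, hCe hy⟩, by simpa using hCe hy⟩)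
  have hmem' : ∀ τ ∈ Ioo (-δ) δ, ∀ y ∈ e.target, y + τ • Z y ∈ e.target := by
    intro τ hτ y hy
    by_cases hyC : y ∈ C
    · exact (hmem τ hτ y hyC).2
    · simpa [hZC y hy hyC] using hy
  have hdiff : ∀ z : ℝ × Plane, z.2 ∈ e.target →
      ContDiffAt ℝ ∞ (fun z : ℝ × Plane ↦ z.2 + z.1 • Z z.2) z := fun z hz ↦
    contDiffAt_snd.add (contDiffAt_fst.smul ((hZ z.2 hz).comp z contDiffAt_snd))
  have hs : ∀ y ∈ e.target, SmoothPairAt (fun y ↦ Φ (e.symm y)) y := fun y hy ↦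
    smoothPairAt_symm he hy hΦ.contMDiffAt
  -- Only the velocity at time `0` is prescribed, so the flow of `Z` may be replaced by the straight
  -- shift `y + τ Z(y)`.
  set B : ℝ × Plane → M₁ × M₂ := fun z ↦ Φ (e.symm (z.2 + z.1 • Z z.2)) with hB
  -- The family factors through the Lagrangian map `Φ`, so `Ω` pulls back to zero also on the time
  -- direction. The Hamiltonian is therefore `0`.
  have hlag : ∀ z : ℝ × Plane, z.1 ∈ Ioo (-δ) δ → z.2 ∈ e.target → ∀ v w,
      pairArea j₁ j₂ ε B v w z = 0 := by
    intro z hτ hz v w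
    have h1 := hmem' z.1 hτ z.2 hz
    rw [hB, pairArea_comp (f := fun y ↦ Φ (e.symm y)) (h := fun z : ℝ × Plane ↦ z.2 + z.1 • Z z.2)
      (hs _ h1) ((hdiff z hz).differentiableAt (by simp))]
    obtain ⟨d1, d2⟩ := mdifferentiableAt_pair (hΦ.contMDiffAt (x := e.symm (z.2 + z.1 • Z z.2)))
    exact (prodSymplectic_symm he h1 d1 d2 _ _).symm.trans (hL _ _ _)
  obtain ⟨H, hin, hout⟩ := isHamiltonianVariation_glueFamily (w := fun _ ↦ 0) hΦ hL he hK hC hCe hCK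
    hδ (B := B) (fun z hτ hz ↦ SmoothPairAt.comp (f := fun y ↦ Φ (e.symm y))
      (hs _ (hmem' z.1 hτ z.2 hz)) (hdiff z hz))
    (fun y hy ↦ by simp [hB]) (fun τ hτ y hy hyC ↦ by simp [hB, hZC y hy hyC])
    (fun z hτ hz ↦ hlag z hτ hz _ _) (fun _ _ ↦ contDiffAt_const) (fun _ _ _ ↦ rfl)
    (fun z hτ hz v ↦ by rw [hlag z hτ hz]; simp [dirDeriv])
  refine ⟨_, δ, H, hout, fun y hy v ↦ ?_⟩
  have hev : inChart (glueFamily Φ e B) e =ᶠ[𝓝 (0, y)] B := by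
    filter_upwards [continuousAt_snd.eventually (e.open_target.mem_nhds hy)] with z hz
      using hin z.1 z.2 hz
  have h0 : (0 : ℝ) ∈ Ioo (-δ) δ := ⟨by simpa using hδ, hδ⟩
  refine ⟨?_, by rw [pairArea_congr hev]; exact hlag (0, y) h0 hy _ _⟩
  have hz : ((0 : ℝ), y).2 + ((0 : ℝ), y).1 • Z ((0 : ℝ), y).2 = y := by simp
  rw [pairForm_congr hev, hB, pairForm_comp (f := fun y ↦ Φ (e.symm y))
    (h := fun z : ℝ × Plane ↦ z.2 + z.1 • Z z.2) (by rw [hz]; exact hs y hy)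
    ((hdiff (0, y) hy).differentiableAt (by simp)),
    (hasFDerivAt_shift (z := (0, y)) ((hZ y hy).differentiableAt (by simp))).fderiv]
  simp [timeDir]

end Tangential

/-! ### Normal Hamiltonian variations from Darboux coordinates -/

section Normal

open Filter Topology

/-- A strip `β(s, q)` around the curve `γ(s) = β(s, 0)` in Darboux coordinates, starting
orthogonally to the curve. -/
structure IsDarbouxStrip {M : Type*} [TopologicalSpace M] [ChartedSpace Plane M]
    [IsManifold (𝓡 2) ∞ M] {g : LorentzMetric M} (j : ParacomplexStructure g) (γ : ℝ → M)
    (β : ℝ × ℝ → M) (U : Set (ℝ × ℝ)) (I : Set ℝ) : Prop where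
  isOpen : IsOpen U
  mem (s : ℝ) : s ∈ I → (s, 0) ∈ U
  smooth (x : ℝ × ℝ) : x ∈ U → ContMDiffAt 𝓘(ℝ, ℝ × ℝ) (𝓡 2) ∞ β x
  apply_zero (s : ℝ) : s ∈ I → β (s, 0) = γ s
  area (x : ℝ × ℝ) : x ∈ U → pullArea j β (0, 1) (1, 0) x = 1
  orthogonal (s : ℝ) : s ∈ I → pullForm g β (0, 1) (1, 0) (s, 0) = 0

/-- The graph of a function over a coordinate curve. -/
def graphMap (i : Fin 2) (f : Plane → ℝ) (z : ℝ × Plane) : ℝ × ℝ := (z.2 i, z.1 * f z.2)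

theorem contDiffAt_graphMap (i : Fin 2) {f : Plane → ℝ} {z : ℝ × Plane}
    (hf : ContDiffAt ℝ ∞ f z.2) : ContDiffAt ℝ ∞ (graphMap i f) z :=
  (contDiffAt_coord contDiffAt_snd i).prodMk (contDiffAt_fst.mul (hf.comp z contDiffAt_snd))

theorem fderiv_graphMap (i : Fin 2) {f : Plane → ℝ} {z : ℝ × Plane}
    (hf : DifferentiableAt ℝ f z.2) (v : ℝ × Plane) :
    fderiv ℝ (graphMap i f) z v = (v.2 i, v.1 * f z.2 + z.1 * dirDeriv v.2 f z.2) := by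
  have h1 : HasFDerivAt (fun z : ℝ × Plane ↦ f z.2)
      ((fderiv ℝ f z.2).comp (ContinuousLinearMap.snd ℝ ℝ Plane)) z :=
    hf.hasFDerivAt.comp z hasFDerivAt_snd
  have h2 : HasFDerivAt (fun z : ℝ × Plane ↦ z.2 i)
      ((EuclideanSpace.proj i : Plane →L[ℝ] ℝ).comp (ContinuousLinearMap.snd ℝ ℝ Plane)) z :=
    ((EuclideanSpace.proj i : Plane →L[ℝ] ℝ).comp (ContinuousLinearMap.snd ℝ ℝ Plane)).hasFDerivAt
  have h3 := h2.prodMk (hasFDerivAt_fst.mul h1)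
  have h4 : fderiv ℝ (graphMap i f) z = _ := h3.fderiv
  rw [h4]
  simp [dirDeriv]
  ring

section Strip

variable {M : Type*} [TopologicalSpace M] [ChartedSpace Plane M] [IsManifold (𝓡 2) ∞ M]
  {g : LorentzMetric M} {j : ParacomplexStructure g} {γ : ℝ → M} {β : ℝ × ℝ → M}
  {U : Set (ℝ × ℝ)} {I : Set ℝ}

theorem IsDarbouxStrip.area_apply (H : IsDarbouxStrip j γ β U I) {x : ℝ × ℝ} (hx : x ∈ U)
    (v w : ℝ × ℝ) : pullArea j β v w x = v.2 * w.1 - v.1 * w.2 := by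
  obtain ⟨B, hB⟩ := pullArea_linear j β x
  have hs : ∀ v w, B v w = - B w v := fun v w ↦ by rw [hB, pullArea_skew, hB]
  have h1 := hs (1, 0) (1, 0)
  have h2 := hs (0, 1) (0, 1)
  have h3 := hs (1, 0) (0, 1)
  have h4 := H.area x hx
  have ha : ∀ a : ℝ × ℝ, a = a.1 • ((1 : ℝ), (0 : ℝ)) + a.2 • ((0 : ℝ), (1 : ℝ)) := by
    intro a
    ext <;> simp
  rw [← hB] at h4 ⊢
  rw [h4] at h3
  rw [ha v, ha w]
  simp only [map_add, map_smul, LinearMap.add_apply, LinearMap.smul_apply, smul_eq_mul, h4, h3,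
    show B (1, 0) (1, 0) = 0 by linarith, show B (0, 1) (0, 1) = 0 by linarith]
  simp
  ring

/-- In the strip the area form is `dq ∧ ds`, and on the graph `s = yᵢ`, `q = τ f(y)`. The pull-back
is thus explicit for all times, not only to first order. -/
theorem IsDarbouxStrip.pullArea_graph (H : IsDarbouxStrip j γ β U I) {i : Fin 2} {f : Plane → ℝ}
    {z : ℝ × Plane} (hf : DifferentiableAt ℝ f z.2)
    (hg : DifferentiableAt ℝ (graphMap i f) z) (hz : graphMap i f z ∈ U) (v w : ℝ × Plane) :
    pullArea j (fun z ↦ β (graphMap i f z)) v w z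
      = (v.1 * f z.2 + z.1 * dirDeriv v.2 f z.2) * w.2 i
        - v.2 i * (w.1 * f z.2 + z.1 * dirDeriv w.2 f z.2) := by
  rw [pullArea_comp j ((H.smooth _ hz).mdifferentiableAt (by simp)) hg, H.area_apply hz,
    fderiv_graphMap i hf, fderiv_graphMap i hf]

/-- At time `0` the velocity is `f ∂_q`, which is orthogonal to the curve because the strip starts
orthogonally. -/
theorem IsDarbouxStrip.pullForm_graph (H : IsDarbouxStrip j γ β U I) {i : Fin 2} {f : Plane → ℝ}
    {y : Plane} (hf : DifferentiableAt ℝ f y)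
    (hg : DifferentiableAt ℝ (graphMap i f) (0, y)) (hy : y i ∈ I) (v : Plane) :
    pullForm g (fun z ↦ β (graphMap i f z)) timeDir (0, v) (0, y) = 0 := by
  have h0 : graphMap i f (0, y) = (y i, 0) := by simp [graphMap]
  have hz : graphMap i f (0, y) ∈ U := h0 ▸ H.mem _ hy
  rw [pullForm_comp g ((H.smooth _ hz).mdifferentiableAt (by simp)) hg,
    fderiv_graphMap i hf, fderiv_graphMap i hf, h0]
  obtain ⟨B, hB⟩ := pullForm_linear g β (y i, 0)
  have h1 := H.orthogonal (y i) hy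
  rw [← hB] at h1 ⊢
  have e1 : ((timeDir.2 i : ℝ), timeDir.1 * f y + 0 * dirDeriv timeDir.2 f y)
      = f y • ((0 : ℝ), (1 : ℝ)) := by simp [timeDir]
  have e2 : (v i, 0 * f y + 0 * dirDeriv v f y) = v i • ((1 : ℝ), (0 : ℝ)) := by simp
  simp only [e1, e2, map_smul, LinearMap.smul_apply, h1, smul_zero]

end Strip

variable {M₁ M₂ S : Type*}
  [TopologicalSpace M₁] [ChartedSpace Plane M₁] [IsManifold (𝓡 2) ∞ M₁]
  [TopologicalSpace M₂] [ChartedSpace Plane M₂] [IsManifold (𝓡 2) ∞ M₂]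
  [TopologicalSpace S] [ChartedSpace Plane S] [IsManifold (𝓡 2) ∞ S] [T2Space S]
  {g₁ : LorentzMetric M₁} {g₂ : LorentzMetric M₂} {j₁ : ParacomplexStructure g₁}
  {j₂ : ParacomplexStructure g₂} {ε : ℝ}

/-- Every compactly supported function on a product of two curves is the Hamiltonian of a variation
whose velocity at time `0` is normal. -/
theorem exists_normal_variation (hε : ε * ε = 1) {Φ : S → M₁ × M₂}
    (hΦ : ContMDiff (𝓡 2) ((𝓡 2).prod (𝓡 2)) ∞ Φ) (hL : IsLagrangian j₁ j₂ ε Φ)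
    {e : OpenPartialHomeomorph S Plane} (he : IsSmoothChart e)
    {γ₁ : ℝ → M₁} {γ₂ : ℝ → M₂} {β₁ : ℝ × ℝ → M₁} {β₂ : ℝ × ℝ → M₂} {U₁ U₂ : Set (ℝ × ℝ)}
    {I₁ I₂ : Set ℝ} (hβ₁ : IsDarbouxStrip j₁ γ₁ β₁ U₁ I₁) (hβ₂ : IsDarbouxStrip j₂ γ₂ β₂ U₂ I₂)
    (hγ : ∀ y ∈ e.target, y 0 ∈ I₁ ∧ y 1 ∈ I₂ ∧ Φ (e.symm y) = (γ₁ (y 0), γ₂ (y 1)))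
    {K : Set S} (hK : IsCompact K)
    {C : Set Plane} (hC : IsCompact C) (hCe : C ⊆ e.target) (hCK : e.symm '' C ⊆ K)
    {w : Plane → ℝ} (hw : ∀ y ∈ e.target, ContDiffAt ℝ ∞ w y)
    (hwC : ∀ y ∈ e.target, y ∉ C → w y = 0) :
    ∃ F δ, IsHamiltonianVariation j₁ j₂ ε Φ F K δ ∧
      (∀ τ ∈ Ioo (-δ) δ, ∀ p ∉ e.symm '' C, F τ p = Φ p) ∧
      ∀ y ∈ e.target, ∀ v, pairForm g₁ g₂ ε (inChart F e) timeDir (0, v) (0, y) = 0 ∧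
        pairArea j₁ j₂ ε (inChart F e) timeDir (0, v) (0, y) = dirDeriv v w y := by
  -- On the product of the strips `Ω = dq₁ ∧ ds + ε dq₂ ∧ dt`. The choice `q₁ = τ ∂_s w`, `q₂ = ε τ
  -- ∂_t w` makes `q₁ ds + ε q₂ dt = τ dw`, since `ε² = 1`. The family consists of the graphs of `τ
  -- dw`, which are Lagrangian and have the Hamiltonian `w` at all times.
  set f₁ : Plane → ℝ := dirDeriv fstDir w with hf₁
  set f₂ : Plane → ℝ := fun y ↦ ε * dirDeriv sndDir w y with hf₂
  have sf₁ : ∀ y ∈ e.target, ContDiffAt ℝ ∞ f₁ y := fun y hy ↦ contDiffAt_dirDeriv (hw y hy) _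
  have sf₂ : ∀ y ∈ e.target, ContDiffAt ℝ ∞ f₂ y := fun y hy ↦
    contDiffAt_const.mul (contDiffAt_dirDeriv (hw y hy) _)
  have df₁ := fun y hy ↦ differentiableAt_of_smooth (sf₁ y hy)
  have df₂ := fun y hy ↦ differentiableAt_of_smooth (sf₂ y hy)
  have sg₁ : ∀ z : ℝ × Plane, z.2 ∈ e.target → ContDiffAt ℝ ∞ (graphMap 0 f₁) z := fun z hz ↦
    contDiffAt_graphMap 0 (sf₁ _ hz)
  have sg₂ : ∀ z : ℝ × Plane, z.2 ∈ e.target → ContDiffAt ℝ ∞ (graphMap 1 f₂) z := fun z hz ↦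
    contDiffAt_graphMap 1 (sf₂ _ hz)
  have dg₁ := fun z hz ↦ (sg₁ z hz).differentiableAt (by simp)
  have dg₂ := fun z hz ↦ (sg₂ z hz).differentiableAt (by simp)
  have hd0 : ∀ y ∈ e.target, y ∉ C → ∀ v, dirDeriv v w y = 0 := by
    intro y hy hyC v
    have : w =ᶠ[𝓝 y] fun _ ↦ 0 := by
      filter_upwards [e.open_target.mem_nhds hy, hC.isClosed.isOpen_compl.mem_nhds hyC] with x h1 h2
        using hwC x h1 h2
    rw [dirDeriv_congr this]
    simp [dirDeriv]
  have h00 : ∀ y ∈ e.target, graphMap 0 f₁ (0, y) ∈ U₁ ∧ graphMap 1 f₂ (0, y) ∈ U₂ := by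
    intro y hy
    simp only [graphMap, zero_mul]
    exact ⟨hβ₁.mem _ (hγ y hy).1, hβ₂.mem _ (hγ y hy).2.1⟩
  have hcg : ContinuousOn (fun z ↦ (graphMap 0 f₁ z, graphMap 1 f₂ z))
      ((univ : Set ℝ) ×ˢ e.target) := fun z hz ↦
    ((sg₁ z hz.2).continuousAt.prodMk (sg₂ z hz.2).continuousAt).continuousWithinAt
  obtain ⟨δ, hδ, hmem⟩ := exists_Ioo_forall_mem (hcg.isOpen_inter_preimage
    (isOpen_univ.prod e.open_target) (hβ₁.isOpen.prod hβ₂.isOpen)) hC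
    (fun y hy ↦ ⟨⟨trivial, hCe hy⟩, h00 y (hCe hy)⟩)
  have hout0 : ∀ τ : ℝ, ∀ y ∈ e.target, y ∉ C →
      graphMap 0 f₁ (τ, y) = (y 0, 0) ∧ graphMap 1 f₂ (τ, y) = (y 1, 0) := by
    intro τ y hy hyC
    simp [graphMap, hf₁, hf₂, hd0 y hy hyC]
  have hmem' : ∀ z : ℝ × Plane, z.1 ∈ Ioo (-δ) δ → z.2 ∈ e.target →
      graphMap 0 f₁ z ∈ U₁ ∧ graphMap 1 f₂ z ∈ U₂ := by
    rintro ⟨τ, y⟩ hτ hy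
    by_cases hyC : y ∈ C
    · exact (hmem τ hτ y hyC).2
    · rw [(hout0 τ y hy hyC).1, (hout0 τ y hy hyC).2]
      exact ⟨hβ₁.mem _ (hγ y hy).1, hβ₂.mem _ (hγ y hy).2.1⟩
  set B : ℝ × Plane → M₁ × M₂ := fun z ↦ (β₁ (graphMap 0 f₁ z), β₂ (graphMap 1 f₂ z)) with hB
  have harea : ∀ z : ℝ × Plane, z.1 ∈ Ioo (-δ) δ → z.2 ∈ e.target → ∀ v w,
      pairArea j₁ j₂ ε B v w z = _ + ε * _ := fun z hτ hz v w ↦ by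
    simp only [pairArea, hB, one_mul]
    rw [hβ₁.pullArea_graph (df₁ _ hz) (dg₁ z hz) (hmem' z hτ hz).1,
      hβ₂.pullArea_graph (df₂ _ hz) (dg₂ z hz) (hmem' z hτ hz).2]
  have hdf₂ : ∀ y ∈ e.target, ∀ v, dirDeriv v f₂ y = ε * dirDeriv v (dirDeriv sndDir w) y :=
    fun y hy v ↦
      dirDeriv_const_mul ε (differentiableAt_of_smooth (contDiffAt_dirDeriv (hw y hy) sndDir)) v
  obtain ⟨H, hin, hout⟩ := isHamiltonianVariation_glueFamily (w := w) hΦ hL he hK hC hCe hCK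
    hδ (B := B) (fun z hτ hz ↦
      ⟨ContMDiffAt.comp (I' := 𝓘(ℝ, ℝ × ℝ)) (g := β₁) (f := graphMap 0 f₁) z (hβ₁.smooth _ (hmem' z hτ hz).1)
        (sg₁ z hz).contMDiffAt,
      ContMDiffAt.comp (I' := 𝓘(ℝ, ℝ × ℝ)) (g := β₂) (f := graphMap 1 f₂) z (hβ₂.smooth _ (hmem' z hτ hz).2)
        (sg₂ z hz).contMDiffAt⟩)
    (fun y hy ↦ by
      simp only [hB, graphMap, zero_mul, (hγ y hy).2.2, hβ₁.apply_zero _ (hγ y hy).1,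
        hβ₂.apply_zero _ (hγ y hy).2.1])
    (fun τ hτ y hy hyC ↦ by
      simp only [hB, (hout0 τ y hy hyC).1, (hout0 τ y hy hyC).2, (hγ y hy).2.2,
        hβ₁.apply_zero _ (hγ y hy).1, hβ₂.apply_zero _ (hγ y hy).2.1])
    -- On the two coordinate vectors the form is `τ (ε² ∂_s∂_t w - ∂_t∂_s w)`.
    (fun z hτ hz ↦ by
      rw [harea z hτ hz, hdf₂ _ hz, hdf₂ _ hz]
      simp only [hf₁, fstDir, sndDir, PiLp.single_apply]
      simp only [← fstDir.eq_1, ← sndDir.eq_1]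
      rw [dirDeriv_comm (hw _ hz) sndDir fstDir]
      norm_num
      linear_combination z.1 * dirDeriv fstDir (dirDeriv sndDir w) z.2 * hε)
    hw hwC
    (fun z hτ hz v ↦ by
      rw [harea z hτ hz]
      simp only [hf₁, hf₂, timeDir]
      conv_rhs => rw [plane_eq_smul_add v, dirDeriv_add_vec, dirDeriv_smul_vec, dirDeriv_smul_vec]
      simp only [PiLp.zero_apply, dirDeriv, map_zero]
      linear_combination v 1 * fderiv ℝ w z.2 sndDir * hε)
  refine ⟨_, δ, H, hout, fun y hy v ↦ ?_⟩
  have hev : inChart (glueFamily Φ e B) e =ᶠ[𝓝 (0, y)] B := by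
    filter_upwards [continuousAt_snd.eventually (e.open_target.mem_nhds hy)] with z hz
      using hin z.1 z.2 hz
  have h0 : (0 : ℝ) ∈ Ioo (-δ) δ := ⟨by simpa using hδ, hδ⟩
  constructor
  · rw [pairForm_congr hev]
    simp only [pairForm, hB]
    rw [hβ₁.pullForm_graph (df₁ y hy) (dg₁ (0, y) hy) (hγ y hy).1,
      hβ₂.pullForm_graph (df₂ y hy) (dg₂ (0, y) hy) (hγ y hy).2.1]
    simp
  · rw [pairArea_congr hev, harea (0, y) h0 hy]
    simp only [hf₁, hf₂, timeDir]
    conv_rhs => rw [plane_eq_smul_add v, dirDeriv_add_vec, dirDeriv_smul_vec, dirDeriv_smul_vec]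
    simp only [PiLp.zero_apply]
    linear_combination v 1 * dirDeriv sndDir w y * hε

end Normal

/-! ### Local diffeomorphisms and primitives -/

section LocalDiffeo

open Filter Topology MeasureTheory

/-- The inverse function theorem for smooth maps, with smoothness on the whole domain. -/
theorem exists_local_diffeo {E : Type*} [NormedAddCommGroup E] [NormedSpace ℝ E]
    [FiniteDimensional ℝ E] {f : E → E} {a : E} (hf : ∀ᶠ x in 𝓝 a, ContDiffAt ℝ ∞ f x)
    (hinj : ∀ v, fderiv ℝ f a v = 0 → v = 0) {N : Set E} (hN : N ∈ 𝓝 a) :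
    ∃ P : OpenPartialHomeomorph E E, a ∈ P.source ∧ P.source ⊆ N ∧ (∀ x, P x = f x) ∧
      (∀ x ∈ P.source, ContDiffAt ℝ ∞ f x) ∧ ∀ y ∈ P.target, ContDiffAt ℝ ∞ P.symm y := by
  have : CompleteSpace E := FiniteDimensional.complete ℝ E
  have hfa := hf.self_of_nhds
  let L : E ≃L[ℝ] E := (LinearEquiv.ofInjectiveEndo (fderiv ℝ f a : E →ₗ[ℝ] E)
    ((injective_iff_map_eq_zero _).mpr hinj)).toContinuousLinearEquiv
  have hL : (L : E →L[ℝ] E) = fderiv ℝ f a := by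
    ext v
    rfl
  have hd : HasFDerivAt f (L : E →L[ℝ] E) a := by
    rw [hL]
    exact (hfa.differentiableAt (by simp)).hasFDerivAt
  have hev : ∀ᶠ x in 𝓝 a, fderiv ℝ f x ∈ range ((↑) : (E ≃L[ℝ] E) → E →L[ℝ] E) := by
    have hc : ContinuousAt (fderiv ℝ f) a :=
      (hfa.fderiv_right (m := ∞) (by simp)).continuousAt
    refine hc.eventually ?_
    rw [← hL]
    exact L.nhds
  -- The inverse is smooth at every point where the derivative is invertible, so the domain is
  -- shrunk to an open set on which this holds throughout.
  obtain ⟨V, hV, hVo, haV⟩ := mem_nhds_iff.mp (hf.and (hev.and hN))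
  let P₀ := hfa.toOpenPartialHomeomorph f hd (by simp)
  refine ⟨P₀.restrOpen V hVo, ⟨hfa.mem_toOpenPartialHomeomorph_source hd (by simp), haV⟩,
    fun x hx ↦ (hV hx.2).2.2, fun x ↦ rfl, fun x hx ↦ (hV hx.2).1, fun y hy ↦ ?_⟩
  have hy' := (P₀.restrOpen V hVo).map_target hy
  obtain ⟨L', hL'⟩ := (hV hy'.2).2.1
  refine (P₀.restrOpen V hVo).contDiffAt_symm (f₀' := L') hy ?_ (hV hy'.2).1
  rw [hL']
  exact ((hV hy'.2).1.differentiableAt (by simp)).hasFDerivAt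

/-- Primitives of smooth functions, with respect to the second variable. -/
theorem exists_smooth_primitive {f : ℝ × ℝ → ℝ} {s₀ : ℝ}
    (hf : ∀ᶠ x in 𝓝 (s₀, (0 : ℝ)), ContDiffAt ℝ ∞ f x) :
    ∃ h : ℝ × ℝ → ℝ, (∀ᶠ x in 𝓝 (s₀, (0 : ℝ)), ContDiffAt ℝ ∞ h x ∧
      HasDerivAt (fun η ↦ h (x.1, η)) (f x) x.2) ∧ ∀ s, h (s, 0) = 0 := by
  obtain ⟨r, hr, hball⟩ := Metric.mem_nhds_iff.mp hf
  set V : Set (ℝ × ℝ) := Metric.ball (s₀, 0) r with hV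
  have hVo : IsOpen V := Metric.isOpen_ball
  have hVf : ∀ x ∈ V, ContDiffAt ℝ ∞ f x := fun x hx ↦ hball hx
  -- The ball contains the segment from each of its points to the axis, so the integral runs inside
  -- the domain of smoothness.
  have hstar : ∀ x ∈ V, ∀ t : ℝ, |t| ≤ |x.2| → (x.1, t) ∈ V := by
    intro x hx t ht
    simp only [hV, Metric.mem_ball, Prod.dist_eq, max_lt_iff, Real.dist_eq, sub_zero] at hx ⊢
    exact ⟨hx.1, ht.trans_lt hx.2⟩
  -- Rescaling the interval to `[0, 1]` turns the variable limit into a parameter of the integrand,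
  -- and the primitive is smooth as a parametric integral.
  set D : (ℝ × ℝ) × ℝ → ℝ := fun z ↦ f (z.1.1, z.1.2 * z.2) with hD
  set U : Set ((ℝ × ℝ) × ℝ) := (fun z ↦ (z.1.1, z.1.2 * z.2)) ⁻¹' V with hU
  have hUo : IsOpen U := hVo.preimage (by fun_prop)
  have hDU : ContDiffOn ℝ ∞ D U := fun z hz ↦ by
    have h1 : ContDiffAt ℝ ∞ (fun z : (ℝ × ℝ) × ℝ ↦ (z.1.1, z.1.2 * z.2)) z := by fun_prop
    exact (ContDiffAt.comp (g := f) z (hVf _ hz) h1).contDiffWithinAt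
  have hT : ∀ x ∈ V, ∀ t ∈ Icc (0 : ℝ) 1, (x, t) ∈ U := fun x hx t ht ↦ by
    refine hstar x hx _ ?_
    rw [abs_mul, abs_of_nonneg ht.1]
    exact mul_le_of_le_one_right (abs_nonneg _) ht.2
  have hI : ∀ x, x.2 * (∫ t in Icc (0 : ℝ) 1, D (x, t)) = ∫ t in (0 : ℝ)..x.2, f (x.1, t) := by
    intro x
    rw [integral_Icc_eq_integral_Ioc, ← intervalIntegral.integral_of_le zero_le_one]
    have := intervalIntegral.smul_integral_comp_mul_left (a := 0) (b := 1) (fun t ↦ f (x.1, t)) x.2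
    simpa using this
  refine ⟨fun x ↦ x.2 * ∫ t in Icc (0 : ℝ) 1, D (x, t), ?_, fun s ↦ by simp⟩
  filter_upwards [hVo.mem_nhds (Metric.mem_ball_self hr)] with x hx
  constructor
  · refine contDiffAt_snd.mul (contDiffAt_infty.mpr fun n ↦ ?_)
    exact (contDiffOn_setIntegral isCompact_Icc hUo n hDU).contDiffAt
      ((isOpen_setOf_forall_mem_compact hUo isCompact_Icc).mem_nhds (hT x hx))
  · have hfc : ContinuousOn (fun t ↦ f (x.1, t)) {t | (x.1, t) ∈ V} := fun t ht ↦
      (ContinuousAt.comp (g := f) (f := fun t ↦ (x.1, t)) (hVf _ ht).continuousAt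
        (by fun_prop)).continuousWithinAt
    have ho : IsOpen {t | (x.1, t) ∈ V} := hVo.preimage (by fun_prop)
    have h1 : IntervalIntegrable (fun t ↦ f (x.1, t)) volume 0 x.2 := by
      refine ContinuousOn.intervalIntegrable (hfc.mono fun t ht ↦ hstar x hx t ?_)
      simpa using abs_sub_left_of_mem_uIcc ht
    have h2 := intervalIntegral.integral_hasDerivAt_right h1
      (hfc.stronglyMeasurableAtFilter ho x.2 hx) (hfc.continuousAt (ho.mem_nhds hx))
    refine h2.congr_of_eventuallyEq (Eventually.of_forall fun η ↦ ?_)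
    exact hI (x.1, η)

end LocalDiffeo

/-! ### Orthogonal fields along curves that are not null -/

section Strip

open Filter Topology

variable {M : Type*} [TopologicalSpace M] [ChartedSpace Plane M] [IsManifold (𝓡 2) ∞ M]

theorem eventually_slice_zero {p : ℝ × ℝ → Prop} {s₀ : ℝ} (h : ∀ᶠ x in 𝓝 (s₀, (0 : ℝ)), p x) :
    ∀ᶠ s in 𝓝 s₀, p (s, 0) :=
  (show Tendsto (fun s : ℝ ↦ (s, (0 : ℝ))) (𝓝 s₀) (𝓝 (s₀, 0)) from
    (by fun_prop : Continuous fun s : ℝ ↦ (s, (0 : ℝ))).continuousAt).eventually h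

/-- Along a curve which is not null there is a vector field, in coordinates, which is orthogonal to
the curve and not tangent to it. -/
theorem exists_orthogonal_field {g : LorentzMetric M} (j : ParacomplexStructure g) {x : M}
    {c : ℝ → Plane} {s₀ : ℝ} (hc : ∀ᶠ s in 𝓝 s₀, ContDiffAt ℝ ∞ c s)
    (hcx : c s₀ ∈ (chartAt Plane x).target)
    (hne : pullForm g (chartAt Plane x).symm (deriv c s₀) (deriv c s₀) (c s₀) ≠ 0) :
    ∃ N : ℝ → Plane, (∀ᶠ s in 𝓝 s₀, ContDiffAt ℝ ∞ N s ∧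
        pullForm g (chartAt Plane x).symm (N s) (deriv c s) (c s) = 0) ∧
      pullArea j (chartAt Plane x).symm (N s₀) (deriv c s₀) (c s₀) ≠ 0 := by
  set e := chartAt Plane x
  have lin : ∀ (y : Plane) (B : Plane →ₗ[ℝ] Plane →ₗ[ℝ] ℝ) (v w : Plane), B v w
      = v 0 * B fstDir w + v 1 * B sndDir w := fun y B v w ↦ by
    nth_rw 1 [plane_eq_smul_add v]
    simp
  have lin' : ∀ (y : Plane) (B : Plane →ₗ[ℝ] Plane →ₗ[ℝ] ℝ) (v w : Plane), B v w
      = w 0 * B v fstDir + w 1 * B v sndDir := fun y B v w ↦ by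
    nth_rw 1 [plane_eq_smul_add w]
    simp
  set p : Plane → ℝ → ℝ := fun b s ↦ deriv c s 0 * pullForm g e.symm b fstDir (c s)
    + deriv c s 1 * pullForm g e.symm b sndDir (c s) with hp
  have hpe : ∀ b s, pullForm g e.symm b (deriv c s) (c s) = p b s := by
    intro b s
    obtain ⟨B, hB⟩ := pullForm_linear g e.symm (c s)
    simp only [hp, ← hB]
    exact lin' (c s) B b _
  have hps : ∀ b, ∀ᶠ s in 𝓝 s₀, ContDiffAt ℝ ∞ (p b) s := by
    intro b
    filter_upwards [hc, hc.self_of_nhds.continuousAt.eventually (e.open_target.mem_nhds hcx)]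
      with s h1 h2
    have hd : ContDiffAt ℝ ∞ (deriv c) s := by
      have := (h1.fderiv_right (m := ∞) (by simp)).clm_apply (contDiffAt_const (c := (1 : ℝ)))
      exact this
    have hf := fun w ↦ (contDiffAt_pullForm g (chartAt_symm_contMDiffAt x h2) b w).comp s h1
    exact ((contDiffAt_coord hd 0).mul (hf fstDir)).add ((contDiffAt_coord hd 1).mul (hf sndDir))
  -- The covector `g(·, c')` has components `p₀`, `p₁`, and it annihilates `(-p₁, p₀)`.
  refine ⟨fun s ↦ (-p sndDir s) • fstDir + p fstDir s • sndDir, ?_, ?_⟩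
  · filter_upwards [hps fstDir, hps sndDir] with s h1 h2
    refine ⟨(h2.neg.smul contDiffAt_const).add (h1.smul contDiffAt_const), ?_⟩
    obtain ⟨B, hB⟩ := pullForm_linear g e.symm (c s)
    have e1 := hpe fstDir s
    have e2 := hpe sndDir s
    rw [← hB] at e1 e2 ⊢
    simp only [map_add, map_smul, LinearMap.add_apply, LinearMap.smul_apply, e1, e2, smul_eq_mul]
    ring
  · set V := deriv c s₀
    obtain ⟨A, hA⟩ := pullArea_linear j e.symm (c s₀)
    have hs : ∀ v w, A v w = - A w v := fun v w ↦ by rw [hA, pullArea_skew, hA]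
    have h1 : A fstDir fstDir = 0 := by linarith [hs fstDir fstDir]
    have h2 : A sndDir sndDir = 0 := by linarith [hs sndDir sndDir]
    have hA2 : ∀ v w, A v w = (v 0 * w 1 - v 1 * w 0) * A fstDir sndDir := by
      intro v w
      rw [lin 0 A v w, lin' 0 A fstDir w, lin' 0 A sndDir w, h1, h2, hs sndDir fstDir]
      ring
    obtain ⟨B, hB⟩ := pullForm_linear g e.symm (c s₀)
    -- The area form is not zero, since on `V` and `jV` it equals `-g(V, V)`.
    have hne' : A fstDir sndDir ≠ 0 := by
      intro h0
      obtain ⟨W, hW⟩ := exists_mfderiv_symm_eq contMDiffOn_chart contMDiffOn_chart_symm hcx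
        (j.endo (e.symm (c s₀)) (mfderiv (𝓡 2) (𝓡 2) e.symm (c s₀) V))
      have h3 := hA2 V W
      rw [h0, mul_zero, hA] at h3
      have h4 : pullArea j e.symm V W (c s₀) = - pullForm g e.symm V V (c s₀) := by
        rw [pullArea, pullForm, ← j.form_endo]
        exact congrArg _ hW
      exact hne (by rw [h4] at h3; linarith)
    have h5 : pullForm g e.symm V V (c s₀) = V 0 * p fstDir s₀ + V 1 * p sndDir s₀ := by
      rw [← hpe, ← hpe, ← hB, ← hB, ← hB]
      exact lin 0 B V V
    rw [← hA, hA2]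
    have h6 : ((-p sndDir s₀) • fstDir + p fstDir s₀ • sndDir) 0 = -p sndDir s₀ := by
      simp [fstDir, sndDir]
    have h7 : ((-p sndDir s₀) • fstDir + p fstDir s₀ • sndDir) 1 = p fstDir s₀ := by
      simp [fstDir, sndDir]
    rw [h6, h7]
    -- The remaining factor is `-p₁V₁ - p₀V₀ = -g(V, V)`.
    refine mul_ne_zero ?_ hne'
    rw [h5] at hne
    intro h8
    exact hne (by linarith)

end Strip

/-! ### Existence of Darboux strips -/

section StripExistence

open Filter Topology

variable {M : Type*} [TopologicalSpace M] [ChartedSpace Plane M] [IsManifold (𝓡 2) ∞ M]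

theorem fderiv_ruled {c N : ℝ → Plane} {x : ℝ × ℝ} (hc : DifferentiableAt ℝ c x.1)
    (hN : DifferentiableAt ℝ N x.1) (v : ℝ × ℝ) :
    fderiv ℝ (fun x : ℝ × ℝ ↦ c x.1 + x.2 • N x.1) x v
      = v.1 • deriv c x.1 + (x.2 • v.1 • deriv N x.1 + v.2 • N x.1) := by
  have h1 : HasFDerivAt (fun x : ℝ × ℝ ↦ c x.1) _ x := hc.hasFDerivAt.comp x hasFDerivAt_fst
  have h2 : HasFDerivAt (fun x : ℝ × ℝ ↦ N x.1) _ x := hN.hasFDerivAt.comp x hasFDerivAt_fst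
  have h3 := h1.add (hasFDerivAt_snd.smul h2)
  have h4 : fderiv ℝ (fun x : ℝ × ℝ ↦ c x.1 + x.2 • N x.1) x = _ := h3.fderiv
  rw [h4]
  simp

theorem fderiv_shear {h : ℝ × ℝ → ℝ} {x : ℝ × ℝ} (hh : DifferentiableAt ℝ h x) (v : ℝ × ℝ) :
    fderiv ℝ (fun x : ℝ × ℝ ↦ (x.1, h x)) x v = (v.1, fderiv ℝ h x v) := by
  have h1 : fderiv ℝ (fun x : ℝ × ℝ ↦ (x.1, h x)) x = _ :=
    (hasFDerivAt_fst.prodMk hh.hasFDerivAt).fderiv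
  rw [h1]
  simp

/-- Every curve which is not null starts a Darboux strip. -/
theorem exists_darbouxStrip {g : LorentzMetric M} (j : ParacomplexStructure g) {γ : ℝ → M} {s₀ : ℝ}
    (hγ : ∀ᶠ s in 𝓝 s₀, ContMDiffAt 𝓘(ℝ, ℝ) (𝓡 2) ∞ γ s) (hne : pullForm g γ 1 1 s₀ ≠ 0) :
    ∃ β U, ∃ I ∈ 𝓝 s₀, IsDarbouxStrip j γ β U I := by
  set e := chartAt Plane (γ s₀) with he
  set c : ℝ → Plane := fun s ↦ e (γ s) with hc
  have hsrc : ∀ᶠ s in 𝓝 s₀, γ s ∈ e.source := hγ.self_of_nhds.continuousAt.eventually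
    (e.open_source.mem_nhds (mem_chart_source Plane (γ s₀)))
  have hcs : ∀ᶠ s in 𝓝 s₀, ContDiffAt ℝ ∞ c s := by
    filter_upwards [hγ, hsrc] with s h1 h2 using contDiffAt_chart_comp h1 h2
  have hct : c s₀ ∈ e.target := e.map_source hsrc.self_of_nhds
  rw [pullForm_chart g hγ.self_of_nhds hsrc.self_of_nhds] at hne
  obtain ⟨N, hN, hN0⟩ := exists_orthogonal_field j hcs hct hne
  -- The strip is first ruled by the orthogonal field. Its area density `f` is then normalized to
  -- `1` by changing the transverse parameter.
  set B : ℝ × ℝ → Plane := fun x ↦ c x.1 + x.2 • N x.1 with hB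
  have hfst : Tendsto (fun x : ℝ × ℝ ↦ x.1) (𝓝 (s₀, 0)) (𝓝 s₀) := continuous_fst.continuousAt
  have hBs : ∀ᶠ x in 𝓝 (s₀, (0 : ℝ)), ContDiffAt ℝ ∞ B x := by
    filter_upwards [hfst.eventually hcs, hfst.eventually hN] with x h1 h2
    exact (h1.comp x contDiffAt_fst).add (contDiffAt_snd.smul (h2.1.comp x contDiffAt_fst))
  have hB0 : ∀ s, B (s, 0) = c s := fun s ↦ by simp [hB]
  have hBt : ∀ᶠ x in 𝓝 (s₀, (0 : ℝ)), B x ∈ e.target :=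
    hBs.self_of_nhds.continuousAt.eventually (e.open_target.mem_nhds (by rwa [hB0]))
  set b : ℝ × ℝ → M := fun x ↦ e.symm (B x) with hb
  have hbs : ∀ᶠ x in 𝓝 (s₀, (0 : ℝ)), ContMDiffAt 𝓘(ℝ, ℝ × ℝ) (𝓡 2) ∞ b x := by
    filter_upwards [hBs, hBt] with x h1 h2
    exact (chartAt_symm_contMDiffAt (γ s₀) h2).comp x h1.contMDiffAt
  set f : ℝ × ℝ → ℝ := pullArea j b (0, 1) (1, 0) with hf
  have hfs : ∀ᶠ x in 𝓝 (s₀, (0 : ℝ)), ContDiffAt ℝ ∞ f x := hbs.mono fun x hx ↦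
    contDiffAt_pullArea j hx _ _
  have hslice : ∀ᶠ s in 𝓝 s₀, pullForm g b (0, 1) (1, 0) (s, 0) = 0 ∧
      f (s, 0) = pullArea j e.symm (N s) (deriv c s) (c s) := by
    filter_upwards [hcs, hN, eventually_slice_zero hBs, eventually_slice_zero hBt]
      with s h1 h2 h3 h4
    have h5 := (chartAt_symm_contMDiffAt (γ s₀) h4).mdifferentiableAt (by simp)
    have h6 := fderiv_ruled (x := (s, 0)) (h1.differentiableAt (by simp))
      (h2.1.differentiableAt (by simp))
    have e1 : fderiv ℝ B (s, 0) (0, 1) = N s := by rw [h6]; simp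
    have e2 : fderiv ℝ B (s, 0) (1, 0) = deriv c s := by rw [h6]; simp
    rw [hf, hb, pullForm_comp g h5 (h3.differentiableAt (by simp)),
      pullArea_comp j h5 (h3.differentiableAt (by simp)), e1, e2, hB0]
    exact ⟨h2.2, rfl⟩
  have hf0 : f (s₀, 0) ≠ 0 := hslice.self_of_nhds.2 ▸ hN0
  -- With `h` the primitive of `f` in the transverse variable, the shear `(s, h)` multiplies the
  -- transverse vector by `f`, and the strip in the new coordinates has area density `1`.
  obtain ⟨h, hh, hh0⟩ := exists_smooth_primitive hfs
  have hder : ∀ᶠ x in 𝓝 (s₀, (0 : ℝ)), fderiv ℝ h x (0, 1) = f x := by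
    filter_upwards [hh] with x hx
    have h1 : HasDerivAt (fun η : ℝ ↦ (x.1, η)) ((0 : ℝ), (1 : ℝ)) x.2 :=
      (hasDerivAt_const _ _).prodMk (hasDerivAt_id _)
    exact ((hx.1.differentiableAt (by simp)).hasFDerivAt.comp_hasDerivAt (x := x.2)
      (f := fun η : ℝ ↦ (x.1, η)) h1).unique hx.2
  -- The primitive vanishes on the axis. The shear therefore fixes the curve and its tangent vector
  -- and only rescales the transverse vector there, so orthogonality is kept.
  have hder0 : ∀ᶠ s in 𝓝 s₀, fderiv ℝ h (s, 0) (1, 0) = 0 := by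
    filter_upwards [eventually_slice_zero hh] with s hs
    have h1 : HasDerivAt (fun η : ℝ ↦ (η, (0 : ℝ))) ((1 : ℝ), (0 : ℝ)) s :=
      (hasDerivAt_id _).prodMk (hasDerivAt_const _ _)
    have h2 := (hs.1.differentiableAt (by simp)).hasFDerivAt.comp_hasDerivAt (x := s)
      (f := fun η : ℝ ↦ (η, (0 : ℝ))) h1
    have h3 : (h ∘ fun η : ℝ ↦ (η, (0 : ℝ))) = fun _ ↦ 0 := funext hh0
    rw [h3] at h2
    exact h2.unique (hasDerivAt_const _ _)
  set Ψ : ℝ × ℝ → ℝ × ℝ := fun x ↦ (x.1, h x) with hΨ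
  have hall := hbs.and (hh.and (hder.and
    (hfs.self_of_nhds.continuousAt.eventually_ne hf0)))
  obtain ⟨P, hP0, hPN, hPΨ, hPs, hPt⟩ := exists_local_diffeo (f := Ψ) (a := (s₀, 0))
    (hh.mono fun x hx ↦ contDiffAt_fst.prodMk hx.1) (fun v hv ↦ by
      rw [fderiv_shear (hh.self_of_nhds.1.differentiableAt (by simp))] at hv
      have h1 : v.1 = 0 := congrArg Prod.fst hv
      have h2 : fderiv ℝ h (s₀, 0) v = 0 := congrArg Prod.snd hv
      have h3 : v = v.2 • ((0 : ℝ), (1 : ℝ)) := by ext <;> simp [h1]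
      rw [h3, map_smul, hder.self_of_nhds, smul_eq_mul] at h2
      rw [h3, (mul_eq_zero.mp h2).resolve_right hf0, zero_smul]) hall
  have hPN' : ∀ x ∈ P.source, ContMDiffAt 𝓘(ℝ, ℝ × ℝ) (𝓡 2) ∞ b x ∧
      (ContDiffAt ℝ ∞ h x ∧ HasDerivAt (fun η ↦ h (x.1, η)) (f x) x.2) ∧
      fderiv ℝ h x (0, 1) = f x ∧ f x ≠ 0 := fun x hx ↦ hPN hx
  set β : ℝ × ℝ → M := fun y ↦ b (P.symm y) with hβ
  have hβs : ∀ y ∈ P.target, ContMDiffAt 𝓘(ℝ, ℝ × ℝ) (𝓡 2) ∞ β y := fun y hy ↦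
    ContMDiffAt.comp (I' := 𝓘(ℝ, ℝ × ℝ)) (g := b) (f := P.symm) y
      (hPN' _ (P.map_target hy)).1 (hPt y hy).contMDiffAt
  have hbβ : ∀ x ∈ P.source, b =ᶠ[𝓝 x] fun x ↦ β (Ψ x) := by
    intro x hx
    filter_upwards [P.open_source.mem_nhds hx] with x' hx'
    rw [← hPΨ, hβ]
    simp only [P.left_inv hx']
  have hmem : ∀ x ∈ P.source, Ψ x ∈ P.target := fun x hx ↦ hPΨ x ▸ P.map_source hx
  have hΨ0 : ∀ s, Ψ (s, 0) = (s, 0) := fun s ↦ by simp [hΨ, hh0]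
  refine ⟨β, P.target, _, (eventually_slice_zero (P.open_source.mem_nhds hP0)).and
    (hslice.and (hder0.and hsrc)), P.open_target, ?_, hβs, ?_, ?_, ?_⟩
  · rintro s ⟨hs, -⟩
    rw [← hΨ0]
    exact hmem _ hs
  · rintro s ⟨hs, -, -, hs2⟩
    have h1 := P.left_inv hs
    rw [hPΨ, hΨ0] at h1
    simp only [hβ, h1, hb, hB0, hc]
    exact e.left_inv hs2
  · intro y hy
    have hx := P.map_target hy
    have hy' : Ψ (P.symm y) = y := by rw [← hPΨ, P.right_inv hy]
    obtain ⟨-, h2, h3, h4⟩ := hPN' _ hx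
    have h5 : f (P.symm y) = _ := pullArea_congr j (hbβ _ hx) (0, 1) (1, 0)
    -- The image of `∂_s` has an extra transverse component, which an alternating form does not see
    -- against the transverse vector. Cancelling `f` leaves density `1`.
    rw [pullArea_comp j ((hβs _ (hmem _ hx)).mdifferentiableAt (by simp))
      ((hPs _ hx).differentiableAt (by simp)), fderiv_shear (h2.1.differentiableAt (by simp)),
      fderiv_shear (h2.1.differentiableAt (by simp)), h3, hy'] at h5
    obtain ⟨A, hA⟩ := pullArea_linear j β y
    have hs : A (0, 1) (0, 1) = 0 := by
      have := pullArea_skew j β (0, 1) (0, 1) y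
      rw [← hA] at this
      linarith
    rw [← hA] at h5 ⊢
    have e1 : ((0 : ℝ), f (P.symm y)) = f (P.symm y) • ((0 : ℝ), (1 : ℝ)) := by simp
    have e2 : ((1 : ℝ), fderiv ℝ h (P.symm y) (1, 0))
        = (1, 0) + fderiv ℝ h (P.symm y) (1, 0) • ((0 : ℝ), (1 : ℝ)) := by simp
    simp only [e1, e2, map_smul, map_add, LinearMap.smul_apply, hs, smul_eq_mul, mul_zero,
      add_zero] at h5
    exact mul_left_cancel₀ h4 (by linarith)
  · rintro s ⟨hs, hs1, hs2, -⟩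
    obtain ⟨-, h2, h3, h4⟩ := hPN' _ hs
    have h5 := hs1.1
    rw [pullForm_congr g (hbβ _ hs), pullForm_comp g ((hβs _ (hmem _ hs)).mdifferentiableAt (by simp))
      ((hPs _ hs).differentiableAt (by simp)), fderiv_shear (h2.1.differentiableAt (by simp)),
      fderiv_shear (h2.1.differentiableAt (by simp)), h3, hs2, hΨ0] at h5
    obtain ⟨A, hA⟩ := pullForm_linear g β (s, 0)
    rw [← hA] at h5 ⊢
    have e1 : ((0 : ℝ), f (s, 0)) = f (s, 0) • ((0 : ℝ), (1 : ℝ)) := by simp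
    simp only [e1, map_smul, LinearMap.smul_apply, smul_eq_mul] at h5
    exact (mul_eq_zero.mp h5).resolve_left h4

end StripExistence

/-! ### Infinitesimal splitting of the immersion -/

section Splitting

theorem exists_eq_add_smul {V : Type*} [AddCommGroup V] [Module ℝ V]
    (hV : Module.finrank ℝ V = 2) {W₁ W₂ : Type*} [AddCommGroup W₁] [Module ℝ W₁]
    [AddCommGroup W₂] [Module ℝ W₂] {A : V →ₗ[ℝ] W₁} {B : V →ₗ[ℝ] W₂} {v₁ v₂ : V}
    (hB₁ : B v₁ = 0) (hA₂ : A v₂ = 0) (hA₁ : A v₁ ≠ 0) (hB₂ : B v₂ ≠ 0) (v : V) :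
    ∃ a b : ℝ, v = a • v₁ + b • v₂ := by
  have hli : LinearIndependent ℝ ![v₁, v₂] := by
    rw [LinearIndependent.pair_iff]
    intro s t hst
    have h1 := congrArg A hst
    have h2 := congrArg B hst
    simp only [map_add, map_smul, hA₂, hB₁, smul_zero, add_zero, zero_add, map_zero] at h1 h2
    exact ⟨(smul_eq_zero.mp h1).resolve_right hA₁, (smul_eq_zero.mp h2).resolve_right hB₂⟩
  have : FiniteDimensional ℝ V := Module.finite_of_finrank_eq_succ hV
  let b := basisOfLinearIndependentOfCardEqFinrank hli (by simp [hV])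
  refine ⟨b.repr v 0, b.repr v 1, ?_⟩
  have := b.sum_repr v
  rw [Fin.sum_univ_two] at this
  simpa [b] using this.symm

theorem exists_of_finrank_range_eq_one {V W : Type*} [AddCommGroup V] [Module ℝ V]
    (hV : Module.finrank ℝ V = 2) [AddCommGroup W] [Module ℝ W] {A : V →ₗ[ℝ] W}
    (hA : Module.finrank ℝ (LinearMap.range A) = 1) :
    (∃ v, v ≠ 0 ∧ A v = 0) ∧ ∃ w, A w ≠ 0 := by
  constructor
  · by_contra! h
    have hi : Function.Injective A := (injective_iff_map_eq_zero A).mpr fun v hv ↦ by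
      by_contra h0
      exact h v h0 hv
    rw [LinearMap.finrank_range_of_inj hi, hV] at hA
    omega
  · by_contra! h
    have : A = 0 := LinearMap.ext h
    rw [this, LinearMap.range_zero, finrank_bot] at hA
    omega

/-- A vector `v` in the kernel of `A` has `B v ≠ 0` by injectivity. Since `B` takes values in the
line through `B v`, a multiple of `v` can be subtracted from any `w` with `A w ≠ 0` to bring it into
the kernel of `B`. -/
theorem exists_splitting {V W₁ W₂ : Type*} [AddCommGroup V] [Module ℝ V]
    [AddCommGroup W₁] [Module ℝ W₁] [AddCommGroup W₂] [Module ℝ W₂] {A : V →ₗ[ℝ] W₁}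
    {B : V →ₗ[ℝ] W₂} (hinj : ∀ v, A v = 0 → B v = 0 → v = 0)
    (h : ∀ v w, A w = 0 → B w ≠ 0 → ∃ c : ℝ, c • B w = B v) (h₀ : ∃ v, v ≠ 0 ∧ A v = 0)
    (h₁ : ∃ w, A w ≠ 0) : ∃ v₁ v₂, B v₁ = 0 ∧ A v₂ = 0 ∧ A v₁ ≠ 0 ∧ B v₂ ≠ 0 := by
  obtain ⟨v, hv, hAv⟩ := h₀
  obtain ⟨w, hw⟩ := h₁
  have hBv : B v ≠ 0 := fun h0 ↦ hv (hinj v hAv h0)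
  obtain ⟨c, hc⟩ := h w v hAv hBv
  exact ⟨w - c • v, v, by simp [hc], hAv, by simpa [hAv] using hw, hBv⟩

variable {M : Type*} [TopologicalSpace M] [ChartedSpace Plane M] [IsManifold (𝓡 2) ∞ M]

/-- The area form is nondegenerate. If `v` and `w` were independent, `j v` would be orthogonal to a
basis, hence zero, although `j` is invertible. -/
theorem ParacomplexStructure.exists_smul_eq {g : LorentzMetric M} (j : ParacomplexStructure g)
    {x : M} {v w : TangentSpace (𝓡 2) x} (hv : v ≠ 0) (h : g.form x (j.endo x v) w = 0) :
    ∃ c : ℝ, c • v = w := by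
  by_contra! hne
  have hli : LinearIndependent ℝ ![v, w] := (LinearIndependent.pair_iff' hv).mpr hne
  have : FiniteDimensional ℝ (TangentSpace (𝓡 2) x) :=
    Module.finite_of_finrank_eq_succ (finrank_tangentPlane x)
  let b := basisOfLinearIndependentOfCardEqFinrank hli (by simp [finrank_tangentPlane x])
  have h0 : ∀ u, g.form x (j.endo x v) u = 0 := by
    intro u
    have h1 := b.sum_repr u
    rw [Fin.sum_univ_two] at h1
    rw [← h1]
    simp [b, h, j.form_endo_self]
  obtain ⟨u, hu⟩ := g.exists_pos x
  have h2 := g.smul_eq j hu.ne' (j.endo x v)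
  rw [g.symm x u (j.endo x v), h0, g.symm x (j.endo x u) (j.endo x v), h0, zero_smul, zero_smul,
    sub_zero] at h2
  have h3 : j.endo x v = 0 := (smul_eq_zero.mp h2).resolve_left hu.ne'
  apply hv
  rw [← j.endo_endo x v, h3, map_zero]

variable {M₁ M₂ S : Type*}
  [TopologicalSpace M₁] [ChartedSpace Plane M₁] [IsManifold (𝓡 2) ∞ M₁]
  [TopologicalSpace M₂] [ChartedSpace Plane M₂] [IsManifold (𝓡 2) ∞ M₂]
  [TopologicalSpace S] [ChartedSpace Plane S]
  {g₁ : LorentzMetric M₁} {g₂ : LorentzMetric M₂} {j₁ : ParacomplexStructure g₁}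
  {j₂ : ParacomplexStructure g₂} {ε : ℝ}

/-- A nondegenerate Lagrangian immersion of projected rank one is, infinitesimally, a product of two
curves which are not null. -/
theorem exists_tangent_splitting (hε : ε ≠ 0) {Φ : S → M₁ × M₂}
    (hΦ : IsNondegLagrangianImmersion j₁ j₂ ε Φ) (hrank : IsProjectedRankOne Φ) (p : S) :
    ∃ v₁ v₂ : TangentSpace (𝓡 2) p,
      mfderiv (𝓡 2) (𝓡 2) (fun q ↦ (Φ q).2) p v₁ = 0 ∧
      mfderiv (𝓡 2) (𝓡 2) (fun q ↦ (Φ q).1) p v₂ = 0 ∧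
      g₁.form (Φ p).1 (mfderiv (𝓡 2) (𝓡 2) (fun q ↦ (Φ q).1) p v₁)
        (mfderiv (𝓡 2) (𝓡 2) (fun q ↦ (Φ q).1) p v₁) ≠ 0 ∧
      g₂.form (Φ p).2 (mfderiv (𝓡 2) (𝓡 2) (fun q ↦ (Φ q).2) p v₂)
        (mfderiv (𝓡 2) (𝓡 2) (fun q ↦ (Φ q).2) p v₂) ≠ 0 := by
  have hinj := hΦ.injective p
  have hlag := hΦ.lagrangian p
  have hnd := hΦ.nondegenerate p
  have hr := hrank p
  simp only [prodSymplectic, prodEndo, prodMetric, pairDeriv, inducedMetric] at hlag hnd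
  have hinj' : ∀ v, mfderiv (𝓡 2) (𝓡 2) (fun q ↦ (Φ q).1) p v = 0 →
      mfderiv (𝓡 2) (𝓡 2) (fun q ↦ (Φ q).2) p v = 0 → v = 0 := by
    intro v h1 h2
    apply hinj
    simp only [pairDeriv, h1, h2, map_zero]
  clear hinj
  generalize mfderiv (𝓡 2) (𝓡 2) (fun q ↦ (Φ q).1) p = A at *
  generalize mfderiv (𝓡 2) (𝓡 2) (fun q ↦ (Φ q).2) p = B at *
  have hsplit : ∃ v₁ v₂, B v₁ = 0 ∧ A v₂ = 0 ∧ A v₁ ≠ 0 ∧ B v₂ ≠ 0 := by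
    rcases hr with hr | hr
    · obtain ⟨h0, h1⟩ := exists_of_finrank_range_eq_one (finrank_tangentPlane p) hr
      -- For `w` in the kernel of `dφ` the Lagrangian condition reads `ε ω₂(dψ w, dψ v) = 0`, so `dψ
      -- v` is a multiple of `dψ w`. Thus rank one of `dφ` forces rank one of `dψ`; the other case
      -- is symmetric.
      refine exists_splitting (A := A.toLinearMap) (B := B.toLinearMap) hinj'
        (fun v w hw hw' ↦ ?_) h0 h1
      have h2 := hlag w v
      have hw0 : A w = 0 := hw
      rw [hw0, map_zero, map_zero, zero_apply, zero_add] at h2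
      exact j₂.exists_smul_eq hw' ((mul_eq_zero.mp h2).resolve_left hε)
    · obtain ⟨h0, h1⟩ := exists_of_finrank_range_eq_one (finrank_tangentPlane p) hr
      obtain ⟨v₂, v₁, h⟩ := exists_splitting (A := B.toLinearMap) (B := A.toLinearMap)
        (fun v h h' ↦ hinj' v h' h) (fun v w hw hw' ↦ by
          have h2 := hlag w v
          have hw0 : B w = 0 := hw
          rw [hw0, map_zero, map_zero, zero_apply, mul_zero, add_zero] at h2
          exact j₁.exists_smul_eq hw' h2) h0 h1
      exact ⟨v₁, v₂, h.2.1, h.1, h.2.2.2, h.2.2.1⟩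
  obtain ⟨v₁, v₂, hB₁, hA₂, hA₁, hB₂⟩ := hsplit
  have hspan := exists_eq_add_smul (finrank_tangentPlane p) (A := A.toLinearMap)
    (B := B.toLinearMap) hB₁ hA₂ hA₁ hB₂
  -- The vectors `v₁` and `v₂` are orthogonal for the induced metric, since their images lie in
  -- different factors. If one of them were null, it would be in the radical.
  refine ⟨v₁, v₂, hB₁, hA₂, fun h0 ↦ ?_, fun h0 ↦ ?_⟩
  · apply hA₁
    rw [hnd v₁ fun w ↦ ?_, map_zero]
    obtain ⟨a, b, rfl⟩ := hspan w
    simp [hB₁, hA₂, h0]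
  · apply hB₂
    rw [hnd v₂ fun w ↦ ?_, map_zero]
    obtain ⟨a, b, rfl⟩ := hspan w
    simp [hB₁, hA₂, h0]

/-- The splitting of the tangent plane, in a chart. -/
theorem exists_coord_splitting (hε : ε ≠ 0) {Φ : S → M₁ × M₂}
    (hΦ : IsNondegLagrangianImmersion j₁ j₂ ε Φ) (hrank : IsProjectedRankOne Φ)
    {e : OpenPartialHomeomorph S Plane} (he : IsSmoothChart e) {y : Plane} (hy : y ∈ e.target) :
    ∃ v₁ v₂ : Plane,
      mfderiv (𝓡 2) (𝓡 2) (fun y ↦ (Φ (e.symm y)).2) y v₁ = 0 ∧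
      mfderiv (𝓡 2) (𝓡 2) (fun y ↦ (Φ (e.symm y)).1) y v₂ = 0 ∧
      pullForm g₁ (fun y ↦ (Φ (e.symm y)).1) v₁ v₁ y ≠ 0 ∧
      pullForm g₂ (fun y ↦ (Φ (e.symm y)).2) v₂ v₂ y ≠ 0 := by
  obtain ⟨w₁, w₂, h⟩ := exists_tangent_splitting hε hΦ hrank (e.symm y)
  obtain ⟨v₁, rfl⟩ := exists_mfderiv_symm_eq he.contMDiffOn he.contMDiffOn_symm hy w₁
  obtain ⟨v₂, rfl⟩ := exists_mfderiv_symm_eq he.contMDiffOn he.contMDiffOn_symm hy w₂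
  have hs₁ : MDifferentiableAt (𝓡 2) (𝓡 2) (fun q ↦ (Φ q).1) (e.symm y) :=
    (contMDiffAt_fst.comp _ hΦ.contMDiff.contMDiffAt).mdifferentiableAt (n := ∞) (by simp)
  have hs₂ : MDifferentiableAt (𝓡 2) (𝓡 2) (fun q ↦ (Φ q).2) (e.symm y) :=
    (contMDiffAt_snd.comp _ hΦ.contMDiff.contMDiffAt).mdifferentiableAt (n := ∞) (by simp)
  simp only [← mfderiv_comp_symm he hy hs₁, ← mfderiv_comp_symm he hy hs₂] at h
  exact ⟨v₁, v₂, h⟩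

end Splitting

/-! ### Arclength -/

section Arclength

open Filter Topology

variable {M : Type*} [TopologicalSpace M] [ChartedSpace Plane M] [IsManifold (𝓡 2) ∞ M]

/-- Parametrization of a curve by arclength. -/
theorem exists_arclength (g : LorentzMetric M) {γ : ℝ → M} {s₀ : ℝ}
    (hγ : ∀ᶠ s in 𝓝 s₀, ContMDiffAt 𝓘(ℝ, ℝ) (𝓡 2) ∞ γ s) (hne : pullForm g γ 1 1 s₀ ≠ 0) :
    ∃ (P : OpenPartialHomeomorph ℝ ℝ) (e : ℝ), s₀ ∈ P.source ∧ e * e = 1 ∧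
      (∀ s ∈ P.source, ContDiffAt ℝ ∞ P s ∧ deriv P s ≠ 0) ∧
      ∀ t ∈ P.target, ContMDiffAt 𝓘(ℝ, ℝ) (𝓡 2) ∞ (fun t ↦ γ (P.symm t)) t ∧
        pullForm g (fun t ↦ γ (P.symm t)) 1 1 t = e := by
  set q : ℝ → ℝ := pullForm g γ 1 1 with hq
  set e : ℝ := Real.sign (q s₀) with he
  have hee : e * e = 1 := by
    rcases lt_or_gt_of_ne hne with h | h
    · simp [he, Real.sign_of_neg h]
    · simp [he, Real.sign_of_pos h]
  have hqs : ∀ᶠ s in 𝓝 s₀, ContDiffAt ℝ ∞ q s := hγ.mono fun s hs ↦ contDiffAt_pullForm g hs _ _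
  have hpos : ∀ᶠ s in 𝓝 s₀, 0 < e * q s := by
    have hc : ContinuousAt (fun s ↦ e * q s) s₀ :=
      continuousAt_const.mul hqs.self_of_nhds.continuousAt
    refine hc.eventually (lt_mem_nhds ?_)
    exact Real.sign_mul_pos_of_ne_zero _ hne
  set l : ℝ → ℝ := fun s ↦ √(e * q s) with hl
  have hls : ∀ᶠ s in 𝓝 s₀, ContDiffAt ℝ ∞ l s := by
    filter_upwards [hqs, hpos] with s h1 h2 using (contDiffAt_const.mul h1).sqrt h2.ne'
  have hshift : Tendsto (fun x : ℝ × ℝ ↦ x.2 + s₀) (𝓝 (s₀, 0)) (𝓝 s₀) := by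
    have : Continuous fun x : ℝ × ℝ ↦ x.2 + s₀ := by fun_prop
    simpa using this.tendsto (s₀, 0)
  -- The primitive is provided in a second variable starting at `0`. The length element is shifted
  -- by `s₀`, and the first variable is idle.
  obtain ⟨h, hh, -⟩ := exists_smooth_primitive (f := fun x ↦ l (x.2 + s₀)) (s₀ := s₀)
    ((hshift.eventually hls).mono fun x hx ↦
      ContDiffAt.comp (g := l) (f := fun x : ℝ × ℝ ↦ x.2 + s₀) x hx (by fun_prop))
  set H : ℝ → ℝ := fun s ↦ h (s₀, s - s₀) with hH
  have hback : Tendsto (fun s : ℝ ↦ (s₀, s - s₀)) (𝓝 s₀) (𝓝 (s₀, 0)) := by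
    have : Continuous fun s : ℝ ↦ (s₀, s - s₀) := by fun_prop
    simpa using this.tendsto s₀
  have hHs : ∀ᶠ s in 𝓝 s₀, ContDiffAt ℝ ∞ H s ∧ HasDerivAt H (l s) s := by
    filter_upwards [hback.eventually hh] with s hs
    refine ⟨ContDiffAt.comp (g := h) (f := fun s : ℝ ↦ (s₀, s - s₀)) s hs.1 (by fun_prop), ?_⟩
    have h1 := hs.2
    simp only [sub_add_cancel] at h1
    exact h1.comp_sub_const s s₀
  obtain ⟨P, hP0, hPN, hPH, -, hPt⟩ := exists_local_diffeo (hHs.mono fun s hs ↦ hs.1)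
    (fun v hv ↦ by
      have h1 := hHs.self_of_nhds.2.hasFDerivAt.fderiv
      rw [h1] at hv
      have h2 : v * l s₀ = 0 := hv
      exact (mul_eq_zero.mp h2).resolve_right (Real.sqrt_pos.mpr hpos.self_of_nhds).ne')
    (hHs.and (hpos.and hγ))
  have hPN' : ∀ s ∈ P.source, (ContDiffAt ℝ ∞ H s ∧ HasDerivAt H (l s) s) ∧ 0 < e * q s ∧
    ContMDiffAt 𝓘(ℝ, ℝ) (𝓡 2) ∞ γ s := fun s hs ↦ hPN hs
  have hPe : (P : ℝ → ℝ) = H := funext hPH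
  refine ⟨P, e, hP0, hee, fun s hs ↦ ?_, fun t ht ↦ ?_⟩
  · obtain ⟨h1, h2, h3⟩ := hPN' s hs
    rw [hPe, h1.2.deriv]
    exact ⟨h1.1, (Real.sqrt_pos.mpr h2).ne'⟩
  · obtain ⟨h1, h2, h3⟩ := hPN' _ (P.map_target ht)
    refine ⟨ContMDiffAt.comp (I' := 𝓘(ℝ, ℝ)) (g := γ) (f := P.symm) t h3 (hPt t ht).contMDiffAt, ?_⟩
    have hd : HasDerivAt P.symm (l (P.symm t))⁻¹ t :=
      P.hasDerivAt_symm ht (Real.sqrt_pos.mpr h2).ne' (hPe ▸ h1.2)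
    have h4 : fderiv ℝ P.symm t 1 = (l (P.symm t))⁻¹ • (1 : ℝ) := by
      rw [hd.hasFDerivAt.fderiv]
      simp
    rw [pullForm_comp g (h3.mdifferentiableAt (by simp)) hd.differentiableAt, h4]
    obtain ⟨A, hA⟩ := pullForm_linear g γ (P.symm t)
    have h5 : A 1 1 = q (P.symm t) := hA 1 1
    have h6 : l (P.symm t) * l (P.symm t) = e * q (P.symm t) := Real.mul_self_sqrt h2.le
    have h7 : l (P.symm t) ≠ 0 := (Real.sqrt_pos.mpr h2).ne'
    rw [← hA]
    have h8 : q (P.symm t) = e * (l (P.symm t) * l (P.symm t)) := by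
      rw [h6, ← mul_assoc, hee, one_mul]
    rw [map_smul, map_smul, LinearMap.smul_apply, h5, h8, smul_eq_mul, smul_eq_mul]
    field_simp

end Arclength

/-! ### Coordinates that separate two maps of rank one -/

section ProductCoordinates

open Filter Topology

/-- The function is constant along the segment, which lies in the convex set. Only the derivative in
the direction of the segment is needed. -/
theorem eq_of_fderiv_sub_eq_zero {h : Plane → Plane} {B : Set Plane} (hB : Convex ℝ B) {x x' : Plane}
    (hx : x ∈ B) (hx' : x' ∈ B)
    (hh : ∀ z ∈ B, DifferentiableAt ℝ h z ∧ fderiv ℝ h z (x - x') = 0) : h x = h x' := by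
  have h1 : ∀ t ∈ Icc (0 : ℝ) 1, HasDerivAt (fun t : ℝ ↦ h (x' + t • (x - x'))) 0 t := by
    intro t ht
    have hz : x' + t • (x - x') ∈ B := hB.add_smul_sub_mem hx' hx ht
    have h2 : HasDerivAt (fun t : ℝ ↦ x' + t • (x - x')) (x - x') t := by
      simpa using ((hasDerivAt_id t).smul_const (x - x')).const_add x'
    have h3 := (hh _ hz).1.hasFDerivAt.comp_hasDerivAt t h2
    rwa [(hh _ hz).2] at h3
  have h4 := constant_of_has_deriv_right_zero
    (fun t ht ↦ (h1 t ht).continuousAt.continuousWithinAt)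
    (fun t ht ↦ (h1 t ⟨ht.1, ht.2.le⟩).hasDerivWithinAt) 1 (by simp)
  simpa using h4

/-- The point with given coordinates. -/
def planePoint (s t : ℝ) : Plane := s • fstDir + t • sndDir

@[simp] theorem planePoint_zero (s t : ℝ) : planePoint s t 0 = s := by
  simp [planePoint, fstDir, sndDir]

@[simp] theorem planePoint_one (s t : ℝ) : planePoint s t 1 = t := by
  simp [planePoint, fstDir, sndDir]

theorem planePoint_eta (v : Plane) : planePoint (v 0) (v 1) = v := (plane_eq_smul_add v).symm

theorem planePoint_eq_zero {s t : ℝ} (h : planePoint s t = 0) : s = 0 ∧ t = 0 := by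
  have h0 := congrArg (fun v : Plane ↦ v 0) h
  have h1 := congrArg (fun v : Plane ↦ v 1) h
  simpa using And.intro h0 h1

theorem contDiffAt_planePoint {E : Type*} [NormedAddCommGroup E] [NormedSpace ℝ E] {a b : E → ℝ}
    {z : E} (ha : ContDiffAt ℝ ∞ a z) (hb : ContDiffAt ℝ ∞ b z) :
    ContDiffAt ℝ ∞ (fun z ↦ planePoint (a z) (b z)) z :=
  (ha.smul contDiffAt_const).add (hb.smul contDiffAt_const)

theorem fderiv_planePoint {E : Type*} [NormedAddCommGroup E] [NormedSpace ℝ E] {a b : E → ℝ}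
    {z : E} (ha : DifferentiableAt ℝ a z) (hb : DifferentiableAt ℝ b z) (v : E) :
    fderiv ℝ (fun z ↦ planePoint (a z) (b z)) z v
      = planePoint (fderiv ℝ a z v) (fderiv ℝ b z v) := by
  have h := ((ha.hasFDerivAt.smul_const fstDir).add (hb.hasFDerivAt.smul_const sndDir)).fderiv
  have h' : fderiv ℝ (fun z ↦ planePoint (a z) (b z)) z = _ := h
  rw [h']
  simp [planePoint]

theorem dist_planePoint_le_left (x z : Plane) : dist (planePoint (x 0) (z 1)) z ≤ dist x z := by
  rw [EuclideanSpace.dist_eq, EuclideanSpace.dist_eq]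
  apply Real.sqrt_le_sqrt
  simp [Fin.sum_univ_two]

theorem dist_planePoint_le_right (x z : Plane) : dist (planePoint (z 0) (x 1)) z ≤ dist x z := by
  rw [EuclideanSpace.dist_eq, EuclideanSpace.dist_eq]
  apply Real.sqrt_le_sqrt
  simp [Fin.sum_univ_two]

/-- Two maps of the plane with complementary kernels of dimension one are functions of the first and of
the second coordinate, in suitable coordinates. -/
theorem exists_product_coordinates {φ ψ : Plane → Plane} {y₀ : Plane}
    (hs : ∀ᶠ y in 𝓝 y₀, ContDiffAt ℝ ∞ φ y ∧ ContDiffAt ℝ ∞ ψ y)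
    (hsplit : ∀ᶠ y in 𝓝 y₀, ∃ v₁ v₂, fderiv ℝ ψ y v₁ = 0 ∧ fderiv ℝ φ y v₂ = 0 ∧
      fderiv ℝ φ y v₁ ≠ 0 ∧ fderiv ℝ ψ y v₂ ≠ 0) :
    ∃ P : OpenPartialHomeomorph Plane Plane, y₀ ∈ P.source ∧
      (∀ y ∈ P.source, ContDiffAt ℝ ∞ P y) ∧ (∀ x ∈ P.target, ContDiffAt ℝ ∞ P.symm x) ∧
      ∀ᶠ y in 𝓝 y₀, φ y = φ (P.symm (planePoint (P y 0) (P y₀ 1))) ∧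
        ψ y = ψ (P.symm (planePoint (P y₀ 0) (P y 1))) := by
  have hfin : Module.finrank ℝ Plane = 2 := finrank_euclideanSpace_fin
  obtain ⟨v₁, v₂, hψ₁, hφ₂, hφ₁, hψ₂⟩ := hsplit.self_of_nhds
  have hcoord : ∀ v : Plane, v ≠ 0 → ∃ i, v i ≠ 0 := by
    intro v hv
    by_contra! h
    exact hv (by ext i; simpa using h i)
  -- At the base point one component of each map already sees the complementary directions. These
  -- two components together form a local diffeomorphism.
  obtain ⟨a, ha⟩ := hcoord _ hφ₁
  obtain ⟨b, hb⟩ := hcoord _ hψ₂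
  set Θ : Plane → Plane := fun y ↦ planePoint (φ y a) (ψ y b) with hΘ
  have hΘd : ∀ y, ContDiffAt ℝ ∞ φ y → ContDiffAt ℝ ∞ ψ y → ∀ v,
      fderiv ℝ Θ y v = planePoint (fderiv ℝ φ y v a) (fderiv ℝ ψ y v b) := by
    intro y h1 h2 v
    rw [hΘ, fderiv_planePoint ((contDiffAt_coord h1 a).differentiableAt (by simp))
      ((contDiffAt_coord h2 b).differentiableAt (by simp)),
      fderiv_apply_coord (h1.differentiableAt (by simp)),
      fderiv_apply_coord (h2.differentiableAt (by simp))]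
    rfl
  obtain ⟨P, hP0, hPN, hPΘ, hPs, hPt⟩ := exists_local_diffeo (f := Θ) (a := y₀)
    (hs.mono fun y hy ↦ contDiffAt_planePoint (contDiffAt_coord hy.1 a) (contDiffAt_coord hy.2 b))
    (fun v hv ↦ by
      obtain ⟨α, β, rfl⟩ := exists_eq_add_smul hfin (A := (fderiv ℝ φ y₀).toLinearMap)
        (B := (fderiv ℝ ψ y₀).toLinearMap) hψ₁ hφ₂ hφ₁ hψ₂ v
      rw [hΘd y₀ hs.self_of_nhds.1 hs.self_of_nhds.2] at hv
      have h := planePoint_eq_zero hv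
      simp only [map_add, map_smul, hφ₂, hψ₁, smul_zero, add_zero, zero_add, PiLp.smul_apply,
        smul_eq_mul] at h
      rw [(mul_eq_zero.mp h.1).resolve_right ha, (mul_eq_zero.mp h.2).resolve_right hb]
      simp) (hs.and hsplit)
  have hPe : (P : Plane → Plane) = Θ := funext hPΘ
  have hPN' : ∀ y ∈ P.source, (ContDiffAt ℝ ∞ φ y ∧ ContDiffAt ℝ ∞ ψ y) ∧
      ∃ v₁ v₂, fderiv ℝ ψ y v₁ = 0 ∧ fderiv ℝ φ y v₂ = 0 ∧ fderiv ℝ φ y v₁ ≠ 0 ∧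
      fderiv ℝ ψ y v₂ ≠ 0 := fun y hy ↦ hPN hy
  have hker : ∀ x ∈ P.target, ∀ v,
      fderiv ℝ P (P.symm x) (fderiv ℝ P.symm x v) = v := by
    intro x hx v
    have h1 : (fun x ↦ P (P.symm x)) =ᶠ[𝓝 x] id := by
      filter_upwards [P.open_target.mem_nhds hx] with x' hx' using P.right_inv hx'
    have h2 := fderiv_comp x (g := P) (f := P.symm)
      ((hPe ▸ hPs _ (P.map_target hx)).differentiableAt (by simp))
      ((hPt x hx).differentiableAt (by simp))
    have h3 : fderiv ℝ (P ∘ P.symm) x = ContinuousLinearMap.id ℝ Plane := by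
      rw [← fderiv_id (x := x)]
      exact h1.fderiv_eq
    rw [h3] at h2
    exact (congrArg (fun L : Plane →L[ℝ] Plane ↦ L v) h2).symm
  have hinj : ∀ y ∈ P.source, ∀ v, fderiv ℝ P y v = 0 → v = 0 := by
    intro y hy v hv
    have h1 : (fun y ↦ P.symm (P y)) =ᶠ[𝓝 y] id := by
      filter_upwards [P.open_source.mem_nhds hy] with y' hy' using P.left_inv hy'
    have h2 := fderiv_comp y (g := P.symm) (f := P)
      ((hPt _ (P.map_source hy)).differentiableAt (by simp))
      ((hPe ▸ hPs _ hy).differentiableAt (by simp))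
    have h3 : fderiv ℝ (P.symm ∘ P) y = ContinuousLinearMap.id ℝ Plane := by
      rw [← fderiv_id (x := y)]
      exact h1.fderiv_eq
    rw [h3] at h2
    have h4 := congrArg (fun L : Plane →L[ℝ] Plane ↦ L v) h2
    simpa [hv] using h4
  -- The second coordinate vector is mapped to a vector on which the chosen component of `φ` has
  -- derivative zero. On the complement of the kernel of `dφ` that component is injective, so the
  -- whole derivative of `φ` vanishes on it; likewise for `ψ`.
  have hzero : ∀ x ∈ P.target, (∀ t : ℝ, fderiv ℝ (fun x ↦ φ (P.symm x)) x (t • sndDir) = 0) ∧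
      ∀ t : ℝ, fderiv ℝ (fun x ↦ ψ (P.symm x)) x (t • fstDir) = 0 := by
    intro x hx
    have hy := P.map_target hx
    obtain ⟨⟨hφs, hψs⟩, w₁, w₂, k1, k2, k3, k4⟩ := hPN' _ hy
    have hd : ∀ v, fderiv ℝ P (P.symm x) v
        = planePoint (fderiv ℝ φ (P.symm x) v a) (fderiv ℝ ψ (P.symm x) v b) := by
      rw [hPe]
      exact hΘd _ hφs hψs
    have hw₁ : fderiv ℝ φ (P.symm x) w₁ a ≠ 0 := by
      intro h0
      have := hinj _ hy w₁ (by rw [hd, h0, k1]; simp [planePoint])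
      exact k3 (by rw [this, map_zero])
    have hw₂ : fderiv ℝ ψ (P.symm x) w₂ b ≠ 0 := by
      intro h0
      have := hinj _ hy w₂ (by rw [hd, h0, k2]; simp [planePoint])
      exact k4 (by rw [this, map_zero])
    have hspan := exists_eq_add_smul hfin (A := (fderiv ℝ φ (P.symm x)).toLinearMap)
        (B := (fderiv ℝ ψ (P.symm x)).toLinearMap) k1 k2 k3 k4
    have e1 : ∀ v, fderiv ℝ (fun x ↦ φ (P.symm x)) x v
        = fderiv ℝ φ (P.symm x) (fderiv ℝ P.symm x v) := fun v ↦ by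
      have := fderiv_comp x (g := φ) (f := P.symm) (hφs.differentiableAt (by simp))
        ((hPt x hx).differentiableAt (by simp))
      exact congrArg (fun L : Plane →L[ℝ] Plane ↦ L v) this
    have e2 : ∀ v, fderiv ℝ (fun x ↦ ψ (P.symm x)) x v
        = fderiv ℝ ψ (P.symm x) (fderiv ℝ P.symm x v) := fun v ↦ by
      have := fderiv_comp x (g := ψ) (f := P.symm) (hψs.differentiableAt (by simp))
        ((hPt x hx).differentiableAt (by simp))
      exact congrArg (fun L : Plane →L[ℝ] Plane ↦ L v) this
    constructor
    · intro t
      obtain ⟨α, β, hαβ⟩ := hspan (fderiv ℝ P.symm x sndDir)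
      have h1 := congrArg (fun v : Plane ↦ v 0) (hker x hx sndDir)
      rw [hd, hαβ] at h1
      simp only [map_add, map_smul, k2, smul_zero, add_zero, planePoint_zero, PiLp.smul_apply,
        smul_eq_mul] at h1
      have h2 : α = 0 := (mul_eq_zero.mp (h1.trans (by simp [sndDir]))).resolve_right hw₁
      rw [e1, map_smul, hαβ, h2]
      simp [k2]
    · intro t
      obtain ⟨α, β, hαβ⟩ := hspan (fderiv ℝ P.symm x fstDir)
      have h1 := congrArg (fun v : Plane ↦ v 1) (hker x hx fstDir)
      rw [hd, hαβ] at h1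
      simp only [map_add, map_smul, k1, smul_zero, zero_add, planePoint_one, PiLp.smul_apply,
        smul_eq_mul] at h1
      have h2 : β = 0 := (mul_eq_zero.mp (h1.trans (by simp [fstDir]))).resolve_right hw₂
      rw [e2, map_smul, hαβ, h2]
      simp [k1]
  refine ⟨P, hP0, hPe ▸ hPs, hPt, ?_⟩
  -- Replacing one coordinate of a point of the ball by that of the centre brings it closer to the
  -- centre, so the segments parallel to the axes stay in the ball.
  obtain ⟨r, hr, hball⟩ := Metric.isOpen_iff.mp P.open_target _ (P.map_source hP0)
  filter_upwards [P.open_source.mem_nhds hP0,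
    (P.continuousAt hP0).eventually (Metric.ball_mem_nhds _ hr)] with y hy hyr
  have hdiff : ∀ x ∈ Metric.ball (P y₀) r, DifferentiableAt ℝ (fun x ↦ φ (P.symm x)) x ∧
      DifferentiableAt ℝ (fun x ↦ ψ (P.symm x)) x := fun x hx ↦
    ⟨((hPN' _ (P.map_target (hball hx))).1.1.differentiableAt (by simp)).comp x
      ((hPt x (hball hx)).differentiableAt (by simp)),
    ((hPN' _ (P.map_target (hball hx))).1.2.differentiableAt (by simp)).comp x
      ((hPt x (hball hx)).differentiableAt (by simp))⟩
  constructor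
  · have h1 := eq_of_fderiv_sub_eq_zero (h := fun x ↦ φ (P.symm x)) (convex_ball (P y₀) r) hyr
      (Metric.mem_ball.mpr ((dist_planePoint_le_left (P y) (P y₀)).trans_lt hyr))
      (fun z hz ↦ ⟨(hdiff z hz).1, by
        have : P y - planePoint (P y 0) (P y₀ 1) = (P y 1 - P y₀ 1) • sndDir := by
          nth_rw 1 [← planePoint_eta (P y)]
          simp only [planePoint]
          module
        rw [this]
        exact (hzero z (hball hz)).1 _⟩)
    simpa only [P.left_inv hy] using h1
  · have h1 := eq_of_fderiv_sub_eq_zero (h := fun x ↦ ψ (P.symm x)) (convex_ball (P y₀) r) hyr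
      (Metric.mem_ball.mpr ((dist_planePoint_le_right (P y) (P y₀)).trans_lt hyr))
      (fun z hz ↦ ⟨(hdiff z hz).2, by
        have : P y - planePoint (P y₀ 0) (P y 1) = (P y 0 - P y₀ 0) • fstDir := by
          nth_rw 1 [← planePoint_eta (P y)]
          simp only [planePoint]
          module
        rw [this]
        exact (hzero z (hball hz)).2 _⟩)
    simpa only [P.left_inv hy] using h1

end ProductCoordinates

/-! ### Adapted charts -/

section AdaptedCharts

open Filter Topology

variable {M₁ M₂ S : Type*}
  [TopologicalSpace M₁] [ChartedSpace Plane M₁] [IsManifold (𝓡 2) ∞ M₁]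
  [TopologicalSpace M₂] [ChartedSpace Plane M₂] [IsManifold (𝓡 2) ∞ M₂]
  [TopologicalSpace S] [ChartedSpace Plane S]

/-- A chart in which `Φ` is a product of two curves, parametrized by arclength. -/
structure IsAdaptedChart (g₁ : LorentzMetric M₁) (g₂ : LorentzMetric M₂) (ε : ℝ) (Φ : S → M₁ × M₂)
    (e : OpenPartialHomeomorph S Plane) (γ₁ : ℝ → M₁) (γ₂ : ℝ → M₂) (e₁ e₂ : ℝ) : Prop where
  smooth : IsSmoothChart e
  sign_fst : e₁ * e₁ = 1
  sign_snd : e₂ * e₂ = 1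
  smooth_fst (y : Plane) : y ∈ e.target → ContMDiffAt 𝓘(ℝ, ℝ) (𝓡 2) ∞ γ₁ (y 0)
  smooth_snd (y : Plane) : y ∈ e.target → ContMDiffAt 𝓘(ℝ, ℝ) (𝓡 2) ∞ γ₂ (y 1)
  form_fst (y : Plane) : y ∈ e.target → pullForm g₁ γ₁ 1 1 (y 0) = e₁
  form_snd (y : Plane) : y ∈ e.target → ε * pullForm g₂ γ₂ 1 1 (y 1) = e₂
  eq (y : Plane) : y ∈ e.target → Φ (e.symm y) = (γ₁ (y 0), γ₂ (y 1))

theorem fderiv_chart_comp {M : Type*} [TopologicalSpace M] [ChartedSpace Plane M]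
    [IsManifold (𝓡 2) ∞ M] {f : Plane → M} {y : Plane} {x : M}
    (hf : ContMDiffAt (𝓡 2) (𝓡 2) ∞ f y) (hx : f y ∈ (chartAt Plane x).source) (v : Plane) :
    fderiv ℝ (fun y ↦ chartAt Plane x (f y)) y v
      = mfderiv (𝓡 2) (𝓡 2) (chartAt Plane x) (f y) (mfderiv (𝓡 2) (𝓡 2) f y v) := by
  have := mfderiv_comp y (I' := 𝓡 2) ((chartAt_contMDiffAt x hx).mdifferentiableAt (by simp))
    (hf.mdifferentiableAt (by simp))
  have h : fderiv ℝ (fun y ↦ chartAt Plane x (f y)) y = _ := mfderiv_eq_fderiv.symm.trans this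
  rw [h]
  rfl

/-- If `f` is the composition of a curve with a function, and `f` is not null in some direction,
then neither is the curve. -/
theorem pullForm_ne_zero_of_comp {M : Type*} [TopologicalSpace M] [ChartedSpace Plane M]
    [IsManifold (𝓡 2) ∞ M] {g : LorentzMetric M} {f : Plane → M} {γ : ℝ → M} {a : Plane → ℝ}
    {y v : Plane} (hfa : f =ᶠ[𝓝 y] fun y ↦ γ (a y)) (hγ : ContMDiffAt 𝓘(ℝ, ℝ) (𝓡 2) ∞ γ (a y))
    (ha : ContDiffAt ℝ ∞ a y) (hne : pullForm g f v v y ≠ 0) : pullForm g γ 1 1 (a y) ≠ 0 := by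
  rw [pullForm_congr g hfa, pullForm_comp g (hγ.mdifferentiableAt (by simp))
    (ha.differentiableAt (by simp))] at hne
  intro h0
  apply hne
  obtain ⟨A, hA⟩ := pullForm_linear g γ (a y)
  rw [← hA] at h0 ⊢
  have h1 : fderiv ℝ a y v = fderiv ℝ a y v • (1 : ℝ) := by simp
  rw [h1, map_smul, map_smul, LinearMap.smul_apply, h0, smul_zero, smul_zero]

/-- Around every point there is an adapted chart, together with Darboux strips around its curves. -/
theorem exists_isAdaptedChart [IsManifold (𝓡 2) ∞ S] {g₁ : LorentzMetric M₁} {g₂ : LorentzMetric M₂}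
    {j₁ : ParacomplexStructure g₁} {j₂ : ParacomplexStructure g₂} {ε : ℝ} (hε : ε * ε = 1)
    {Φ : S → M₁ × M₂} (hΦ : IsNondegLagrangianImmersion j₁ j₂ ε Φ) (hrank : IsProjectedRankOne Φ)
    (p : S) :
    ∃ e γ₁ γ₂ e₁ e₂, p ∈ e.source ∧ IsAdaptedChart g₁ g₂ ε Φ e γ₁ γ₂ e₁ e₂ ∧
      ∃ β₁ U₁ I₁ β₂ U₂ I₂, IsDarbouxStrip j₁ γ₁ β₁ U₁ I₁ ∧ IsDarbouxStrip j₂ γ₂ β₂ U₂ I₂ ∧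
        ∀ y ∈ e.target, y 0 ∈ I₁ ∧ y 1 ∈ I₂ := by
  have hε0 : ε ≠ 0 := by
    rintro rfl
    simp at hε
  set c := chartAt Plane p with hc
  have hcs : IsSmoothChart c := IsSmoothChart.chartAt p
  set y₀ := c p with hy₀
  have hy₀c : y₀ ∈ c.target := c.map_source (mem_chart_source Plane p)
  set f₁ : Plane → M₁ := fun y ↦ (Φ (c.symm y)).1 with hf₁
  set f₂ : Plane → M₂ := fun y ↦ (Φ (c.symm y)).2 with hf₂
  have hs₁ : ∀ y ∈ c.target, ContMDiffAt (𝓡 2) (𝓡 2) ∞ f₁ y := fun y hy ↦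
    ContMDiffAt.comp (I' := 𝓡 2) (g := fun p ↦ (Φ p).1) (f := c.symm) y
      (contMDiffAt_fst.comp _ hΦ.contMDiff.contMDiffAt) (hcs.contMDiffAt_symm hy)
  have hs₂ : ∀ y ∈ c.target, ContMDiffAt (𝓡 2) (𝓡 2) ∞ f₂ y := fun y hy ↦
    ContMDiffAt.comp (I' := 𝓡 2) (g := fun p ↦ (Φ p).2) (f := c.symm) y
      (contMDiffAt_snd.comp _ hΦ.contMDiff.contMDiffAt) (hcs.contMDiffAt_symm hy)
  -- Here `κ₁` and `κ₂` are charts of the factors, not curvatures.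
  set κ₁ := chartAt Plane (f₁ y₀) with hκ₁
  set κ₂ := chartAt Plane (f₂ y₀) with hκ₂
  have hnice : ∀ᶠ y in 𝓝 y₀, y ∈ c.target ∧ f₁ y ∈ κ₁.source ∧ f₂ y ∈ κ₂.source :=
    (c.open_target.eventually_mem hy₀c).and
      (((hs₁ y₀ hy₀c).continuousAt.eventually
        (κ₁.open_source.mem_nhds (mem_chart_source Plane (f₁ y₀)))).and
      ((hs₂ y₀ hy₀c).continuousAt.eventually
        (κ₂.open_source.mem_nhds (mem_chart_source Plane (f₂ y₀)))))
  obtain ⟨P, hP0, hPs, hPt, hPev⟩ := exists_product_coordinates (φ := fun y ↦ κ₁ (f₁ y))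
    (ψ := fun y ↦ κ₂ (f₂ y)) (y₀ := y₀)
    (hnice.mono fun y hy ↦ ⟨contDiffAt_chart_comp (hs₁ y hy.1) hy.2.1,
      contDiffAt_chart_comp (hs₂ y hy.1) hy.2.2⟩)
    (hnice.mono fun y hy ↦ by
      obtain ⟨v₁, v₂, h1, h2, h3, h4⟩ := exists_coord_splitting hε0 hΦ hrank hcs hy.1
      refine ⟨v₁, v₂, ?_, ?_, fun h0 ↦ h3 ?_, fun h0 ↦ h4 ?_⟩
      · rw [fderiv_chart_comp (hs₂ y hy.1) hy.2.2, h1]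
        exact map_zero _
      · rw [fderiv_chart_comp (hs₁ y hy.1) hy.2.1, h2]
        exact map_zero _
      · rw [pullForm_chart g₁ (x := f₁ y₀) (hs₁ y hy.1) hy.2.1, h0]
        obtain ⟨A, hA⟩ := pullForm_linear g₁ κ₁.symm (κ₁ (f₁ y))
        rw [← hA, map_zero]
      · rw [pullForm_chart g₂ (x := f₂ y₀) (hs₂ y hy.1) hy.2.2, h0]
        obtain ⟨A, hA⟩ := pullForm_linear g₂ κ₂.symm (κ₂ (f₂ y))
        rw [← hA, map_zero])
  set z₀ := P y₀ with hz₀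
  have hz₀t : z₀ ∈ P.target := P.map_source hP0
  have hcoordP : ∀ i, ∀ y ∈ P.source, ContDiffAt ℝ ∞ (fun y ↦ P y i) y := fun i y hy ↦
    contDiffAt_coord (hPs y hy) i
  -- the two curves
  set l₁ : ℝ → Plane := fun s ↦ P.symm (planePoint s (z₀ 1)) with hl₁
  set l₂ : ℝ → Plane := fun t ↦ P.symm (planePoint (z₀ 0) t) with hl₂
  have hp₁ : ∀ s, ContDiffAt ℝ ∞ (fun s ↦ planePoint s (z₀ 1)) s := fun s ↦
    contDiffAt_planePoint contDiffAt_id contDiffAt_const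
  have hp₂ : ∀ s, ContDiffAt ℝ ∞ (fun t ↦ planePoint (z₀ 0) t) s := fun s ↦
    contDiffAt_planePoint contDiffAt_const contDiffAt_id
  have hev₁ : ∀ᶠ s in 𝓝 (z₀ 0), planePoint s (z₀ 1) ∈ P.target :=
    (hp₁ (z₀ 0)).continuousAt.eventually
      (P.open_target.mem_nhds (by simpa only [planePoint_eta] using hz₀t))
  have hev₂ : ∀ᶠ s in 𝓝 (z₀ 1), planePoint (z₀ 0) s ∈ P.target :=
    (hp₂ (z₀ 1)).continuousAt.eventually
      (P.open_target.mem_nhds (by simpa only [planePoint_eta] using hz₀t))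
  have hls₁ : ∀ᶠ s in 𝓝 (z₀ 0), ContDiffAt ℝ ∞ l₁ s := hev₁.mono fun s hs ↦
    ContDiffAt.comp (g := P.symm) (f := fun s ↦ planePoint s (z₀ 1)) s (hPt _ hs) (hp₁ s)
  have hls₂ : ∀ᶠ s in 𝓝 (z₀ 1), ContDiffAt ℝ ∞ l₂ s := hev₂.mono fun s hs ↦
    ContDiffAt.comp (g := P.symm) (f := fun s ↦ planePoint (z₀ 0) s) s (hPt _ hs) (hp₂ s)
  have hl₁0 : l₁ (z₀ 0) = y₀ := by
    simp only [hl₁, planePoint_eta]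
    exact P.left_inv hP0
  have hl₂0 : l₂ (z₀ 1) = y₀ := by
    simp only [hl₂, planePoint_eta]
    exact P.left_inv hP0
  have hln₁ : ∀ᶠ s in 𝓝 (z₀ 0), l₁ s ∈ c.target ∧ f₁ (l₁ s) ∈ κ₁.source ∧ f₂ (l₁ s) ∈ κ₂.source :=
    hls₁.self_of_nhds.continuousAt.eventually (by rw [hl₁0]; exact hnice)
  have hln₂ : ∀ᶠ s in 𝓝 (z₀ 1), l₂ s ∈ c.target ∧ f₁ (l₂ s) ∈ κ₁.source ∧ f₂ (l₂ s) ∈ κ₂.source :=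
    hls₂.self_of_nhds.continuousAt.eventually (by rw [hl₂0]; exact hnice)
  set γ₁ : ℝ → M₁ := fun s ↦ f₁ (l₁ s) with hγ₁
  set γ₂ : ℝ → M₂ := fun s ↦ f₂ (l₂ s) with hγ₂
  have hγs₁ : ∀ᶠ s in 𝓝 (z₀ 0), ContMDiffAt 𝓘(ℝ, ℝ) (𝓡 2) ∞ γ₁ s := by
    filter_upwards [hls₁, hln₁] with s h1 h2
    exact ContMDiffAt.comp (I' := 𝓡 2) (g := f₁) (f := l₁) s (hs₁ _ h2.1) h1.contMDiffAt
  have hγs₂ : ∀ᶠ s in 𝓝 (z₀ 1), ContMDiffAt 𝓘(ℝ, ℝ) (𝓡 2) ∞ γ₂ s := by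
    filter_upwards [hls₂, hln₂] with s h1 h2
    exact ContMDiffAt.comp (I' := 𝓡 2) (g := f₂) (f := l₂) s (hs₂ _ h2.1) h1.contMDiffAt
  have hc₁ := fun y hy ↦ (hcoordP 0 y hy).continuousAt
  have hc₂ := fun y hy ↦ (hcoordP 1 y hy).continuousAt
  -- The separation of variables holds for the coordinate expressions; charts are injective, so it
  -- holds for the maps.
  have hfγ₁ : ∀ᶠ y in 𝓝 y₀, f₁ y = γ₁ (P y 0) := by
    filter_upwards [hPev, hnice, (hc₁ y₀ hP0).eventually hln₁] with y h1 h2 h3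
    exact κ₁.injOn h2.2.1 h3.2.1 h1.1
  have hfγ₂ : ∀ᶠ y in 𝓝 y₀, f₂ y = γ₂ (P y 1) := by
    filter_upwards [hPev, hnice, (hc₂ y₀ hP0).eventually hln₂] with y h1 h2 h3
    exact κ₂.injOn h2.2.2 h3.2.2 h1.2
  obtain ⟨v₁, v₂, -, -, hv₁, hv₂⟩ := exists_coord_splitting hε0 hΦ hrank hcs hy₀c
  obtain ⟨Q₁, e₁, hQ₁, he₁, hQs₁, hQt₁⟩ := exists_arclength g₁ hγs₁
    (pullForm_ne_zero_of_comp (f := f₁) (γ := γ₁) (a := fun y ↦ P y 0) hfγ₁ hγs₁.self_of_nhds (hcoordP 0 y₀ hP0) hv₁)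
  obtain ⟨Q₂, e₂, hQ₂, he₂, hQs₂, hQt₂⟩ := exists_arclength g₂ hγs₂
    (pullForm_ne_zero_of_comp (f := f₂) (γ := γ₂) (a := fun y ↦ P y 1) hfγ₂ hγs₂.self_of_nhds (hcoordP 1 y₀ hP0) hv₂)
  have hne : ∀ a : ℝ, a * a = 1 → a ≠ 0 := by
    rintro a ha rfl
    simp at ha
  obtain ⟨β₁, U₁, I₁, hI₁, hβ₁⟩ := exists_darbouxStrip j₁
    ((Q₁.open_target.eventually_mem (Q₁.map_source hQ₁)).mono
      fun t ht ↦ (hQt₁ t ht).1) (by rw [(hQt₁ _ (Q₁.map_source hQ₁)).2]; exact hne _ he₁)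
  obtain ⟨β₂, U₂, I₂, hI₂, hβ₂⟩ := exists_darbouxStrip j₂
    ((Q₂.open_target.eventually_mem (Q₂.map_source hQ₂)).mono
      fun t ht ↦ (hQt₂ t ht).1) (by rw [(hQt₂ _ (Q₂.map_source hQ₂)).2]; exact hne _ he₂)
  -- the chart
  have hsrc : ∀ᶠ y in 𝓝 y₀, y ∈ P.source ∧ P y 0 ∈ Q₁.source ∧ P y 1 ∈ Q₂.source :=
    (P.open_source.eventually_mem hP0).and
      (((hc₁ y₀ hP0).eventually (Q₁.open_source.mem_nhds hQ₁)).and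
      ((hc₂ y₀ hP0).eventually (Q₂.open_source.mem_nhds hQ₂)))
  have hA : ∀ y, y ∈ P.source ∧ P y 0 ∈ Q₁.source ∧ P y 1 ∈ Q₂.source →
      ContDiffAt ℝ ∞ (fun y ↦ Q₁ (P y 0)) y ∧ ContDiffAt ℝ ∞ (fun y ↦ Q₂ (P y 1)) y := fun y hy ↦
    ⟨ContDiffAt.comp (g := Q₁) (f := fun y ↦ P y 0) y (hQs₁ _ hy.2.1).1 (hcoordP 0 y hy.1),
      ContDiffAt.comp (g := Q₂) (f := fun y ↦ P y 1) y (hQs₂ _ hy.2.2).1 (hcoordP 1 y hy.1)⟩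
  have hA0 := hA y₀ hsrc.self_of_nhds
  -- Each separated coordinate is replaced by the arclength of its curve. The source is shrunk until
  -- all conditions found near `y₀` hold on it.
  obtain ⟨R, hR0, hRN, hRe, hRs, hRt⟩ := exists_local_diffeo
    (f := fun y ↦ planePoint (Q₁ (P y 0)) (Q₂ (P y 1))) (a := y₀)
    (hsrc.mono fun y hy ↦ contDiffAt_planePoint (hA y hy).1 (hA y hy).2)
    (fun v hv ↦ by
      rw [fderiv_planePoint (hA0.1.differentiableAt (by simp))
        (hA0.2.differentiableAt (by simp))] at hv
      have hv' := planePoint_eq_zero hv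
      have k1 := fderiv_comp y₀ (g := Q₁) (f := fun y ↦ P y 0)
        ((hQs₁ _ hQ₁).1.differentiableAt (by simp))
        ((hcoordP 0 y₀ hP0).differentiableAt (by simp))
      have k2 := fderiv_comp y₀ (g := Q₂) (f := fun y ↦ P y 1)
        ((hQs₂ _ hQ₂).1.differentiableAt (by simp))
        ((hcoordP 1 y₀ hP0).differentiableAt (by simp))
      have hPd : DifferentiableAt ℝ P y₀ := (hPs y₀ hP0).differentiableAt (by simp)
      have k1' := congrArg (fun L : Plane →L[ℝ] ℝ ↦ L v) k1
      have k2' := congrArg (fun L : Plane →L[ℝ] ℝ ↦ L v) k2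
      simp only [ContinuousLinearMap.comp_apply, fderiv_eq_smul_deriv,
        smul_eq_mul] at k1' k2'
      have m1 := (mul_eq_zero.mp (k1'.symm.trans hv'.1)).resolve_right (hQs₁ _ hQ₁).2
      have m2 := (mul_eq_zero.mp (k2'.symm.trans hv'.2)).resolve_right (hQs₂ _ hQ₂).2
      have m3 : fderiv ℝ P y₀ v = 0 := by
        rw [← planePoint_eta (fderiv ℝ P y₀ v), fderiv_apply_coord hPd, fderiv_apply_coord hPd,
          dirDeriv, dirDeriv, m1, m2]
        simp [planePoint]
      have h1 : (P.symm ∘ P) =ᶠ[𝓝 y₀] id := by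
        filter_upwards [P.open_source.mem_nhds hP0] with y' hy' using P.left_inv hy'
      have h2 := fderiv_comp y₀ (g := P.symm) (f := P)
        ((hPt _ hz₀t).differentiableAt (by simp)) hPd
      rw [h1.fderiv_eq, fderiv_id] at h2
      have h4 := congrArg (fun L : Plane →L[ℝ] Plane ↦ L v) h2
      simpa [m3] using h4)
    (hsrc.and ((hnice.mono fun y h ↦ h.1).and ((hfγ₁.and hfγ₂).and
      ((hA0.1.continuousAt.eventually hI₁).and (hA0.2.continuousAt.eventually hI₂)))))
  have hRN' : ∀ y ∈ R.source, (y ∈ P.source ∧ P y 0 ∈ Q₁.source ∧ P y 1 ∈ Q₂.source) ∧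
      y ∈ c.target ∧ (f₁ y = γ₁ (P y 0) ∧ f₂ y = γ₂ (P y 1)) ∧ Q₁ (P y 0) ∈ I₁ ∧ Q₂ (P y 1) ∈ I₂ :=
    fun y hy ↦ hRN hy
  set e := c.trans R with he
  have hpoint : ∀ x ∈ e.target, R.symm x ∈ R.source ∧ x ∈ R.target ∧
      x 0 = Q₁ (P (R.symm x) 0) ∧ x 1 = Q₂ (P (R.symm x) 1) := by
    intro x hx
    have hx' : x ∈ R.target := hx.1
    have h1 := hRe (R.symm x)
    rw [R.right_inv hx'] at h1
    refine ⟨R.map_target hx', hx', ?_, ?_⟩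
    · exact (congrArg (fun v : Plane ↦ v 0) h1).trans (planePoint_zero _ _)
    · exact (congrArg (fun v : Plane ↦ v 1) h1).trans (planePoint_one _ _)
  have hQmem : ∀ x ∈ e.target, x 0 ∈ Q₁.target ∧ x 1 ∈ Q₂.target := by
    intro x hx
    obtain ⟨h1, h2, h3, h4⟩ := hpoint x hx
    rw [h3, h4]
    exact ⟨Q₁.map_source (hRN' _ h1).1.2.1, Q₂.map_source (hRN' _ h1).1.2.2⟩
  have hεe : (ε * e₂) * (ε * e₂) = 1 := by
    calc (ε * e₂) * (ε * e₂) = (ε * ε) * (e₂ * e₂) := by ring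
      _ = 1 := by rw [hε, he₂, one_mul]
  -- The second sign of an adapted chart is that of `ε g₂`, the part of `G^ε` belonging to the
  -- second factor; the arclength was taken for `g₂`.
  refine ⟨e, fun t ↦ γ₁ (Q₁.symm t), fun t ↦ γ₂ (Q₂.symm t), e₁, ε * e₂,
    ⟨mem_chart_source Plane p, hR0⟩,
    ⟨⟨fun q hq ↦ ?_, fun x hx ↦ ?_⟩, he₁, hεe, fun x hx ↦ (hQt₁ _ (hQmem x hx).1).1,
      fun x hx ↦ (hQt₂ _ (hQmem x hx).2).1, fun x hx ↦ (hQt₁ _ (hQmem x hx).1).2,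
      fun x hx ↦ by rw [(hQt₂ _ (hQmem x hx).2).2], fun x hx ↦ ?_⟩,
    β₁, U₁, I₁, β₂, U₂, I₂, hβ₁, hβ₂, fun x hx ↦ ?_⟩
  · have hq' : c q ∈ R.source := hq.2
    have hRc : ContDiffAt ℝ ∞ R (c q) := by
      have : (R : Plane → Plane) = _ := funext hRe
      rw [this]
      exact hRs _ hq'
    exact (ContMDiffAt.comp (I' := 𝓡 2) (g := R) (f := c) q hRc.contMDiffAt
      (hcs.contMDiffAt hq.1)).contMDiffWithinAt
  · have h1 := hpoint x hx
    exact (ContMDiffAt.comp (I' := 𝓡 2) (g := c.symm) (f := R.symm) x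
      (hcs.contMDiffAt_symm (hRN' _ h1.1).2.1) (hRt x h1.2.1).contMDiffAt).contMDiffWithinAt
  · obtain ⟨h1, h2, h3, h4⟩ := hpoint x hx
    obtain ⟨k1, k2, k3, -⟩ := hRN' _ h1
    have h5 : e.symm x = c.symm (R.symm x) := rfl
    rw [h5, h3, h4, Q₁.left_inv k1.2.1, Q₂.left_inv k1.2.2, ← k3.1, ← k3.2]
  · obtain ⟨h1, h2, h3, h4⟩ := hpoint x hx
    rw [h3, h4]
    exact (hRN' _ h1).2.2.2

end AdaptedCharts

/-! ### Variation formulas in adapted charts -/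

section AdaptedVariation

open Filter Topology

variable {M₁ M₂ S : Type*}
  [TopologicalSpace M₁] [ChartedSpace Plane M₁] [IsManifold (𝓡 2) ∞ M₁]
  [TopologicalSpace M₂] [ChartedSpace Plane M₂] [IsManifold (𝓡 2) ∞ M₂]
  [TopologicalSpace S] [ChartedSpace Plane S]

section Factor

variable {M : Type*} [TopologicalSpace M] [ChartedSpace Plane M] [IsManifold (𝓡 2) ∞ M]
  {g : LorentzMetric M}

theorem fderiv_planeCoord (i : Fin 2) (y v : Plane) : fderiv ℝ (fun y : Plane ↦ y i) y v = v i :=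
  congrArg (fun L : Plane →L[ℝ] ℝ ↦ L v) (EuclideanSpace.proj i : Plane →L[ℝ] ℝ).hasFDerivAt.fderiv

theorem pullForm_curve {f : Plane → M} {γ : ℝ → M} {i : Fin 2} {y : Plane}
    (hf : f =ᶠ[𝓝 y] fun y ↦ γ (y i)) (hγ : ContMDiffAt 𝓘(ℝ, ℝ) (𝓡 2) ∞ γ (y i)) (v w : Plane) :
    pullForm g f v w y = v i * w i * pullForm g γ 1 1 (y i) := by
  rw [pullForm_congr g hf, pullForm_comp g (h := fun y : Plane ↦ y i)
    (hγ.mdifferentiableAt (by simp)) (by fun_prop), fderiv_planeCoord, fderiv_planeCoord]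
  obtain ⟨A, hA⟩ := pullForm_linear g γ (y i)
  rw [← hA, ← hA, ← mul_one (v i), ← mul_one (w i), ← smul_eq_mul (v i), ← smul_eq_mul (w i),
    map_smul, map_smul, LinearMap.smul_apply]
  simp only [smul_eq_mul]
  ring

theorem pullArea_curve (j : ParacomplexStructure g) {f : Plane → M} {γ : ℝ → M} {i : Fin 2}
    {y : Plane} (hf : f =ᶠ[𝓝 y] fun y ↦ γ (y i)) (hγ : ContMDiffAt 𝓘(ℝ, ℝ) (𝓡 2) ∞ γ (y i))
    (v w : Plane) : pullArea j f v w y = 0 := by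
  rw [pullArea_congr j hf, pullArea_comp j (h := fun y : Plane ↦ y i)
    (hγ.mdifferentiableAt (by simp)) (by fun_prop), fderiv_planeCoord, fderiv_planeCoord]
  obtain ⟨A, hA⟩ := pullArea_linear j γ (y i)
  have h := pullArea_skew j γ 1 1 (y i)
  rw [← hA] at h ⊢
  rw [← mul_one (v i), ← mul_one (w i), ← smul_eq_mul (v i), ← smul_eq_mul (w i),
    map_smul, map_smul, LinearMap.smul_apply]
  simp only [smul_eq_mul]
  rw [show A 1 1 = 0 by linarith]
  ring

theorem pullForm_slice (g : LorentzMetric M) {f : ℝ × Plane → M} {y : Plane}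
    (hf : ContMDiffAt 𝓘(ℝ, ℝ × Plane) (𝓡 2) ∞ f (0, y)) (v w : Plane) :
    pullForm g f (0, v) (0, w) (0, y) = pullForm g (fun y ↦ f (0, y)) v w y := by
  rw [pullForm_comp g (h := fun y : Plane ↦ ((0 : ℝ), y)) (hf.mdifferentiableAt (by simp))
    (by fun_prop), fderiv_prodMk_right, fderiv_prodMk_right]

theorem pullArea_slice (j : ParacomplexStructure g) {f : ℝ × Plane → M} {y : Plane}
    (hf : ContMDiffAt 𝓘(ℝ, ℝ × Plane) (𝓡 2) ∞ f (0, y)) (v w : Plane) :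
    pullArea j f (0, v) (0, w) (0, y) = pullArea j (fun y ↦ f (0, y)) v w y := by
  rw [pullArea_comp j (h := fun y : Plane ↦ ((0 : ℝ), y)) (hf.mdifferentiableAt (by simp))
    (by fun_prop), fderiv_prodMk_right, fderiv_prodMk_right]

/-- The jets of all deformations of a map that traces out a curve. -/
theorem exists_factorJets (j : ParacomplexStructure g) {φ : Plane → M} {y₀ d d' : Plane} {s ε : ℝ}
    (hs : s * s = 1) (hε : ε * ε = 1)
    (hφ : ∀ᶠ y in 𝓝 y₀, ContMDiffAt 𝓘(ℝ, Plane) (𝓡 2) ∞ φ y)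
    (hd : ∀ᶠ y in 𝓝 y₀, pullForm g φ d d y = s) (hd' : ∀ᶠ y in 𝓝 y₀, pullForm g φ d' d y = 0)
    (ha : ∀ᶠ y in 𝓝 y₀, pullArea j φ d' d y = 0) :
    ∃ k : ℝ, ∀ f : ℝ × Plane → M,
      (∀ᶠ z in 𝓝 ((0 : ℝ), y₀), ContMDiffAt 𝓘(ℝ, ℝ × Plane) (𝓡 2) ∞ f z) →
      (∀ᶠ y in 𝓝 y₀, f (0, y) = φ y) →
      FactorJets (fun v w z ↦ ε * pullForm g f v w z) (fun v w z ↦ ε * pullArea j f v w z) y₀ d d'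
        (ε * s) (ε * g.gaussCurvature (φ y₀)) k := by
  obtain ⟨k, hk⟩ := exists_adapted_movingFrame j hs hφ hd
  refine ⟨k, fun f hf h0 ↦ ?_⟩
  obtain ⟨Ap, Am, W, H, h1, hW⟩ := hk f hf h0
  refine H.factorJets hf.self_of_nhds h1 hW ?_ hs hε
  filter_upwards [(tendsto_slice y₀).eventually H.form, (tendsto_slice y₀).eventually H.area, h1,
    (tendsto_slice y₀).eventually hf, h0.eventually_nhds, hd', ha] with y a1 a2 a3 a4 a5 a6 a7
  -- As the frame is `1` on `d`, the vanishing of metric and area form on `d'`, `d` makes the sum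
  -- and the difference of the two frame values on `d'` vanish.
  have b1 := a1 (0, d') (0, d)
  have b2 := a2 (0, d') (0, d)
  have a5' : (fun y ↦ f (0, y)) =ᶠ[𝓝 y] φ := a5
  rw [pullForm_slice g a4, pullForm_congr g a5', a6, a3.1, a3.2] at b1
  rw [pullArea_slice j a4, pullArea_congr j a5', a7, a3.1, a3.2] at b2
  constructor
  · linear_combination -s * b1 - s * b2 - Ap (0, d') (0, y) * hs
  · linear_combination -s * b1 + s * b2 - Am (0, d') (0, y) * hs

end Factor

variable {g₁ : LorentzMetric M₁} {g₂ : LorentzMetric M₂} {ε : ℝ} {Φ : S → M₁ × M₂}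
  {e : OpenPartialHomeomorph S Plane} {γ₁ : ℝ → M₁} {γ₂ : ℝ → M₂} {e₁ e₂ : ℝ}

theorem IsAdaptedChart.eventually_eq (A : IsAdaptedChart g₁ g₂ ε Φ e γ₁ γ₂ e₁ e₂) {y : Plane}
    (hy : y ∈ e.target) :
    (fun y ↦ (Φ (e.symm y)).1) =ᶠ[𝓝 y] (fun y ↦ γ₁ (y 0)) ∧
    (fun y ↦ (Φ (e.symm y)).2) =ᶠ[𝓝 y] (fun y ↦ γ₂ (y 1)) := by
  constructor <;>
  · filter_upwards [e.open_target.mem_nhds hy] with y' hy'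
    rw [A.eq y' hy']

theorem IsAdaptedChart.pullForm_fst (A : IsAdaptedChart g₁ g₂ ε Φ e γ₁ γ₂ e₁ e₂) {y : Plane}
    (hy : y ∈ e.target)
    (v w : Plane) :
    pullForm g₁ (fun y ↦ (Φ (e.symm y)).1) v w y = v 0 * w 0 * e₁ := by
  rw [pullForm_curve (A.eventually_eq hy).1 (A.smooth_fst y hy), A.form_fst y hy]

theorem IsAdaptedChart.pullForm_snd (A : IsAdaptedChart g₁ g₂ ε Φ e γ₁ γ₂ e₁ e₂) {y : Plane}
    (hy : y ∈ e.target)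
    (v w : Plane) :
    ε * pullForm g₂ (fun y ↦ (Φ (e.symm y)).2) v w y = v 1 * w 1 * e₂ := by
  rw [pullForm_curve (A.eventually_eq hy).2 (A.smooth_snd y hy), ← A.form_snd y hy]
  ring

theorem IsAdaptedChart.pairForm_eq (A : IsAdaptedChart g₁ g₂ ε Φ e γ₁ γ₂ e₁ e₂) {y : Plane}
    (hy : y ∈ e.target)
    (v w : Plane) :
    pairForm g₁ g₂ ε (fun y ↦ Φ (e.symm y)) v w y = v 0 * w 0 * e₁ + v 1 * w 1 * e₂ := by
  rw [pairForm, A.pullForm_fst hy, A.pullForm_snd hy, one_mul]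

theorem IsAdaptedChart.contMDiffAt_components (A : IsAdaptedChart g₁ g₂ ε Φ e γ₁ γ₂ e₁ e₂) {y : Plane}
    (hy : y ∈ e.target) :
    ContMDiffAt 𝓘(ℝ, Plane) (𝓡 2) ∞ (fun y ↦ (Φ (e.symm y)).1) y ∧
    ContMDiffAt 𝓘(ℝ, Plane) (𝓡 2) ∞ (fun y ↦ (Φ (e.symm y)).2) y :=
  ⟨(ContMDiffAt.comp (I' := 𝓘(ℝ, ℝ)) (g := γ₁) (f := fun y : Plane ↦ y 0) y (A.smooth_fst y hy)
      (contDiffAt_coord contDiffAt_id 0).contMDiffAt).congr_of_eventuallyEq (A.eventually_eq hy).1,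
    (ContMDiffAt.comp (I' := 𝓘(ℝ, ℝ)) (g := γ₂) (f := fun y : Plane ↦ y 1) y (A.smooth_snd y hy)
      (contDiffAt_coord contDiffAt_id 1).contMDiffAt).congr_of_eventuallyEq (A.eventually_eq hy).2⟩

variable [IsManifold (𝓡 2) ∞ S] {j₁ : ParacomplexStructure g₁} {j₂ : ParacomplexStructure g₂}

theorem IsHamiltonianVariation.eventually_smoothPairAt {F : ℝ → S → M₁ × M₂} {K : Set S} {δ : ℝ}
    (H : IsHamiltonianVariation j₁ j₂ ε Φ F K δ) (he : IsSmoothChart e) {y : Plane}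
    (hy : y ∈ e.target) : ∀ᶠ z in 𝓝 ((0 : ℝ), y), z.1 ∈ Ioo (-δ) δ ∧ z.2 ∈ e.target ∧
      SmoothPairAt (inChart F e) z := by
  have h0 : (0 : ℝ) ∈ Ioo (-δ) δ := ⟨by simpa using H.pos, H.pos⟩
  filter_upwards [(isOpen_Ioo.prod e.open_target).mem_nhds (show ((0 : ℝ), y) ∈ _ from ⟨h0, hy⟩)]
    with z hz using ⟨hz.1, hz.2, H.smoothPairAt he hz.1 hz.2⟩

/-- The jets of the two factors of all Hamiltonian variations, in an adapted chart. -/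
theorem IsAdaptedChart.exists_factorJets (A : IsAdaptedChart g₁ g₂ ε Φ e γ₁ γ₂ e₁ e₂)
    (hε : ε * ε = 1) (j₁ : ParacomplexStructure g₁) (j₂ : ParacomplexStructure g₂) {y₀ : Plane}
    (hy : y₀ ∈ e.target) :
    ∃ k₁ k₂ : ℝ, ∀ (F : ℝ → S → M₁ × M₂) (K : Set S) (δ : ℝ),
      IsHamiltonianVariation j₁ j₂ ε Φ F K δ →
      FactorJets (fun v w z ↦ 1 * pullForm g₁ (fun z ↦ (inChart F e z).1) v w z)
        (fun v w z ↦ 1 * pullArea j₁ (fun z ↦ (inChart F e z).1) v w z) y₀ fstDir sndDir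
        e₁ (g₁.gaussCurvature (Φ (e.symm y₀)).1) k₁ ∧
      FactorJets (fun v w z ↦ ε * pullForm g₂ (fun z ↦ (inChart F e z).2) v w z)
        (fun v w z ↦ ε * pullArea j₂ (fun z ↦ (inChart F e z).2) v w z) y₀ sndDir fstDir
        e₂ (ε * g₂.gaussCurvature (Φ (e.symm y₀)).2) k₂ := by
  have hev := e.open_target.eventually_mem hy
  -- For `g₂` itself the second curve has sign `ε e₂`. Scaling the form by `ε` turns this sign into
  -- `e₂` and the curvature into `ε κ₂`.
  have hs : (ε * e₂) * (ε * e₂) = 1 := by linear_combination e₂ * e₂ * hε + A.sign_snd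
  have hεe : ε * (ε * e₂) = e₂ := by linear_combination e₂ * hε
  have hsnd : ∀ y ∈ e.target, ∀ v w, pullForm g₂ (fun y ↦ (Φ (e.symm y)).2) v w y
      = v 1 * w 1 * (ε * e₂) := fun y h v w ↦ by
    linear_combination ε * A.pullForm_snd h v w
      - pullForm g₂ (fun y ↦ (Φ (e.symm y)).2) v w y * hε
  obtain ⟨k₁, h₁⟩ := _root_.exists_factorJets j₁ (φ := fun y ↦ (Φ (e.symm y)).1) (y₀ := y₀)
    (d := fstDir) (d' := sndDir) A.sign_fst (one_mul 1)
    (hev.mono fun y h ↦ (A.contMDiffAt_components h).1)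
    (hev.mono fun y h ↦ by rw [A.pullForm_fst h]; simp [fstDir])
    (hev.mono fun y h ↦ by rw [A.pullForm_fst h]; simp [sndDir])
    (hev.mono fun y h ↦ pullArea_curve j₁ (A.eventually_eq h).1 (A.smooth_fst y h) _ _)
  obtain ⟨k₂, h₂⟩ := _root_.exists_factorJets j₂ (φ := fun y ↦ (Φ (e.symm y)).2) (y₀ := y₀)
    (d := sndDir) (d' := fstDir) hs hε
    (hev.mono fun y h ↦ (A.contMDiffAt_components h).2)
    (hev.mono fun y h ↦ by rw [hsnd y h]; simp [sndDir])
    (hev.mono fun y h ↦ by rw [hsnd y h]; simp [fstDir])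
    (hev.mono fun y h ↦ pullArea_curve j₂ (A.eventually_eq h).2 (A.smooth_snd y h) _ _)
  refine ⟨k₁, k₂, fun F K δ H ↦ ?_⟩
  have hF := H.eventually_smoothPairAt A.smooth hy
  have h0 : ∀ y, inChart F e (0, y) = Φ (e.symm y) := fun y ↦ congrFun H.zero _
  have r₁ := h₁ _ (hF.mono fun z hz ↦ hz.2.2.1) (Eventually.of_forall fun y ↦ by rw [h0])
  have r₂ := h₂ _ (hF.mono fun z hz ↦ hz.2.2.2) (Eventually.of_forall fun y ↦ by rw [h0])
  rw [one_mul, one_mul] at r₁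
  rw [hεe] at r₂
  exact ⟨r₁, r₂⟩

/-- The first and the second variation of the area density, in an adapted chart. -/
theorem IsAdaptedChart.exists_variation_formulas (A : IsAdaptedChart g₁ g₂ ε Φ e γ₁ γ₂ e₁ e₂)
    (hε : ε * ε = 1) (j₁ : ParacomplexStructure g₁) (j₂ : ParacomplexStructure g₂) {y₀ : Plane}
    (hy : y₀ ∈ e.target) :
    ∃ k₁ k₂ : ℝ, ∀ (F : ℝ → S → M₁ × M₂) (K : Set S) (δ : ℝ),
      IsHamiltonianVariation j₁ j₂ ε Φ F K δ →
      ContDiffAt ℝ ∞ (areaDensity (pairForm g₁ g₂ ε (inChart F e)) fstDir sndDir) (0, y₀) ∧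
      areaDensity (pairForm g₁ g₂ ε (inChart F e)) fstDir sndDir (0, y₀) = 1 ∧
      dirDeriv timeDir (areaDensity (pairForm g₁ g₂ ε (inChart F e)) fstDir sndDir) (0, y₀)
        = e₁ * dirDeriv (0, fstDir) (pairForm g₁ g₂ ε (inChart F e) timeDir (0, fstDir)) (0, y₀)
        + e₂ * dirDeriv (0, sndDir) (pairForm g₁ g₂ ε (inChart F e) timeDir (0, sndDir)) (0, y₀)
        + k₁ * e₁ * pairArea j₁ j₂ ε (inChart F e) timeDir (0, fstDir) (0, y₀)
        + k₂ * e₂ * pairArea j₁ j₂ ε (inChart F e) timeDir (0, sndDir) (0, y₀) ∧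
      ∀ u : ℝ × Plane → ℝ, (∀ᶠ z in 𝓝 ((0 : ℝ), y₀), ContDiffAt ℝ ∞ u z ∧ ∀ v : Plane,
        pairArea j₁ j₂ ε (inChart F e) timeDir (0, v) z = dirDeriv (0, v) u z) →
      dirDeriv timeDir (dirDeriv timeDir
          (areaDensity (pairForm g₁ g₂ ε (inChart F e)) fstDir sndDir)) (0, y₀)
        = - (e₁ * dirDeriv (0, fstDir) (pairArea j₁ j₂ ε (inChart F e) timeDir (0, fstDir)) (0, y₀)
            + e₂ * dirDeriv (0, sndDir) (pairArea j₁ j₂ ε (inChart F e) timeDir (0, sndDir))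
              (0, y₀)) ^ 2
        - (k₁ * e₁ * pairArea j₁ j₂ ε (inChart F e) timeDir (0, fstDir) (0, y₀)
          - k₂ * e₂ * pairArea j₁ j₂ ε (inChart F e) timeDir (0, sndDir) (0, y₀)) ^ 2
        + e₁ * g₁.gaussCurvature (Φ (e.symm y₀)).1
          * pairArea j₁ j₂ ε (inChart F e) timeDir (0, fstDir) (0, y₀) ^ 2
        + e₂ * (ε * g₂.gaussCurvature (Φ (e.symm y₀)).2)
          * pairArea j₁ j₂ ε (inChart F e) timeDir (0, sndDir) (0, y₀) ^ 2
        + dirDeriv (0, fstDir) (fluxFst (pairForm g₁ g₂ ε (inChart F e))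
          (pairArea j₁ j₂ ε (inChart F e)) fstDir sndDir e₁ e₂) (0, y₀)
        + dirDeriv (0, sndDir) (fluxSnd (pairForm g₁ g₂ ε (inChart F e))
          (pairArea j₁ j₂ ε (inChart F e)) fstDir sndDir e₁ e₂) (0, y₀)
        + k₁ * e₁ * dirDeriv (0, fstDir) (secondPotential (pairForm g₁ g₂ ε (inChart F e))
          (pairArea j₁ j₂ ε (inChart F e)) u fstDir sndDir e₁ e₂) (0, y₀)
        + k₂ * e₂ * dirDeriv (0, sndDir) (secondPotential (pairForm g₁ g₂ ε (inChart F e))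
          (pairArea j₁ j₂ ε (inChart F e)) u fstDir sndDir e₁ e₂) (0, y₀) := by
  obtain ⟨k₁, k₂, h⟩ := A.exists_factorJets hε j₁ j₂ hy
  -- The numbers `k₁` and `k₂` are fixed before the variation, so the second variation of one family
  -- can be compared with the first variations of others at the same point.
  refine ⟨k₁, k₂, fun F K δ H ↦ ?_⟩
  obtain ⟨J₁, J₂⟩ := h F K δ H
  have hF := H.eventually_smoothPairAt A.smooth hy
  have hval : ∀ v w : Plane, ∀ᶠ y in 𝓝 y₀, pairForm g₁ g₂ ε (inChart F e) (0, v) (0, w) (0, y)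
      = v 0 * w 0 * e₁ + v 1 * w 1 * e₂ := fun v w ↦ by
    filter_upwards [(tendsto_slice y₀).eventually hF] with y h1
    rw [← pairForm_slice h1.2.2, ← A.pairForm_eq h1.2.1]
    simp only [inChart, H.zero]
  have sG := fun v w ↦ contDiffAt_pairForm (g₁ := g₁) (g₂ := g₂) (ε := ε) hF.self_of_nhds.2.2 v w
  obtain ⟨a1, a2, a3, a4⟩ := areaDensity_jets A.sign_fst A.sign_snd sG
    ((hval fstDir fstDir).mono fun y h ↦ by rw [h]; simp [fstDir])
    ((hval sndDir sndDir).mono fun y h ↦ by rw [h]; simp [sndDir])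
    ((hval fstDir sndDir).mono fun y h ↦ by rw [h]; simp [fstDir, sndDir])
  refine ⟨a1, a2, ?_, fun u hu ↦ ?_⟩
  · rw [a3]
    exact first_variation J₁ J₂ (fun v w ↦ rfl) (fun v w ↦ rfl)
  · rw [a4]
    refine second_variation A.sign_fst A.sign_snd J₁ J₂ (fun v w ↦ rfl) (fun v w ↦ rfl)
      (fun v w ↦ ?_) hu.self_of_nhds.1 (hu.mono fun z hz ↦ hz.2 _) (hu.mono fun z hz ↦ hz.2 _)
    ext z
    rw [pullForm_symm]

end AdaptedVariation

/-! ### Transitions between adapted charts -/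

section Transition

open Filter Topology

section Abstract

variable {G ar G' ar' : ℝ × Plane → ℝ × Plane → ℝ × Plane → ℝ} {H : ℝ × Plane → ℝ × Plane}
  {L : ℝ × Plane →L[ℝ] ℝ × Plane} {z : ℝ × Plane} {a b e₁ e₂ : ℝ}

theorem dirDeriv_comp_of_hasFDerivAt (hL : HasFDerivAt H L z) {f : ℝ × Plane → ℝ}
    (hf : DifferentiableAt ℝ f (H z)) (v : ℝ × Plane) :
    dirDeriv v (fun z ↦ f (H z)) z = dirDeriv (L v) f (H z) := by
  have h := (hf.hasFDerivAt.comp z hL).fderiv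
  exact congrArg (fun T : ℝ × Plane →L[ℝ] ℝ ↦ T v) h

theorem dirDeriv_const_mul_comp (hL : HasFDerivAt H L z) (c : ℝ) {f : ℝ × Plane → ℝ}
    (hf : DifferentiableAt ℝ f (H z)) (v : ℝ × Plane) :
    dirDeriv v (fun z ↦ c * f (H z)) z = c * dirDeriv (L v) f (H z) := by
  rw [← dirDeriv_comp_of_hasFDerivAt hL hf]
  exact dirDeriv_const_mul c (DifferentiableAt.comp z hf hL.differentiableAt) v

/-- A change of coordinates which, to first order, reflects the coordinate axes. -/
structure IsReflectionAt (H : ℝ × Plane → ℝ × Plane) (L : ℝ × Plane →L[ℝ] ℝ × Plane) (a b : ℝ)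
    (z : ℝ × Plane) : Prop where
  hasFDerivAt : HasFDerivAt H L z
  fst : a * a = 1
  snd : b * b = 1
  map_time : L timeDir = timeDir
  map_fst : L (0, fstDir) = a • ((0 : ℝ), fstDir)
  map_snd : L (0, sndDir) = b • ((0 : ℝ), sndDir)

/-- `G` is the pull-back of `G'`. -/
structure IsPullbackAt (G G' : ℝ × Plane → ℝ × Plane → ℝ × Plane → ℝ) (H : ℝ × Plane → ℝ × Plane)
    (L : ℝ × Plane →L[ℝ] ℝ × Plane) (z : ℝ × Plane) : Prop where
  eq : ∀ᶠ z' in 𝓝 z, ∀ v w, G v w z' = G' (L v) (L w) (H z')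
  smul_left (c : ℝ) (v w z : ℝ × Plane) : G' (c • v) w z = c * G' v w z
  smul_right (c : ℝ) (v w z : ℝ × Plane) : G' v (c • w) z = c * G' v w z
  smooth (v w : ℝ × Plane) : ContDiffAt ℝ ∞ (G' v w) (H z)

theorem IsPullbackAt.dirDeriv_eq (hR : IsReflectionAt H L a b z) (hG : IsPullbackAt G G' H L z)
    {v w v' w' : ℝ × Plane} {c d : ℝ} (hv : L v = c • v') (hw : L w = d • w') (t : ℝ × Plane) :
    dirDeriv t (G v w) z = c * d * dirDeriv (L t) (G' v' w') (H z) := by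
  have h : G v w =ᶠ[𝓝 z] fun z ↦ c * d * G' v' w' (H z) := by
    filter_upwards [hG.eq] with z' hz'
    rw [hz', hv, hw, hG.smul_left, hG.smul_right]
    ring
  have hd := differentiableAt_of_smooth (hG.smooth v' w')
  rw [dirDeriv_congr h, dirDeriv_const_mul_comp hR.hasFDerivAt _ hd]

/-- Every term contains the first direction an odd number of times and the second an even number of
times, so only the factor `a` remains. For `fluxSnd` the roles are exchanged. -/
theorem fluxFst_pullback (hR : IsReflectionAt H L a b z) (hG : IsPullbackAt G G' H L z)
    (har : IsPullbackAt ar ar' H L z) :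
    fluxFst G ar fstDir sndDir e₁ e₂ z = a * fluxFst G' ar' fstDir sndDir e₁ e₂ (H z) := by
  have ht : L timeDir = (1 : ℝ) • timeDir := by rw [hR.map_time, one_smul]
  simp only [fluxFst]
  rw [hG.dirDeriv_eq hR ht hR.map_fst, hG.dirDeriv_eq hR ht ht,
    har.dirDeriv_eq hR ht hR.map_snd, hG.dirDeriv_eq hR hR.map_snd hR.map_snd,
    hG.eq.self_of_nhds, har.eq.self_of_nhds, hR.map_time, hR.map_fst, hR.map_snd, har.smul_right,
    hG.smul_right, dirDeriv_smul_vec, dirDeriv_smul_vec]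
  linear_combination (2 * e₁ * e₂ * a * ar' timeDir (0, fstDir) (H z)
      * dirDeriv (0, sndDir) (ar' timeDir (0, sndDir)) (H z)
    + e₁ * e₂ * a * G' timeDir (0, fstDir) (H z)
      * dirDeriv timeDir (G' (0, sndDir) (0, sndDir)) (H z)) * hR.snd

theorem fluxSnd_pullback (hR : IsReflectionAt H L a b z) (hG : IsPullbackAt G G' H L z)
    (har : IsPullbackAt ar ar' H L z) :
    fluxSnd G ar fstDir sndDir e₁ e₂ z = b * fluxSnd G' ar' fstDir sndDir e₁ e₂ (H z) := by
  have ht : L timeDir = (1 : ℝ) • timeDir := by rw [hR.map_time, one_smul]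
  have hp : (fun z ↦ G timeDir (0, fstDir) z * G timeDir (0, sndDir) z) =ᶠ[𝓝 z] fun z ↦
      a * b * (G' timeDir (0, fstDir) (H z) * G' timeDir (0, sndDir) (H z)) := by
    filter_upwards [hG.eq] with z' hz'
    rw [hz', hz', hR.map_time, hR.map_fst, hR.map_snd, hG.smul_right, hG.smul_right]
    ring
  have hd := (differentiableAt_of_smooth (hG.smooth timeDir (0, fstDir))).fun_mul
    (differentiableAt_of_smooth (hG.smooth timeDir (0, sndDir)))
  simp only [fluxSnd]
  rw [dirDeriv_congr hp, dirDeriv_const_mul_comp hR.hasFDerivAt _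
      (f := fun z ↦ G' timeDir (0, fstDir) z * G' timeDir (0, sndDir) z) hd,
    hG.dirDeriv_eq hR ht hR.map_snd, hG.dirDeriv_eq hR ht ht,
    har.dirDeriv_eq hR ht hR.map_snd, hG.dirDeriv_eq hR hR.map_fst hR.map_fst,
    hG.eq.self_of_nhds, har.eq.self_of_nhds, hR.map_time, hR.map_fst, hR.map_snd, har.smul_right,
    hG.smul_right, dirDeriv_smul_vec, dirDeriv_smul_vec, dirDeriv_smul_vec]
  linear_combination (-2 * e₁ * e₂ * b * ar' timeDir (0, fstDir) (H z)
      * dirDeriv (0, fstDir) (ar' timeDir (0, sndDir)) (H z)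
    + e₁ * e₂ * b * G' timeDir (0, sndDir) (H z)
      * dirDeriv timeDir (G' (0, fstDir) (0, fstDir)) (H z)
    - 2 * e₁ * e₂ * b * dirDeriv (0, fstDir)
      (fun z ↦ G' timeDir (0, fstDir) z * G' timeDir (0, sndDir) z) (H z)) * hR.fst

/-- Each direction occurs twice or not at all, so the signs of the reflection disappear. -/
theorem secondPotential_pullback (hR : IsReflectionAt H L a b z) (hG : IsPullbackAt G G' H L z)
    (har : IsPullbackAt ar ar' H L z) {u u' : ℝ × Plane → ℝ}
    (hu : u =ᶠ[𝓝 z] fun z ↦ u' (H z)) (hu' : ContDiffAt ℝ ∞ u' (H z)) :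
    secondPotential G ar u fstDir sndDir e₁ e₂ z
      = secondPotential G' ar' u' fstDir sndDir e₁ e₂ (H z) := by
  simp only [secondPotential]
  rw [dirDeriv_congr hu, dirDeriv_comp_of_hasFDerivAt hR.hasFDerivAt
    (differentiableAt_of_smooth hu'), hG.eq.self_of_nhds, hG.eq.self_of_nhds, har.eq.self_of_nhds,
    har.eq.self_of_nhds, hR.map_time, hR.map_fst, hR.map_snd, har.smul_right,
    hG.smul_right, har.smul_right, hG.smul_right]
  linear_combination (-e₁ * (G' timeDir (0, fstDir) (H z) * ar' timeDir (0, fstDir) (H z))) * hR.fst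
    - e₂ * (G' timeDir (0, sndDir) (H z) * ar' timeDir (0, sndDir) (H z)) * hR.snd

end Abstract

variable {M₁ M₂ S : Type*}
  [TopologicalSpace M₁] [ChartedSpace Plane M₁] [IsManifold (𝓡 2) ∞ M₁]
  [TopologicalSpace M₂] [ChartedSpace Plane M₂] [IsManifold (𝓡 2) ∞ M₂]
  [TopologicalSpace S] [ChartedSpace Plane S] {g₁ : LorentzMetric M₁} {g₂ : LorentzMetric M₂}
  {ε : ℝ} {Φ : S → M₁ × M₂}
  {e e' : OpenPartialHomeomorph S Plane} {γ₁ γ₁' : ℝ → M₁} {γ₂ γ₂' : ℝ → M₂} {e₁ e₂ e₁' e₂' : ℝ}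

theorem pullForm_symm_transition {M : Type*} [TopologicalSpace M] [ChartedSpace Plane M]
    [IsManifold (𝓡 2) ∞ M] {g : LorentzMetric M} {f : S → M} (he : IsSmoothChart e)
    (he' : IsSmoothChart e') {y : Plane} (hy : y ∈ e.target) (hy' : e.symm y ∈ e'.source)
    (hf : ContMDiffAt 𝓘(ℝ, Plane) (𝓡 2) ∞ (fun y ↦ f (e'.symm y)) (e' (e.symm y)))
    (v w : Plane) : pullForm g (fun y ↦ f (e.symm y)) v w y
      = pullForm g (fun y ↦ f (e'.symm y)) (fderiv ℝ (fun y ↦ e' (e.symm y)) y v)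
        (fderiv ℝ (fun y ↦ e' (e.symm y)) y w) (e' (e.symm y)) := by
  have h : (fun y ↦ f (e.symm y)) =ᶠ[𝓝 y] fun y ↦ f (e'.symm (e' (e.symm y))) := by
    filter_upwards [(e.continuousAt_symm hy).eventually (e'.open_source.mem_nhds hy')] with x hx
    rw [e'.left_inv hx]
  rw [pullForm_congr g h, pullForm_comp g (h := fun y ↦ e' (e.symm y))
    (hf.mdifferentiableAt (by simp)) ((he.contDiffAt_transition he' hy hy').differentiableAt
    (by simp))]

/-- Two signs that differ by a square coincide, and the square is `1`. -/
theorem eq_one_of_sign_mul {a e e' : ℝ} (he : e * e = 1) (he' : e' * e' = 1)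
    (h : e = a * a * e') : a * a = 1 ∧ e = e' := by
  have h1 : a * a = 1 := by
    rcases mul_self_eq_one_iff.mp he with rfl | rfl <;>
      rcases mul_self_eq_one_iff.mp he' with rfl | rfl <;> nlinarith [mul_self_nonneg a]
  exact ⟨h1, by rw [h, h1, one_mul]⟩

/-- A continuous function with values `±1` is locally constant. This makes the derivative of a
transition between adapted charts locally constant. -/
theorem eventually_eq_of_mul_self_eq_one {f : Plane → ℝ} {y : Plane} (hf : ContinuousAt f y)
    (h : ∀ᶠ x in 𝓝 y, f x * f x = 1) : ∀ᶠ x in 𝓝 y, f x = f y := by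
  have h0 := h.self_of_nhds
  filter_upwards [h, hf.eventually (Metric.ball_mem_nhds (f y) one_pos)] with x h1 h2
  rw [Real.dist_eq, abs_lt] at h2
  obtain ⟨h2, h2'⟩ := h2
  rcases mul_self_eq_one_iff.mp h0 with h3 | h3 <;> rcases mul_self_eq_one_iff.mp h1 with h4 | h4 <;>
    linarith

/-- The transition map between adapted charts. -/
theorem IsAdaptedChart.transition (A : IsAdaptedChart g₁ g₂ ε Φ e γ₁ γ₂ e₁ e₂)
    (A' : IsAdaptedChart g₁ g₂ ε Φ e' γ₁' γ₂' e₁' e₂') {y : Plane} (hy : y ∈ e.target)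
    (hy' : e.symm y ∈ e'.source) : e₁ = e₁' ∧ e₂ = e₂' ∧ ∃ a b : ℝ, a * a = 1 ∧ b * b = 1 ∧
      ∀ᶠ x in 𝓝 y, ∀ v : Plane,
        fderiv ℝ (fun y ↦ e' (e.symm y)) x v = planePoint (a * v 0) (b * v 1) := by
  set h : Plane → Plane := fun y ↦ e' (e.symm y) with hh
  have hev : ∀ᶠ x in 𝓝 y, x ∈ e.target ∧ e.symm x ∈ e'.source :=
    (e.open_target.eventually_mem hy).and
      ((e.continuousAt_symm hy).eventually (e'.open_source.mem_nhds hy'))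
  -- The two factors of the induced metric are intrinsic, and in each adapted chart they are `e₁
  -- ds²` and `e₂ dt²`. So the transition preserves `ds²` and `dt²` separately.
  have key : ∀ x, x ∈ e.target ∧ e.symm x ∈ e'.source → ∀ v w : Plane,
      v 0 * w 0 * e₁ = fderiv ℝ h x v 0 * fderiv ℝ h x w 0 * e₁' ∧
      v 1 * w 1 * e₂ = fderiv ℝ h x v 1 * fderiv ℝ h x w 1 * e₂' := by
    rintro x ⟨hx, hx'⟩ v w
    have ht := e'.map_source hx'
    have hs := A'.contMDiffAt_components ht
    rw [← A.pullForm_fst hx, ← A.pullForm_snd hx, ← A'.pullForm_fst ht, ← A'.pullForm_snd ht,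
      ← pullForm_symm_transition (f := fun p ↦ (Φ p).1) A.smooth A'.smooth hx hx' hs.1,
      ← pullForm_symm_transition (f := fun p ↦ (Φ p).2) A.smooth A'.smooth hx hx' hs.2]
    exact ⟨rfl, rfl⟩
  have hne : ∀ c : ℝ, c * c = 1 → c ≠ 0 := by
    rintro c hc rfl
    simp at hc
  have key' : ∀ x, x ∈ e.target ∧ e.symm x ∈ e'.source →
      (fderiv ℝ h x fstDir 0 * fderiv ℝ h x fstDir 0 = 1 ∧ e₁ = e₁') ∧
      (fderiv ℝ h x sndDir 1 * fderiv ℝ h x sndDir 1 = 1 ∧ e₂ = e₂') ∧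
      fderiv ℝ h x fstDir 1 = 0 ∧ fderiv ℝ h x sndDir 0 = 0 := by
    intro x hx
    have k1 := key x hx fstDir fstDir
    have k2 := key x hx sndDir sndDir
    simp only [fstDir, sndDir, PiLp.single_apply] at k1 k2
    norm_num at k1 k2
    refine ⟨eq_one_of_sign_mul A.sign_fst A'.sign_fst k1.1,
      eq_one_of_sign_mul A.sign_snd A'.sign_snd k2.2, ?_, ?_⟩
    · exact k1.2.resolve_right (hne _ A'.sign_snd)
    · exact k2.1.resolve_right (hne _ A'.sign_fst)
  have hc : ∀ v i, ContinuousAt (fun x ↦ fderiv ℝ h x v i) y := fun v i ↦ by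
    have h1 : ContDiffAt ℝ ∞ h y := A.smooth.contDiffAt_transition A'.smooth hy hy'
    have h2 := (h1.fderiv_right (m := ∞) (by simp)).clm_apply (contDiffAt_const (c := v))
    exact (contDiffAt_coord h2 i).continuousAt
  obtain ⟨⟨a1, a2⟩, ⟨b1, b2⟩, -, -⟩ := key' y ⟨hy, hy'⟩
  refine ⟨a2, b2, _, _, a1, b1, ?_⟩
  filter_upwards [hev, eventually_eq_of_mul_self_eq_one (hc fstDir 0)
    (hev.mono fun x hx ↦ (key' x hx).1.1), eventually_eq_of_mul_self_eq_one (hc sndDir 1)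
    (hev.mono fun x hx ↦ (key' x hx).2.1.1)] with x h1 h2 h3 v
  obtain ⟨-, -, c1, c2⟩ := key' x h1
  nth_rw 1 [plane_eq_smul_add v]
  rw [map_add, map_smul, map_smul, ← planePoint_eta (fderiv ℝ h x fstDir),
    ← planePoint_eta (fderiv ℝ h x sndDir), c1, c2, h2, h3]
  simp only [planePoint]
  module

end Transition

/-! ### Smoothness and locality of the flux and of the potential -/

section Smoothness

variable {G ar : ℝ × Plane → ℝ × Plane → ℝ × Plane → ℝ} {u : ℝ × Plane → ℝ} {d d' : Plane}
  {e₁ e₂ : ℝ} {z : ℝ × Plane}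

theorem contDiffAt_fluxFst (hG : ∀ v w, ContDiffAt ℝ ∞ (G v w) z)
    (har : ∀ v w, ContDiffAt ℝ ∞ (ar v w) z) : ContDiffAt ℝ ∞ (fluxFst G ar d d' e₁ e₂) z :=
  ((contDiffAt_const.mul ((contDiffAt_dirDeriv (hG _ _) _).sub
      (contDiffAt_const.mul (contDiffAt_dirDeriv (hG _ _) _)))).add
    (contDiffAt_const.mul ((har _ _).mul (contDiffAt_dirDeriv (har _ _) _)))).add
    (contDiffAt_const.mul ((hG _ _).mul (contDiffAt_dirDeriv (hG _ _) _)))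

theorem contDiffAt_fluxSnd (hG : ∀ v w, ContDiffAt ℝ ∞ (G v w) z)
    (har : ∀ v w, ContDiffAt ℝ ∞ (ar v w) z) : ContDiffAt ℝ ∞ (fluxSnd G ar d d' e₁ e₂) z :=
  (((contDiffAt_const.mul ((contDiffAt_dirDeriv (hG _ _) _).sub
      (contDiffAt_const.mul (contDiffAt_dirDeriv (hG _ _) _)))).sub
    (contDiffAt_const.mul ((har _ _).mul (contDiffAt_dirDeriv (har _ _) _)))).add
    (contDiffAt_const.mul ((hG _ _).mul (contDiffAt_dirDeriv (hG _ _) _)))).sub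
    (contDiffAt_const.mul (contDiffAt_dirDeriv ((hG _ _).mul (hG _ _)) _))

theorem contDiffAt_secondPotential (hG : ∀ v w, ContDiffAt ℝ ∞ (G v w) z)
    (har : ∀ v w, ContDiffAt ℝ ∞ (ar v w) z) (hu : ContDiffAt ℝ ∞ u z) :
    ContDiffAt ℝ ∞ (secondPotential G ar u d d' e₁ e₂) z :=
  (contDiffAt_dirDeriv hu _).sub ((contDiffAt_const.mul ((hG _ _).mul (har _ _))).add
    (contDiffAt_const.mul ((hG _ _).mul (har _ _))))

theorem contDiffAt_slice {f : ℝ × Plane → ℝ} {y : Plane} (hf : ContDiffAt ℝ ∞ f (0, y)) :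
    ContDiffAt ℝ ∞ (fun y ↦ f (0, y)) y :=
  ContDiffAt.comp (g := f) (f := fun y : Plane ↦ ((0 : ℝ), y)) y hf (by fun_prop)

open Filter Topology

/-- Every term contains the velocity or the potential, both of which vanish near the point. Hence
the flux and the second order potential of a variation are supported where it moves. -/
theorem flux_eq_zero (hG : ∀ᶠ z' in 𝓝 z, ∀ v, G timeDir v z' = 0)
    (har : ∀ᶠ z' in 𝓝 z, ∀ v, ar timeDir v z' = 0) (hu : ∀ᶠ z' in 𝓝 z, u z' = 0) :
    fluxFst G ar d d' e₁ e₂ z = 0 ∧ fluxSnd G ar d d' e₁ e₂ z = 0 ∧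
      secondPotential G ar u d d' e₁ e₂ z = 0 := by
  have h0 : ∀ f : ℝ × Plane → ℝ, (∀ᶠ z' in 𝓝 z, f z' = 0) → ∀ v, dirDeriv v f z = 0 := by
    intro f hf v
    have : f =ᶠ[𝓝 z] fun _ ↦ 0 := hf
    rw [dirDeriv_congr this]
    simp [dirDeriv]
  have hp : ∀ᶠ z' in 𝓝 z, G timeDir (0, d) z' * G timeDir (0, d') z' = 0 :=
    hG.mono fun z' h ↦ by rw [h, zero_mul]
  simp [fluxFst, fluxSnd, secondPotential, h0 _ hu, h0 _ (hG.mono fun z' h ↦ h _), h0 _ hp,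
    hG.self_of_nhds, har.self_of_nhds]

end Smoothness

/-! ### Comparison of variations in overlapping charts -/

section LocalVariations

open Filter Topology

variable {M₁ M₂ S : Type*}
  [TopologicalSpace M₁] [ChartedSpace Plane M₁] [IsManifold (𝓡 2) ∞ M₁]
  [TopologicalSpace M₂] [ChartedSpace Plane M₂] [IsManifold (𝓡 2) ∞ M₂]
  [TopologicalSpace S] [ChartedSpace Plane S] [IsManifold (𝓡 2) ∞ S]
  {g₁ : LorentzMetric M₁} {g₂ : LorentzMetric M₂}
  {j₁ : ParacomplexStructure g₁} {j₂ : ParacomplexStructure g₂} {ε : ℝ} {Φ : S → M₁ × M₂}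
  {e e' : OpenPartialHomeomorph S Plane} {γ₁ γ₁' : ℝ → M₁} {γ₂ γ₂' : ℝ → M₂} {e₁ e₂ e₁' e₂' : ℝ}
  {F : ℝ → S → M₁ × M₂} {K : Set S} {δ : ℝ}

theorem eventually_time_and {p : Plane → Prop} {y : Plane} (hδ : 0 < δ) (h : ∀ᶠ x in 𝓝 y, p x) :
    ∀ᶠ z in 𝓝 ((0 : ℝ), y), z.1 ∈ Ioo (-δ) δ ∧ p z.2 :=
  (isOpen_Ioo.eventually_mem (show (0 : ℝ) ∈ Ioo (-δ) δ from ⟨by simpa using hδ, hδ⟩)).prod_nhds h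

/-- A transition between adapted charts is a reflection, and relates the data of a variation in the
two charts. -/
theorem IsAdaptedChart.exists_reflection (A : IsAdaptedChart g₁ g₂ ε Φ e γ₁ γ₂ e₁ e₂)
    (A' : IsAdaptedChart g₁ g₂ ε Φ e' γ₁' γ₂' e₁' e₂') {y : Plane} (hy : y ∈ e.target)
    (hy' : e.symm y ∈ e'.source) : e₁ = e₁' ∧ e₂ = e₂' ∧ ∃ a b L,
      (∀ᶠ x in 𝓝 y, ∀ v : Plane, L ((0 : ℝ), v) = (0, fderiv ℝ (fun y ↦ e' (e.symm y)) x v)) ∧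
      ∀ F K δ, IsHamiltonianVariation j₁ j₂ ε Φ F K δ → ∀ᶠ x in 𝓝 y,
        (x ∈ e.target ∧ e.symm x ∈ e'.source) ∧
        IsReflectionAt (fun z ↦ (z.1, e' (e.symm z.2))) L a b (0, x) ∧
        IsPullbackAt (pairForm g₁ g₂ ε (inChart F e)) (pairForm g₁ g₂ ε (inChart F e'))
          (fun z ↦ (z.1, e' (e.symm z.2))) L (0, x) ∧
        IsPullbackAt (pairArea j₁ j₂ ε (inChart F e)) (pairArea j₁ j₂ ε (inChart F e'))
          (fun z ↦ (z.1, e' (e.symm z.2))) L (0, x) := by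
  obtain ⟨h₁, h₂, a, b, ha, hb, hD⟩ := A.transition A' hy hy'
  set h : Plane → Plane := fun y ↦ e' (e.symm y) with hh
  -- The derivative of the transition is locally constant. One linear map `L` can thus serve on a
  -- neighbourhood, and constant directions are sent to constant directions.
  have hD' : ∀ᶠ x in 𝓝 y, fderiv ℝ h x = fderiv ℝ h y := by
    filter_upwards [hD] with x hx
    ext1 v
    rw [hx, hD.self_of_nhds]
  refine ⟨h₁, h₂, a, b, (ContinuousLinearMap.id ℝ ℝ).prodMap (fderiv ℝ h y), ?_, fun F K δ H ↦ ?_⟩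
  · filter_upwards [hD'] with x hx v
    rw [hx]
    simp
  · have hev : ∀ᶠ x in 𝓝 y, x ∈ e.target ∧ e.symm x ∈ e'.source :=
      (e.open_target.eventually_mem hy).and
        ((e.continuousAt_symm hy).eventually (e'.open_source.mem_nhds hy'))
    filter_upwards [hev, hev.eventually_nhds, hD'.eventually_nhds] with x hx hx2 hx3
    have ht := e'.map_source hx.2
    have hsm := A.smooth.contDiffAt_transition A'.smooth hx.1 hx.2
    have hmem : ∀ᶠ z in 𝓝 ((0 : ℝ), x), z.1 ∈ Ioo (-δ) δ ∧
        (z.2 ∈ e.target ∧ e.symm z.2 ∈ e'.source) ∧ fderiv ℝ h z.2 = fderiv ℝ h y :=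
      eventually_time_and H.pos (hx2.and hx3)
    have h0 : (0 : ℝ) ∈ Ioo (-δ) δ := hmem.self_of_nhds.1
    refine ⟨hx, ⟨?_, ha, hb, ?_, ?_, ?_⟩, ⟨?_, ?_, ?_, ?_⟩, ⟨?_, ?_, ?_, ?_⟩⟩
    · rw [← hx3.self_of_nhds]
      exact hasFDerivAt_prodMap (hsm.differentiableAt (by simp))
    · simp [timeDir]
    · rw [ContinuousLinearMap.coe_prodMap', Prod.map_apply, hD.self_of_nhds]
      simp [planePoint, fstDir]
    · rw [ContinuousLinearMap.coe_prodMap', Prod.map_apply, hD.self_of_nhds]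
      simp [planePoint, sndDir]
    · filter_upwards [hmem] with z hz v w
      rw [← Prod.mk.eta (p := z), pairForm_transition F A.smooth A'.smooth hz.2.1.1 hz.2.1.2
        (H.smoothPairAt A'.smooth hz.1 (e'.map_source hz.2.1.2)), ← hz.2.2]
      rfl
    · intro c v w z
      obtain ⟨B, hB⟩ := pairForm_linear (g₁ := g₁) (g₂ := g₂) (ε := ε) (inChart F e') z
      rw [hB, hB, map_smul, LinearMap.smul_apply, smul_eq_mul]
    · intro c v w z
      obtain ⟨B, hB⟩ := pairForm_linear (g₁ := g₁) (g₂ := g₂) (ε := ε) (inChart F e') z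
      rw [hB, hB, map_smul, smul_eq_mul]
    · exact fun v w ↦ contDiffAt_pairForm (H.smoothPairAt A'.smooth h0 ht) v w
    · filter_upwards [hmem] with z hz v w
      rw [← Prod.mk.eta (p := z), pairArea_transition F A.smooth A'.smooth hz.2.1.1 hz.2.1.2
        (H.smoothPairAt A'.smooth hz.1 (e'.map_source hz.2.1.2)), ← hz.2.2]
      rfl
    · intro c v w z
      obtain ⟨B, hB⟩ := pairArea_linear (j₁ := j₁) (j₂ := j₂) (ε := ε) (inChart F e') z
      rw [hB, hB, map_smul, LinearMap.smul_apply, smul_eq_mul]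
    · intro c v w z
      obtain ⟨B, hB⟩ := pairArea_linear (j₁ := j₁) (j₂ := j₂) (ε := ε) (inChart F e') z
      rw [hB, hB, map_smul, smul_eq_mul]
    · exact fun v w ↦ contDiffAt_pairArea (H.smoothPairAt A'.smooth h0 ht) v w

/-- The family factors through the projection to `Plane`, which annihilates the time direction. -/
theorem pair_eq_zero_of_static {f : Plane → M₁ × M₂} {z : ℝ × Plane} (hf : SmoothPairAt f z.2)
    (h : inChart F e =ᶠ[𝓝 z] fun z ↦ f z.2) (v : ℝ × Plane) :
    pairForm g₁ g₂ ε (inChart F e) timeDir v z = 0 ∧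
      pairArea j₁ j₂ ε (inChart F e) timeDir v z = 0 := by
  have h0 : fderiv ℝ (fun z : ℝ × Plane ↦ z.2) z timeDir = 0 := by
    rw [hasFDerivAt_snd.fderiv]
    rfl
  constructor
  · rw [pairForm_congr h, pairForm_comp (h := fun z : ℝ × Plane ↦ z.2) hf (by fun_prop), h0]
    obtain ⟨B, hB⟩ := pairForm_linear (g₁ := g₁) (g₂ := g₂) (ε := ε) f z.2
    rw [hB, map_zero, LinearMap.zero_apply]
  · rw [pairArea_congr h, pairArea_comp (h := fun z : ℝ × Plane ↦ z.2) hf (by fun_prop), h0]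
    obtain ⟨B, hB⟩ := pairArea_linear (j₁ := j₁) (j₂ := j₂) (ε := ε) f z.2
    rw [hB, map_zero, LinearMap.zero_apply]

/-- Where a variation does not move the surface, its velocity vanishes. -/
theorem eventually_pair_eq_zero (hΦ : ∀ x ∈ e.target, SmoothPairAt (fun y ↦ Φ (e.symm y)) x)
    (hδ : 0 < δ) {C : Set S} (hC : IsClosed C) (hF : ∀ τ ∈ Ioo (-δ) δ, ∀ p ∉ C, F τ p = Φ p)
    {y : Plane} (hy : y ∈ e.target) (hyC : e.symm y ∉ C) :
    ∀ᶠ z in 𝓝 ((0 : ℝ), y), ∀ v, pairForm g₁ g₂ ε (inChart F e) timeDir v z = 0 ∧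
      pairArea j₁ j₂ ε (inChart F e) timeDir v z = 0 := by
  have hmem : ∀ᶠ z in 𝓝 ((0 : ℝ), y), z.1 ∈ Ioo (-δ) δ ∧ z.2 ∈ e.target ∧ e.symm z.2 ∉ C :=
    eventually_time_and hδ ((e.open_target.eventually_mem hy).and
      ((e.continuousAt_symm hy).eventually (hC.isOpen_compl.mem_nhds hyC)))
  filter_upwards [hmem.eventually_nhds] with z hz v
  refine pair_eq_zero_of_static (hΦ z.2 hz.self_of_nhds.2.1) ?_ v
  filter_upwards [hz] with z' hz' using hF _ hz'.1 _ hz'.2.2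

end LocalVariations

/-! ### Variations realizing the cut-off flux and potential -/

section CutoffVariations

open Filter Topology

variable {M₁ M₂ S : Type*}
  [TopologicalSpace M₁] [ChartedSpace Plane M₁] [IsManifold (𝓡 2) ∞ M₁]
  [TopologicalSpace M₂] [ChartedSpace Plane M₂] [IsManifold (𝓡 2) ∞ M₂]
  [TopologicalSpace S] [ChartedSpace Plane S] [IsManifold (𝓡 2) ∞ S] [T2Space S]
  {g₁ : LorentzMetric M₁} {g₂ : LorentzMetric M₂}
  {j₁ : ParacomplexStructure g₁} {j₂ : ParacomplexStructure g₂} {ε : ℝ} {Φ : S → M₁ × M₂}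
  {e e' : OpenPartialHomeomorph S Plane} {γ₁ γ₁' : ℝ → M₁} {γ₂ γ₂' : ℝ → M₂} {e₁ e₂ e₁' e₂' : ℝ}
  {F F' : ℝ → S → M₁ × M₂} {K : Set S} {δ δ' : ℝ} {u : ℝ → S → ℝ} {χ : S → ℝ}

/-- The function `u` is a potential of the variation `F` in all charts. -/
def IsChartPotential (j₁ : ParacomplexStructure g₁) (j₂ : ParacomplexStructure g₂) (ε : ℝ)
    (F : ℝ → S → M₁ × M₂) (K : Set S) (δ : ℝ) (u : ℝ → S → ℝ) : Prop :=
  (∀ τ ∈ Ioo (-δ) δ, ∀ p ∉ K, u τ p = 0) ∧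
    ∀ e : OpenPartialHomeomorph S Plane, IsSmoothChart e → ∀ z : ℝ × Plane, z.1 ∈ Ioo (-δ) δ →
      z.2 ∈ e.target → ContDiffAt ℝ ∞ (fun z : ℝ × Plane ↦ u z.1 (e.symm z.2)) z ∧
      ∀ v : Plane, pairArea j₁ j₂ ε (inChart F e) timeDir (0, v) z
        = dirDeriv (0, v) (fun z : ℝ × Plane ↦ u z.1 (e.symm z.2)) z

/-- The first tangential flux of a variation at time `0`, in a chart. -/
def chartFluxFst (j₁ : ParacomplexStructure g₁) (j₂ : ParacomplexStructure g₂) (ε : ℝ)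
    (F : ℝ → S → M₁ × M₂) (e : OpenPartialHomeomorph S Plane) (e₁ e₂ : ℝ) (y : Plane) : ℝ :=
  fluxFst (pairForm g₁ g₂ ε (inChart F e)) (pairArea j₁ j₂ ε (inChart F e)) fstDir sndDir e₁ e₂ (0, y)

/-- The second tangential flux of a variation at time `0`, in a chart. -/
def chartFluxSnd (j₁ : ParacomplexStructure g₁) (j₂ : ParacomplexStructure g₂) (ε : ℝ)
    (F : ℝ → S → M₁ × M₂) (e : OpenPartialHomeomorph S Plane) (e₁ e₂ : ℝ) (y : Plane) : ℝ :=
  fluxSnd (pairForm g₁ g₂ ε (inChart F e)) (pairArea j₁ j₂ ε (inChart F e)) fstDir sndDir e₁ e₂ (0, y)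

/-- The second order potential of a variation at time `0`, in a chart. -/
def chartPotential (j₁ : ParacomplexStructure g₁) (j₂ : ParacomplexStructure g₂) (ε : ℝ)
    (F : ℝ → S → M₁ × M₂) (u : ℝ → S → ℝ) (e : OpenPartialHomeomorph S Plane) (e₁ e₂ : ℝ)
    (y : Plane) : ℝ :=
  secondPotential (pairForm g₁ g₂ ε (inChart F e)) (pairArea j₁ j₂ ε (inChart F e))
    (fun z ↦ u z.1 (e.symm z.2)) fstDir sndDir e₁ e₂ (0, y)

/-- The velocity of `X` is the part of the tangential flux of `F` cut off by `χ`. -/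
def IsCutoffTangential (j₁ : ParacomplexStructure g₁) (j₂ : ParacomplexStructure g₂) (ε : ℝ)
    (Φ : S → M₁ × M₂) (F : ℝ → S → M₁ × M₂) (χ : S → ℝ) (X : ℝ → S → M₁ × M₂) : Prop :=
  ∀ e γ₁ γ₂ e₁ e₂, IsAdaptedChart g₁ g₂ ε Φ e γ₁ γ₂ e₁ e₂ → ∀ y ∈ e.target, ∀ᶠ x in 𝓝 y,
    pairForm g₁ g₂ ε (inChart X e) timeDir (0, fstDir) (0, x)
      = e₁ * (χ (e.symm x) * chartFluxFst j₁ j₂ ε F e e₁ e₂ x) ∧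
    pairForm g₁ g₂ ε (inChart X e) timeDir (0, sndDir) (0, x)
      = e₂ * (χ (e.symm x) * chartFluxSnd j₁ j₂ ε F e e₁ e₂ x) ∧
    ∀ v, pairArea j₁ j₂ ε (inChart X e) timeDir (0, v) (0, x) = 0

/-- The velocity of `Y` is normal, and its Hamiltonian is the part of the second order potential of
`F` cut off by `χ`. -/
def IsCutoffNormal (j₁ : ParacomplexStructure g₁) (j₂ : ParacomplexStructure g₂) (ε : ℝ)
    (Φ : S → M₁ × M₂) (F : ℝ → S → M₁ × M₂) (u : ℝ → S → ℝ) (χ : S → ℝ)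
    (Y : ℝ → S → M₁ × M₂) : Prop :=
  ∀ e γ₁ γ₂ e₁ e₂, IsAdaptedChart g₁ g₂ ε Φ e γ₁ γ₂ e₁ e₂ → ∀ y ∈ e.target, ∀ᶠ x in 𝓝 y,
    ∀ v, pairForm g₁ g₂ ε (inChart Y e) timeDir (0, v) (0, x) = 0 ∧
      pairArea j₁ j₂ ε (inChart Y e) timeDir (0, v) (0, x)
        = dirDeriv v (fun x ↦ χ (e.symm x) * chartPotential j₁ j₂ ε F u e e₁ e₂ x) x

theorem IsHamiltonianVariation.zero_mem (H : IsHamiltonianVariation j₁ j₂ ε Φ F K δ) :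
    (0 : ℝ) ∈ Ioo (-δ) δ :=
  ⟨by simpa using H.pos, H.pos⟩

theorem IsHamiltonianVariation.contDiffAt_chartFlux (H : IsHamiltonianVariation j₁ j₂ ε Φ F K δ)
    (he : IsSmoothChart e) {y : Plane} (hy : y ∈ e.target) :
    ContDiffAt ℝ ∞ (chartFluxFst j₁ j₂ ε F e e₁ e₂) y ∧
      ContDiffAt ℝ ∞ (chartFluxSnd j₁ j₂ ε F e e₁ e₂) y := by
  have hs := H.smoothPairAt he (z := (0, y)) H.zero_mem hy
  exact ⟨contDiffAt_slice (contDiffAt_fluxFst (contDiffAt_pairForm hs) (contDiffAt_pairArea hs)),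
    contDiffAt_slice (contDiffAt_fluxSnd (contDiffAt_pairForm hs) (contDiffAt_pairArea hs))⟩

theorem IsHamiltonianVariation.contDiffAt_chartPotential
    (H : IsHamiltonianVariation j₁ j₂ ε Φ F K δ) (hu : IsChartPotential j₁ j₂ ε F K δ u)
    (he : IsSmoothChart e) {y : Plane} (hy : y ∈ e.target) :
    ContDiffAt ℝ ∞ (chartPotential j₁ j₂ ε F u e e₁ e₂) y := by
  have hs := H.smoothPairAt he (z := (0, y)) H.zero_mem hy
  exact contDiffAt_slice (contDiffAt_secondPotential (contDiffAt_pairForm hs)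
    (contDiffAt_pairArea hs) (hu.2 e he (0, y) H.zero_mem hy).1)

/-- Outside the closed set `K` the family is static and the potential vanishes. This keeps the
auxiliary variations supported in the same `K`. -/
theorem IsHamiltonianVariation.chartFlux_eq_zero (H : IsHamiltonianVariation j₁ j₂ ε Φ F K δ)
    (hΦ : ContMDiff (𝓡 2) ((𝓡 2).prod (𝓡 2)) ∞ Φ) (hu : IsChartPotential j₁ j₂ ε F K δ u)
    (he : IsSmoothChart e) {y : Plane} (hy : y ∈ e.target) (hyK : e.symm y ∉ K) :
    chartFluxFst j₁ j₂ ε F e e₁ e₂ y = 0 ∧ chartFluxSnd j₁ j₂ ε F e e₁ e₂ y = 0 ∧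
      chartPotential j₁ j₂ ε F u e e₁ e₂ y = 0 := by
  have h := eventually_pair_eq_zero (g₁ := g₁) (g₂ := g₂) (j₁ := j₁) (j₂ := j₂) (ε := ε)
    (fun x hx ↦ smoothPairAt_symm he hx hΦ.contMDiffAt) H.pos H.isCompact.isClosed
    H.eq_of_notMem hy hyK
  refine flux_eq_zero (h.mono fun z hz v ↦ (hz v).1) (h.mono fun z hz v ↦ (hz v).2) ?_
  filter_upwards [eventually_time_and H.pos ((e.open_target.eventually_mem hy).and
      ((e.continuousAt_symm hy).eventually (H.isCompact.isClosed.isOpen_compl.mem_nhds hyK)))]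
    with z hz using hu.1 _ hz.1 _ hz.2.2

/-- The auxiliary variations move only points of `tsupport χ ∩ K`: the cut-off vanishes off the
first set, flux and potential off the second. -/
theorem isCompact_image_tsupport_inter (hK : IsCompact K) (hχ : tsupport χ ⊆ e.source) :
    IsCompact (e '' (tsupport χ ∩ K)) ∧ e '' (tsupport χ ∩ K) ⊆ e.target ∧
      e.symm '' (e '' (tsupport χ ∩ K)) = tsupport χ ∩ K := by
  have hs : tsupport χ ∩ K ⊆ e.source := inter_subset_left.trans hχ
  refine ⟨(hK.inter_left (isClosed_tsupport χ)).image_of_continuousOn (e.continuousOn.mono hs), ?_,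
    e.toPartialEquiv.symm_image_image_of_subset_source hs⟩
  rintro _ ⟨p, hp, rfl⟩
  exact e.map_source (hs hp)

theorem notMem_of_notMem_image {y : Plane} (hy : y ∈ e.target)
    (h : y ∉ e '' (tsupport χ ∩ K)) (hχ : χ (e.symm y) ≠ 0) : e.symm y ∉ K := fun hK ↦
  h ⟨e.symm y, ⟨subset_tsupport χ hχ, hK⟩, e.right_inv hy⟩

theorem contDiffAt_comp_symm (hχ : ContMDiff (𝓡 2) 𝓘(ℝ, ℝ) ∞ χ) (he : IsSmoothChart e) {y : Plane}
    (hy : y ∈ e.target) : ContDiffAt ℝ ∞ (fun y ↦ χ (e.symm y)) y :=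
  (ContMDiffAt.comp (g := χ) y hχ.contMDiffAt (he.contMDiffAt_symm hy)).contDiffAt

/-- The tangential variation whose velocity is a cut off of the tangential flux of `F`. -/
theorem IsAdaptedChart.exists_cutoff_tangential (A' : IsAdaptedChart g₁ g₂ ε Φ e' γ₁' γ₂' e₁' e₂')
    (hΦ : ContMDiff (𝓡 2) ((𝓡 2).prod (𝓡 2)) ∞ Φ) (hL : IsLagrangian j₁ j₂ ε Φ)
    (H : IsHamiltonianVariation j₁ j₂ ε Φ F K δ)
    (hχ : ContMDiff (𝓡 2) 𝓘(ℝ, ℝ) ∞ χ) (hχe : tsupport χ ⊆ e'.source) :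
    ∃ F' δ', IsHamiltonianVariation j₁ j₂ ε Φ F' K δ' ∧
      IsCutoffTangential j₁ j₂ ε Φ F χ F' := by
  obtain ⟨u, hu⟩ : ∃ u, IsChartPotential j₁ j₂ ε F K δ u := H.exists_potential
  obtain ⟨hC, hCe, hCK⟩ := isCompact_image_tsupport_inter H.isCompact hχe
  obtain ⟨F', δ', H', hstat, hF'⟩ := exists_tangential_variation (g₁ := g₁) (g₂ := g₂) (j₁ := j₁)
    (j₂ := j₂) (ε := ε) hΦ hL A'.smooth H.isCompact hC hCe
    (hCK.trans_subset inter_subset_right)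
    (Z := fun y ↦ planePoint (χ (e'.symm y) * chartFluxFst j₁ j₂ ε F e' e₁' e₂' y)
      (χ (e'.symm y) * chartFluxSnd j₁ j₂ ε F e' e₁' e₂' y))
    (fun y hy ↦ contDiffAt_planePoint
      ((contDiffAt_comp_symm hχ A'.smooth hy).mul (H.contDiffAt_chartFlux A'.smooth hy).1)
      ((contDiffAt_comp_symm hχ A'.smooth hy).mul (H.contDiffAt_chartFlux A'.smooth hy).2))
    (fun y hy hyC ↦ by
      by_cases h0 : χ (e'.symm y) = 0
      · simp [h0, planePoint]
      · obtain ⟨h1, h2, -⟩ := H.chartFlux_eq_zero hΦ hu A'.smooth (e₁ := e₁') (e₂ := e₂') hy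
          (notMem_of_notMem_image hy hyC h0)
        simp [h1, h2, planePoint])
  refine ⟨F', δ', H', fun e γ₁ γ₂ e₁ e₂ A y hy ↦ ?_⟩
  -- The variation was built in the chart `e'`. In another adapted chart the claim follows by
  -- reflection on the overlap, where the signs in the flux match those in the direction vectors.
  -- Off the domain of `e'` both sides vanish, because there the cut-off is zero near the point.
  by_cases hy' : e.symm y ∈ e'.source
  · obtain ⟨rfl, rfl, a, b, L, -, hR⟩ := A.exists_reflection (j₁ := j₁) (j₂ := j₂) A' hy hy'
    filter_upwards [hR F K δ H, hR F' K δ' H'] with x hx hx'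
    obtain ⟨⟨hxe, hxe'⟩, hr, hG, har⟩ := hx
    obtain ⟨-, -, hG', har'⟩ := hx'
    have ht := e'.map_source hxe'
    have hinv : e'.symm (e' (e.symm x)) = e.symm x := e'.left_inv hxe'
    have f1 : chartFluxFst j₁ j₂ ε F e e₁ e₂ x = a * chartFluxFst j₁ j₂ ε F e' e₁ e₂ (e' (e.symm x)) :=
      fluxFst_pullback hr hG har
    have f2 : chartFluxSnd j₁ j₂ ε F e e₁ e₂ x = b * chartFluxSnd j₁ j₂ ε F e' e₁ e₂ (e' (e.symm x)) :=
      fluxSnd_pullback hr hG har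
    have hz : ∀ v, pairForm g₁ g₂ ε (inChart F' e') timeDir (0, v) (0, e' (e.symm x)) = _ :=
      fun v ↦ (hF' _ ht v).1
    refine ⟨?_, ?_, fun v ↦ ?_⟩
    · rw [hG'.eq.self_of_nhds, hr.map_time, hr.map_fst, hG'.smul_right, hz, A'.pairForm_eq ht, f1,
        hinv]
      simp [fstDir]
      ring
    · rw [hG'.eq.self_of_nhds, hr.map_time, hr.map_snd, hG'.smul_right, hz, A'.pairForm_eq ht, f2,
        hinv]
      simp [sndDir]
      ring
    · have h1 : (0, v) = v 0 • ((0 : ℝ), fstDir) + v 1 • ((0 : ℝ), sndDir) := by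
        simp [← plane_eq_smul_add]
      rw [har'.eq.self_of_nhds, hr.map_time, h1, map_add, map_smul, map_smul, hr.map_fst, hr.map_snd]
      have := (hF' _ ht (v 0 • a • fstDir + v 1 • b • sndDir)).2
      simpa using this
  · have hyC : e.symm y ∉ tsupport χ := fun h ↦ hy' (hχe h)
    have hcl := (isClosed_tsupport χ).isOpen_compl
    have h := eventually_pair_eq_zero (g₁ := g₁) (g₂ := g₂) (j₁ := j₁) (j₂ := j₂) (ε := ε)
      (fun x hx ↦ smoothPairAt_symm A.smooth hx hΦ.contMDiffAt) H'.pos (isClosed_tsupport χ)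
      (fun τ hτ p hp ↦ hstat τ hτ p fun hp' ↦ hp (hCK ▸ hp').1) hy hyC
    filter_upwards [(tendsto_slice y).eventually h,
      (e.continuousAt_symm hy).eventually (hcl.mem_nhds hyC)] with x hx hxC
    have hχ0 : χ (e.symm x) = 0 := image_eq_zero_of_notMem_tsupport hxC
    exact ⟨by rw [(hx _).1, hχ0]; simp, by rw [(hx _).1, hχ0]; simp, fun v ↦ (hx _).2⟩

/-- The normal variation whose Hamiltonian is a cut off of the second order potential of `F`. -/
theorem IsAdaptedChart.exists_cutoff_normal (A' : IsAdaptedChart g₁ g₂ ε Φ e' γ₁' γ₂' e₁' e₂')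
    (hε : ε * ε = 1) {β₁ : ℝ × ℝ → M₁} {β₂ : ℝ × ℝ → M₂} {U₁ U₂ : Set (ℝ × ℝ)}
    {I₁ I₂ : Set ℝ} (hβ₁ : IsDarbouxStrip j₁ γ₁' β₁ U₁ I₁) (hβ₂ : IsDarbouxStrip j₂ γ₂' β₂ U₂ I₂)
    (hI : ∀ y ∈ e'.target, y 0 ∈ I₁ ∧ y 1 ∈ I₂)
    (hΦ : ContMDiff (𝓡 2) ((𝓡 2).prod (𝓡 2)) ∞ Φ) (hL : IsLagrangian j₁ j₂ ε Φ)
    (H : IsHamiltonianVariation j₁ j₂ ε Φ F K δ) (hu : IsChartPotential j₁ j₂ ε F K δ u)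
    (hχ : ContMDiff (𝓡 2) 𝓘(ℝ, ℝ) ∞ χ) (hχe : tsupport χ ⊆ e'.source) :
    ∃ F' δ', IsHamiltonianVariation j₁ j₂ ε Φ F' K δ' ∧
      IsCutoffNormal j₁ j₂ ε Φ F u χ F' := by
  obtain ⟨hC, hCe, hCK⟩ := isCompact_image_tsupport_inter H.isCompact hχe
  have hw : ∀ y ∈ e'.target, ContDiffAt ℝ ∞
      (fun y ↦ χ (e'.symm y) * chartPotential j₁ j₂ ε F u e' e₁' e₂' y) y := fun y hy ↦
    (contDiffAt_comp_symm hχ A'.smooth hy).mul (H.contDiffAt_chartPotential hu A'.smooth hy)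
  obtain ⟨F', δ', H', hstat, hF'⟩ := exists_normal_variation hε hΦ hL A'.smooth hβ₁ hβ₂
    (fun y hy ↦ ⟨(hI y hy).1, (hI y hy).2, A'.eq y hy⟩) H.isCompact hC hCe
    (hCK.trans_subset inter_subset_right) hw
    (fun y hy hyC ↦ by
      by_cases h0 : χ (e'.symm y) = 0
      · simp [h0]
      · simp [(H.chartFlux_eq_zero hΦ hu A'.smooth (e₁ := e₁') (e₂ := e₂') hy
          (notMem_of_notMem_image hy hyC h0)).2.2])
  refine ⟨F', δ', H', fun e γ₁ γ₂ e₁ e₂ A y hy ↦ ?_⟩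
  by_cases hy' : e.symm y ∈ e'.source
  · obtain ⟨rfl, rfl, a, b, L, hLv, hR⟩ := A.exists_reflection (j₁ := j₁) (j₂ := j₂) A' hy hy'
    -- The potential is invariant under reflections, so the Hamiltonian is the same function on the
    -- surface in both charts.
    have hfun : ∀ᶠ x in 𝓝 y, χ (e.symm x) * chartPotential j₁ j₂ ε F u e e₁ e₂ x
        = χ (e'.symm (e' (e.symm x)))
          * chartPotential j₁ j₂ ε F u e' e₁ e₂ (e' (e.symm x)) := by
      filter_upwards [hR F K δ H, (hR F K δ H).eventually_nhds] with x hx hx2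
      obtain ⟨⟨hxe, hxe'⟩, hr, hG, har⟩ := hx
      rw [e'.left_inv hxe']
      congr 1
      refine secondPotential_pullback hr hG har ?_
        (hu.2 e' A'.smooth _ H.zero_mem (e'.map_source hxe')).1
      filter_upwards [eventually_time_and H.pos (hx2.mono fun _ h ↦ h.1)] with z hz
      rw [e'.left_inv hz.2.2]
    filter_upwards [hR F' K δ' H', hfun.eventually_nhds, hLv] with x hx' hxf hxL v
    obtain ⟨⟨hxe, hxe'⟩, hr, hG', har'⟩ := hx'
    have ht := e'.map_source hxe'
    have hh := A.smooth.contDiffAt_transition A'.smooth hxe hxe'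
    have hz := hF' _ ht (fderiv ℝ (fun y ↦ e' (e.symm y)) x v)
    constructor
    · rw [hG'.eq.self_of_nhds, hr.map_time, hxL]
      exact hz.1
    · rw [har'.eq.self_of_nhds, hr.map_time, hxL, dirDeriv_congr hxf]
      refine hz.2.trans ?_
      have := ((differentiableAt_of_smooth (hw _ ht)).hasFDerivAt.comp x
        (hh.differentiableAt (by simp)).hasFDerivAt).fderiv
      exact (congrArg (fun T : Plane →L[ℝ] ℝ ↦ T v) this).symm
  · have hyC : e.symm y ∉ tsupport χ := fun h ↦ hy' (hχe h)
    have hcl := (isClosed_tsupport χ).isOpen_compl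
    have h := eventually_pair_eq_zero (g₁ := g₁) (g₂ := g₂) (j₁ := j₁) (j₂ := j₂) (ε := ε)
      (fun x hx ↦ smoothPairAt_symm A.smooth hx hΦ.contMDiffAt) H'.pos (isClosed_tsupport χ)
      (fun τ hτ p hp ↦ hstat τ hτ p fun hp' ↦ hp (hCK ▸ hp').1) hy hyC
    filter_upwards [(tendsto_slice y).eventually h,
      ((e.continuousAt_symm hy).eventually (hcl.mem_nhds hyC)).eventually_nhds] with x hx hxC v
    have hχ0 : (fun x ↦ χ (e.symm x) * chartPotential j₁ j₂ ε F u e e₁ e₂ x)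
        =ᶠ[𝓝 x] fun _ ↦ 0 := by
      filter_upwards [hxC] with x' hx'
      rw [image_eq_zero_of_notMem_tsupport hx', zero_mul]
    rw [dirDeriv_congr hχ0]
    exact ⟨(hx _).1, (hx _).2.trans (by simp [dirDeriv])⟩

end CutoffVariations

/-! ### The pointwise inequality -/

section Inequality

open Filter Topology

/-- In an adapted chart the tangent vector of the curve has norm `s = ±1`, so `s` is the sign in the
curvature hypothesis. -/
theorem SignedCurvatureNonpos.mul_nonpos {M S : Type*} [TopologicalSpace M] [ChartedSpace Plane M]
    [IsManifold (𝓡 2) ∞ M] [TopologicalSpace S] [ChartedSpace Plane S] [IsManifold (𝓡 2) ∞ S]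
    {g : LorentzMetric M} {f : S → M} (h : SignedCurvatureNonpos g f)
    {e : OpenPartialHomeomorph S Plane} (he : IsSmoothChart e) {y : Plane} (hy : y ∈ e.target)
    (hf : MDifferentiableAt (𝓡 2) (𝓡 2) f (e.symm y)) {s : ℝ} (hs : s * s = 1) {v : Plane}
    (hv : pullForm g (fun y ↦ f (e.symm y)) v v y = s) :
    s * g.gaussCurvature (f (e.symm y)) ≤ 0 := by
  have h1 := mfderiv_comp_symm he hy hf v
  have hv' : g.form (f (e.symm y))
      (mfderiv (𝓡 2) (𝓡 2) f (e.symm y) (mfderiv (𝓡 2) (𝓡 2) e.symm y v))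
      (mfderiv (𝓡 2) (𝓡 2) f (e.symm y) (mfderiv (𝓡 2) (𝓡 2) e.symm y v)) = s := by
    rw [← h1]
    exact hv
  have h2 := h (e.symm y) (mfderiv (𝓡 2) (𝓡 2) e.symm y v) (fun h0 ↦ by
    rw [h0, map_zero] at hv'
    simp [← hv'] at hs)
  rw [hv'] at h2
  rcases mul_self_eq_one_iff.mp hs with rfl | rfl
  · simpa using h2
  · simpa [Real.sign_of_neg] using h2

/-- Derivatives in time of two functions which are proportional along two points. -/
theorem dirDeriv_timeDir_transfer {f f' : ℝ × Plane → ℝ} {y y' : Plane} {c : ℝ}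
    (hf : ContDiffAt ℝ ∞ f (0, y)) (hf' : ContDiffAt ℝ ∞ f' (0, y'))
    (h : ∀ᶠ τ in 𝓝 (0 : ℝ), f (τ, y) = c * f' (τ, y')) :
    ∀ᶠ τ in 𝓝 (0 : ℝ), dirDeriv timeDir f (τ, y) = c * dirDeriv timeDir f' (τ, y') := by
  have hline : ∀ {f : ℝ × Plane → ℝ} {y : Plane}, ContDiffAt ℝ ∞ f (0, y) →
      ∀ᶠ τ in 𝓝 (0 : ℝ), HasDerivAt (fun τ ↦ f (τ, y)) (dirDeriv timeDir f (τ, y)) τ := by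
    intro f y hf
    have h1 : ∀ᶠ z in 𝓝 ((0 : ℝ), y), ContDiffAt ℝ 1 f z :=
      (hf.of_le (m := 1) (by exact_mod_cast le_top)).eventually (by simp)
    have h2 : Tendsto (fun τ : ℝ ↦ (τ, y)) (𝓝 0) (𝓝 ((0 : ℝ), y)) :=
      Continuous.tendsto (by fun_prop) 0
    filter_upwards [h2.eventually h1] with τ hτ
    have h3 : HasDerivAt (fun τ : ℝ ↦ (τ, y)) timeDir τ :=
      (hasDerivAt_id τ).prodMk (hasDerivAt_const τ y)
    exact (hτ.differentiableAt (by simp)).hasFDerivAt.comp_hasDerivAt τ h3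
  filter_upwards [hline hf, hline hf', h.eventually_nhds] with τ h1 h2 h3
  exact (h1.congr_of_eventuallyEq (h3.mono fun _ h ↦ h.symm)).unique (h2.const_mul c)

theorem dirDeriv_finsetSum {ι E : Type*} [NormedAddCommGroup E] [NormedSpace ℝ E] {J : Finset ι}
    {f : ι → E → ℝ} {z : E} (hf : ∀ j ∈ J, DifferentiableAt ℝ (f j) z) (v : E) :
    dirDeriv v (fun z ↦ ∑ j ∈ J, f j z) z = ∑ j ∈ J, dirDeriv v (f j) z := by
  simp only [dirDeriv]
  rw [fderiv_fun_sum hf, sum_apply]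

/-- Derivatives are the sums of the derivatives of the terms cut off by a partition of unity. -/
theorem sum_dirDeriv_mul_eq {ι : Type*} {J : Finset ι} {χ : ι → Plane → ℝ} {f : Plane → ℝ}
    {y : Plane} (hχ : ∀ j, ContDiffAt ℝ ∞ (χ j) y) (hf : ContDiffAt ℝ ∞ f y)
    (hsum : ∀ᶠ x in 𝓝 y, ∑ j ∈ J, χ j x = 1) (v : Plane) :
    ∑ j ∈ J, dirDeriv v (fun x ↦ χ j x * f x) y = dirDeriv v f y := by
  rw [← dirDeriv_finsetSum fun j _ ↦ differentiableAt_of_smooth ((hχ j).mul hf)]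
  refine dirDeriv_congr ?_ v
  filter_upwards [hsum] with x hx
  rw [← Finset.sum_mul, hx, one_mul]

variable {M₁ M₂ S : Type*}
  [TopologicalSpace M₁] [ChartedSpace Plane M₁] [IsManifold (𝓡 2) ∞ M₁]
  [TopologicalSpace M₂] [ChartedSpace Plane M₂] [IsManifold (𝓡 2) ∞ M₂]
  [TopologicalSpace S] [ChartedSpace Plane S] [IsManifold (𝓡 2) ∞ S] [T2Space S]
  {g₁ : LorentzMetric M₁} {g₂ : LorentzMetric M₂}
  {j₁ : ParacomplexStructure g₁} {j₂ : ParacomplexStructure g₂} {ε : ℝ} {Φ : S → M₁ × M₂}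
  {e : OpenPartialHomeomorph S Plane} {γ₁ : ℝ → M₁} {γ₂ : ℝ → M₂} {e₁ e₂ : ℝ}
  {F F' : ℝ → S → M₁ × M₂} {K : Set S} {δ δ' : ℝ} {u : ℝ → S → ℝ} {χ : S → ℝ}

/-- The area density of a variation in a chart. -/
def chartDensity (g₁ : LorentzMetric M₁) (g₂ : LorentzMetric M₂) (ε : ℝ) (F : ℝ → S → M₁ × M₂)
    (e : OpenPartialHomeomorph S Plane) : ℝ × Plane → ℝ :=
  areaDensity (pairForm g₁ g₂ ε (inChart F e)) fstDir sndDir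

/-- The second variation of the area density is at most the sum of the first variations in the
directions of the parts of the flux. -/
theorem IsAdaptedChart.second_variation_le (A : IsAdaptedChart g₁ g₂ ε Φ e γ₁ γ₂ e₁ e₂)
    (hε : ε * ε = 1) (hΦ : ContMDiff (𝓡 2) ((𝓡 2).prod (𝓡 2)) ∞ Φ)
    (hφ : SignedCurvatureNonpos g₁ (fun p ↦ (Φ p).1))
    (hψ : SignedCurvatureNonpos g₂ (fun p ↦ (Φ p).2))
    (H : IsHamiltonianVariation j₁ j₂ ε Φ F K δ) (hu : IsChartPotential j₁ j₂ ε F K δ u)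
    {ι : Type*} {J : Finset ι} {χ : ι → S → ℝ} (hχ : ∀ j, ContMDiff (𝓡 2) 𝓘(ℝ, ℝ) ∞ (χ j))
    {X Y : ι → ℝ → S → M₁ × M₂} {δX δY : ι → ℝ}
    (HX : ∀ j, IsHamiltonianVariation j₁ j₂ ε Φ (X j) K (δX j))
    (HY : ∀ j, IsHamiltonianVariation j₁ j₂ ε Φ (Y j) K (δY j))
    (hX : ∀ j, IsCutoffTangential j₁ j₂ ε Φ F (χ j) (X j))
    (hY : ∀ j, IsCutoffNormal j₁ j₂ ε Φ F u (χ j) (Y j)) {y : Plane} (hy : y ∈ e.target)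
    (hsum : ∀ᶠ p in 𝓝 (e.symm y), ∑ j ∈ J, χ j p = 1) :
    dirDeriv timeDir (dirDeriv timeDir (chartDensity g₁ g₂ ε F e)) (0, y)
      ≤ ∑ j ∈ J, (dirDeriv timeDir (chartDensity g₁ g₂ ε (X j) e) (0, y)
        + dirDeriv timeDir (chartDensity g₁ g₂ ε (Y j) e) (0, y)) := by
  obtain ⟨k₁, k₂, hform⟩ := A.exists_variation_formulas hε j₁ j₂ hy
  obtain ⟨-, -, -, h2⟩ := hform F K δ H
  have h2 := h2 (fun z ↦ u z.1 (e.symm z.2)) (by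
    filter_upwards [H.eventually_smoothPairAt A.smooth hy] with z hz
    exact hu.2 e A.smooth z hz.1 hz.2.1)
  have hd := contMDiffAt_pair (hΦ.contMDiffAt (x := e.symm y))
  have c₁ : e₁ * g₁.gaussCurvature (Φ (e.symm y)).1 ≤ 0 :=
    hφ.mul_nonpos A.smooth hy (hd.1.mdifferentiableAt (by simp)) A.sign_fst (v := fstDir) (by
      rw [A.pullForm_fst hy]
      simp [fstDir])
  -- The sign of `g₂` itself on the second curve is `ε e₂`. The product with the curvature is the
  -- coefficient `e₂ (ε κ₂)` of the second variation.
  have c₂ : (ε * e₂) * g₂.gaussCurvature (Φ (e.symm y)).2 ≤ 0 :=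
    hψ.mul_nonpos A.smooth hy (hd.2.mdifferentiableAt (by simp))
      (by linear_combination e₂ * e₂ * hε + A.sign_snd) (v := sndDir) (by
        have := A.pullForm_snd hy sndDir sndDir
        simp only [sndDir, PiLp.single_apply] at this ⊢
        simp only [if_true, one_mul] at this
        rw [← this]
        linear_combination (-(pullForm g₂ (fun y ↦ (Φ (e.symm y)).2) (EuclideanSpace.single 1 1)
          (EuclideanSpace.single 1 1) y)) * hε)
  have hs := H.smoothPairAt A.smooth (z := (0, y)) H.zero_mem hy
  have sG := contDiffAt_pairForm (g₁ := g₁) (g₂ := g₂) (ε := ε) hs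
  have sar := contDiffAt_pairArea (j₁ := j₁) (j₂ := j₂) (ε := ε) hs
  have su := (hu.2 e A.smooth (0, y) H.zero_mem hy).1
  have sχ : ∀ j, ContDiffAt ℝ ∞ (fun x ↦ χ j (e.symm x)) y := fun j ↦
    contDiffAt_comp_symm (hχ j) A.smooth hy
  have hsum' : ∀ᶠ x in 𝓝 y, ∑ j ∈ J, χ j (e.symm x) = 1 :=
    (e.continuousAt_symm hy).eventually hsum
  obtain ⟨sf₁, sf₂⟩ := H.contDiffAt_chartFlux A.smooth hy (e₁ := e₁) (e₂ := e₂)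
  have sf₃ := H.contDiffAt_chartPotential hu A.smooth hy (e₁ := e₁) (e₂ := e₂)
  -- The family `X j` has no Hamiltonian part and contributes the divergence of the cut-off flux.
  -- The family `Y j` has no tangential part and contributes the derivatives of the cut-off
  -- potential.
  have hterm : ∀ j, dirDeriv timeDir (chartDensity g₁ g₂ ε (X j) e) (0, y)
      + dirDeriv timeDir (chartDensity g₁ g₂ ε (Y j) e) (0, y)
      = dirDeriv fstDir (fun x ↦ χ j (e.symm x) * chartFluxFst j₁ j₂ ε F e e₁ e₂ x) y
      + dirDeriv sndDir (fun x ↦ χ j (e.symm x) * chartFluxSnd j₁ j₂ ε F e e₁ e₂ x) y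
      + k₁ * e₁ * dirDeriv fstDir
          (fun x ↦ χ j (e.symm x) * chartPotential j₁ j₂ ε F u e e₁ e₂ x) y
      + k₂ * e₂ * dirDeriv sndDir
          (fun x ↦ χ j (e.symm x) * chartPotential j₁ j₂ ε F u e e₁ e₂ x) y := by
    intro j
    obtain ⟨-, -, x1, -⟩ := hform (X j) K (δX j) (HX j)
    obtain ⟨-, -, y1, -⟩ := hform (Y j) K (δY j) (HY j)
    have sX := contDiffAt_pairForm (g₁ := g₁) (g₂ := g₂) (ε := ε)
      ((HX j).smoothPairAt A.smooth (z := (0, y)) (HX j).zero_mem hy)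
    have sY := contDiffAt_pairForm (g₁ := g₁) (g₂ := g₂) (ε := ε)
      ((HY j).smoothPairAt A.smooth (z := (0, y)) (HY j).zero_mem hy)
    have pX := hX j e γ₁ γ₂ e₁ e₂ A y hy
    have pY := hY j e γ₁ γ₂ e₁ e₂ A y hy
    have q1 : dirDeriv (0, fstDir) (pairForm g₁ g₂ ε (inChart (X j) e) timeDir (0, fstDir)) (0, y)
        = e₁ * dirDeriv fstDir (fun x ↦ χ j (e.symm x) * chartFluxFst j₁ j₂ ε F e e₁ e₂ x) y := by
      rw [dirDeriv_slice_eq (differentiableAt_of_smooth (sX _ _)),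
        dirDeriv_congr (pX.mono fun x hx ↦ hx.1),
        dirDeriv_const_mul _ (differentiableAt_of_smooth ((sχ j).mul sf₁))]
    have q2 : dirDeriv (0, sndDir) (pairForm g₁ g₂ ε (inChart (X j) e) timeDir (0, sndDir)) (0, y)
        = e₂ * dirDeriv sndDir (fun x ↦ χ j (e.symm x) * chartFluxSnd j₁ j₂ ε F e e₁ e₂ x) y := by
      rw [dirDeriv_slice_eq (differentiableAt_of_smooth (sX _ _)),
        dirDeriv_congr (pX.mono fun x hx ↦ hx.2.1),
        dirDeriv_const_mul _ (differentiableAt_of_smooth ((sχ j).mul sf₂))]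
    have q3 : ∀ v w : Plane,
        dirDeriv (0, w) (pairForm g₁ g₂ ε (inChart (Y j) e) timeDir (0, v)) (0, y) = 0 := fun v w ↦
      dirDeriv_slice_const (differentiableAt_of_smooth (sY _ _)) (pY.mono fun x hx ↦ (hx v).1) w
    rw [chartDensity, chartDensity, x1, y1, q1, q2, q3, q3, pX.self_of_nhds.2.2,
      pX.self_of_nhds.2.2, (pY.self_of_nhds _).2, (pY.self_of_nhds _).2]
    linear_combination dirDeriv fstDir
        (fun x ↦ χ j (e.symm x) * chartFluxFst j₁ j₂ ε F e e₁ e₂ x) y * A.sign_fst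
      + dirDeriv sndDir
        (fun x ↦ χ j (e.symm x) * chartFluxSnd j₁ j₂ ε F e e₁ e₂ x) y * A.sign_snd
  simp only [hterm, Finset.sum_add_distrib, ← Finset.mul_sum]
  -- The cut-offs add up to `1` near the point, so their derivatives cancel in the sum and the uncut
  -- flux and potential remain.
  rw [sum_dirDeriv_mul_eq sχ sf₁ hsum', sum_dirDeriv_mul_eq sχ sf₂ hsum',
    sum_dirDeriv_mul_eq sχ sf₃ hsum', sum_dirDeriv_mul_eq sχ sf₃ hsum']
  rw [chartDensity, h2,
    dirDeriv_slice_eq (differentiableAt_of_smooth (contDiffAt_fluxFst sG sar)),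
    dirDeriv_slice_eq (differentiableAt_of_smooth (contDiffAt_fluxSnd sG sar)),
    dirDeriv_slice_eq (differentiableAt_of_smooth (contDiffAt_secondPotential sG sar su)),
    dirDeriv_slice_eq (differentiableAt_of_smooth (contDiffAt_secondPotential sG sar su))]
  unfold chartFluxFst chartFluxSnd chartPotential
  -- What is left of the second variation are two negative squares and two curvature terms.
  have n1 := mul_nonneg (neg_nonneg.mpr c₁)
    (sq_nonneg (pairArea j₁ j₂ ε (inChart F e) timeDir (0, fstDir) (0, y)))
  have n2 := mul_nonneg (neg_nonneg.mpr c₂)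
    (sq_nonneg (pairArea j₁ j₂ ε (inChart F e) timeDir (0, sndDir) (0, y)))
  have n3 := sq_nonneg
    (e₁ * dirDeriv (0, fstDir) (pairArea j₁ j₂ ε (inChart F e) timeDir (0, fstDir)) (0, y)
      + e₂ * dirDeriv (0, sndDir) (pairArea j₁ j₂ ε (inChart F e) timeDir (0, sndDir)) (0, y))
  have n4 := sq_nonneg
    (k₁ * e₁ * pairArea j₁ j₂ ε (inChart F e) timeDir (0, fstDir) (0, y)
      - k₂ * e₂ * pairArea j₁ j₂ ε (inChart F e) timeDir (0, sndDir) (0, y))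
  linarith

end Inequality

/-! ### Integration and conclusion -/

section Stability

open Filter Topology MeasureTheory

variable {M₁ M₂ S : Type*}
  [TopologicalSpace M₁] [ChartedSpace Plane M₁] [IsManifold (𝓡 2) ∞ M₁]
  [TopologicalSpace M₂] [ChartedSpace Plane M₂] [IsManifold (𝓡 2) ∞ M₂]
  [TopologicalSpace S] [ChartedSpace Plane S] [IsManifold (𝓡 2) ∞ S] [T2Space S]
  {g₁ : LorentzMetric M₁} {g₂ : LorentzMetric M₂}
  {j₁ : ParacomplexStructure g₁} {j₂ : ParacomplexStructure g₂} {ε : ℝ} {Φ : S → M₁ × M₂}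
  {e c : OpenPartialHomeomorph S Plane} {γ₁ : ℝ → M₁} {γ₂ : ℝ → M₂} {e₁ e₂ : ℝ}
  {F : ℝ → S → M₁ × M₂} {K : Set S} {δ : ℝ}

/-- In an adapted chart the density at time `0` is `1`. It is a multiple of the density in the other
chart, which therefore cannot vanish. -/
theorem IsHamiltonianVariation.gramDet_ne_zero (H : IsHamiltonianVariation j₁ j₂ ε Φ F K δ)
    (hε : ε * ε = 1) (A : IsAdaptedChart g₁ g₂ ε Φ e γ₁ γ₂ e₁ e₂) (hc : IsSmoothChart c) {y : Plane}
    (hy : y ∈ c.target) (hy' : c.symm y ∈ e.source) :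
    gramDet (pairForm g₁ g₂ ε (inChart F c)) (0, y) ≠ 0 := by
  obtain ⟨k₁, k₂, hform⟩ := A.exists_variation_formulas hε j₁ j₂ (e.map_source hy')
  obtain ⟨-, h1, -⟩ := hform F K δ H
  have hinv : e.symm (e (c.symm y)) = c.symm y := e.left_inv hy'
  have hy2 : c (e.symm (e (c.symm y))) = y := by rw [hinv, c.right_inv hy]
  rw [areaDensity_transition F A.smooth hc (e.map_source hy') (hinv.symm ▸ c.map_target hy)
    (by rw [hy2]; exact H.smoothPairAt hc (z := (0, y)) H.zero_mem hy), hy2,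
    areaDensity_eq_sqrt] at h1
  intro h0
  simp [h0] at h1

variable [SigmaCompactSpace S]

/-- The derivatives in time of the area density in a chart, from those in an adapted chart. -/
theorem IsHamiltonianVariation.dirDeriv_chartDensity (H : IsHamiltonianVariation j₁ j₂ ε Φ F K δ)
    (hε : ε * ε = 1) (A : IsAdaptedChart g₁ g₂ ε Φ e γ₁ γ₂ e₁ e₂) (hc : IsSmoothChart c) {y : Plane}
    (hy : y ∈ c.target) (hy' : c.symm y ∈ e.source) :
    dirDeriv timeDir (chartDensity g₁ g₂ ε F c) (0, y)
      = |jacobianDet (fun y ↦ e (c.symm y)) y|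
        * dirDeriv timeDir (chartDensity g₁ g₂ ε F e) (0, e (c.symm y)) ∧
    dirDeriv timeDir (dirDeriv timeDir (chartDensity g₁ g₂ ε F c)) (0, y)
      = |jacobianDet (fun y ↦ e (c.symm y)) y|
        * dirDeriv timeDir (dirDeriv timeDir (chartDensity g₁ g₂ ε F e)) (0, e (c.symm y)) := by
  have ht := e.map_source hy'
  have s1 : ContDiffAt ℝ ∞ (chartDensity g₁ g₂ ε F c) (0, y) :=
    (H.contDiffOn_areaDensity hc).contDiffAt ((H.isOpen_smoothRegion hc).mem_nhds
      ⟨⟨H.zero_mem, hy⟩, H.gramDet_ne_zero hε A hc hy hy'⟩)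
  obtain ⟨k₁, k₂, hform⟩ := A.exists_variation_formulas hε j₁ j₂ ht
  have s2 : ContDiffAt ℝ ∞ (chartDensity g₁ g₂ ε F e) (0, e (c.symm y)) := (hform F K δ H).1
  have h0 : ∀ᶠ τ in 𝓝 (0 : ℝ), chartDensity g₁ g₂ ε F c (τ, y)
      = |jacobianDet (fun y ↦ e (c.symm y)) y|
        * chartDensity g₁ g₂ ε F e (τ, e (c.symm y)) := by
    filter_upwards [isOpen_Ioo.mem_nhds H.zero_mem] with τ hτ
    exact areaDensity_transition F hc A.smooth hy hy'
      (H.smoothPairAt A.smooth (z := (τ, e (c.symm y))) hτ ht)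
  have h1 := dirDeriv_timeDir_transfer s1 s2 h0
  exact ⟨h1.self_of_nhds, (dirDeriv_timeDir_transfer (contDiffAt_dirDeriv s1 _)
    (contDiffAt_dirDeriv s2 _) h1).self_of_nhds⟩

/-- Partition functions subordinate to a cover by open sets, indexed by the points of the space. -/
theorem exists_finite_partition {V : S → Set S} (hV : ∀ p, IsOpen (V p)) (hp : ∀ p, p ∈ V p)
    (hK : IsCompact K) : ∃ (χ : S → S → ℝ) (J : Finset S),
      (∀ j, ContMDiff (𝓡 2) 𝓘(ℝ, ℝ) ∞ (χ j)) ∧ (∀ j, tsupport (χ j) ⊆ V j) ∧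
      ∀ p ∈ K, ∀ᶠ q in 𝓝 p, ∑ j ∈ J, χ j q = 1 := by
  obtain ⟨f, hf⟩ := SmoothPartitionOfUnity.exists_isSubordinate (𝓡 2) isClosed_univ V hV
    (fun p _ ↦ mem_iUnion.mpr ⟨p, hp p⟩)
  refine ⟨fun j ↦ f j, (f.locallyFinite.closure.finite_nonempty_inter_compact hK).toFinset,
    fun j ↦ (f j).contMDiff, hf, fun p hpK ↦ ?_⟩
  -- The sum must be `1` near `p`, since it is differentiated later. Near `p` only functions whose
  -- closed support contains `p` are nonzero, and for `p` in `K` these are all indexed by `J`.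
  filter_upwards [f.eventually_finsupport_subset p] with q hq
  refine f.sum_finsupport' q (mem_univ q) (hq.trans fun j hj ↦ ?_)
  simp only [Finite.mem_toFinset, mem_ofPred_eq]
  exact ⟨p, (f.mem_fintsupport_iff p j).mp hj, hpK⟩

/-- The second variation of the volume is nonpositive. -/
theorem IsHamiltonianMinimal.hasNonposHamiltonianSecondVariation
    (hmin : IsHamiltonianMinimal j₁ j₂ ε Φ) (hε : ε * ε = 1)
    (hΦ : IsNondegLagrangianImmersion j₁ j₂ ε Φ) (hrank : IsProjectedRankOne Φ)
    (hφ : SignedCurvatureNonpos g₁ (fun p ↦ (Φ p).1))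
    (hψ : SignedCurvatureNonpos g₂ (fun p ↦ (Φ p).2)) :
    HasNonposHamiltonianSecondVariation j₁ j₂ ε Φ := by
  intro F K δ H
  choose e γ₁ γ₂ e₁ e₂ hpe A β₁ U₁ I₁ β₂ U₂ I₂ hβ₁ hβ₂ hI using
    exists_isAdaptedChart (j₁ := j₁) (j₂ := j₂) hε hΦ hrank
  obtain ⟨u, hu⟩ : ∃ u, IsChartPotential j₁ j₂ ε F K δ u := H.exists_potential
  obtain ⟨χ, J, hχ, hχe, hsum⟩ := exists_finite_partition (fun p ↦ (e p).open_source) hpe H.isCompact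
  choose X δX HX hX using fun j ↦ (A j).exists_cutoff_tangential hΦ.contMDiff hΦ.lagrangian H
    (hχ j) (hχe j)
  choose Y δY HY hY using fun j ↦ (A j).exists_cutoff_normal hε (hβ₁ j) (hβ₂ j) (hI j)
    hΦ.contMDiff hΦ.lagrangian H hu (hχ j) (hχe j)
  have hvol : ∀ {G : ℝ → S → M₁ × M₂} {δ : ℝ} (HG : IsHamiltonianVariation j₁ j₂ ε Φ G K δ), _ :=
    fun {G δ} HG ↦ HG.volume_variation fun i y hy ↦
      HG.gramDet_ne_zero hε (A ((chartAt Plane i).symm y)) (IsSmoothChart.chartAt i) hy (hpe _)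
  obtain ⟨hC2, hV, -, hint⟩ := hvol H
  refine ⟨hC2, hV.trans_le ?_⟩
  -- This is the only use of minimality. It applies to all the auxiliary variations, because they
  -- have the same support set `K` as `F`.
  have hzero : ∀ {G : ℝ → S → M₁ × M₂} {δ : ℝ} (HG : IsHamiltonianVariation j₁ j₂ ε Φ G K δ),
      ∑ i ∈ chartIndices H.isCompact, ∫ y in chartCompact K i, chartWeight i y *
        dirDeriv timeDir (chartDensity g₁ g₂ ε G (chartAt Plane i)) (0, y) = 0 := fun {G δ} HG ↦
    (hvol HG).2.2.1.symm.trans (hmin G K δ HG).deriv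
  have hintX := fun j i ↦ ((hvol (HX j)).2.2.2 i).1
  have hintY := fun j i ↦ ((hvol (HY j)).2.2.2 i).1
  calc _ ≤ ∑ i ∈ chartIndices H.isCompact, ∫ y in chartCompact K i, ∑ j ∈ J,
        (chartWeight i y * dirDeriv timeDir (chartDensity g₁ g₂ ε (X j) (chartAt Plane i)) (0, y)
        + chartWeight i y
          * dirDeriv timeDir (chartDensity g₁ g₂ ε (Y j) (chartAt Plane i)) (0, y)) := by
        refine Finset.sum_le_sum fun i _ ↦ setIntegral_mono_on (hint i).2
          (integrable_finsetSum _ fun j _ ↦ (hintX j i).add (hintY j i))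
          (isCompact_chartCompact H.isCompact i).measurableSet fun y hy ↦ ?_
        have hyt := chartCompact_subset_target K i hy
        have hyK := symm_mem_of_mem_chartCompact hy
        -- Each point is treated in the adapted chart chosen for it. The integrands themselves refer
        -- to the preferred charts only, so measurability of this choice plays no role.
        set p := (chartAt Plane i).symm y with hp
        have ht := (e p).map_source (hpe p)
        have hc := IsSmoothChart.chartAt (S := S) i
        have hle := (A p).second_variation_le hε hΦ.contMDiff hφ hψ H hu hχ HX HY hX hY ht
          (J := J) (by rw [(e p).left_inv (hpe p)]; exact hsum p hyK)
        have hF := (H.dirDeriv_chartDensity hε (A p) hc hyt (hpe p)).2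
        have hX1 := fun j ↦ ((HX j).dirDeriv_chartDensity hε (A p) hc hyt (hpe p)).1
        have hY1 := fun j ↦ ((HY j).dirDeriv_chartDensity hε (A p) hc hyt (hpe p)).1
        -- First and second time derivatives of the density acquire the same nonnegative Jacobian
        -- factor, so the inequality passes to the preferred chart.
        simp only [hX1, hY1, ← mul_add, ← Finset.mul_sum]
        exact mul_le_mul_of_nonneg_left (hF.trans_le (mul_le_mul_of_nonneg_left hle (abs_nonneg _)))
          (chartWeight_nonneg i y)
    _ = ∑ j ∈ J, ((∑ i ∈ chartIndices H.isCompact, ∫ y in chartCompact K i, chartWeight i y *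
          dirDeriv timeDir (chartDensity g₁ g₂ ε (X j) (chartAt Plane i)) (0, y))
        + ∑ i ∈ chartIndices H.isCompact, ∫ y in chartCompact K i, chartWeight i y *
          dirDeriv timeDir (chartDensity g₁ g₂ ε (Y j) (chartAt Plane i)) (0, y)) := by
        -- The finite sums over charts and over the partition are exchanged, so that each auxiliary
        -- variation contributes its full first variation of volume.
        simp only [← Finset.sum_add_distrib]
        rw [Finset.sum_comm]
        refine Finset.sum_congr rfl fun i _ ↦ ?_
        refine (integral_finsetSum _ fun j _ ↦ (hintX j i).add (hintY j i)).trans ?_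
        exact Finset.sum_congr rfl fun j _ ↦ integral_add (hintX j i) (hintY j i)
    _ = 0 := by
        simp only [hzero (HX _), hzero (HY _), add_zero, Finset.sum_const_zero]
    _ ≤ 0 := le_rfl

end Stability

theorem theorem5 {M₁ M₂ S : Type*}
    [TopologicalSpace M₁] [ChartedSpace Plane M₁] [IsManifold (𝓡 2) ∞ M₁]
    [T2Space M₁] [SigmaCompactSpace M₁] [ConnectedSpace M₁]
    [TopologicalSpace M₂] [ChartedSpace Plane M₂] [IsManifold (𝓡 2) ∞ M₂]
    [T2Space M₂] [SigmaCompactSpace M₂] [ConnectedSpace M₂]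
    [TopologicalSpace S] [ChartedSpace Plane S] [IsManifold (𝓡 2) ∞ S]
    [T2Space S] [SigmaCompactSpace S]
    (g₁ : LorentzMetric M₁) (j₁ : ParacomplexStructure g₁)
    (g₂ : LorentzMetric M₂) (j₂ : ParacomplexStructure g₂)
    (ε : ℝ) (hε : ε = 1 ∨ ε = -1)
    (Φ : S → M₁ × M₂)
    (hΦ : IsNondegLagrangianImmersion j₁ j₂ ε Φ)
    (hrank : IsProjectedRankOne Φ)
    (hmin : IsHamiltonianMinimal j₁ j₂ ε Φ)
    (hφ : SignedCurvatureNonpos g₁ (fun p ↦ (Φ p).1))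
    (hψ : SignedCurvatureNonpos g₂ (fun p ↦ (Φ p).2)) :
    HasNonposHamiltonianSecondVariation j₁ j₂ ε Φ :=
  hmin.hasNonposHamiltonianSecondVariation (mul_self_eq_one_iff.mpr hε) hΦ hrank hφ hψ

end
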